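/- **Definitions.** For a finite nonempty $X\subset\mathbb R^d$ let $R(X)$ be the smallest axes-parallel box containing $X$. Balls are closed; a ball may be degenerate (radius $0$). For balls $C,C'$ with centres $c,c'$ and radii $\rho,\rho'$ put $d(C,C')=|cc'|-(\rho+\rho')$ (a point is a ball of radius $0$). Let $\sigma>0$. Two finite nonempty point sets $X,Y$ are *$\sigma$-well-separated* if there are disjoint balls $C_X\supseteq R(X)$ and $C_Y\supseteq R(Y)$ of the same radius $\rho$ with $d(C_X,C_Y)\ge \sigma\rho$. Let $D=\{D_1,\dots,D_n\}$ be a set of pairwise disjoint balls in $\mathbb R^d$, $D_i$ having centre $c_i$ and radius $r_i\ge 0$; for $A\subseteq D$ let $A'$ be the set of the centres of the balls in $A$. Nonempty $A,B\subseteq D$ are *$s$-well-separated* if there are disjoint balls $C_{A'}\supseteq R(A')$ and $C_{B'}\supseteq R(B')$ of the same radius $\rho$ such that (i) $|A|=|B|=1$; or (ii) $A=\{D_k\}$, $|B|>1$ and $d(c_k,C_{B'})-r_k\ge(3s+4)\rho$; or (iii) $|A|>1$, $B=\{D_k\}$ and $d(c_k,C_{A'})-r_k\ge(3s+4)\rho$;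 or (iv) $|A|,|B|>1$ and $d(C_{A'},C_{B'})\ge(3s+4)\rho$. A *well-separated pair decomposition* (WSPD) of $D$ with respect to $s$, of size $m$, is a family $\{A_1,B_1\},\dots,\{A_m,B_m\}$ of pairs of nonempty subsets of $D$ such that $A_i,B_i$ are $s$-well-separated for every $i$, and for any two distinct $D_p,D_q\in D$ there is exactly one $i$ with $D_p\in A_i,\ D_q\in B_i$ or $D_p\in B_i,\ D_q\in A_i$. A WSPD of a finite point set is defined in the same way. A *split tree* of a finite point set $F$ is a binary tree, with leaves corresponding to the points of $F$, such that at every internal node $u$, storing the set $S_u$ of the points at the leaves below $u$, the box $R(S_u)$ is halved perpendicularly to one of its longest sides and the two children store the points of $S_u$ in the two halves (points on the cut go to the left child). The machine model is a real RAM with unit costs: a fixed program over finitely many arrays; each memory cell holds either a real number or, on a machine whose arrays have $M$ cells each, a natural number less than $M$. Reals may be added, subtracted, multiplied, divided, compared, and square roots may be taken; there is no rounding. The space of a run on such a machine is $O(M)$ cells. The input is $n$, $d$, $s$, the coordinates of the centres, and the radii. The output is a binary tree $T$, stored with pointers, whose leaves are labelled by the balls, together with a list of pairs of nodes of $T$,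 a node representing the set of the balls below it. **Theorem.** There are a program and an absolute constant $K>0$ such that the following holds for all integers $d,n\ge1$, all real $s>0$ and every set $D$ of $n$ pairwise disjoint balls of arbitrary sizes in $\mathbb R^d$. Put $$\kappa=\max(s,1)^d\;\frac{\Gamma(d/2+1)}{\pi^{d/2}} .$$ On input $(D,s)$ the program outputs a split tree $T$ of the centres and a WSPD $W$ of $D$ with respect to $s$ of size at most $K\kappa n$, in time at most $K\kappa\, n\log(n+1)$, on a machine with $M\le K\kappa n$. Moreover, $W$ refines a WSPD $W'$ of the centres with respect to $3s+6$ all of whose sets are stored at nodes of $T$: every pair of $W$ either corresponds to a pair of $W'$, or arises from a pair of $W'$ consisting of a singleton and a set with more than one element by replacing the latter by a subset. -/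

import Mathlib

noncomputable section

namespace BallWSPD

/-! ## Well-separated pair decompositions -/

/-- The Euclidean space `ℝ^d`. -/
abbrev Pt (d : ℕ) : Type := EuclideanSpace ℝ (Fin d)

/-- The bounding box `R(X)`: the smallest axes-parallel box containing `X`
(for finite `X`, the product over `k` of the intervals `[min_X x_k, max_X x_k]`). -/
def boundingBox {d : ℕ} (X : Set (Pt d)) : Set (Pt d) :=
  {x | ∀ k : Fin d, ∃ a ∈ X, ∃ b ∈ X, a k ≤ x k ∧ x k ≤ b k}

/-- The distance `|c c'| - (ρ + ρ')` between the ball with centre `c` and radius `ρ` and the ball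
with centre `c'` and radius `ρ'`; a point is a ball of radius `0`. -/
def ballDist {d : ℕ} (c : Pt d) (ρ : ℝ) (c' : Pt d) (ρ' : ℝ) : ℝ :=
  dist c c' - (ρ + ρ')

/-- `closedBall a ρ` and `closedBall b ρ` are disjoint balls of the same radius that contain the
bounding boxes of `X` and `Y`, respectively. -/
def EnclosingBalls {d : ℕ} (X Y : Set (Pt d)) (a b : Pt d) (ρ : ℝ) : Prop :=
  0 ≤ ρ ∧ Disjoint (Metric.closedBall a ρ) (Metric.closedBall b ρ) ∧
    boundingBox X ⊆ Metric.closedBall a ρ ∧ boundingBox Y ⊆ Metric.closedBall b ρ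

/-- Two point sets are well-separated with respect to `s`. -/
def PointsWellSeparated {d : ℕ} (s : ℝ) (X Y : Set (Pt d)) : Prop :=
  ∃ (a b : Pt d) (ρ : ℝ), EnclosingBalls X Y a b ρ ∧ s * ρ ≤ ballDist a ρ b ρ

/-- Two sets `A`, `B` of balls are well-separated with respect to `s`. The balls are
`closedBall (c i) (r i)`, `i : Fin n`, and sets of balls are given as sets of indices. -/
def BallsWellSeparated {d n : ℕ} (c : Fin n → Pt d) (r : Fin n → ℝ) (s : ℝ)
    (A B : Finset (Fin n)) : Prop :=
  A.Nonempty ∧ B.Nonempty ∧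
  ∃ (a b : Pt d) (ρ : ℝ), EnclosingBalls (c '' (A : Set (Fin n))) (c '' (B : Set (Fin n))) a b ρ ∧
    ((A.card = 1 ∧ B.card = 1) ∨
     (∃ k, A = {k} ∧ 1 < B.card ∧ (3 * s + 4) * ρ ≤ ballDist (c k) 0 b ρ - r k) ∨
     (∃ k, 1 < A.card ∧ B = {k} ∧ (3 * s + 4) * ρ ≤ ballDist (c k) 0 a ρ - r k) ∨
     (1 < A.card ∧ 1 < B.card ∧ (3 * s + 4) * ρ ≤ ballDist a ρ b ρ))

/-- Every two distinct indices are separated by exactly one of the `m` pairs `{A i, B i}`. -/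
def CoversOnce {n m : ℕ} (A B : Fin m → Finset (Fin n)) : Prop :=
  ∀ p q : Fin n, p ≠ q → ∃! i : Fin m, (p ∈ A i ∧ q ∈ B i) ∨ (p ∈ B i ∧ q ∈ A i)

/-- `{A i, B i}`, `i : Fin m`, is a well-separated pair decomposition, with respect to `s`, of the
set of balls `closedBall (c i) (r i)`. Its size is `m`. -/
def IsBallWSPD {d n m : ℕ} (c : Fin n → Pt d) (r : Fin n → ℝ) (s : ℝ)
    (A B : Fin m → Finset (Fin n)) : Prop :=
  (∀ i, BallsWellSeparated c r s (A i) (B i)) ∧ CoversOnce A B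

/-- `{A i, B i}`, `i : Fin m`, is a well-separated pair decomposition, with respect to `s`, of the
point set `{c i}`. -/
def IsPointWSPD {d n m : ℕ} (c : Fin n → Pt d) (s : ℝ) (A B : Fin m → Finset (Fin n)) : Prop :=
  (∀ i, (A i).Nonempty ∧ (B i).Nonempty ∧
    PointsWellSeparated s (c '' (A i : Set (Fin n))) (c '' (B i : Set (Fin n)))) ∧
  CoversOnce A B

/-! ## Split trees -/

/-- Binary trees with leaves labelled by elements of `ι`. -/
inductive BTree (ι : Type) : Type
  | leaf (i : ι) : BTree ι
  | node (left right : BTree ι) : BTree ι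

/-- The set `S_u` stored at the root `u` of a tree: the labels of its leaves. -/
def BTree.labels {ι : Type} [DecidableEq ι] : BTree ι → Finset ι
  | .leaf i => {i}
  | .node l r => l.labels ∪ r.labels

/-- `U` is the subtree of the given tree at one of its nodes. -/
def BTree.HasSubtree {ι : Type} (U : BTree ι) : BTree ι → Prop
  | .leaf i => U = .leaf i
  | .node l r => U = .node l r ∨ U.HasSubtree l ∨ U.HasSubtree r

/-- `lo` and `hi` are the ends of the `k`-th side of the bounding box of the points `c i`, `i ∈ S`. -/
def IsSide {d n : ℕ} (c : Fin n → Pt d) (S : Finset (Fin n)) (k : Fin d) (lo hi : ℝ) : Prop :=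
  IsLeast ((fun i => c i k) '' (S : Set (Fin n))) lo ∧
    IsGreatest ((fun i => c i k) '' (S : Set (Fin n))) hi

/-- At every internal node of the tree, the bounding box of the points stored there is cut into two
halves perpendicularly to one of its longest sides, and the two children store the points in the
two halves (points on the cut go to the left). -/
def IsSplitTree {d n : ℕ} (c : Fin n → Pt d) : BTree (Fin n) → Prop
  | .leaf _ => True
  | .node l r =>
      IsSplitTree c l ∧ IsSplitTree c r ∧
      ∃ (k : Fin d) (lo hi : ℝ), IsSide c (l.labels ∪ r.labels) k lo hi ∧
        (∀ (k' : Fin d) (lo' hi' : ℝ), IsSide c (l.labels ∪ r.labels) k' lo' hi' →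
          hi' - lo' ≤ hi - lo) ∧
        (∀ i ∈ l.labels, c i k ≤ (lo + hi) / 2) ∧ (∀ i ∈ r.labels, (lo + hi) / 2 < c i k)

/-- `T` is a split tree of the points `c i`, `i : Fin n`. -/
def IsSplitTreeOf {d n : ℕ} (c : Fin n → Pt d) (T : BTree (Fin n)) : Prop :=
  T.labels = Finset.univ ∧ IsSplitTree c T

/-- Both sets of each of the pairs `{A i, B i}` are stored at nodes of `T`. -/
def PairsFromTree {n m : ℕ} (T : BTree (Fin n)) (A B : Fin m → Finset (Fin n)) : Prop :=
  ∀ i, (∃ U : BTree (Fin n), U.HasSubtree T ∧ A i = U.labels) ∧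
    (∃ V : BTree (Fin n), V.HasSubtree T ∧ B i = V.labels)

/-- Each pair `{A i, B i}` is one of the pairs `{A' j, B' j}`, or arises from one in which exactly
one of the two sets is a singleton by replacing the other set by a subset. -/
def RefinesSingletonPairs {n m m' : ℕ} (A B : Fin m → Finset (Fin n))
    (A' B' : Fin m' → Finset (Fin n)) : Prop :=
  ∀ i, ∃ j, (A i = A' j ∧ B i = B' j) ∨
    ((A' j).card = 1 ∧ 1 < (B' j).card ∧ A i = A' j ∧ B i ⊆ B' j) ∨
    ((B' j).card = 1 ∧ 1 < (A' j).card ∧ B i = B' j ∧ A i ⊆ A' j)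

/-! ## A real random access machine

A program is a fixed finite text that works on finitely many named arrays of words (natural
numbers) and of real numbers. A machine of size `M` has, in each array, the cells `0, …, M - 1`, and
words are natural numbers below `M`: a run that addresses another cell or produces a larger word
gets stuck. Variables are arrays of which only cell `0` is used. A program mentions finitely many
arrays, so a run on a machine of size `M` uses `O(M)` memory cells. Real numbers take one cell;
they can be added, subtracted, multiplied, divided and compared, and square roots can be extracted,
but they cannot be rounded or used as addresses. Every operation, every memory access, every
constant and every control step costs one unit of time. -/

/-- Contents of the memory: `word a j` and `real a j` are the cells number `j` of the word array
number `a` and of the real array number `a`. -/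
structure Store : Type where
  word : ℕ → ℕ → ℕ
  real : ℕ → ℕ → ℝ

/-- Write the word `v` into cell `j` of the word array `a`. -/
def Store.setWord (σ : Store) (a j v : ℕ) : Store :=
  { σ with word := fun a' j' => if a' = a ∧ j' = j then v else σ.word a' j' }

/-- Write the real number `v` into cell `j` of the real array `a`. -/
def Store.setReal (σ : Store) (a j : ℕ) (v : ℝ) : Store :=
  { σ with real := fun a' j' => if a' = a ∧ j' = j then v else σ.real a' j' }

/-- Word expressions. -/
inductive WExpr : Type
  | const (k : ℕ) : WExpr
  | load (a : ℕ) (i : WExpr) : WExpr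
  | plus (e f : WExpr) : WExpr
  | minus (e f : WExpr) : WExpr
  | times (e f : WExpr) : WExpr
  | quot (e f : WExpr) : WExpr

/-- Real expressions. -/
inductive RExpr : Type
  | const (q : ℚ) : RExpr
  | ofWord (e : WExpr) : RExpr
  | load (a : ℕ) (i : WExpr) : RExpr
  | plus (e f : RExpr) : RExpr
  | minus (e f : RExpr) : RExpr
  | times (e f : RExpr) : RExpr
  | quot (e f : RExpr) : RExpr
  | sqrt (e : RExpr) : RExpr

/-- Tests. -/
inductive Test : Type
  | leWord (e f : WExpr) : Test
  | leReal (e f : RExpr) : Test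
  | neg (b : Test) : Test
  | both (b b' : Test) : Test

/-- Programs. -/
inductive Prog : Type
  | skip : Prog
  | setWord (a : ℕ) (i e : WExpr) : Prog
  | setReal (a : ℕ) (i : WExpr) (e : RExpr) : Prog
  | seq (P Q : Prog) : Prog
  | ite (b : Test) (P Q : Prog) : Prog
  | loop (b : Test) (P : Prog) : Prog

/-- A natural number as a word of a machine of size `M`. -/
def fit (M v : ℕ) : Option ℕ := if v < M then some v else none

/-- The value of a word expression, `none` if the machine of size `M` gets stuck.
Subtraction is truncated and division is rounded down. -/
def WExpr.eval (M : ℕ) (σ : Store) : WExpr → Option ℕ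
  | .const k => fit M k
  | .load a i => (i.eval M σ).bind fun j => fit M (σ.word a j)
  | .plus e f => (e.eval M σ).bind fun x => (f.eval M σ).bind fun y => fit M (x + y)
  | .minus e f => (e.eval M σ).bind fun x => (f.eval M σ).bind fun y => fit M (x - y)
  | .times e f => (e.eval M σ).bind fun x => (f.eval M σ).bind fun y => fit M (x * y)
  | .quot e f => (e.eval M σ).bind fun x => (f.eval M σ).bind fun y =>
      if y = 0 then none else fit M (x / y)

/-- The value of a real expression, `none` if the machine of size `M` gets stuck. -/
def RExpr.eval (M : ℕ) (σ : Store) : RExpr → Option ℝ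
  | .const q => some (q : ℝ)
  | .ofWord e => (e.eval M σ).map fun x => (x : ℝ)
  | .load a i => (i.eval M σ).map fun j => σ.real a j
  | .plus e f => (e.eval M σ).bind fun x => (f.eval M σ).map fun y => x + y
  | .minus e f => (e.eval M σ).bind fun x => (f.eval M σ).map fun y => x - y
  | .times e f => (e.eval M σ).bind fun x => (f.eval M σ).map fun y => x * y
  | .quot e f => (e.eval M σ).bind fun x => (f.eval M σ).bind fun y =>
      if y = 0 then none else some (x / y)
  | .sqrt e => (e.eval M σ).bind fun x => if x < 0 then none else some (Real.sqrt x)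

/-- The outcome of a test, `none` if the machine of size `M` gets stuck. -/
def Test.eval (M : ℕ) (σ : Store) : Test → Option Bool
  | .leWord e f => (e.eval M σ).bind fun x => (f.eval M σ).map fun y => decide (x ≤ y)
  | .leReal e f => (e.eval M σ).bind fun x => (f.eval M σ).map fun y => decide (x ≤ y)
  | .neg b => (b.eval M σ).map fun x => !x
  | .both b b' => (b.eval M σ).bind fun x => (b'.eval M σ).map fun y => x && y

/-- The time for the evaluation of a word expression: its number of symbols. -/
def WExpr.cost : WExpr → ℕ
  | .const _ => 1
  | .load _ i => i.cost + 1
  | .plus e f => e.cost + f.cost + 1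
  | .minus e f => e.cost + f.cost + 1
  | .times e f => e.cost + f.cost + 1
  | .quot e f => e.cost + f.cost + 1

/-- The time for the evaluation of a real expression: its number of symbols. -/
def RExpr.cost : RExpr → ℕ
  | .const _ => 1
  | .ofWord e => e.cost + 1
  | .load _ i => i.cost + 1
  | .plus e f => e.cost + f.cost + 1
  | .minus e f => e.cost + f.cost + 1
  | .times e f => e.cost + f.cost + 1
  | .quot e f => e.cost + f.cost + 1
  | .sqrt e => e.cost + 1

/-- The time for the evaluation of a test: its number of symbols. -/
def Test.cost : Test → ℕ
  | .leWord e f => e.cost + f.cost + 1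
  | .leReal e f => e.cost + f.cost + 1
  | .neg b => b.cost + 1
  | .both b b' => b.cost + b'.cost + 1

/-- `Exec M P σ t τ`: started in `σ` on a machine of size `M`, the program `P` halts after exactly
`t` units of time, and the final contents of the memory are `τ`. -/
inductive Exec (M : ℕ) : Prog → Store → ℕ → Store → Prop
  | skip (σ : Store) : Exec M .skip σ 1 σ
  | setWord (σ : Store) (a : ℕ) (i e : WExpr) (j v : ℕ)
      (hi : i.eval M σ = some j) (he : e.eval M σ = some v) :
      Exec M (.setWord a i e) σ (i.cost + e.cost + 1) (σ.setWord a j v)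
  | setReal (σ : Store) (a : ℕ) (i : WExpr) (e : RExpr) (j : ℕ) (v : ℝ)
      (hi : i.eval M σ = some j) (he : e.eval M σ = some v) :
      Exec M (.setReal a i e) σ (i.cost + e.cost + 1) (σ.setReal a j v)
  | seq (P Q : Prog) (σ σ' σ'' : Store) (t t' : ℕ)
      (hP : Exec M P σ t σ') (hQ : Exec M Q σ' t' σ'') : Exec M (.seq P Q) σ (t + t') σ''
  | iteTrue (b : Test) (P Q : Prog) (σ σ' : Store) (t : ℕ)
      (hb : b.eval M σ = some true) (hP : Exec M P σ t σ') :
      Exec M (.ite b P Q) σ (b.cost + 1 + t) σ'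
  | iteFalse (b : Test) (P Q : Prog) (σ σ' : Store) (t : ℕ)
      (hb : b.eval M σ = some false) (hQ : Exec M Q σ t σ') :
      Exec M (.ite b P Q) σ (b.cost + 1 + t) σ'
  | loopDone (b : Test) (P : Prog) (σ : Store) (hb : b.eval M σ = some false) :
      Exec M (.loop b P) σ (b.cost + 1) σ
  | loopStep (b : Test) (P : Prog) (σ σ' σ'' : Store) (t t' : ℕ)
      (hb : b.eval M σ = some true) (hP : Exec M P σ t σ')
      (hL : Exec M (.loop b P) σ' t' σ'') :
      Exec M (.loop b P) σ (b.cost + 1 + t + t') σ''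

/-! ## Input and output of the algorithm -/

/-- The memory holds the input: the numbers `n`, `d`, `s`, the coordinates of the centres (row by
row), and the radii. All other cells are arbitrary. -/
def HoldsInput {d n : ℕ} (c : Fin n → Pt d) (r : Fin n → ℝ) (s : ℝ) (σ : Store) : Prop :=
  σ.word 0 0 = n ∧ σ.word 1 0 = d ∧
  (∀ (i : Fin n) (k : Fin d), σ.real 0 ((i : ℕ) * d + k) = c i k) ∧
  (∀ i : Fin n, σ.real 1 i = r i) ∧ σ.real 2 0 = s

/-- The memory holds the given tree at node `u`: the word arrays `5`, `6` and `7` are the pointers to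
the left child and to the right child, and the label; the left pointer is `0` exactly at leaves
(the root of the whole tree has number `0`, so that no child has this number). -/
def HoldsTree {n : ℕ} (σ : Store) : BTree (Fin n) → ℕ → Prop
  | .leaf i, u => σ.word 5 u = 0 ∧ σ.word 7 u = i
  | .node l r, u => σ.word 5 u ≠ 0 ∧ HoldsTree σ l (σ.word 5 u) ∧ HoldsTree σ r (σ.word 6 u)

/-- The memory holds the output: a tree `T` with root number `0`, the number `m` of pairs, and, for
each `i < m`, two nodes of `T` at which the sets `A i` and `B i` are stored. -/
def HoldsOutput {n m : ℕ} (σ : Store) (T : BTree (Fin n)) (A B : Fin m → Finset (Fin n)) : Prop :=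
  HoldsTree σ T 0 ∧ σ.word 2 0 = m ∧
  ∀ i : Fin m, ∃ U V : BTree (Fin n), U.HasSubtree T ∧ V.HasSubtree T ∧
    HoldsTree σ U (σ.word 3 i) ∧ HoldsTree σ V (σ.word 4 i) ∧ A i = U.labels ∧ B i = V.labels

/-- The factor `max(s,1)^d * Γ(d/2 + 1) / π^(d/2)`. -/
def sepFactor (d : ℕ) (s : ℝ) : ℝ :=
  max s 1 ^ d * Real.Gamma ((d : ℝ) / 2 + 1) / Real.pi ^ ((d : ℝ) / 2)

end BallWSPD

end

noncomputable section

namespace BallWSPD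

/-! ## A program logic with time bounds -/

/-! The decomposition comes from a search in the split tree of the centres. Take two disjoint sets
`U`, `V` stored in the tree. The pair is output if the centres of the two bounding boxes are at
distance at least `(3s+8)ρ` for the half diagonal `ρ` of either box (`CentreCrit`), and if, for a
single ball of radius `r` against a box of half diagonal `ρ`, this distance is at least `(3s+5)ρ +
r` (`LeafCrit`). Otherwise the set with the longer box is replaced by its two children. Subtracting
the radii of the enclosing balls turns `3s+8` into `3s+6` and `3s+5` into `3s+4`, which gives the
required separation (`GoodPair.ballsWellSeparated`). Two single balls always pass the test because
they are disjoint, so the search ends. `LeafCrit` is vacuous for two inner nodes. Hence the same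
search with `CentreCrit` alone yields a decomposition of the centres, and the given one differs from
it only below pairs of a leaf and an inner node (`AllRun.refinesSingletonPairs`).

Size. There are `n - 1` more output pairs than split pairs, so it suffices to count the latter. A
split pair is charged to the set that was split, say `V`; its partners `U` are pairwise disjoint and
not longer than `V`. If `CentreCrit` fails, then `U` is near `V`. The tree cuts space into cells,
and the cell of `U` has all sides at least half the length of `V`. It therefore contains a cube of
this size near `V`, and such cubes are disjoint (`card_not_centreCrit`). If only `LeafCrit` fails,
then `U` is one ball, whose centre is at distance `D` from the box centre with `(3s+8)ρ ≤ D <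
(3s+5)ρ + r`. This ball contains a ball of radius `3ρ` centred on the sphere of radius `(3s+8)ρ`
around the box centre, and disjointness of the input balls leaves room for at most `(s+4)^d` of them
(`card_not_leafCrit`). The second count is what makes balls of arbitrary sizes harmless.

Constants. The factor `κ` is `max(s,1)^d` divided by the volume `v` of the unit ball. Since `v² ≤
8^d / d!`, the factorial beats all exponential factors, the power `√d^d` of the cube packing, and a
further factor `d` for computing one distance. So `d` times the number of splits per node is at most
an absolute constant times `κ` (`exists_sepFactor_bounds`), and so is `d` itself.

The tree. The points are sorted once by each coordinate. The tree is then built in about `log₂ n`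
rounds, each halving the bound on the sizes of the current segments. A round copies the sorted lists
into the segments by a counting sort and then splits each large segment repeatedly. The cut is found
by walking from both ends of the sorted list at equal speed, and only the part found complete by
this walk is moved. The lists of the other coordinates are cleaned lazily: each segment keeps a
window in each list, and only stale points at the ends of a window are dropped. The total length of
the windows is the potential that pays for all this, so a round costs `O(dn)`.

Time and space on the machine are derived from a small Hoare logic with running times, whose loop
rules use a potential (`WP.loop_potential`). -/

@[simp] theorem Store.setWord_word (σ : Store) (a j v a' : ℕ) :
    (σ.setWord a j v).word a' =
      if a' = a then Function.update (σ.word a) j v else σ.word a' := by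
  funext j'
  by_cases h : a' = a
  · subst h; simp [Store.setWord, Function.update_apply]
  · simp [Store.setWord, h]

@[simp] theorem Store.setWord_real (σ : Store) (a j v : ℕ) :
    (σ.setWord a j v).real = σ.real := rfl

@[simp] theorem Store.setReal_word (σ : Store) (a j : ℕ) (v : ℝ) :
    (σ.setReal a j v).word = σ.word := rfl

@[simp] theorem Store.setReal_real (σ : Store) (a j : ℕ) (v : ℝ) (a' : ℕ) :
    (σ.setReal a j v).real a' =
      if a' = a then Function.update (σ.real a) j v else σ.real a' := by
  funext j'
  by_cases h : a' = a
  · subst h; simp [Store.setReal, Function.update_apply]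
  · simp [Store.setReal, h]

/-- The value of a word expression, when the machine does not get stuck. -/
def WExpr.val (σ : Store) : WExpr → ℕ
  | .const k => k
  | .load a i => σ.word a (i.val σ)
  | .plus e f => e.val σ + f.val σ
  | .minus e f => e.val σ - f.val σ
  | .times e f => e.val σ * f.val σ
  | .quot e f => e.val σ / f.val σ

/-- The machine of size `M` does not get stuck on a word expression. -/
def WExpr.Safe (M : ℕ) (σ : Store) : WExpr → Prop
  | .const k => k < M
  | .load a i => i.Safe M σ ∧ σ.word a (i.val σ) < M
  | .plus e f => e.Safe M σ ∧ f.Safe M σ ∧ e.val σ + f.val σ < M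
  | .minus e f => e.Safe M σ ∧ f.Safe M σ
  | .times e f => e.Safe M σ ∧ f.Safe M σ ∧ e.val σ * f.val σ < M
  | .quot e f => e.Safe M σ ∧ f.Safe M σ ∧ f.val σ ≠ 0

/-- A difference or a quotient never exceeds its first operand, which is why `WExpr.Safe` asks for
no bound there. Since every safe value is below `M`, a safe address needs no further check. -/
theorem WExpr.val_lt {M : ℕ} {σ : Store} {e : WExpr} (h : e.Safe M σ) : e.val σ < M := by
  induction e with
  | const k => exact h
  | load a i ih => exact h.2
  | plus e f => exact h.2.2
  | minus e f ihe ihf => exact lt_of_le_of_lt (Nat.sub_le _ _) (ihe h.1)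
  | times e f => exact h.2.2
  | quot e f ihe ihf => exact lt_of_le_of_lt (Nat.div_le_self _ _) (ihe h.1)

theorem WExpr.eval_eq {M : ℕ} {σ : Store} {e : WExpr} (h : e.Safe M σ) :
    e.eval M σ = some (e.val σ) := by
  have hlt := WExpr.val_lt h
  induction e with
  | const k => simp [WExpr.eval, fit, WExpr.val] at *; exact hlt
  | load a i ih => simp [WExpr.eval, ih h.1 (WExpr.val_lt h.1), fit, WExpr.val] at *; exact hlt
  | plus e f ihe ihf =>
    simp [WExpr.eval, ihe h.1 (WExpr.val_lt h.1), ihf h.2.1 (WExpr.val_lt h.2.1), fit,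
      WExpr.val] at *; exact hlt
  | minus e f ihe ihf =>
    simp [WExpr.eval, ihe h.1 (WExpr.val_lt h.1), ihf h.2 (WExpr.val_lt h.2), fit,
      WExpr.val] at *; exact hlt
  | times e f ihe ihf =>
    simp [WExpr.eval, ihe h.1 (WExpr.val_lt h.1), ihf h.2.1 (WExpr.val_lt h.2.1), fit,
      WExpr.val] at *; exact hlt
  | quot e f ihe ihf =>
    have h0 : ¬ f.val σ = 0 := h.2.2
    simp [WExpr.eval, ihe h.1 (WExpr.val_lt h.1), ihf h.2.1 (WExpr.val_lt h.2.1), fit,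
      WExpr.val, h0] at *; exact hlt

/-- The value of a real expression, when the machine does not get stuck. -/
def RExpr.val (σ : Store) : RExpr → ℝ
  | .const q => (q : ℝ)
  | .ofWord e => (e.val σ : ℝ)
  | .load a i => σ.real a (i.val σ)
  | .plus e f => e.val σ + f.val σ
  | .minus e f => e.val σ - f.val σ
  | .times e f => e.val σ * f.val σ
  | .quot e f => e.val σ / f.val σ
  | .sqrt e => Real.sqrt (e.val σ)

/-- The machine of size `M` does not get stuck on a real expression. -/
def RExpr.Safe (M : ℕ) (σ : Store) : RExpr → Prop
  | .const _ => True
  | .ofWord e => e.Safe M σ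
  | .load _ i => i.Safe M σ
  | .plus e f => e.Safe M σ ∧ f.Safe M σ
  | .minus e f => e.Safe M σ ∧ f.Safe M σ
  | .times e f => e.Safe M σ ∧ f.Safe M σ
  | .quot e f => e.Safe M σ ∧ f.Safe M σ ∧ f.val σ ≠ 0
  | .sqrt e => e.Safe M σ ∧ 0 ≤ e.val σ

theorem RExpr.eval_eq {M : ℕ} {σ : Store} {e : RExpr} (h : e.Safe M σ) :
    e.eval M σ = some (e.val σ) := by
  induction e with
  | const q => rfl
  | ofWord e => simp [RExpr.eval, RExpr.val, WExpr.eval_eq (show e.Safe M σ from h)]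
  | load a i => simp [RExpr.eval, RExpr.val, WExpr.eval_eq (show i.Safe M σ from h)]
  | plus e f ihe ihf => simp [RExpr.eval, RExpr.val, ihe h.1, ihf h.2]
  | minus e f ihe ihf => simp [RExpr.eval, RExpr.val, ihe h.1, ihf h.2]
  | times e f ihe ihf => simp [RExpr.eval, RExpr.val, ihe h.1, ihf h.2]
  | quot e f ihe ihf =>
    have h0 : ¬ f.val σ = 0 := h.2.2
    simp [RExpr.eval, RExpr.val, ihe h.1, ihf h.2.1, h0]
  | sqrt e ihe => simp [RExpr.eval, RExpr.val, ihe h.1, not_lt.mpr h.2]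

/-- The outcome of a test, when the machine does not get stuck. -/
def Test.val (σ : Store) : Test → Prop
  | .leWord e f => e.val σ ≤ f.val σ
  | .leReal e f => e.val σ ≤ f.val σ
  | .neg b => ¬ b.val σ
  | .both b b' => b.val σ ∧ b'.val σ

/-- The machine of size `M` does not get stuck on a test. -/
def Test.Safe (M : ℕ) (σ : Store) : Test → Prop
  | .leWord e f => e.Safe M σ ∧ f.Safe M σ
  | .leReal e f => e.Safe M σ ∧ f.Safe M σ
  | .neg b => b.Safe M σ
  | .both b b' => b.Safe M σ ∧ b'.Safe M σ

open Classical in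
theorem Test.eval_eq {M : ℕ} {σ : Store} {b : Test} (h : b.Safe M σ) :
    b.eval M σ = some (decide (b.val σ)) := by
  induction b with
  | leWord e f =>
    by_cases hv : e.val σ ≤ f.val σ <;>
      simp [Test.eval, Test.val, WExpr.eval_eq h.1, WExpr.eval_eq h.2, hv]
  | leReal e f =>
    by_cases hv : e.val σ ≤ f.val σ <;>
      simp [Test.eval, Test.val, RExpr.eval_eq h.1, RExpr.eval_eq h.2, hv]
  | neg b ih => by_cases hv : b.val σ <;> simp [Test.eval, Test.val, ih h, hv]
  | both b b' ih ih' =>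
    by_cases hv : b.val σ <;> by_cases hv' : b'.val σ <;>
      simp [Test.eval, Test.val, ih h.1, ih' h.2, hv, hv']

/-- `P`, started in `σ`, halts, and its running time and final store satisfy `Q`. -/
def WP (M : ℕ) (P : Prog) (σ : Store) (Q : ℕ → Store → Prop) : Prop :=
  ∃ t τ, Exec M P σ t τ ∧ Q t τ

theorem WP.mono {M : ℕ} {P : Prog} {σ : Store} {Q Q' : ℕ → Store → Prop} (h : WP M P σ Q)
    (hQ : ∀ t τ, Q t τ → Q' t τ) : WP M P σ Q' := by
  obtain ⟨t, τ, he, hq⟩ := h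
  exact ⟨t, τ, he, hQ t τ hq⟩

theorem WP.seq {M : ℕ} {P P' : Prog} {σ : Store} {Q Q' : ℕ → Store → Prop}
    (h : WP M P σ Q) (h' : ∀ t τ, Q t τ → WP M P' τ (fun t' => Q' (t + t'))) :
    WP M (.seq P P') σ Q' := by
  obtain ⟨t, τ, he, hq⟩ := h
  obtain ⟨t', τ', he', hq'⟩ := h' t τ hq
  exact ⟨_, _, .seq _ _ _ _ _ _ _ he he', hq'⟩

/-- A precondition of a program, computed by symbolic execution up to the loops. -/
def pre (M : ℕ) : Prog → (ℕ → Store → Prop) → Store → Prop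
  | .skip, Q, σ => Q 1 σ
  | .setWord a i e, Q, σ => i.Safe M σ ∧ e.Safe M σ ∧
      Q (i.cost + e.cost + 1) (σ.setWord a (i.val σ) (e.val σ))
  | .setReal a i e, Q, σ => i.Safe M σ ∧ e.Safe M σ ∧
      Q (i.cost + e.cost + 1) (σ.setReal a (i.val σ) (e.val σ))
  | .seq P P', Q, σ => pre M P (fun t τ => pre M P' (fun t' => Q (t + t')) τ) σ
  | .ite b P P', Q, σ => b.Safe M σ ∧ (b.val σ → pre M P (fun t => Q (b.cost + 1 + t)) σ) ∧
      (¬ b.val σ → pre M P' (fun t => Q (b.cost + 1 + t)) σ)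
  | .loop b P, Q, σ => WP M (.loop b P) σ Q

/-- Code without loops is verified by unfolding `pre` with `simp`, which leaves only arithmetic side
conditions about bounds and time. Invariants are needed at loops alone. -/
theorem WP.of_pre {M : ℕ} {P : Prog} {σ : Store} {Q : ℕ → Store → Prop} (h : pre M P Q σ) :
    WP M P σ Q := by
  induction P generalizing σ Q with
  | skip => exact ⟨_, _, .skip _, h⟩
  | setWord a i e =>
    exact ⟨_, _, .setWord _ _ _ _ _ _ (WExpr.eval_eq h.1) (WExpr.eval_eq h.2.1), h.2.2⟩
  | setReal a i e =>
    exact ⟨_, _, .setReal _ _ _ _ _ _ (WExpr.eval_eq h.1) (RExpr.eval_eq h.2.1), h.2.2⟩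
  | seq P P' ih ih' => exact WP.seq (ih h) fun t τ h' => ih' h'
  | ite b P P' ih ih' =>
    obtain ⟨hs, h1, h2⟩ := h
    by_cases hb : b.val σ
    · obtain ⟨t, τ, he, hq⟩ := ih (h1 hb)
      exact ⟨_, _, .iteTrue _ _ _ _ _ _ (by simp [Test.eval_eq hs, hb]) he, hq⟩
    · obtain ⟨t, τ, he, hq⟩ := ih' (h2 hb)
      exact ⟨_, _, .iteFalse _ _ _ _ _ _ (by simp [Test.eval_eq hs, hb]) he, hq⟩
  | loop b P => exact h

/-- The word arrays that a program may change. -/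
def Prog.wordArrays : Prog → List ℕ
  | .skip => []
  | .setWord a _ _ => [a]
  | .setReal _ _ _ => []
  | .seq P Q => P.wordArrays ++ Q.wordArrays
  | .ite _ P Q => P.wordArrays ++ Q.wordArrays
  | .loop _ P => P.wordArrays

/-- The real arrays that a program may change. -/
def Prog.realArrays : Prog → List ℕ
  | .skip => []
  | .setWord _ _ _ => []
  | .setReal a _ _ => [a]
  | .seq P Q => P.realArrays ++ Q.realArrays
  | .ite _ P Q => P.realArrays ++ Q.realArrays
  | .loop _ P => P.realArrays

/-- The stores agree on the arrays that `P` does not change. -/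
structure Frame (P : Prog) (σ τ : Store) : Prop where
  word : ∀ a, a ∉ P.wordArrays → τ.word a = σ.word a
  real : ∀ a, a ∉ P.realArrays → τ.real a = σ.real a

theorem Frame.refl (P : Prog) (σ : Store) : Frame P σ σ := ⟨fun _ _ => rfl, fun _ _ => rfl⟩

theorem Frame.trans {P : Prog} {σ τ υ : Store} (h : Frame P σ τ) (h' : Frame P τ υ) :
    Frame P σ υ :=
  ⟨fun a ha => (h'.word a ha).trans (h.word a ha), fun a ha => (h'.real a ha).trans (h.real a ha)⟩

/-- Purely syntactic: an array that is never assigned in the text cannot change. Membership in the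
lists of assigned arrays is decidable, so everything that an invariant does not mention can be
recovered by `decide`. -/
theorem Exec.frame {M : ℕ} {P : Prog} {σ τ : Store} {t : ℕ} (h : Exec M P σ t τ) :
    Frame P σ τ := by
  induction h with
  | skip => exact Frame.refl _ _
  | setWord σ a i e j v hi he =>
    refine ⟨fun a' ha => ?_, fun _ _ => rfl⟩
    have : a' ≠ a := by simpa [Prog.wordArrays] using ha
    funext j'; simp [this]
  | setReal σ a i e j v hi he =>
    refine ⟨fun _ _ => rfl, fun a' ha => ?_⟩
    have : a' ≠ a := by simpa [Prog.realArrays] using ha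
    funext j'; simp [this]
  | seq P Q σ σ' σ'' t t' _ _ ih ih' =>
    refine ⟨fun a ha => ?_, fun a ha => ?_⟩
    · simp only [Prog.wordArrays, List.mem_append, not_or] at ha
      rw [ih'.word a ha.2, ih.word a ha.1]
    · simp only [Prog.realArrays, List.mem_append, not_or] at ha
      rw [ih'.real a ha.2, ih.real a ha.1]
  | iteTrue b P Q σ σ' t _ _ ih =>
    refine ⟨fun a ha => ?_, fun a ha => ?_⟩
    · simp only [Prog.wordArrays, List.mem_append, not_or] at ha
      exact ih.word a ha.1
    · simp only [Prog.realArrays, List.mem_append, not_or] at ha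
      exact ih.real a ha.1
  | iteFalse b P Q σ σ' t _ _ ih =>
    refine ⟨fun a ha => ?_, fun a ha => ?_⟩
    · simp only [Prog.wordArrays, List.mem_append, not_or] at ha
      exact ih.word a ha.2
    · simp only [Prog.realArrays, List.mem_append, not_or] at ha
      exact ih.real a ha.2
  | loopDone => exact Frame.refl _ _
  | loopStep b P σ σ' σ'' t t' _ _ _ ih ih' => exact Frame.trans ⟨ih.word, ih.real⟩ ih'

theorem WP.frame {M : ℕ} {P : Prog} {σ : Store} {Q : ℕ → Store → Prop} (h : WP M P σ Q) :
    WP M P σ (fun t τ => Q t τ ∧ Frame P σ τ) := by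
  obtain ⟨t, τ, he, hq⟩ := h
  exact ⟨t, τ, he, hq, he.frame⟩

/-- The consequence rule, with the frame. -/
theorem WP.conseq {M : ℕ} {P : Prog} {σ : Store} {Q Q' : ℕ → Store → Prop} (h : WP M P σ Q)
    (hQ : ∀ t τ, Frame P σ τ → Q t τ → Q' t τ) : WP M P σ Q' :=
  h.frame.mono fun t τ hq => hQ t τ hq.2 hq.1

/-- Loops with an invariant `I g`, for some value `g` of the ghost state, and a potential `Φ g`
that pays for the time. -/
theorem WP.loop_potential {M : ℕ} {b : Test} {P : Prog} {γ : Type} (I : γ → Store → Prop)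
    (Φ : γ → ℕ) {σ : Store} {g : γ} (h0 : I g σ)
    (hI : ∀ g τ, I g τ → Frame P σ τ → b.Safe M τ ∧ (b.val τ →
      WP M P τ (fun t υ => ∃ g', I g' υ ∧ Φ g' + t + b.cost + 1 ≤ Φ g))) :
    WP M (.loop b P) σ (fun t τ => ∃ g', I g' τ ∧ t + Φ g' ≤ Φ g + b.cost + 1 ∧ ¬ b.val τ) := by
  -- Induction on a bound for the potential. An iteration costs at least its test, so the potential
  -- drops strictly; the same induction gives termination and the time bound.
  suffices H : ∀ N g τ, Φ g ≤ N → I g τ → Frame P σ τ → WP M (.loop b P) τ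
      (fun t υ => ∃ g', I g' υ ∧ t + Φ g' ≤ Φ g + b.cost + 1 ∧ ¬ b.val υ) from
    H (Φ g) g σ le_rfl h0 (Frame.refl _ _)
  intro N
  induction N with
  | zero =>
    intro g τ hN hg hf
    obtain ⟨hs, hb⟩ := hI g τ hg hf
    by_cases hv : b.val τ
    · obtain ⟨t, υ, he, g', hg', hle⟩ := hb hv
      omega
    · exact ⟨_, _, .loopDone _ _ _ (by simp [Test.eval_eq hs, hv]), g, hg, by omega, hv⟩
  | succ N ih =>
    intro g τ hN hg hf
    obtain ⟨hs, hb⟩ := hI g τ hg hf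
    by_cases hv : b.val τ
    · obtain ⟨t, υ, he, g', hg', hle⟩ := hb hv
      obtain ⟨t', υ', he', g'', hg'', hle', hv'⟩ := ih g' υ (by omega) hg' (hf.trans he.frame)
      exact ⟨_, _, .loopStep _ _ _ _ _ _ _ (by simp [Test.eval_eq hs, hv]) he he', g'', hg'',
        by omega, hv'⟩
    · exact ⟨_, _, .loopDone _ _ _ (by simp [Test.eval_eq hs, hv]), g, hg, by omega, hv⟩

/-- Loops with a counter. -/
theorem WP.loop_count {M : ℕ} {b : Test} {P : Prog} (I : ℕ → Store → Prop) (N C : ℕ)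
    {σ : Store} (h0 : I 0 σ)
    (hI : ∀ q τ, q < N → I q τ → Frame P σ τ → b.Safe M τ ∧ b.val τ ∧
      WP M P τ (fun t υ => I (q + 1) υ ∧ t ≤ C))
    (hN : ∀ τ, I N τ → Frame P σ τ → b.Safe M τ ∧ ¬ b.val τ) :
    WP M (.loop b P) σ (fun t τ => I N τ ∧ t ≤ N * (C + b.cost + 1) + b.cost + 1) := by
  have h := WP.loop_potential (M := M) (b := b) (P := P) (σ := σ)
    (fun q τ => q ≤ N ∧ I q τ) (fun q => (N - q) * (C + b.cost + 1)) (g := 0) ⟨Nat.zero_le _, h0⟩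
    (by
      rintro q τ ⟨hq, hi⟩ hf
      rcases hq.lt_or_eq with hlt | rfl
      · obtain ⟨hs, hv, hw⟩ := hI q τ hlt hi hf
        refine ⟨hs, fun _ => hw.mono ?_⟩
        rintro t υ ⟨h1, h2⟩
        refine ⟨q + 1, ⟨hlt, h1⟩, ?_⟩
        obtain ⟨k, hk⟩ := Nat.exists_eq_add_of_lt hlt
        have e1 : N - q = k + 1 := by omega
        have e2 : N - (q + 1) = k := by omega
        rw [e1, e2, Nat.succ_mul]
        omega
      · obtain ⟨hs, hv⟩ := hN τ hi hf
        exact ⟨hs, fun h => absurd h hv⟩)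
  refine h.conseq ?_
  rintro t τ hf ⟨q, ⟨hq, hi⟩, ht, hv⟩
  have hf' : Frame P σ τ := ⟨hf.word, hf.real⟩
  rcases hq.lt_or_eq with hlt | rfl
  · exact absurd (hI q τ hlt hi hf').2.1 hv
  · refine ⟨hi, ?_⟩
    simp only [Nat.sub_zero] at ht
    omega

/-- A word variable: cell `0` of an array. -/
def wv (a : ℕ) : WExpr := .load a (.const 0)

/-- A real variable: cell `0` of an array. -/
def rv (a : ℕ) : RExpr := .load a (.const 0)

@[simp] theorem wv_val (σ : Store) (a : ℕ) : (wv a).val σ = σ.word a 0 := rfl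
@[simp] theorem wv_safe (M : ℕ) (σ : Store) (a : ℕ) :
    (wv a).Safe M σ ↔ σ.word a 0 < M := by
  simp only [wv, WExpr.Safe, WExpr.val]; omega
@[simp] theorem wv_cost (a : ℕ) : (wv a).cost = 2 := rfl
@[simp] theorem rv_val (σ : Store) (a : ℕ) : (rv a).val σ = σ.real a 0 := rfl
@[simp] theorem rv_safe (M : ℕ) (σ : Store) (a : ℕ) :
    (rv a).Safe M σ ↔ 0 < M := by
  simp only [rv, RExpr.Safe, WExpr.Safe]
@[simp] theorem rv_cost (a : ℕ) : (rv a).cost = 2 := rfl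

/-- Assignment to a word variable. -/
def wset (a : ℕ) (e : WExpr) : Prog := .setWord a (.const 0) e

/-- Assignment to a real variable. -/
def rset (a : ℕ) (e : RExpr) : Prog := .setReal a (.const 0) e

/-- Increment of a word variable. -/
def incr (a : ℕ) : Prog := wset a (.plus (wv a) (.const 1))

/-- The test `e < f`. -/
def ltw (e f : WExpr) : Test := .neg (.leWord f e)

/-- The test `e = f`. -/
def eqw (e f : WExpr) : Test := .both (.leWord e f) (.leWord f e)

@[simp] theorem ltw_val (σ : Store) (e f : WExpr) : (ltw e f).val σ ↔ e.val σ < f.val σ := by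
  simp [ltw, Test.val]
@[simp] theorem ltw_safe (M : ℕ) (σ : Store) (e f : WExpr) :
    (ltw e f).Safe M σ ↔ e.Safe M σ ∧ f.Safe M σ := by
  simp [ltw, Test.Safe, and_comm]
@[simp] theorem ltw_cost (e f : WExpr) : (ltw e f).cost = e.cost + f.cost + 2 := by
  simp [ltw, Test.cost]; omega
@[simp] theorem eqw_val (σ : Store) (e f : WExpr) : (eqw e f).val σ ↔ e.val σ = f.val σ := by
  simp [eqw, Test.val]; omega
@[simp] theorem eqw_safe (M : ℕ) (σ : Store) (e f : WExpr) :
    (eqw e f).Safe M σ ↔ e.Safe M σ ∧ f.Safe M σ := by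
  simp [eqw, Test.Safe, and_comm]
@[simp] theorem eqw_cost (e f : WExpr) : (eqw e f).cost = 2 * e.cost + 2 * f.cost + 3 := by
  simp [eqw, Test.cost]; omega

attribute [simp] pre WExpr.val WExpr.Safe WExpr.cost RExpr.val RExpr.Safe RExpr.cost
  Test.val Test.Safe Test.cost wset rset incr

/-- `for q in [0, N)`: the counter is the variable `q`, the bound is the variable `a`. -/
def forLoop (q a : ℕ) (P : Prog) : Prog :=
  .seq (wset q (.const 0)) (.loop (ltw (wv q) (wv a)) (.seq P (incr q)))

infixr:60 " ;; " => Prog.seq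

/-- Each iteration spends 6 units on the increment and 7 on the test, whence `C + 13`; the 10 units
at the end are the initial assignment and the last, failing test. -/
theorem WP.forLoop {M q a : ℕ} {P : Prog} (I : ℕ → Store → Prop) (N C : ℕ) {σ : Store}
    (hqa : q ≠ a) (haP : a ∉ P.wordArrays) (hqP : q ∉ P.wordArrays)
    (hN : σ.word a 0 = N) (hNM : N < M)
    (h0 : I 0 (σ.setWord q 0 0))
    (hI : ∀ k τ, k < N → I k τ → Frame (P ;; incr q) (σ.setWord q 0 0) τ → τ.word q 0 = k →
      WP M P τ (fun t υ => I (k + 1) (υ.setWord q 0 (k + 1)) ∧ t ≤ C)) :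
    WP M (forLoop q a P) σ (fun t τ => I N τ ∧ τ.word q 0 = N ∧ t ≤ N * (C + 13) + 10) := by
  refine WP.of_pre ?_
  simp only [BallWSPD.forLoop, pre, wset, WExpr.Safe, WExpr.val, WExpr.cost]
  refine ⟨by omega, by omega, ?_⟩
  have h := WP.loop_count (M := M) (b := ltw (wv q) (wv a)) (P := P ;; incr q)
    (fun k τ => I k τ ∧ τ.word q 0 = k) N (C + 6)
    (σ := σ.setWord q 0 0) ⟨h0, by simp⟩
    (by
      rintro k τ hk ⟨hi, hq⟩ hf
      have ha : τ.word a 0 = N := by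
        rw [hf.word a (by simp [Prog.wordArrays, haP]; exact fun h => hqa h.symm)]
        simp [hqa.symm, hN]
      refine ⟨by simp [hq, ha]; omega, by simp [hq, ha, hk], ?_⟩
      refine WP.seq (hI k τ hk hi hf hq).frame ?_
      rintro t υ ⟨⟨h1, h2⟩, hf'⟩
      refine WP.of_pre ?_
      have e : υ.word q 0 = k := by rw [hf'.word q hqP, hq]
      simp [e]
      refine ⟨by omega, by omega, ?_, by omega⟩
      exact h1)
    (by
      rintro τ ⟨hi, hq⟩ hf
      have ha : τ.word a 0 = N := by
        rw [hf.word a (by simp [Prog.wordArrays, haP]; exact fun h => hqa h.symm)]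
        simp [hqa.symm, hN]
      simp [hq, ha, hNM])
  refine h.mono ?_
  rintro t τ ⟨⟨hi, hq⟩, ht⟩
  refine ⟨hi, hq, ?_⟩
  simp at ht
  have : C + 6 + 6 + 1 = C + 13 := by omega
  rw [this] at ht
  omega

/-! ## Sorting -/

/-- The aligned blocks of length `w` of `A 0, …, A (n - 1)` are sorted by `key`. -/
def BlockSorted (w n : ℕ) (key : ℕ → ℝ) (A : ℕ → ℕ) : Prop :=
  ∀ b x y, w ∣ b → b ≤ x → x < y → y < b + w → y < n → key (A x) ≤ key (A y)

/-- `A` restricted to `[0, n)` is a permutation. -/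
def PermOn (n : ℕ) (A : ℕ → ℕ) : Prop :=
  (∀ x < n, A x < n) ∧ ∀ z < n, ∃ x < n, A x = z

/-- Between two blocks of a pass of merge sort from `A` to `B`. -/
structure MergeDone (n w : ℕ) (key : ℕ → ℝ) (A B : ℕ → ℕ) (q : ℕ) : Prop where
  le : q ≤ n
  dvd : 2 * w ∣ q ∨ q = n
  src : ∀ x < q, ∃ y < n, B x = A y
  sur : ∀ y < q, ∃ x < q, B x = A y
  srt : ∀ b x y, 2 * w ∣ b → b ≤ x → x < y → y < b + 2 * w → y < q → key (B x) ≤ key (B y)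

/-- Inside the block of a pass of merge sort that starts at `bs`. -/
structure MergeInv (n w : ℕ) (key : ℕ → ℝ) (A B : ℕ → ℕ) (q i j e1 e2 bs : ℕ) : Prop where
  dvd : 2 * w ∣ bs
  he1 : e1 = min (bs + w) n
  he2 : e2 = min (bs + 2 * w) n
  hi : bs ≤ i
  hi1 : i ≤ e1
  hj : e1 ≤ j
  hj2 : j ≤ e2
  hq : q + e1 = i + j
  src : ∀ x < q, ∃ y < n, B x = A y
  sur : ∀ y, y < i ∨ (e1 ≤ y ∧ y < j) → ∃ x < q, B x = A y
  srt : ∀ b x y, 2 * w ∣ b → b ≤ x → x < y → y < b + 2 * w → y < q → key (B x) ≤ key (B y)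
  low : ∀ x, bs ≤ x → x < q → ∀ y, (i ≤ y ∧ y < e1) ∨ (j ≤ y ∧ y < e2) → key (B x) ≤ key (A y)

theorem aligned_unique {w b b' x : ℕ} (h : w ∣ b) (h' : w ∣ b') (hb : b ≤ x) (hx : x < b + w)
    (hb' : b' ≤ x) (hx' : x < b' + w) : b = b' := by
  obtain ⟨c, rfl⟩ := h
  obtain ⟨c', rfl⟩ := h'
  have hw : 0 < w := by omega
  have h1 : w * c < w * (c' + 1) := by rw [Nat.mul_succ]; omega
  have h2 : w * c' < w * (c + 1) := by rw [Nat.mul_succ]; omega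
  have := Nat.lt_of_mul_lt_mul_left h1
  have := Nat.lt_of_mul_lt_mul_left h2
  have : c = c' := by omega
  rw [this]

section Merge

variable {n w : ℕ} {key : ℕ → ℝ} {A B : ℕ → ℕ} {q i j e1 e2 bs : ℕ}

theorem MergeDone.start (h : MergeDone n w key A B q) (hq : q < n) :
    MergeInv n w key A B q q (min (q + w) n) (min (q + w) n) (min (min (q + w) n + w) n) q where
  dvd := by rcases h.dvd with h | h <;> [exact h; omega]
  he1 := rfl
  he2 := by omega
  hi := le_rfl
  hi1 := by omega
  hj := le_rfl
  hj2 := by omega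
  hq := rfl
  src := h.src
  sur := fun y hy => h.sur y (by omega)
  srt := h.srt
  low := fun x hx hx' => by omega

theorem MergeInv.done (h : MergeInv n w key A B q i j e1 e2 bs) (hq : q = e2) :
    MergeDone n w key A B q := by
  have := h.he1; have := h.he2; have := h.hi; have := h.hi1; have := h.hj; have := h.hj2
  have := h.hq
  refine ⟨by omega, ?_, h.src, fun y hy => h.sur y (by omega), h.srt⟩
  rcases le_total (bs + 2 * w) n with h1 | h1
  · left
    have : q = bs + 2 * w := by omega
    rw [this]; exact Dvd.dvd.add h.dvd (dvd_refl _)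
  · right; omega

/-- The head of either run may be taken if it is not larger than the head of the other run, as far
as that run is not exhausted. Both runs are sorted, so it is then at most everything that remains;
this is `hzle`. It preserves `low`, and `low` in turn makes the output sorted. -/
theorem MergeInv.take (h : MergeInv n w key A B q i j e1 e2 bs) (hA : BlockSorted w n key A)
    {z i' j' : ℕ} (hq : q < e2)
    (hz : (z = i ∧ i < e1 ∧ i' = i + 1 ∧ j' = j ∧ (j < e2 → key (A i) ≤ key (A j))) ∨
      (z = j ∧ j < e2 ∧ i' = i ∧ j' = j + 1 ∧ (i < e1 → key (A j) ≤ key (A i)))) :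
    MergeInv n w key A (Function.update B q (A z)) (q + 1) i' j' e1 e2 bs := by
  have h1 := h.he1; have h2 := h.he2; have h3 := h.hi; have h4 := h.hi1; have h5 := h.hj
  have h6 := h.hj2; have h7 := h.hq
  have ne : ∀ x < q, Function.update B q (A z) x = B x := fun x hx =>
    Function.update_of_ne (by omega) _ _
  have hd := h.dvd
  have hd1 : w ∣ bs := dvd_trans (Dvd.intro_left 2 rfl) hd
  have hd2 : w ∣ bs + w := Dvd.dvd.add hd1 (dvd_refl _)
  have hzle : ∀ y, (i' ≤ y ∧ y < e1) ∨ (j' ≤ y ∧ y < e2) → key (A z) ≤ key (A y) := by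
    have hl : ∀ x y, i ≤ x → x ≤ y → y < e1 → key (A x) ≤ key (A y) := by
      intro x y hx hxy hy
      rcases hxy.eq_or_lt with rfl | hxy
      · exact le_rfl
      · exact hA bs x y hd1 (by omega) hxy (by omega) (by omega)
    have hr : ∀ x y, j ≤ x → x ≤ y → y < e2 → key (A x) ≤ key (A y) := by
      intro x y hx hxy hy
      rcases hxy.eq_or_lt with rfl | hxy
      · exact le_rfl
      · exact hA (bs + w) x y hd2 (by omega) hxy (by omega) (by omega)
    intro y hy
    rcases hz with ⟨rfl, hlt, rfl, rfl, hk⟩ | ⟨rfl, hlt, rfl, rfl, hk⟩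
    · rcases hy with hy | hy
      · exact hl _ _ le_rfl (by omega) hy.2
      · exact (hk (by omega)).trans (hr _ _ le_rfl hy.1 hy.2)
    · rcases hy with hy | hy
      · exact (hk (by omega)).trans (hl _ _ le_rfl hy.1 hy.2)
      · exact hr _ _ le_rfl (by omega) hy.2
  refine ⟨hd, h1, h2, by omega, by omega, h5.trans (by omega), by omega, by omega, ?_, ?_, ?_, ?_⟩
  · intro x hx
    rcases Nat.lt_succ_iff_lt_or_eq.mp hx with hx | rfl
    · rw [ne x hx]; exact h.src x hx
    · exact ⟨z, by omega, Function.update_self _ _ _⟩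
  · intro y hy
    by_cases hyz : y = z
    · exact ⟨q, by omega, by rw [Function.update_self, hyz]⟩
    · obtain ⟨x, hx, hxy⟩ := h.sur y (by omega)
      exact ⟨x, by omega, by rw [ne x hx, hxy]⟩
  · intro b x y hb hbx hxy hyb hy
    rw [ne x (by omega)]
    rcases Nat.lt_succ_iff_lt_or_eq.mp hy with hy | rfl
    · rw [ne y hy]; exact h.srt b x y hb hbx hxy hyb hy
    · rw [Function.update_self]
      have : b = bs := aligned_unique hb hd (by omega) hyb (by omega) (by omega)
      exact h.low x (by omega) hxy z (by omega)
  · intro x hx hxq y hy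
    rcases Nat.lt_succ_iff_lt_or_eq.mp hxq with hxq | rfl
    · rw [ne x hxq]; exact h.low x hx hxq y (by omega)
    · rw [Function.update_self]; exact hzle y hy

end Merge

theorem MergeDone.result {n w : ℕ} {key : ℕ → ℝ} {A B : ℕ → ℕ} (h : MergeDone n w key A B n)
    (hA : PermOn n A) : BlockSorted (2 * w) n key B ∧ PermOn n B := by
  refine ⟨h.srt, fun x hx => ?_, fun z hz => ?_⟩
  · obtain ⟨y, hy, e⟩ := h.src x hx
    rw [e]; exact hA.1 y hy
  · obtain ⟨y, hy, rfl⟩ := hA.2 z hz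
    exact h.sur y hy

/-! ### Row-major addresses, and merge sort as a program -/

theorem idx_lt {a b x y : ℕ} (hx : x < a) (hy : y < b) : x * b + y < a * b := by
  calc x * b + y < x * b + b := by omega
    _ = (x + 1) * b := by ring
    _ ≤ a * b := Nat.mul_le_mul_right _ hx

theorem idx_inj {b x y x' y' : ℕ} (hy : y < b) (hy' : y' < b) (h : x * b + y = x' * b + y') :
    x = x' ∧ y = y' := by
  have hb : 0 < b := by omega
  have e1 : (x * b + y) / b = x := by
    rw [Nat.add_comm, Nat.add_mul_div_right _ _ hb, Nat.div_eq_of_lt hy, Nat.zero_add]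
  have e2 : (x' * b + y') / b = x' := by
    rw [Nat.add_comm, Nat.add_mul_div_right _ _ hb, Nat.div_eq_of_lt hy', Nat.zero_add]
  have : x = x' := by rw [← e1, ← e2, h]
  subst this
  exact ⟨rfl, by omega⟩

/-- Coordinate number `word 8` of the point number `e`. -/
def keyE (e : WExpr) : RExpr := .load 0 (.plus (.times e (wv 1)) (wv 8))

/-- The minimum of `e` and the number of points. -/
def minE (e : WExpr) : WExpr := .minus e (.minus e (wv 0))

/-- One step of a pass of merge sort. -/
def mergeStep : Prog :=
  .ite (.leWord (wv 16) (wv 9))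
    (wset 13 (wv 9) ;; wset 15 (minE (.plus (wv 9) (wv 12))) ;; wset 14 (wv 15) ;;
      wset 16 (minE (.plus (wv 15) (wv 12)))) .skip ;;
  wset 21 (.const 1) ;;
  .ite (ltw (wv 14) (wv 16))
    (.ite (ltw (wv 13) (wv 15))
      (.ite (.leReal (keyE (.load 10 (wv 13))) (keyE (.load 10 (wv 14)))) .skip
        (wset 21 (.const 0)))
      (wset 21 (.const 0))) .skip ;;
  .ite (.leWord (.const 1) (wv 21))
    (.setWord 11 (wv 9) (.load 10 (wv 13)) ;; incr 13)
    (.setWord 11 (wv 9) (.load 10 (wv 14)) ;; incr 14)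

/-- The coordinate `k` of the points, in the memory. -/
def key (σ : Store) (d k : ℕ) (x : ℕ) : ℝ := σ.real 0 (x * d + k)

/-- The invariant of a pass of merge sort. -/
def MergeState (n w : ℕ) (key : ℕ → ℝ) (A B : ℕ → ℕ) (q i j e1 e2 : ℕ) : Prop :=
  (e2 = q ∧ MergeDone n w key A B q) ∨ (q < e2 ∧ ∃ bs, MergeInv n w key A B q i j e1 e2 bs)

/-- The opening of a new pair of runs is folded into the step, so each step writes exactly one
element in constant time, and a pass is a plain loop over the `n` positions. -/
theorem mergeStep_spec {M n d k w : ℕ} {σ : Store} {q : ℕ} (hM : 2 * (n * d) + 2 * n + 2 * d + 9 ≤ M)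
    (hn : σ.word 0 0 = n) (hd : σ.word 1 0 = d) (hk : σ.word 8 0 = k) (hkd : k < d)
    (hw : σ.word 12 0 = w) (hw0 : 0 < w) (hwn : w < n) (hq : σ.word 9 0 = q) (hqn : q < n)
    (hP : PermOn n (σ.word 10)) (hS : BlockSorted w n (key σ d k) (σ.word 10))
    (hI : MergeState n w (key σ d k) (σ.word 10) (σ.word 11) q (σ.word 13 0) (σ.word 14 0)
      (σ.word 15 0) (σ.word 16 0)) :
    WP M mergeStep σ (fun t τ => MergeState n w (key σ d k) (σ.word 10) (τ.word 11) (q + 1)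
      (τ.word 13 0) (τ.word 14 0) (τ.word 15 0) (τ.word 16 0) ∧ t ≤ 120) := by
  have hF : WP M (.ite (.leWord (wv 16) (wv 9))
    (wset 13 (wv 9) ;; wset 15 (minE (.plus (wv 9) (wv 12))) ;; wset 14 (wv 15) ;;
      wset 16 (minE (.plus (wv 15) (wv 12)))) .skip) σ (fun t τ => t ≤ 60 ∧ q < τ.word 16 0 ∧
        ∃ bs, MergeInv n w (key σ d k) (σ.word 10) (σ.word 11) q (τ.word 13 0) (τ.word 14 0)
        (τ.word 15 0) (τ.word 16 0) bs) := by
    have h16 : σ.word 16 0 < M := by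
      rcases hI with h | ⟨h, bs, hm⟩
      · omega
      · have := hm.he2; omega
    refine WP.of_pre ?_
    simp only [pre, Test.Safe, Test.val, wv_safe, wv_val, hq]
    refine ⟨by omega, fun hle => ?_, fun hle => ?_⟩
    · rcases hI with ⟨h1, h2⟩ | ⟨h, bs, hm⟩
      · have h3 := h2.start hqn
        simp [minE, hq, hw, hn]
        -- Truncated subtraction yields the minimum with `n` without a branch.
        have e2 : ∀ x, x + w - (x + w - n) = min (x + w) n := by omega
        simp only [e2]
        and_intros
        any_goals omega
        exact ⟨q, h3⟩
      · omega
    · rcases hI with ⟨h1, h2⟩ | ⟨h, bs, hm⟩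
      · omega
      · exact ⟨by simp, h, bs, hm⟩
  refine WP.seq hF.frame ?_
  rintro t τ ⟨⟨ht, hlt, bs, hm⟩, hf⟩
  have f0 : τ.word 0 = σ.word 0 := hf.word _ (by decide)
  have f1 : τ.word 1 = σ.word 1 := hf.word _ (by decide)
  have f8 : τ.word 8 = σ.word 8 := hf.word _ (by decide)
  have f9 : τ.word 9 = σ.word 9 := hf.word _ (by decide)
  have f10 : τ.word 10 = σ.word 10 := hf.word _ (by decide)
  have f11 : τ.word 11 = σ.word 11 := hf.word _ (by decide)
  have fr : τ.real 0 = σ.real 0 := hf.real _ (by decide)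
  have h1 := hm.he1; have h2 := hm.he2; have h3 := hm.hi; have h4 := hm.hi1; have h5 := hm.hj
  have h6 := hm.hj2; have h7 := hm.hq
  have hnd : n ≤ n * d := Nat.le_mul_of_pos_right _ (by omega)
  have fin : ∀ z i' j', ((z = τ.word 13 0 ∧ τ.word 13 0 < τ.word 15 0 ∧ i' = τ.word 13 0 + 1 ∧
      j' = τ.word 14 0 ∧ (τ.word 14 0 < τ.word 16 0 →
        key σ d k (σ.word 10 (τ.word 13 0)) ≤ key σ d k (σ.word 10 (τ.word 14 0)))) ∨
      (z = τ.word 14 0 ∧ τ.word 14 0 < τ.word 16 0 ∧ i' = τ.word 13 0 ∧ j' = τ.word 14 0 + 1 ∧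
        (τ.word 13 0 < τ.word 15 0 →
          key σ d k (σ.word 10 (τ.word 14 0)) ≤ key σ d k (σ.word 10 (τ.word 13 0))))) →
      MergeState n w (key σ d k) (σ.word 10) (Function.update (σ.word 11) q (σ.word 10 z)) (q + 1)
        i' j' (τ.word 15 0) (τ.word 16 0) := by
    intro z i' j' hz
    have h8 := hm.take hS hlt hz
    rcases (Nat.succ_le_of_lt hlt).eq_or_lt with h | h
    · exact .inl ⟨h.symm, h8.done h⟩
    · exact .inr ⟨h, bs, h8⟩
  have hA : ∀ x < n, σ.word 10 x < n := hP.1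
  have hAd : ∀ x < n, σ.word 10 x * d + k < n * d := fun x hx => idx_lt (hA x hx) hkd
  refine WP.of_pre ?_
  simp [ltw_val, f1, f8, f9, f10, f11, hd, hk, hq, keyE, fr]
  have e1 : τ.word 13 0 < M := by omega
  have e2 : τ.word 14 0 < M := by omega
  have e3 : τ.word 15 0 < M := by omega
  have e4 : τ.word 16 0 < M := by omega
  have e5 : 0 < M := by omega
  have e6 : 1 < M := by omega
  have e7 : k < M := by omega
  have e8 : d < M := by omega
  have e9 : q < M := by omega
  simp only [e1, e2, e3, e4, e5, e6, e7, e8, e9, true_and]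
  have bnd : ∀ x < n, σ.word 10 x < M ∧ σ.word 10 x * d < M ∧ σ.word 10 x * d + k < M := by
    intro x hx
    have := hA x hx
    have := hAd x hx
    omega
  have L : τ.word 13 0 < τ.word 15 0 →
      (τ.word 14 0 < τ.word 16 0 →
        key σ d k (σ.word 10 (τ.word 13 0)) ≤ key σ d k (σ.word 10 (τ.word 14 0))) →
      σ.word 10 (τ.word 13 0) < M ∧ τ.word 13 0 + 1 < M ∧
        MergeState n w (key σ d k) (σ.word 10)
          (Function.update (σ.word 11) q (σ.word 10 (τ.word 13 0))) (q + 1)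
        (τ.word 13 0 + 1) (τ.word 14 0) (τ.word 15 0) (τ.word 16 0) := fun ha hb =>
    ⟨(bnd _ (by omega)).1, by omega, fin _ _ _ (.inl ⟨rfl, ha, rfl, rfl, hb⟩)⟩
  have R : τ.word 14 0 < τ.word 16 0 →
      (τ.word 13 0 < τ.word 15 0 →
        key σ d k (σ.word 10 (τ.word 14 0)) ≤ key σ d k (σ.word 10 (τ.word 13 0))) →
      σ.word 10 (τ.word 14 0) < M ∧ τ.word 14 0 + 1 < M ∧
        MergeState n w (key σ d k) (σ.word 10)
          (Function.update (σ.word 11) q (σ.word 10 (τ.word 14 0))) (q + 1)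
        (τ.word 13 0) (τ.word 14 0 + 1) (τ.word 15 0) (τ.word 16 0) := fun ha hb =>
    ⟨(bnd _ (by omega)).1, by omega, fin _ _ _ (.inr ⟨rfl, ha, rfl, rfl, hb⟩)⟩
  refine ⟨fun hj => ⟨fun hi => ⟨?_, fun hle => ?_, fun hle => ?_⟩, fun hi => ?_⟩, fun hj => ?_⟩
  · exact ⟨⟨⟨(bnd _ (by omega)).1, (bnd _ (by omega)).2.1⟩, (bnd _ (by omega)).2.2⟩,
      ⟨(bnd _ (by omega)).1, (bnd _ (by omega)).2.1⟩, (bnd _ (by omega)).2.2⟩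
  · obtain ⟨a, b, c⟩ := L hi fun _ => hle
    exact ⟨a, b, c, by omega⟩
  · obtain ⟨a, b, c⟩ := R hj fun _ => le_of_lt hle
    exact ⟨a, b, c, by omega⟩
  · obtain ⟨a, b, c⟩ := R hj fun h => by omega
    exact ⟨a, b, c, by omega⟩
  · obtain ⟨a, b, c⟩ := L (by omega) fun h => by omega
    exact ⟨a, b, c, by omega⟩

/-- A pass of merge sort: blocks of length `word 12` are merged pairwise. -/
def sortPass : Prog :=
  wset 13 (.const 0) ;; wset 14 (.const 0) ;; wset 15 (.const 0) ;; wset 16 (.const 0) ;;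
  forLoop 9 0 mergeStep ;;
  forLoop 9 0 (.setWord 10 (wv 9) (.load 11 (wv 9))) ;;
  wset 12 (.plus (wv 12) (wv 12))

theorem sortPass_spec {M n d k w : ℕ} {σ : Store} (hM : 2 * (n * d) + 2 * n + 2 * d + 9 ≤ M)
    (hn : σ.word 0 0 = n) (hd : σ.word 1 0 = d) (hk : σ.word 8 0 = k) (hkd : k < d)
    (hw : σ.word 12 0 = w) (hw0 : 0 < w) (hwn : w < n)
    (hP : PermOn n (σ.word 10)) (hS : BlockSorted w n (key σ d k) (σ.word 10)) :
    WP M sortPass σ (fun t τ => PermOn n (τ.word 10) ∧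
      BlockSorted (2 * w) n (key σ d k) (τ.word 10) ∧ τ.word 12 0 = 2 * w ∧
      t ≤ 200 * n + 60) := by
  have h0 : PermOn n (σ.word 10) := hP
  refine WP.seq (Q := fun t τ => t = 3 ∧ τ = σ.setWord 13 0 0)
    (WP.of_pre (by simp; omega)) ?_
  rintro _ _ ⟨rfl, rfl⟩
  refine WP.seq (Q := fun t τ => t = 3 ∧ τ = (σ.setWord 13 0 0).setWord 14 0 0)
    (WP.of_pre (by simp; omega)) ?_
  rintro _ _ ⟨rfl, rfl⟩
  refine WP.seq (Q := fun t τ => t = 3 ∧ τ = ((σ.setWord 13 0 0).setWord 14 0 0).setWord 15 0 0)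
    (WP.of_pre (by simp; omega)) ?_
  rintro _ _ ⟨rfl, rfl⟩
  refine WP.seq (Q := fun t τ => t = 3 ∧
    τ = (((σ.setWord 13 0 0).setWord 14 0 0).setWord 15 0 0).setWord 16 0 0)
    (WP.of_pre (by simp; omega)) ?_
  rintro _ _ ⟨rfl, rfl⟩
  set σ' := (((σ.setWord 13 0 0).setWord 14 0 0).setWord 15 0 0).setWord 16 0 0 with hσ'
  have hn' : σ'.word 0 0 = n := by simp [hσ', hn]
  have H := WP.forLoop (M := M) (q := 9) (a := 0) (P := mergeStep) (σ := σ')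
    (fun q τ => MergeState n w (key σ d k) (σ.word 10) (τ.word 11) q (τ.word 13 0) (τ.word 14 0)
      (τ.word 15 0) (τ.word 16 0)) n 120 (by decide) (by decide) (by decide) hn' (by omega)
    (by
      -- All four ends start at `0`, so the pass is between blocks at position `0` and the first
      -- step opens a block.
      left
      refine ⟨by simp [hσ'], by omega, .inl (dvd_zero _), ?_, ?_, ?_⟩ <;> intros <;> omega)
    (by
      intro q τ hq hI hf h9
      have f0 : τ.word 0 0 = n := by rw [hf.word _ (by decide)]; simp [hσ', hn]
      have f1 : τ.word 1 0 = d := by rw [hf.word _ (by decide)]; simp [hσ', hd]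
      have f8 : τ.word 8 0 = k := by rw [hf.word _ (by decide)]; simp [hσ', hk]
      have f12 : τ.word 12 0 = w := by rw [hf.word _ (by decide)]; simp [hσ', hw]
      have f10 : τ.word 10 = σ.word 10 := by rw [hf.word _ (by decide)]; simp [hσ']
      have fr : key τ d k = key σ d k := by
        funext x; simp only [key]; rw [hf.real _ (by decide)]; simp [hσ']
      have h := mergeStep_spec hM f0 f1 f8 hkd f12 hw0 hwn h9 hq (by rwa [f10]) (by rwa [f10, fr])
        (by rwa [f10, fr])
      refine h.mono ?_
      rintro t υ ⟨h1, h2⟩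
      rw [f10, fr] at h1
      exact ⟨by simpa using h1, h2⟩)
  refine WP.seq H.frame ?_
  rintro t1 τ ⟨⟨hI, -, ht1⟩, hf⟩
  have hdone : MergeDone n w (key σ d k) (σ.word 10) (τ.word 11) n := by
    rcases hI with ⟨-, h⟩ | ⟨h, bs, hm⟩
    · exact h
    · have := hm.he2; omega
  obtain ⟨hs2, hp2⟩ := hdone.result hP
  have f0 : τ.word 0 0 = n := by rw [hf.word _ (by decide)]; simp [hσ', hn]
  have f12 : τ.word 12 0 = w := by rw [hf.word _ (by decide)]; simp [hσ', hw]
  have H2 := WP.forLoop (M := M) (q := 9) (a := 0)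
    (P := .setWord 10 (wv 9) (.load 11 (wv 9))) (σ := τ)
    (fun q υ => ∀ x < q, υ.word 10 x = τ.word 11 x) n 6 (by decide) (by decide) (by decide) f0
    (by omega) (by intro x hx; omega)
    (by
      intro q υ hq hI hf h9
      have f11 : υ.word 11 = τ.word 11 := by rw [hf.word _ (by decide)]; simp
      have := hp2.1 q hq
      refine WP.of_pre ?_
      simp [h9, f11]
      refine ⟨by omega, by omega, fun x hx => ?_⟩
      rcases hx.lt_or_eq with hx | rfl
      · rw [Function.update_of_ne (by omega), hI x hx]
      · simp)
  refine WP.seq H2.frame ?_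
  rintro t2 υ ⟨⟨hc, -, ht2⟩, hf2⟩
  have f12' : υ.word 12 0 = w := by rw [hf2.word _ (by decide)]; exact f12
  refine WP.of_pre ?_
  simp [f12']
  refine ⟨by omega, by omega, ⟨fun x hx => ?_, fun z hz => ?_⟩, ?_, by omega, by omega⟩
  · rw [hc x hx]; exact hp2.1 x hx
  · obtain ⟨x, hx, e⟩ := hp2.2 z hz
    exact ⟨x, hx, by rw [hc x hx, e]⟩
  · intro b x y hb hbx hxy hyb hy
    rw [hc x (by omega), hc y hy]
    exact hs2 b x y hb hbx hxy hyb hy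

/-- Sort the points by their coordinate number `word 8`. -/
def sortDim : Prog :=
  forLoop 9 0 (.setWord 10 (wv 9) (wv 9)) ;;
  wset 12 (.const 1) ;;
  .loop (ltw (wv 12) (wv 0)) sortPass ;;
  forLoop 9 0 (.setWord 17 (.plus (.times (wv 8) (wv 0)) (wv 9)) (.load 10 (wv 9)))

/-- `f` lists the points in the order of their keys. -/
def SortedPerm (n : ℕ) (key : ℕ → ℝ) (f : ℕ → ℕ) : Prop :=
  PermOn n f ∧ ∀ x y, x < y → y < n → key (f x) ≤ key (f y)

theorem clog_le_log_succ (n : ℕ) : Nat.clog 2 n ≤ Nat.log 2 n + 1 := by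
  rw [Nat.clog_le_iff_le_pow (by norm_num)]
  exact (Nat.lt_pow_succ_log_self (by norm_num) n).le

theorem sortDim_spec {M n d k : ℕ} {σ : Store} (hM : 2 * (n * d) + 2 * n + 2 * d + 9 ≤ M)
    (hn : σ.word 0 0 = n) (hn0 : 0 < n) (hd : σ.word 1 0 = d) (hk : σ.word 8 0 = k) (hkd : k < d) :
    WP M sortDim σ (fun t τ => SortedPerm n (key σ d k) (fun x => τ.word 17 (k * n + x)) ∧
      (∀ y, (∀ x < n, y ≠ k * n + x) → τ.word 17 y = σ.word 17 y) ∧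
      t ≤ 400 * (n * (Nat.log 2 n + 1))) := by
  have hnd : n ≤ n * d := Nat.le_mul_of_pos_right _ (by omega)
  have H1 := WP.forLoop (M := M) (q := 9) (a := 0)
    (P := .setWord 10 (wv 9) (wv 9)) (σ := σ)
    (fun q υ => ∀ x < q, υ.word 10 x = x) n 5 (by decide) (by decide) (by decide) hn
    (by omega) (by intro x hx; omega)
    (by
      intro q υ hq hI hf h9
      refine WP.of_pre ?_
      simp [h9]
      refine ⟨by omega, fun x hx => ?_⟩
      rcases hx.lt_or_eq with hx | rfl
      · rw [Function.update_of_ne (by omega), hI x hx]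
      · simp)
  refine WP.seq H1.frame ?_
  rintro t1 τ ⟨⟨hI, -, ht1⟩, hf⟩
  have f0 : τ.word 0 = σ.word 0 := hf.word _ (by decide)
  have f1 : τ.word 1 = σ.word 1 := hf.word _ (by decide)
  have f8 : τ.word 8 = σ.word 8 := hf.word _ (by decide)
  have f17 : τ.word 17 = σ.word 17 := hf.word _ (by decide)
  have fr : τ.real 0 = σ.real 0 := hf.real _ (by decide)
  refine WP.seq (Q := fun t υ => t = 3 ∧ υ = τ.setWord 12 0 1)
    (WP.of_pre (by simp; omega)) ?_
  rintro _ _ ⟨rfl, rfl⟩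
  have H2 := WP.loop_count (M := M) (b := ltw (wv 12) (wv 0)) (P := sortPass)
    (σ := τ.setWord 12 0 1)
    (fun e υ => υ.word 12 0 = 2 ^ e ∧ PermOn n (υ.word 10) ∧
      BlockSorted (2 ^ e) n (key σ d k) (υ.word 10)) (Nat.clog 2 n) (200 * n + 60)
    (by
      refine ⟨by simp, ⟨fun x hx => ?_, fun z hz => ⟨z, hz, ?_⟩⟩, ?_⟩
      · simpa [hI x hx] using hx
      · simp [hI z hz]
      · intro b x y hb hbx hxy hyb; omega)
    (by
      rintro e υ he ⟨h12, hp, hs⟩ hf2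
      have g0 : υ.word 0 0 = n := by rw [hf2.word _ (by decide)]; simp [f0, hn]
      have g1 : υ.word 1 0 = d := by rw [hf2.word _ (by decide)]; simp [f1, hd]
      have g8 : υ.word 8 0 = k := by rw [hf2.word _ (by decide)]; simp [f8, hk]
      have gk : key υ d k = key σ d k := by
        funext x; simp only [key]; rw [hf2.real _ (by decide)]; simp [fr]
      have hlt : 2 ^ e < n := by
        by_contra hc
        have := (Nat.clog_le_iff_le_pow (b := 2) (by norm_num)).mpr (not_lt.mp hc)
        omega
      refine ⟨by simp [h12, g0]; omega, by simp [h12, g0, hlt], ?_⟩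
      refine (sortPass_spec hM g0 g1 g8 hkd h12 (by positivity) hlt hp (by rwa [gk])).mono ?_
      rintro t ρ ⟨a1, a2, a3, a4⟩
      rw [gk] at a2
      have : 2 * 2 ^ e = 2 ^ (e + 1) := by ring
      rw [this] at a2 a3
      exact ⟨⟨a3, a1, a2⟩, a4⟩)
    (by
      rintro υ ⟨h12, hp, hs⟩ hf2
      have g0 : υ.word 0 0 = n := by rw [hf2.word _ (by decide)]; simp [f0, hn]
      have h1 : n ≤ 2 ^ Nat.clog 2 n := Nat.le_pow_clog (by norm_num) n
      -- The final block length overshoots `n` by less than a factor of two, so it is still a word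
      -- of the machine.
      have h2 : 2 ^ Nat.clog 2 n < 2 * n := by
        by_cases h : n = 1
        · subst h; simp
        · have := Nat.pow_pred_clog_lt_self (b := 2) (by norm_num) (x := n) (by omega)
          have h3 : 0 < Nat.clog 2 n := Nat.clog_pos (by norm_num) (by omega)
          have h4 : 2 ^ Nat.clog 2 n = 2 * 2 ^ (Nat.clog 2 n).pred := by
            conv_lhs => rw [← Nat.succ_pred_eq_of_pos h3]
            rw [pow_succ]; ring
          omega
      simp [h12, g0, h1]
      omega)
  refine WP.seq H2.frame ?_
  rintro t2 υ ⟨⟨⟨h12, hp, hs⟩, ht2⟩, hf2⟩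
  have g0 : υ.word 0 0 = n := by rw [hf2.word _ (by decide)]; simp [f0, hn]
  have g8 : υ.word 8 0 = k := by rw [hf2.word _ (by decide)]; simp [f8, hk]
  have g17 : υ.word 17 = σ.word 17 := by rw [hf2.word _ (by decide)]; simp [f17]
  have hkn : ∀ x < n, k * n + x < M := by
    intro x hx
    have := idx_lt hkd hx
    have e : d * n = n * d := mul_comm _ _
    omega
  have H3 := WP.forLoop (M := M) (q := 9) (a := 0)
    (P := .setWord 17 (.plus (.times (wv 8) (wv 0)) (wv 9)) (.load 10 (wv 9))) (σ := υ)
    (fun q ρ => (∀ x < q, ρ.word 17 (k * n + x) = υ.word 10 x) ∧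
      ∀ y, (∀ x < n, y ≠ k * n + x) → ρ.word 17 y = σ.word 17 y) n 12
      (by decide) (by decide) (by decide) g0
    (by omega) ⟨by intro x hx; omega, fun y _ => by simp [g17]⟩
    (by
      intro q ρ hq hI hf h9
      have i8 : ρ.word 8 0 = k := by rw [hf.word _ (by decide)]; simp [g8]
      have i0 : ρ.word 0 0 = n := by rw [hf.word _ (by decide)]; simp [g0]
      have i10 : ρ.word 10 = υ.word 10 := by rw [hf.word _ (by decide)]; simp
      have := hkn q hq
      have := hp.1 q hq
      refine WP.of_pre ?_
      simp [h9, i8, i0, i10]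
      refine ⟨by omega, by omega, fun x hx => ?_, fun y hy => ?_⟩
      · rcases hx.lt_or_eq with hx | rfl
        · rw [Function.update_of_ne (by omega), hI.1 x hx]
        · simp
      · rw [Function.update_of_ne (hy q hq), hI.2 y hy])
  refine H3.mono ?_
  rintro t3 ρ ⟨⟨h1, h2⟩, -, ht3⟩
  refine ⟨⟨⟨fun x hx => ?_, fun z hz => ?_⟩, fun x y hxy hy => ?_⟩, h2, ?_⟩
  · simp only [h1 x hx]; exact hp.1 x hx
  · obtain ⟨x, hx, e⟩ := hp.2 z hz
    exact ⟨x, hx, by simp only [h1 x hx, e]⟩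
  · simp only [h1 x (by omega), h1 y hy]
    have h4 : n ≤ 2 ^ Nat.clog 2 n := Nat.le_pow_clog (by norm_num) n
    exact hs 0 x y (dvd_zero _) (Nat.zero_le _) hxy (by omega) hy
  · have h5 := clog_le_log_succ n
    simp at ht2
    have h6 : Nat.clog 2 n * (200 * n + 60 + 6 + 1) ≤ (Nat.log 2 n + 1) * (267 * n) :=
      Nat.mul_le_mul h5 (by omega)
    have h7 : (Nat.log 2 n + 1) * (267 * n) = 267 * (n * (Nat.log 2 n + 1)) := by ring
    have h8 : n ≤ n * (Nat.log 2 n + 1) := Nat.le_mul_of_pos_right _ (by omega)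
    omega

/-- Sort the points by each of their coordinates. -/
def sortAll : Prog := forLoop 8 1 sortDim

theorem sortAll_spec {M n d : ℕ} {σ : Store} (hM : 2 * (n * d) + 2 * n + 2 * d + 9 ≤ M)
    (hn : σ.word 0 0 = n) (hn0 : 0 < n) (hd : σ.word 1 0 = d) (hd0 : 0 < d) :
    WP M sortAll σ (fun t τ =>
      (∀ k < d, SortedPerm n (key σ d k) (fun x => τ.word 17 (k * n + x))) ∧
      t ≤ 423 * (d * (n * (Nat.log 2 n + 1)))) := by
  have H := WP.forLoop (M := M) (q := 8) (a := 1) (P := sortDim) (σ := σ)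
    (fun k' τ => ∀ k < k', SortedPerm n (key σ d k) (fun x => τ.word 17 (k * n + x))) d
    (400 * (n * (Nat.log 2 n + 1))) (by decide) (by decide) (by decide) hd (by omega)
    (by intro x hx; omega)
    (by
      intro k τ hk hI hf h8
      have f0 : τ.word 0 0 = n := by rw [hf.word _ (by decide)]; simp [hn]
      have f1 : τ.word 1 0 = d := by rw [hf.word _ (by decide)]; simp [hd]
      have fr : ∀ k, key τ d k = key σ d k := by
        intro k
        funext x; simp only [key]; rw [hf.real _ (by decide)]; simp
      refine (sortDim_spec hM f0 hn0 f1 h8 hk).mono ?_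
      rintro t υ ⟨h1, h2, h3⟩
      refine ⟨fun k' hk' => ?_, h3⟩
      rcases Nat.lt_succ_iff_lt_or_eq.mp hk' with hk' | rfl
      · have e : ∀ x < n, υ.word 17 (k' * n + x) = τ.word 17 (k' * n + x) := by
          intro x hx
          refine h2 _ fun y hy h => ?_
          have := (idx_inj hx hy h).1
          omega
        obtain ⟨⟨a1, a2⟩, a3⟩ := hI k' hk'
        refine ⟨⟨fun x hx => ?_, fun z hz => ?_⟩, fun x y hxy hy => ?_⟩
        · simp [e x hx]; exact a1 x hx
        · obtain ⟨x, hx, e'⟩ := a2 z hz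
          exact ⟨x, hx, by simp [e x hx]; exact e'⟩
        · simp [e x (by omega), e y hy]; exact a3 x y hxy hy
      · rw [← fr]; simpa using h1)
  refine H.mono ?_
  rintro t τ ⟨h1, -, h2⟩
  refine ⟨h1, ?_⟩
  have h3 : d * (400 * (n * (Nat.log 2 n + 1)) + 13) = 400 * (d * (n * (Nat.log 2 n + 1))) + 13 * d := by
    ring
  have h4 : d ≤ d * (n * (Nat.log 2 n + 1)) := Nat.le_mul_of_pos_right _ (by positivity)
  omega

/-! ## Distributing the sorted lists to the segments of a partition -/

/-- The points `0, …, n - 1` are partitioned into `ns` nonempty segments: `g` maps points to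
segments, and `sz` gives the sizes. -/
structure Partitioned (n ns : ℕ) (g sz : ℕ → ℕ) : Prop where
  lt : ∀ i < n, g i < ns
  size : ∀ p < ns, sz p = Nat.count (fun i => g i = p) n
  pos : ∀ p < ns, 0 < sz p

/-- `o` lists, segment by segment, the points in the order of their keys; the segment `p` starts at
position `st p`. -/
structure Distributed (n ns : ℕ) (g sz st : ℕ → ℕ) (key : ℕ → ℝ) (o : ℕ → ℕ) : Prop where
  mem : ∀ p < ns, ∀ x, st p ≤ x → x < st p + sz p → o x < n ∧ g (o x) = p
  srt : ∀ p < ns, ∀ x y, st p ≤ x → x < y → y < st p + sz p → key (o x) ≤ key (o y)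
  sur : ∀ i < n, ∃ x, st (g i) ≤ x ∧ x < st (g i) + sz (g i) ∧ o x = i

theorem exists_count_eq (P : ℕ → Prop) [DecidablePred P] {n j : ℕ} (h : j < Nat.count P n) :
    ∃ q < n, P q ∧ Nat.count P q = j := by
  induction n with
  | zero => simp at h
  | succ n ih =>
    rw [Nat.count_succ] at h
    by_cases hj : j < Nat.count P n
    · obtain ⟨q, hq, h1⟩ := ih hj
      exact ⟨q, by omega, h1⟩
    · split_ifs at h with hP
      · exact ⟨n, by omega, hP, by omega⟩
      · omega

/-- A finite set mapped onto itself is mapped injectively, so `PermOn` needs no clause about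
injectivity. -/
theorem PermOn.bijOn {n : ℕ} {f : ℕ → ℕ} (h : PermOn n f) :
    Set.BijOn f (Finset.range n : Set ℕ) (Finset.range n : Set ℕ) := by
  have hm : Set.MapsTo f (Finset.range n : Set ℕ) (Finset.range n : Set ℕ) := fun x hx => by
    simpa using h.1 x (by simpa using hx)
  have hs : Set.SurjOn f (Finset.range n : Set ℕ) (Finset.range n : Set ℕ) := fun z hz => by
    obtain ⟨x, hx, e⟩ := h.2 z (by simpa using hz)
    exact ⟨x, by simpa using hx, e⟩
  exact ⟨hm, Finset.injOn_of_surjOn_of_card_le f hm hs le_rfl, hs⟩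

theorem PermOn.count {n : ℕ} {f : ℕ → ℕ} (h : PermOn n f) (P : ℕ → Prop) [DecidablePred P] :
    Nat.count (fun x => P (f x)) n = Nat.count P n := by
  rw [Nat.count_eq_card_filter_range, Nat.count_eq_card_filter_range]
  have hb := h.bijOn
  refine Finset.card_nbij f ?_ ?_ ?_
  · intro x hx
    rw [Finset.mem_coe, Finset.mem_filter] at *
    exact ⟨by simpa using hb.1 (by simpa using hx.1), hx.2⟩
  · intro x hx y hy e
    rw [Finset.mem_coe, Finset.mem_filter] at *
    exact hb.2.1 (by simpa using hx.1) (by simpa using hy.1) e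
  · intro z hz
    rw [Finset.mem_coe, Finset.mem_filter] at *
    obtain ⟨x, hx, e⟩ := hb.2.2 (show z ∈ (Finset.range n : Set ℕ) by simpa using hz.1)
    exact ⟨x, by simp at hx ⊢; exact ⟨hx, by rw [e]; exact hz.2⟩, e⟩

section

variable {n ns : ℕ} {g sz : ℕ → ℕ}

theorem Partitioned.sum (h : Partitioned n ns g sz) : ∑ p ∈ Finset.range ns, sz p = n := by
  have h1 := Finset.card_eq_sum_card_fiberwise (f := g) (s := Finset.range n)
    (t := Finset.range ns) (fun x hx => by simpa using h.lt x (by simpa using hx))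
  rw [Finset.card_range] at h1
  conv_rhs => rw [h1]
  refine Finset.sum_congr rfl fun p hp => ?_
  rw [h.size p (by simpa using hp), Nat.count_eq_card_filter_range]

theorem Partitioned.le (h : Partitioned n ns g sz) : ns ≤ n := by
  conv_rhs => rw [← h.sum]
  calc ns = ∑ p ∈ Finset.range ns, 1 := by simp
    _ ≤ _ := Finset.sum_le_sum fun p hp => h.pos p (by simpa using hp)

theorem Partitioned.start_add_le (h : Partitioned n ns g sz) {p : ℕ} (hp : p < ns) :
    ∑ x ∈ Finset.range p, sz x + sz p ≤ n := by
  rw [← Finset.sum_range_succ]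
  conv_rhs => rw [← h.sum]
  exact Finset.sum_le_sum_of_subset (Finset.range_mono hp)

theorem start_disjoint (sz : ℕ → ℕ) {p p' : ℕ} (hp : p < p') :
    ∑ x ∈ Finset.range p, sz x + sz p ≤ ∑ x ∈ Finset.range p', sz x := by
  rw [← Finset.sum_range_succ]
  exact Finset.sum_le_sum_of_subset (Finset.range_mono hp)

/-- The position of the point number `q` of the list `f` in the distributed list. -/
def slot (g sz f : ℕ → ℕ) (q : ℕ) : ℕ :=
  ∑ x ∈ Finset.range (g (f q)), sz x + Nat.count (fun x => g (f x) = g (f q)) q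

variable {f : ℕ → ℕ}

theorem count_lt_size (h : Partitioned n ns g sz) (hf : PermOn n f) {q : ℕ} (hq : q < n) :
    Nat.count (fun x => g (f x) = g (f q)) q < sz (g (f q)) := by
  rw [h.size _ (h.lt _ (hf.1 q hq)), ← hf.count (fun i => g i = g (f q))]
  exact Nat.count_strict_mono (p := fun x => g (f x) = g (f q)) rfl hq

theorem slot_lt (h : Partitioned n ns g sz) (hf : PermOn n f) {q : ℕ} (hq : q < n) :
    slot g sz f q < n := by
  have h1 := count_lt_size h hf hq
  have h2 := h.start_add_le (h.lt _ (hf.1 q hq))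
  unfold slot; omega

/-- Different segments occupy disjoint intervals of positions, and inside one segment the count of
earlier members increases strictly. -/
theorem slot_inj (h : Partitioned n ns g sz) (hf : PermOn n f) {q q' : ℕ} (hq' : q' < q)
    (hq : q < n) : slot g sz f q' ≠ slot g sz f q := by
  intro e
  have h1 := count_lt_size h hf hq
  have h2 := count_lt_size h hf (hq'.trans hq)
  unfold slot at e
  rcases lt_trichotomy (g (f q')) (g (f q)) with hl | hl | hl
  · have := start_disjoint sz hl; omega
  · have := Nat.count_strict_mono (p := fun x => g (f x) = g (f q)) hl hq'
    rw [hl] at e; omega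
  · have := start_disjoint sz hl; omega

/-- Stability of counting sort: inside a segment positions are given by counting along the sorted
list, so the order of that list is kept. Conversely, position `x` of the segment `p` belongs to the
member with exactly `x - st p` predecessors from `p`. -/
theorem Distributed.of_slot (h : Partitioned n ns g sz) {key : ℕ → ℝ} (hf : SortedPerm n key f)
    {st o : ℕ → ℕ} (hst : ∀ p < ns, st p = ∑ x ∈ Finset.range p, sz x)
    (ho : ∀ q < n, o (slot g sz f q) = f q) : Distributed n ns g sz st key o := by
  have ex : ∀ p < ns, ∀ x, st p ≤ x → x < st p + sz p →
      ∃ q < n, g (f q) = p ∧ Nat.count (fun y => g (f y) = p) q = x - st p ∧ o x = f q := by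
    intro p hp x hx hx'
    have h1 : x - st p < Nat.count (fun y => g (f y) = p) n := by
      rw [hf.1.count (fun i => g i = p), ← h.size p hp]; omega
    obtain ⟨q, hq, hgq, hc⟩ := exists_count_eq _ h1
    refine ⟨q, hq, hgq, hc, ?_⟩
    rw [← ho q hq]
    congr 1
    unfold slot
    rw [hgq, hc, ← hst p hp]
    omega
  refine ⟨fun p hp x hx hx' => ?_, fun p hp x y hx hxy hy => ?_, fun i hi => ?_⟩
  · obtain ⟨q, hq, hgq, -, e⟩ := ex p hp x hx hx'
    rw [e]; exact ⟨hf.1.1 q hq, hgq⟩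
  · obtain ⟨q, hq, hgq, hc, e⟩ := ex p hp x hx (by omega)
    obtain ⟨q', hq', hgq', hc', e'⟩ := ex p hp y (by omega) hy
    rw [e, e']
    refine hf.2 q q' ?_ hq'
    by_contra hle
    have := Nat.count_monotone (fun y => g (f y) = p) (not_lt.mp hle)
    omega
  · obtain ⟨q, hq, rfl⟩ := hf.1.2 i hi
    have h1 := count_lt_size h hf.1 hq
    have h2 := hst _ (h.lt _ (hf.1.1 q hq))
    refine ⟨slot g sz f q, ?_, ?_, ho q hq⟩ <;> unfold slot <;> omega

end

/-- The position `word 8 * n + e`. -/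
def rowE (e : WExpr) : WExpr := .plus (.times (wv 8) (wv 0)) e

/-- One step of the distribution. -/
def distStep : Prog :=
  wset 33 (.load 17 (rowE (wv 9))) ;;
  wset 34 (.load 18 (wv 33)) ;;
  .setWord 23 (rowE (.load 24 (wv 34))) (wv 33) ;;
  .setWord 24 (wv 34) (.plus (.load 24 (wv 34)) (.const 1))

/-- Distribute the list of the points that is sorted by the coordinate `word 8`. -/
def distDim : Prog :=
  forLoop 9 26 (.setWord 24 (wv 9) (.load 25 (wv 9))) ;; forLoop 9 0 distStep

/-- Cell `p` of the word array `24` holds the first free position of the segment `p`, so the point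
read at step `q` lands in its slot. All writes stay in row `k`, so the lists of the other
coordinates survive. -/
theorem distDim_spec {M n d k ns : ℕ} {g sz f : ℕ → ℕ} {σ : Store}
    (hM : 2 * (n * d) + 2 * n + 2 * d + 9 ≤ M) (hn : σ.word 0 0 = n)
    (hk : σ.word 8 0 = k) (hkd : k < d) (hns : σ.word 26 0 = ns)
    (hP : Partitioned n ns g sz) (hg : σ.word 18 = g)
    (hst : ∀ p < ns, σ.word 25 p = ∑ x ∈ Finset.range p, sz x)
    (hf : PermOn n f) (hs : ∀ x < n, σ.word 17 (k * n + x) = f x) :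
    WP M distDim σ (fun t τ => (∀ q < n, τ.word 23 (k * n + slot g sz f q) = f q) ∧
      (∀ y, (∀ x < n, y ≠ k * n + x) → τ.word 23 y = σ.word 23 y) ∧ t ≤ 100 * n + 20) := by
  have hnsn := hP.le
  have hnd : n ≤ n * d := Nat.le_mul_of_pos_right _ (by omega)
  have H1 := WP.forLoop (M := M) (q := 9) (a := 26)
    (P := .setWord 24 (wv 9) (.load 25 (wv 9))) (σ := σ)
    (fun q υ => ∀ x < q, υ.word 24 x = σ.word 25 x) ns 6 (by decide) (by decide) (by decide) hns
    (by omega) (by intro x hx; omega)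
    (by
      intro q υ hq hI hf h9
      have f25 : υ.word 25 = σ.word 25 := by rw [hf.word _ (by decide)]; simp
      have h1 := hst q hq
      have h2 := hP.start_add_le hq
      refine WP.of_pre ?_
      simp [h9, f25]
      refine ⟨by omega, by omega, fun x hx => ?_⟩
      rcases hx.lt_or_eq with hx | rfl
      · rw [Function.update_of_ne (by omega), hI x hx]
      · simp)
  refine WP.seq H1.frame ?_
  rintro t1 τ ⟨⟨hI, -, ht1⟩, hfr⟩
  have f0 : τ.word 0 0 = n := by rw [hfr.word _ (by decide)]; exact hn
  have f8 : τ.word 8 0 = k := by rw [hfr.word _ (by decide)]; exact hk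
  have f17 : τ.word 17 = σ.word 17 := hfr.word _ (by decide)
  have f18 : τ.word 18 = σ.word 18 := hfr.word _ (by decide)
  have f23 : τ.word 23 = σ.word 23 := hfr.word _ (by decide)
  have H2 := WP.forLoop (M := M) (q := 9) (a := 0) (P := distStep) (σ := τ)
    (fun q υ => (∀ p < ns, υ.word 24 p =
        ∑ x ∈ Finset.range p, sz x + Nat.count (fun x => g (f x) = p) q) ∧
      (∀ q' < q, υ.word 23 (k * n + slot g sz f q') = f q') ∧
      ∀ y, (∀ x < n, y ≠ k * n + x) → υ.word 23 y = σ.word 23 y) n 60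
    (by decide) (by decide) (by decide) f0 (by omega)
    (by
      refine ⟨fun p hp => ?_, fun q hq => by omega, fun y _ => by simp [f23]⟩
      simp [hI p hp, hst p hp])
    (by
      rintro q υ hq ⟨i1, i2, i3⟩ hf2 h9
      have g0 : υ.word 0 0 = n := by rw [hf2.word _ (by decide)]; simp [f0]
      have g8 : υ.word 8 0 = k := by rw [hf2.word _ (by decide)]; simp [f8]
      have g17 : υ.word 17 (k * n + q) = f q := by
        rw [hf2.word _ (by decide)]; simp [f17, hs q hq]
      have g18 : υ.word 18 = g := by rw [hf2.word _ (by decide)]; simp [f18, hg]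
      have hfq := hf.1 q hq
      have hgq := hP.lt _ hfq
      have e24 : υ.word 24 (g (f q)) = slot g sz f q := i1 _ hgq
      have hsl := slot_lt hP hf hq
      have b1 := idx_lt hkd hq
      have b2 := idx_lt hkd hsl
      have e : d * n = n * d := mul_comm _ _
      refine WP.of_pre ?_
      simp [distStep, rowE, h9, g0, g8, g17, g18, e24]
      and_intros
      any_goals omega
      · intro p hp
        rw [Nat.count_succ]
        by_cases hpq : p = g (f q)
        · subst hpq
          simp [slot]; omega
        · rw [Function.update_of_ne hpq, if_neg (fun h => hpq h.symm), i1 p hp, Nat.add_zero]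
      · intro q' hq'
        rcases hq'.lt_or_eq with hq' | rfl
        · rw [Function.update_of_ne, i2 q' hq']
          intro h
          exact slot_inj hP hf hq' hq (by omega)
        · simp
      · intro y hy
        rw [Function.update_of_ne (hy _ hsl), i3 y hy])
  refine H2.mono ?_
  rintro t2 υ ⟨⟨-, h1, h2⟩, -, ht2⟩
  exact ⟨h1, h2, by omega⟩

/-- Distribute the sorted lists of points. -/
def distribute : Prog :=
  wset 32 (.const 0) ;;
  forLoop 9 26 (.setWord 25 (wv 9) (wv 32) ;; wset 32 (.plus (wv 32) (.load 19 (wv 9)))) ;;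
  forLoop 8 1 distDim

theorem distribute_spec {M n d ns : ℕ} {σ : Store} {key : ℕ → ℕ → ℝ}
    (hM : 2 * (n * d) + 2 * n + 2 * d + 9 ≤ M) (hn : σ.word 0 0 = n) (hd : σ.word 1 0 = d)
    (hd0 : 0 < d) (hn0 : 0 < n)
    (hns : σ.word 26 0 = ns) (hP : Partitioned n ns (σ.word 18) (σ.word 19))
    (hs : ∀ k < d, SortedPerm n (key k) (fun x => σ.word 17 (k * n + x))) :
    WP M distribute σ (fun t τ => (∀ p < ns, τ.word 25 p + σ.word 19 p ≤ n) ∧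
      (∀ k < d, Distributed n ns (σ.word 18) (σ.word 19) (τ.word 25) (key k)
        (fun x => τ.word 23 (k * n + x))) ∧ t ≤ 200 * (d * n)) := by
  have hnsn := hP.le
  have hnd : n ≤ n * d := Nat.le_mul_of_pos_right _ (by omega)
  have hdn : d ≤ d * n := Nat.le_mul_of_pos_right _ (by omega)
  have hcomm : d * n = n * d := mul_comm _ _
  refine WP.seq (Q := fun t τ => t = 3 ∧ τ = σ.setWord 32 0 0)
    (WP.of_pre (by simp; omega)) ?_
  rintro _ _ ⟨rfl, rfl⟩
  have H1 := WP.forLoop (M := M) (q := 9) (a := 26)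
    (P := .setWord 25 (wv 9) (wv 32) ;; wset 32 (.plus (wv 32) (.load 19 (wv 9))))
    (σ := σ.setWord 32 0 0)
    (fun q υ => υ.word 32 0 = ∑ x ∈ Finset.range q, σ.word 19 x ∧
      ∀ p < q, υ.word 25 p = ∑ x ∈ Finset.range p, σ.word 19 x) ns 14
    (by decide) (by decide) (by decide) (by simp [hns])
    (by omega) ⟨by simp, by intro x hx; omega⟩
    (by
      rintro q υ hq ⟨i1, i2⟩ hf h9
      have f19 : υ.word 19 = σ.word 19 := by rw [hf.word _ (by decide)]; simp
      have h2 := hP.start_add_le hq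
      refine WP.of_pre ?_
      simp [h9, f19, i1]
      and_intros
      any_goals omega
      · rw [Finset.sum_range_succ]
      · intro p hp
        rcases hp.lt_or_eq with hp | rfl
        · rw [Function.update_of_ne (by omega), i2 p hp]
        · simp)
  refine WP.seq H1.frame ?_
  rintro t1 τ ⟨⟨⟨-, hI⟩, -, ht1⟩, hfr⟩
  have f0 : τ.word 0 0 = n := by rw [hfr.word _ (by decide)]; simp [hn]
  have f1 : τ.word 1 0 = d := by rw [hfr.word _ (by decide)]; simp [hd]
  have f26 : τ.word 26 0 = ns := by rw [hfr.word _ (by decide)]; simp [hns]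
  have f17 : τ.word 17 = σ.word 17 := by rw [hfr.word _ (by decide)]; simp
  have f18 : τ.word 18 = σ.word 18 := by rw [hfr.word _ (by decide)]; simp
  have H2 := WP.forLoop (M := M) (q := 8) (a := 1) (P := distDim) (σ := τ)
    (fun k' υ => ∀ k < k', ∀ q < n,
      υ.word 23 (k * n + slot (σ.word 18) (σ.word 19) (fun x => σ.word 17 (k * n + x)) q) =
        σ.word 17 (k * n + q)) d (100 * n + 20)
    (by decide) (by decide) (by decide) f1 (by omega) (by intro k hk; omega)
    (by
      intro k υ hk hI2 hf2 h8
      have g0 : υ.word 0 0 = n := by rw [hf2.word _ (by decide)]; simp [f0]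
      have g26 : υ.word 26 0 = ns := by rw [hf2.word _ (by decide)]; simp [f26]
      have g17 : υ.word 17 = σ.word 17 := by rw [hf2.word _ (by decide)]; simp [f17]
      have g18 : υ.word 18 = σ.word 18 := by rw [hf2.word _ (by decide)]; simp [f18]
      have g25 : υ.word 25 = τ.word 25 := by rw [hf2.word _ (by decide)]; simp
      refine (distDim_spec hM g0 h8 hk g26 hP g18 (by simpa [g25] using hI) (hs k hk).1
        (by simp [g17])).mono ?_
      rintro t ρ ⟨a1, a2, a3⟩
      refine ⟨fun k' hk' q hq => ?_, a3⟩
      simp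
      rcases Nat.lt_succ_iff_lt_or_eq.mp hk' with hk' | rfl
      · rw [a2, hI2 k' hk' q hq]
        intro y hy h
        have hsl := slot_lt hP (hs k' (by omega)).1 hq
        have := (idx_inj hsl hy h).1
        omega
      · exact a1 q hq)
  refine H2.frame.mono ?_
  rintro t2 υ ⟨⟨h1, -, ht2⟩, hf2⟩
  have g25 : υ.word 25 = τ.word 25 := hf2.word _ (by decide)
  refine ⟨fun p hp => ?_, fun k hk => ?_, ?_⟩
  · rw [g25, hI p hp]; exact hP.start_add_le hp
  · exact Distributed.of_slot hP (hs k hk) (fun p hp => by rw [g25, hI p hp]) (h1 k hk)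
  · have : d * (100 * n + 20 + 13) = 100 * (d * n) + 33 * d := by ring
    omega

/-- The amortized form of `WP.forLoop`: an iteration may spend `C` units and whatever it draws from
the potential `φ`. It serves loops whose iterations have very unequal costs. -/
theorem WP.forLoop_potential {M q a : ℕ} {P : Prog} (I : ℕ → ℕ → Store → Prop) (N C φ : ℕ)
    {σ : Store} (hqa : q ≠ a) (haP : a ∉ P.wordArrays) (hqP : q ∉ P.wordArrays)
    (hN : σ.word a 0 = N) (hNM : N < M)
    (h0 : I 0 φ (σ.setWord q 0 0))
    (hI : ∀ k φ τ, k < N → I k φ τ → Frame (P ;; incr q) (σ.setWord q 0 0) τ → τ.word q 0 = k →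
      WP M P τ (fun t υ => ∃ φ', I (k + 1) φ' (υ.setWord q 0 (k + 1)) ∧ t + φ' ≤ C + φ)) :
    WP M (BallWSPD.forLoop q a P) σ
      (fun t τ => ∃ φ', I N φ' τ ∧ τ.word q 0 = N ∧ t + φ' ≤ N * (C + 13) + 10 + φ) := by
  refine WP.of_pre ?_
  simp only [BallWSPD.forLoop, pre, wset, WExpr.Safe, WExpr.val, WExpr.cost]
  refine ⟨by omega, by omega, ?_⟩
  have h := WP.loop_potential (M := M) (b := ltw (wv q) (wv a)) (P := P ;; incr q)
    (fun (g : ℕ × ℕ) τ => g.1 ≤ N ∧ I g.1 g.2 τ ∧ τ.word q 0 = g.1)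
    (fun g => (N - g.1) * (C + 13) + g.2)
    (σ := σ.setWord q 0 0) (g := (0, φ)) ⟨Nat.zero_le _, h0, by simp⟩
    (by
      rintro ⟨k, ψ⟩ τ ⟨hk, hi, hq⟩ hf
      simp only at hk hi hq ⊢
      have ha : τ.word a 0 = N := by
        rw [hf.word a (by simp [Prog.wordArrays, haP]; exact fun h => hqa h.symm)]
        simp [hqa.symm, hN]
      refine ⟨by simp [hq, ha]; omega, fun hlt => ?_⟩
      have hlt : k < N := by simpa [hq, ha] using hlt
      refine WP.seq (hI k ψ τ hlt hi hf hq).frame ?_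
      rintro t υ ⟨⟨φ', h1, h2⟩, hf'⟩
      refine WP.of_pre ?_
      have e : υ.word q 0 = k := by rw [hf'.word q hqP, hq]
      refine ⟨by simp; omega, by simp [e]; omega, (k + 1, φ'), ⟨hlt, by simpa [e] using h1,
        by simp [e]⟩, ?_⟩
      simp
      obtain ⟨m, hm⟩ := Nat.exists_eq_add_of_lt hlt
      have e1 : N - k = m + 1 := by omega
      have e2 : N - (k + 1) = m := by omega
      rw [e1, e2, Nat.succ_mul]
      omega)
  refine h.frame.mono ?_
  rintro t τ ⟨⟨⟨k, ψ⟩, ⟨hk, hi, hq⟩, ht, hv⟩, hf⟩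
  simp only at hk hi hq ht
  have ha : τ.word a 0 = N := by
    rw [hf.word a (by simp [Prog.wordArrays, haP]; exact fun h => hqa h.symm)]
    simp [hqa.symm, hN]
  have : k = N := by
    have : ¬ k < N := by simpa [hq, ha] using hv
    omega
  subst this
  refine ⟨ψ, hi, hq, ?_⟩
  simp at ht
  omega

/-! ## Splitting a segment -/

/-- All points of the segment `p` are listed by `o` at positions in `[L, R)`. -/
structure Window (n : ℕ) (g : ℕ → ℕ) (p s e : ℕ) (o : ℕ → ℕ) (L R : ℕ) : Prop where
  left : s ≤ L
  right : R ≤ e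
  mem : ∀ i < n, g i = p → ∃ x, L ≤ x ∧ x < R ∧ o x = i

theorem Window.succ {n p s e L R : ℕ} {g o : ℕ → ℕ} (h : Window n g p s e o L R)
    (hL : g (o L) ≠ p) : Window n g p s e o (L + 1) R := by
  refine ⟨h.left.trans (Nat.le_succ _), h.right, fun i hi hg => ?_⟩
  obtain ⟨x, h1, h2, h3⟩ := h.mem i hi hg
  refine ⟨x, Nat.succ_le_of_lt (lt_of_le_of_ne h1 ?_), h2, h3⟩
  rintro rfl
  exact hL (h3 ▸ hg)

theorem Window.pred {n p s e L R : ℕ} {g o : ℕ → ℕ} (h : Window n g p s e o L R)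
    (hR : g (o (R - 1)) ≠ p) : Window n g p s e o L (R - 1) := by
  refine ⟨h.left, (Nat.sub_le _ _).trans h.right, fun i hi hg => ?_⟩
  obtain ⟨x, h1, h2, h3⟩ := h.mem i hi hg
  refine ⟨x, h1, ?_, h3⟩
  have : x ≠ R - 1 := by
    rintro rfl
    exact hR (h3 ▸ hg)
  omega

/-- Advance the left end of the window of the coordinate `word 8`. -/
def skipLeft : Prog :=
  .loop (.neg (eqw (.load 18 (.load 23 (rowE (.load 28 (wv 8))))) (wv 27)))
    (.setWord 28 (wv 8) (.plus (.load 28 (wv 8)) (.const 1)))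

/-- Move the right end of the window of the coordinate `word 8`. -/
def skipRight : Prog :=
  .loop (.neg (eqw (.load 18 (.load 23 (rowE (.minus (.load 29 (wv 8)) (.const 1))))) (wv 27)))
    (.setWord 29 (wv 8) (.minus (.load 29 (wv 8)) (.const 1)))

section Scan

variable {M n d k p s e i₀ ns : ℕ} {g : ℕ → ℕ} {o : ℕ → ℕ} {σ : Store}

/-- A window must list all points of its segment, but may still list points that have left it. Those
at the left end are discarded here; each of them shortens the window, and the 130 units released by
that pay for the iteration. The member `i₀` stops the loop before the window is empty. -/
theorem skipLeft_spec (hM : 2 * (n * d) + 2 * n + 2 * d + 9 ≤ M) (hn : σ.word 0 0 = n)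
    (hk : σ.word 8 0 = k) (hkd : k < d) (hp : σ.word 27 0 = p)
    (hg : ∀ i < n, σ.word 18 i < n) (hpn : p < n) (he : e ≤ n)
    (ho : ∀ x, s ≤ x → x < e → σ.word 23 (k * n + x) = o x ∧ o x < n)
    (hi₀ : i₀ < n) (hgi : σ.word 18 i₀ = p)
    (hW : Window n (σ.word 18) p s e o (σ.word 28 k) (σ.word 29 k)) :
    WP M skipLeft σ (fun t τ => ∃ L, τ.word 28 = Function.update (σ.word 28) k L ∧
      Window n (σ.word 18) p s e o L (σ.word 29 k) ∧ σ.word 18 (o L) = p ∧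
      L < σ.word 29 k ∧ t + 130 * (σ.word 29 k - L) ≤ 130 * (σ.word 29 k - σ.word 28 k) + 44) := by
  have hnd : n ≤ n * d := Nat.le_mul_of_pos_right _ (by omega)
  have hdn : d * n = n * d := mul_comm _ _
  have H := WP.loop_potential (M := M)
    (b := .neg (eqw (.load 18 (.load 23 (rowE (.load 28 (wv 8))))) (wv 27)))
    (P := .setWord 28 (wv 8) (.plus (.load 28 (wv 8)) (.const 1))) (σ := σ)
    (fun L τ => τ.word 28 = Function.update (σ.word 28) k L ∧
      Window n (σ.word 18) p s e o L (σ.word 29 k))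
    (fun L => 130 * (σ.word 29 k - L)) (g := σ.word 28 k) ⟨by simp, hW⟩
    (by
      rintro L τ ⟨h28, hw⟩ hf
      have f0 : τ.word 0 0 = n := by rw [hf.word _ (by decide), hn]
      have f8 : τ.word 8 0 = k := by rw [hf.word _ (by decide), hk]
      have f18 : τ.word 18 = σ.word 18 := hf.word _ (by decide)
      have f23 : τ.word 23 = σ.word 23 := hf.word _ (by decide)
      have f27 : τ.word 27 0 = p := by rw [hf.word _ (by decide), hp]
      obtain ⟨x, hx1, hx2, -⟩ := hw.mem i₀ hi₀ hgi
      have h1 := hw.left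
      have h2 := hw.right
      obtain ⟨e1, e2⟩ := ho L h1 (by omega)
      have h3 := hg _ e2
      have h4 := idx_lt hkd (show L < n by omega)
      constructor
      · simp [rowE, f0, f8, f18, f23, f27, h28, e1]
        and_intros <;> omega
      · intro hv
        have hv : ¬ σ.word 18 (o L) = p := by
          simpa [rowE, f0, f8, f18, f23, f27, h28, e1] using hv
        refine WP.of_pre ?_
        simp [rowE, f8, h28]
        refine ⟨by omega, by omega, L + 1, ⟨rfl, hw.succ hv⟩, by omega⟩)
  refine H.frame.mono ?_
  rintro t τ ⟨⟨L, ⟨h28, hw⟩, ht, hv⟩, hf⟩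
  have f0 : τ.word 0 0 = n := by rw [hf.word _ (by decide), hn]
  have f8 : τ.word 8 0 = k := by rw [hf.word _ (by decide), hk]
  have f18 : τ.word 18 = σ.word 18 := hf.word _ (by decide)
  have f23 : τ.word 23 = σ.word 23 := hf.word _ (by decide)
  have f27 : τ.word 27 0 = p := by rw [hf.word _ (by decide), hp]
  obtain ⟨x, hx1, hx2, -⟩ := hw.mem i₀ hi₀ hgi
  have h1 := hw.left
  have h2 := hw.right
  obtain ⟨e1, e2⟩ := ho L h1 (by omega)
  refine ⟨L, h28, hw, ?_, by omega, ?_⟩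
  · simpa [rowE, f0, f8, f18, f23, f27, h28, e1] using hv
  · simp [rowE] at ht
    omega

theorem skipRight_spec (hM : 2 * (n * d) + 2 * n + 2 * d + 9 ≤ M) (hn : σ.word 0 0 = n)
    (hk : σ.word 8 0 = k) (hkd : k < d) (hp : σ.word 27 0 = p)
    (hg : ∀ i < n, σ.word 18 i < n) (hpn : p < n) (he : e ≤ n)
    (ho : ∀ x, s ≤ x → x < e → σ.word 23 (k * n + x) = o x ∧ o x < n)
    (hi₀ : i₀ < n) (hgi : σ.word 18 i₀ = p)
    (hW : Window n (σ.word 18) p s e o (σ.word 28 k) (σ.word 29 k)) :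
    WP M skipRight σ (fun t τ => ∃ R, τ.word 29 = Function.update (σ.word 29) k R ∧
      Window n (σ.word 18) p s e o (σ.word 28 k) R ∧ σ.word 18 (o (R - 1)) = p ∧
      σ.word 28 k < R ∧ t + 130 * (R - σ.word 28 k) ≤ 130 * (σ.word 29 k - σ.word 28 k) + 44) := by
  have hnd : n ≤ n * d := Nat.le_mul_of_pos_right _ (by omega)
  have hdn : d * n = n * d := mul_comm _ _
  have H := WP.loop_potential (M := M)
    (b := .neg (eqw (.load 18 (.load 23 (rowE (.minus (.load 29 (wv 8)) (.const 1))))) (wv 27)))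
    (P := .setWord 29 (wv 8) (.minus (.load 29 (wv 8)) (.const 1))) (σ := σ)
    (fun R τ => τ.word 29 = Function.update (σ.word 29) k R ∧
      Window n (σ.word 18) p s e o (σ.word 28 k) R)
    (fun R => 130 * (R - σ.word 28 k)) (g := σ.word 29 k) ⟨by simp, hW⟩
    (by
      rintro R τ ⟨h29, hw⟩ hf
      have f0 : τ.word 0 0 = n := by rw [hf.word _ (by decide), hn]
      have f8 : τ.word 8 0 = k := by rw [hf.word _ (by decide), hk]
      have f18 : τ.word 18 = σ.word 18 := hf.word _ (by decide)
      have f23 : τ.word 23 = σ.word 23 := hf.word _ (by decide)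
      have f27 : τ.word 27 0 = p := by rw [hf.word _ (by decide), hp]
      obtain ⟨x, hx1, hx2, -⟩ := hw.mem i₀ hi₀ hgi
      have h1 := hw.left
      have h2 := hw.right
      obtain ⟨e1, e2⟩ := ho (R - 1) (by omega) (by omega)
      have h3 := hg _ e2
      have h4 := idx_lt hkd (show R - 1 < n by omega)
      constructor
      · simp [rowE, f0, f8, f18, f23, f27, h29, e1]
        and_intros <;> omega
      · intro hv
        have hv : ¬ σ.word 18 (o (R - 1)) = p := by
          simpa [rowE, f0, f8, f18, f23, f27, h29, e1] using hv
        refine WP.of_pre ?_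
        simp [rowE, f8, h29]
        refine ⟨by omega, by omega, R - 1, ⟨rfl, hw.pred hv⟩, by omega⟩)
  refine H.frame.mono ?_
  rintro t τ ⟨⟨R, ⟨h29, hw⟩, ht, hv⟩, hf⟩
  have f0 : τ.word 0 0 = n := by rw [hf.word _ (by decide), hn]
  have f8 : τ.word 8 0 = k := by rw [hf.word _ (by decide), hk]
  have f18 : τ.word 18 = σ.word 18 := hf.word _ (by decide)
  have f23 : τ.word 23 = σ.word 23 := hf.word _ (by decide)
  have f27 : τ.word 27 0 = p := by rw [hf.word _ (by decide), hp]
  obtain ⟨x, hx1, hx2, -⟩ := hw.mem i₀ hi₀ hgi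
  have h1 := hw.left
  have h2 := hw.right
  obtain ⟨e1, e2⟩ := ho (R - 1) (by omega) (by omega)
  refine ⟨R, h29, hw, ?_, by omega, ?_⟩
  · simpa [rowE, f0, f8, f18, f23, f27, h29, e1] using hv
  · simp [rowE] at ht
    omega

end Scan

/-- The variables that are fixed while a segment, listed at positions in `[s, e)`, is split at
most once: the segment `p`, the node `u`, and the sorted lists `o k` of the points. -/
structure SegCtx (M n d p u s e : ℕ) (o : ℕ → ℕ → ℕ) (σ : Store) : Prop where
  hM : 2 * (n * d) + 2 * n + 2 * d + 9 ≤ M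
  hn : σ.word 0 0 = n
  hd : σ.word 1 0 = d
  hp : σ.word 27 0 = p
  hu : σ.word 40 0 = u
  hg : ∀ i < n, σ.word 18 i < n
  hpn : p < n
  hun : u + 1 < 2 * n
  he : e ≤ n
  ho : ∀ k < d, ∀ x, s ≤ x → x < e → σ.word 23 (k * n + x) = o k x ∧ o k x < n

theorem SegCtx.transfer {M n d p u s e : ℕ} {o : ℕ → ℕ → ℕ} {σ τ : Store}
    (h : SegCtx M n d p u s e o σ) (h0 : τ.word 0 = σ.word 0) (h1 : τ.word 1 = σ.word 1)
    (h27 : τ.word 27 = σ.word 27) (h40 : τ.word 40 = σ.word 40) (h18 : τ.word 18 = σ.word 18)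
    (h23 : τ.word 23 = σ.word 23) : SegCtx M n d p u s e o τ where
  hM := h.hM
  hn := h0 ▸ h.hn
  hd := h1 ▸ h.hd
  hp := h27 ▸ h.hp
  hu := h40 ▸ h.hu
  hg := h18 ▸ h.hg
  hpn := h.hpn
  hun := h.hun
  he := h.he
  ho := h23 ▸ h.ho

/-- One step of the scan: the bounding box of the segment in the coordinate `word 8`. -/
def scanStep : Prog :=
  skipLeft ;; skipRight ;;
  rset 6 (keyE (.load 23 (rowE (.load 28 (wv 8))))) ;;
  rset 7 (keyE (.load 23 (rowE (.minus (.load 29 (wv 8)) (.const 1))))) ;;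
  .setReal 3 (.plus (.times (wv 40) (wv 1)) (wv 8))
    (.times (.plus (rv 6) (rv 7)) (.const (1 / 2))) ;;
  rset 8 (.plus (rv 8) (.times (.times (.minus (rv 7) (rv 6)) (.const (1 / 2)))
    (.times (.minus (rv 7) (rv 6)) (.const (1 / 2))))) ;;
  .ite (.leReal (rv 9) (.minus (rv 7) (rv 6)))
    (rset 9 (.minus (rv 7) (rv 6)) ;; rset 10 (.times (.plus (rv 6) (rv 7)) (.const (1 / 2))) ;;
      wset 30 (wv 8)) .skip

theorem scanStep_spec {M n d p u s e k i₀ : ℕ} {o : ℕ → ℕ → ℕ} {σ : Store}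
    (h : SegCtx M n d p u s e o σ) (hk : σ.word 8 0 = k) (hkd : k < d)
    (hi₀ : i₀ < n) (hgi : σ.word 18 i₀ = p)
    (hW : Window n (σ.word 18) p s e (o k) (σ.word 28 k) (σ.word 29 k)) :
    WP M scanStep σ (fun t τ => ∃ L R, τ.word 28 = Function.update (σ.word 28) k L ∧
      τ.word 29 = Function.update (σ.word 29) k R ∧
      Window n (σ.word 18) p s e (o k) L R ∧ L < R ∧ σ.word 18 (o k L) = p ∧
      σ.word 18 (o k (R - 1)) = p ∧
      τ.real 3 = Function.update (σ.real 3) (u * d + k)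
        ((key σ d k (o k L) + key σ d k (o k (R - 1))) / 2) ∧
      τ.real 8 0 = σ.real 8 0 + ((key σ d k (o k (R - 1)) - key σ d k (o k L)) / 2) ^ 2 ∧
      ((σ.real 9 0 ≤ key σ d k (o k (R - 1)) - key σ d k (o k L) ∧ τ.word 30 0 = k ∧
        τ.real 9 0 = key σ d k (o k (R - 1)) - key σ d k (o k L) ∧
        τ.real 10 0 = (key σ d k (o k L) + key σ d k (o k (R - 1))) / 2) ∨
       (key σ d k (o k (R - 1)) - key σ d k (o k L) < σ.real 9 0 ∧
        τ.word 30 0 = σ.word 30 0 ∧ τ.real 9 0 = σ.real 9 0 ∧ τ.real 10 0 = σ.real 10 0)) ∧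
      t + 130 * (R - L) ≤ 200 + 130 * (σ.word 29 k - σ.word 28 k)) := by
  have hM := h.hM
  have hnd : n ≤ n * d := Nat.le_mul_of_pos_right _ (by omega)
  have hdn : d * n = n * d := mul_comm _ _
  refine WP.seq (skipLeft_spec h.hM h.hn hk hkd h.hp h.hg h.hpn h.he (h.ho k hkd) hi₀ hgi hW).frame ?_
  rintro t1 τ ⟨⟨L, hL28, hWL, hgL, hLR, ht1⟩, hf⟩
  have f8 : τ.word 8 0 = k := by rw [hf.word _ (by decide), hk]
  have f18 : τ.word 18 = σ.word 18 := hf.word _ (by decide)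
  have f29 : τ.word 29 = σ.word 29 := hf.word _ (by decide)
  have f30 : τ.word 30 = σ.word 30 := hf.word _ (by decide)
  have h' : SegCtx M n d p u s e o τ := h.transfer (hf.word _ (by decide)) (hf.word _ (by decide))
    (hf.word _ (by decide)) (hf.word _ (by decide)) (hf.word _ (by decide)) (hf.word _ (by decide))
  have fr : τ.real = σ.real := by funext a; exact hf.real a (by simp [skipLeft, Prog.realArrays])
  refine WP.seq (skipRight_spec h'.hM h'.hn f8 hkd h'.hp h'.hg h'.hpn h'.he (h'.ho k hkd) hi₀
    (by rwa [f18]) (by simpa [f18, f29, hL28] using hWL)).frame ?_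
  rintro t2 υ ⟨⟨R, hR29, hWR, hgR, hLR', ht2⟩, hf2⟩
  rw [f18] at hgR hWR
  simp only [hL28, Function.update_self, f29] at hLR' hWR hR29 ht2
  have g8 : υ.word 8 0 = k := by rw [hf2.word _ (by decide), f8]
  have g28 : υ.word 28 = Function.update (σ.word 28) k L := by rw [hf2.word _ (by decide), hL28]
  have g30 : υ.word 30 = σ.word 30 := by rw [hf2.word _ (by decide), f30]
  have h2 : SegCtx M n d p u s e o υ := h'.transfer (hf2.word _ (by decide)) (hf2.word _ (by decide))
    (hf2.word _ (by decide)) (hf2.word _ (by decide)) (hf2.word _ (by decide))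
    (hf2.word _ (by decide))
  have gr : υ.real = σ.real := by
    rw [← fr]; funext a; exact hf2.real a (by simp [skipRight, Prog.realArrays])
  have b1 := hWR.left
  have b2 := hWR.right
  have b3 := h.he
  obtain ⟨o1, o2⟩ := h2.ho k hkd L b1 (by omega)
  obtain ⟨o3, o4⟩ := h2.ho k hkd (R - 1) (by omega) (by omega)
  have c1 := idx_lt hkd (show L < n by omega)
  have c2 := idx_lt hkd (show R - 1 < n by omega)
  have c3 := idx_lt o2 hkd
  have c4 := idx_lt o4 hkd
  have c5 := idx_lt (show u < 2 * n by have := h.hun; omega) hkd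
  have c6 : 2 * n * d = 2 * (n * d) := mul_assoc _ _ _
  have hun := h.hun
  refine WP.of_pre ?_
  simp [rowE, keyE, h2.hn, h2.hd, h2.hu, g8, g28, hR29, o1, o3, gr]
  have fin : ∀ x : ℝ, x * 2⁻¹ = x / 2 := fun x => rfl
  and_intros
  any_goals omega
  all_goals intro hle
  · refine ⟨by omega, by omega, L, rfl, R, rfl, hWR, hLR', hgL, hgR, ?_, ?_, .inl ⟨hle, rfl, ?_⟩, ?_⟩
    · congr 1
    · simp only [key]; ring
    · rfl
    · omega
  · refine ⟨L, rfl, R, rfl, hWR, hLR', hgL, hgR, ?_, ?_, .inr ⟨hle, by rw [g30]⟩, ?_⟩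
    · congr 1
    · simp only [key]; ring
    · omega

/-- The bounding box of the segment `p`. -/
def scan : Prog := rset 8 (.const 0) ;; rset 9 (.const (-1)) ;; forLoop 8 1 scanStep

/-- The sum of the lengths of the windows. -/
def windowSum (d : ℕ) (L R : ℕ → ℕ) : ℕ := ∑ k ∈ Finset.range d, (R k - L k)

theorem windowSum_update {d k : ℕ} (hk : k < d) (L R : ℕ → ℕ) (l r : ℕ) :
    windowSum d (Function.update L k l) (Function.update R k r) + (R k - L k) =
      windowSum d L R + (r - l) := by
  unfold windowSum
  rw [← Finset.add_sum_erase _ _ (Finset.mem_range.mpr hk),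
    ← Finset.add_sum_erase (Finset.range d) (fun k => R k - L k) (Finset.mem_range.mpr hk)]
  have : ∑ x ∈ (Finset.range d).erase k, (Function.update R k r x - Function.update L k l x) =
      ∑ x ∈ (Finset.range d).erase k, (R x - L x) := by
    refine Finset.sum_congr rfl fun x hx => ?_
    have := Finset.ne_of_mem_erase hx
    rw [Function.update_of_ne this, Function.update_of_ne this]
  rw [this]
  simp
  omega

/-- The windows after the scan, together with the result of the scan for the coordinates
below `K`. -/
structure Scanned (n d p u s e K : ℕ) (g : ℕ → ℕ) (o : ℕ → ℕ → ℕ) (key : ℕ → ℕ → ℝ)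
    (σ τ : Store) : Prop where
  win : ∀ k < d, Window n g p s e (o k) (τ.word 28 k) (τ.word 29 k)
  ends : ∀ k < K, τ.word 28 k < τ.word 29 k ∧ g (o k (τ.word 28 k)) = p ∧
    g (o k (τ.word 29 k - 1)) = p
  ctr : ∀ k < K, τ.real 3 (u * d + k) =
    (key k (o k (τ.word 28 k)) + key k (o k (τ.word 29 k - 1))) / 2
  ctr_other : ∀ y, (∀ k < d, y ≠ u * d + k) → τ.real 3 y = σ.real 3 y
  sum : τ.real 8 0 = ∑ k ∈ Finset.range K,
    ((key k (o k (τ.word 29 k - 1)) - key k (o k (τ.word 28 k))) / 2) ^ 2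
  best : ∀ k < K, key k (o k (τ.word 29 k - 1)) - key k (o k (τ.word 28 k)) ≤ τ.real 9 0
  arg : 0 < K → τ.word 30 0 < K ∧
    τ.real 9 0 = key (τ.word 30 0) (o (τ.word 30 0) (τ.word 29 (τ.word 30 0) - 1)) -
      key (τ.word 30 0) (o (τ.word 30 0) (τ.word 28 (τ.word 30 0))) ∧
    τ.real 10 0 = (key (τ.word 30 0) (o (τ.word 30 0) (τ.word 28 (τ.word 30 0))) +
      key (τ.word 30 0) (o (τ.word 30 0) (τ.word 29 (τ.word 30 0) - 1))) / 2
  arg_zero : K = 0 → τ.real 9 0 = -1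

/-- Finding the extreme members costs `O(d)` apart from the discarded positions, which are paid by
the decrease of `windowSum`. The half diagonal, the box centre and the longest side come out of the
same loop over the coordinates. -/
theorem scan_spec {M n d p u s e i₀ : ℕ} {o : ℕ → ℕ → ℕ} {σ : Store}
    (h : SegCtx M n d p u s e o σ) (hd0 : 0 < d) (hi₀ : i₀ < n) (hgi : σ.word 18 i₀ = p)
    (hsrt : ∀ k < d, ∀ x y, s ≤ x → x < y → y < e → key σ d k (o k x) ≤ key σ d k (o k y))
    (hW : ∀ k < d, Window n (σ.word 18) p s e (o k) (σ.word 28 k) (σ.word 29 k)) :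
    WP M scan σ (fun t τ => Scanned n d p u s e d (σ.word 18) o (key σ d) σ τ ∧
      t + 130 * windowSum d (τ.word 28) (τ.word 29) ≤
        300 * d + 130 * windowSum d (σ.word 28) (σ.word 29)) := by
  have hM := h.hM
  refine WP.seq (Q := fun t τ => t = 3 ∧ τ = σ.setReal 8 0 0)
    (WP.of_pre (by simp; omega)) ?_
  rintro _ _ ⟨rfl, rfl⟩
  refine WP.seq (Q := fun t τ => t = 3 ∧ τ = (σ.setReal 8 0 0).setReal 9 0 (-1))
    (WP.of_pre (by simp; omega)) ?_
  rintro _ _ ⟨rfl, rfl⟩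
  have H := WP.forLoop_potential (M := M) (q := 8) (a := 1) (P := scanStep)
    (σ := (σ.setReal 8 0 0).setReal 9 0 (-1))
    (fun K φ τ => Scanned n d p u s e K (σ.word 18) o (key σ d) σ τ ∧
      φ = 130 * windowSum d (τ.word 28) (τ.word 29)) d 200
    (130 * windowSum d (σ.word 28) (σ.word 29)) (by decide) (by decide) (by decide)
    (by simp [h.hd]) (by omega)
    (by
      refine ⟨⟨by simpa using hW, ?_, ?_, by simp, by simp, ?_, ?_, by simp⟩, by simp⟩ <;>
        intros <;> omega)
    (by
      rintro k φ τ hk ⟨hs, rfl⟩ hf h8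
      have f18 : τ.word 18 = σ.word 18 := by rw [hf.word _ (by decide)]; simp
      have hc : SegCtx M n d p u s e o τ := h.transfer (by rw [hf.word _ (by decide)]; simp)
        (by rw [hf.word _ (by decide)]; simp)
        (by rw [hf.word _ (by decide)]; simp) (by rw [hf.word _ (by decide)]; simp)
        (by rw [hf.word _ (by decide)]; simp) (by rw [hf.word _ (by decide)]; simp)
      have fk : ∀ k, key τ d k = key σ d k := by
        intro k; funext x; simp only [key]; rw [hf.real _ (by decide)]; simp
      have hw := scanStep_spec hc h8 hk hi₀ (by rwa [f18]) (by rw [f18]; exact hs.win k hk)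
      refine hw.mono ?_
      rintro t υ ⟨L, R, a1, a2, a3, a4, a5, a6, a7, a8, a9, a10⟩
      simp only [fk, f18] at a3 a5 a6 a7 a8 a9
      have hne : ∀ k' < k, k' ≠ k := fun k' hk' => hk'.ne
      refine ⟨_, ⟨⟨?_, ?_, ?_, ?_, ?_, ?_, ?_, by simp⟩, rfl⟩, ?_⟩
      · intro k' hk'
        by_cases hkk : k' = k
        · subst hkk; simpa [a1, a2] using a3
        · simpa [a1, a2, hkk] using hs.win k' hk'
      · intro k' hk'
        rcases Nat.lt_succ_iff_lt_or_eq.mp hk' with hk' | rfl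
        · simpa [a1, a2, hne k' hk'] using hs.ends k' hk'
        · simp [a1, a2]; exact ⟨a4, a5, a6⟩
      · intro k' hk'
        rcases Nat.lt_succ_iff_lt_or_eq.mp hk' with hk' | rfl
        · simpa [a1, a2, a7, hne k' hk'] using hs.ctr k' hk'
        · simp [a1, a2, a7]
      · intro y hy
        simp [a7, Function.update_of_ne (hy k hk), hs.ctr_other y hy]
      · simp [Finset.sum_range_succ, a8, hs.sum, a1, a2]
        refine Finset.sum_congr rfl fun k' hk' => ?_
        have := hne k' (by simpa using hk')
        simp [this]
      · intro k' hk'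
        rcases Nat.lt_succ_iff_lt_or_eq.mp hk' with hk' | rfl
        · have := hs.best k' hk'
          simp [a1, a2, hne k' hk']
          rcases a9 with ⟨b1, b2, b3, b4⟩ | ⟨b1, b2, b3, b4⟩
          · rw [b3]; simp only [sub_eq_add_neg] at *; linarith
          · rw [b3]; simpa using this
        · simp [a1, a2]
          rcases a9 with ⟨b1, b2, b3, b4⟩ | ⟨b1, b2, b3, b4⟩
          · rw [b3]; linarith
          · rw [b3]; linarith
      · intro _
        rcases a9 with ⟨b1, b2, b3, b4⟩ | ⟨b1, b2, b3, b4⟩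
        · simp [a1, a2, b2, b3, b4]
        -- The best length starts at `-1` and side lengths are nonnegative, so the first coordinate
        -- always wins. If the old best is kept, there was an earlier coordinate.
        · have hk0 : 0 < k := by
            rcases Nat.eq_zero_or_pos k with h0 | h0
            · exfalso
              have e1 := hs.arg_zero h0
              rw [e1] at b1
              have hl := a3.left
              have hr := a3.right
              rcases Nat.lt_or_ge L (R - 1) with hlt | hge
              · have := hsrt k hk L (R - 1) hl hlt (by omega)
                linarith
              · have : R - 1 = L := by omega
                rw [this] at b1
                linarith
            · exact h0
          obtain ⟨c1, c2, c3⟩ := hs.arg hk0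
          have := hne _ c1
          simp [a1, a2, b2, b3, b4, this, ← c2, ← c3]
          omega
      · have := windowSum_update hk (τ.word 28) (τ.word 29) L R
        simp [a1, a2]
        omega)
  refine H.mono ?_
  rintro t τ ⟨φ, ⟨h1, rfl⟩, -, ht⟩
  refine ⟨h1, ?_⟩
  omega

/-- The position `word 30 * n + e`. -/
def rowB (e : WExpr) : WExpr := .plus (.times (wv 30) (wv 0)) e

/-- The coordinate `word 30` of the point `e`. -/
def keyB (e : WExpr) : RExpr := .load 0 (.plus (.times e (wv 1)) (wv 30))

/-- The point at distance `word 31` from the left end of the window. -/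
def leftE : WExpr := .load 23 (rowB (.plus (.load 28 (wv 30)) (wv 31)))

/-- The point at distance `word 31` from the right end of the window. -/
def rightE : WExpr := .load 23 (rowB (.minus (.load 29 (wv 30)) (.plus (wv 31) (.const 1))))

/-- Walk from both ends of the window towards the cut. -/
def cut : Prog :=
  wset 31 (.const 0) ;;
  .loop (.both (.leReal (keyB leftE) (rv 10)) (.neg (.leReal (keyB rightE) (rv 10)))) (incr 31)

/-- Both walks advance at the same speed, so the cost is proportional to the number `j` of positions
at either end, and `2 * j ≤ R - L` because the two ends cannot overlap. Stale points inside the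
window take part in the walk; this does no harm, since the cost is charged to positions and not to
points. -/
theorem cut_spec {M n d p u s e kb L R : ℕ} {o : ℕ → ℕ → ℕ} {σ : Store} {X : ℕ → ℝ} {mid : ℝ}
    (h : SegCtx M n d p u s e o σ) (hkb : σ.word 30 0 = kb) (hkd : kb < d)
    (hL : σ.word 28 kb = L) (hR : σ.word 29 kb = R) (hsL : s ≤ L) (hRe : R ≤ e) (hLR : L < R)
    (hX : ∀ x, X x = key σ d kb (o kb x)) (hmid : σ.real 10 0 = mid)
    (h1 : X L ≤ mid) (h2 : mid < X (R - 1)) :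
    WP M cut σ (fun t τ => ∃ j, τ.word 31 0 = j ∧ 1 ≤ j ∧ 2 * j ≤ R - L ∧ L + j < R ∧
      (∀ x, L ≤ x → x < L + j → X x ≤ mid) ∧ (∀ x, R - j ≤ x → x < R → mid < X x) ∧
      (mid < X (L + j) ∨ X (R - (j + 1)) ≤ mid) ∧ t ≤ 60 * j + 60) := by
  have hM := h.hM
  have he := h.he
  have hnd : n ≤ n * d := Nat.le_mul_of_pos_right _ (by omega)
  have hdn : d * n = n * d := mul_comm _ _
  refine WP.seq (Q := fun t τ => t = 3 ∧ τ = σ.setWord 31 0 0)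
    (WP.of_pre (by simp; omega)) ?_
  rintro _ _ ⟨rfl, rfl⟩
  have bound : ∀ j, (∀ x, L ≤ x → x < L + j → X x ≤ mid) →
      (∀ x, R - j ≤ x → x < R → mid < X x) → 2 * j ≤ R - L → L + j < R := by
    intro j a b c
    omega
  have hev : ∀ τ : Store, Frame (incr 31) (σ.setWord 31 0 0) τ → ∀ j, τ.word 31 0 = j →
      L + j < R →
      (Test.both (.leReal (keyB leftE) (rv 10)) (.neg (.leReal (keyB rightE) (rv 10)))).Safe M τ ∧
      ((Test.both (.leReal (keyB leftE) (rv 10)) (.neg (.leReal (keyB rightE) (rv 10)))).val τ ↔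
        X (L + j) ≤ mid ∧ mid < X (R - (j + 1))) := by
    intro τ hf j hj hlt
    have f0 : τ.word 0 0 = n := by rw [hf.word _ (by decide)]; simp [h.hn]
    have f1 : τ.word 1 0 = d := by rw [hf.word _ (by decide)]; simp [h.hd]
    have f30 : τ.word 30 0 = kb := by rw [hf.word _ (by decide)]; simp [hkb]
    have f28 : τ.word 28 kb = L := by rw [hf.word _ (by decide)]; simp [hL]
    have f29 : τ.word 29 kb = R := by rw [hf.word _ (by decide)]; simp [hR]
    have f23 : τ.word 23 = σ.word 23 := by rw [hf.word _ (by decide)]; simp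
    have fr : τ.real = σ.real := by
      funext a; rw [hf.real a (by simp [Prog.realArrays])]; simp
    obtain ⟨o1, o2⟩ := h.ho kb hkd (L + j) (by omega) (by omega)
    obtain ⟨o3, o4⟩ := h.ho kb hkd (R - (j + 1)) (by omega) (by omega)
    have c1 := idx_lt hkd (show L + j < n by omega)
    have c2 := idx_lt hkd (show R - (j + 1) < n by omega)
    have c3 := idx_lt o2 hkd
    have c4 := idx_lt o4 hkd
    constructor
    · simp [leftE, rightE, rowB, keyB, f0, f1, f30, f28, f29, f23, hj, o1, o3]
      and_intros <;> omega
    · simp [leftE, rightE, rowB, keyB, f0, f1, f30, f28, f29, f23, hj, o1, o3, fr, hmid, hX, key]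
  have H := WP.loop_potential (M := M) (σ := σ.setWord 31 0 0)
    (b := .both (.leReal (keyB leftE) (rv 10)) (.neg (.leReal (keyB rightE) (rv 10))))
    (P := incr 31)
    (fun j τ => τ.word 31 0 = j ∧ 2 * j ≤ R - L ∧ L + j < R ∧
      (∀ x, L ≤ x → x < L + j → X x ≤ mid) ∧ (∀ x, R - j ≤ x → x < R → mid < X x))
    (fun j => 60 * (R - j)) (g := 0)
    ⟨by simp, by omega, by omega, fun x _ _ => by omega, fun x _ _ => by omega⟩
    (by
      rintro j τ ⟨hj, hj2, hlt, hl, hr⟩ hf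
      obtain ⟨hs, hv⟩ := hev τ hf j hj hlt
      refine ⟨hs, fun hval => ?_⟩
      obtain ⟨v1, v2⟩ := hv.mp hval
      have hl' : ∀ x, L ≤ x → x < L + (j + 1) → X x ≤ mid := by
        intro x hx hx'
        rcases Nat.lt_or_ge x (L + j) with hlt | hge
        · exact hl x hx hlt
        · have : x = L + j := by omega
          rw [this]; exact v1
      have hr' : ∀ x, R - (j + 1) ≤ x → x < R → mid < X x := by
        intro x hx hx'
        rcases Nat.lt_or_ge x (R - j) with hlt | hge
        · have : x = R - (j + 1) := by omega
          rw [this]; exact v2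
        · exact hr x hge hx'
      -- The walks do not meet: a position reached from both ends would lie on both sides of the
      -- cut.
      have hlt2 : L + j < R - (j + 1) := by
        by_contra hc
        exact absurd (hr' (L + j) (by omega) hlt) (not_lt.mpr v1)
      refine WP.of_pre ?_
      simp only [pre, incr, wset]
      refine ⟨by simp; omega, by simp [hj]; omega, j + 1, ⟨by simp [hj], by omega, by omega, hl', hr'⟩, ?_⟩
      simp [leftE, rightE, rowB, keyB]
      omega)
  refine H.frame.mono ?_
  rintro t τ ⟨⟨j, ⟨hj, hj2, hlt, hl, hr⟩, ht, hv⟩, hf⟩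
  obtain ⟨hs, hv'⟩ := hev τ ⟨hf.word, hf.real⟩ j hj hlt
  have hor : mid < X (L + j) ∨ X (R - (j + 1)) ≤ mid := by
    by_contra hc
    push Not at hc
    exact hv (hv'.mpr hc)
  refine ⟨j, hj, ?_, hj2, hlt, hl, hr, hor, ?_⟩
  -- The extreme positions lie on different sides of the cut, so the first test succeeds.
  · by_contra h0
    have : j = 0 := by omega
    subst this
    rcases hor with hc | hc
    · rw [Nat.add_zero] at hc; linarith
    · simp at hc; linarith
  · simp [leftE, rightE, rowB, keyB] at ht
    omega

/-- Twice the number of segments. -/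
def twoE : WExpr := .plus (wv 26) (wv 26)

/-- Choose the part of the window that is cut off: positions `word 35, …`, with length `word 31`. -/
def choosePart : Prog :=
  .ite (.leReal (keyB leftE) (rv 10))
    (wset 35 (.minus (.load 29 (wv 30)) (wv 31)) ;; .setWord 29 (wv 30) (wv 35) ;;
      .setWord 20 (wv 26) twoE ;; .setWord 20 (wv 27) (.minus twoE (.const 1)))
    (wset 35 (.load 28 (wv 30)) ;; .setWord 28 (wv 30) (.plus (wv 35) (wv 31)) ;;
      .setWord 20 (wv 26) (.minus twoE (.const 1)) ;; .setWord 20 (wv 27) twoE)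

/-- If position `L + j` is still on the left side, it was the right walk that reached the cut, so
the last `j` positions contain everything beyond it; otherwise the first `j` positions are the whole
left part. A forest with `ns` leaves uses the node numbers `0, …, 2 * ns - 2`, so the children get
`2 * ns - 1` and `2 * ns`. The left child gets the former number, whichever part is moved to the new
segment. -/
theorem choosePart_spec {M n d p u s e kb L R j ns : ℕ} {o : ℕ → ℕ → ℕ} {σ : Store} {X : ℕ → ℝ}
    {mid : ℝ} (h : SegCtx M n d p u s e o σ) (hkb : σ.word 30 0 = kb) (hkd : kb < d)
    (hL : σ.word 28 kb = L) (hR : σ.word 29 kb = R) (hsL : s ≤ L) (hRe : R ≤ e)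
    (hX : ∀ x, X x = key σ d kb (o kb x)) (hmid : σ.real 10 0 = mid)
    (hj : σ.word 31 0 = j) (hlt : L + j < R) (hns : σ.word 26 0 = ns) (hnsn : ns < n) :
    WP M choosePart σ (fun t τ => t ≤ 100 ∧
      ((X (L + j) ≤ mid ∧ τ.word 35 0 = R - j ∧ τ.word 28 = σ.word 28 ∧
        τ.word 29 = Function.update (σ.word 29) kb (R - j) ∧
        τ.word 20 = Function.update (Function.update (σ.word 20) ns (2 * ns)) p (2 * ns - 1)) ∨
       (mid < X (L + j) ∧ τ.word 35 0 = L ∧ τ.word 29 = σ.word 29 ∧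
        τ.word 28 = Function.update (σ.word 28) kb (L + j) ∧
        τ.word 20 = Function.update (Function.update (σ.word 20) ns (2 * ns - 1)) p (2 * ns)))) := by
  have hM := h.hM
  have he := h.he
  have hp := h.hpn
  have hnd : n ≤ n * d := Nat.le_mul_of_pos_right _ (by omega)
  have hdn : d * n = n * d := mul_comm _ _
  obtain ⟨o1, o2⟩ := h.ho kb hkd (L + j) (by omega) (by omega)
  have c1 := idx_lt hkd (show L + j < n by omega)
  have c3 := idx_lt o2 hkd
  have e2 : ns + ns = 2 * ns := by omega
  refine WP.of_pre ?_
  simp [choosePart, leftE, rowB, keyB, twoE, h.hn, h.hd, h.hp, hkb, hL, hR, hj, hns, o1, hmid, hX, key, e2]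
  and_intros
  any_goals omega
  · intro hle
    and_intros
    any_goals omega
    exact .inl hle
  · intro hle
    and_intros
    any_goals omega
    exact .inr hle

theorem count_update {g : ℕ → ℕ} {n i p v : ℕ} (hi : i < n) (hg : g i = p) (hv : v ≠ p) :
    Nat.count (fun x => Function.update g i v x = p) n + 1 = Nat.count (fun x => g x = p) n := by
  induction n with
  | zero => omega
  | succ n ih =>
    rw [Nat.count_succ, Nat.count_succ]
    rcases Nat.lt_succ_iff_lt_or_eq.mp hi with h | rfl
    · have := ih h
      rw [Function.update_of_ne (by omega : n ≠ i)]
      omega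
    · have : Nat.count (fun x => Function.update g i v x = p) i = Nat.count (fun x => g x = p) i := by
        rw [Nat.count_eq_card_filter_range, Nat.count_eq_card_filter_range]
        congr 1
        refine Finset.filter_congr fun x hx => ?_
        have : x < i := by simpa using hx
        rw [Function.update_of_ne (by omega)]
      simp [this, hg, hv]

/-- Move one point to the new segment, if it belongs to the segment `word 27`. -/
def tagStep : Prog :=
  wset 34 (.load 23 (rowB (.plus (wv 35) (wv 33)))) ;;
  .ite (eqw (.load 18 (wv 34)) (wv 27)) (.setWord 18 (wv 34) (wv 26) ;; incr 32) .skip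

/-- Move the points of the part that is cut off to the new segment. -/
def tag : Prog := wset 32 (.const 0) ;; forLoop 33 31 tagStep

/-- Only points that still carry the label `p` are moved, so stale entries of the window are left
alone. The counter `word 32` is the size of the new segment, and the two sizes add up to the old
one. -/
theorem tag_spec {M n d p u s e kb x₀ j ns : ℕ} {o : ℕ → ℕ → ℕ} {σ : Store}
    (h : SegCtx M n d p u s e o σ) (hkb : σ.word 30 0 = kb) (hkd : kb < d)
    (hx₀ : σ.word 35 0 = x₀) (hj : σ.word 31 0 = j) (hsx : s ≤ x₀) (hxe : x₀ + j ≤ e)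
    (hns : σ.word 26 0 = ns) (hnsn : ns < n) (hg : ∀ i < n, σ.word 18 i < ns) (hpns : p < ns) :
    WP M tag σ (fun t τ =>
      (∀ i < n, (τ.word 18 i = ns ∧ σ.word 18 i = p ∧ ∃ x, x₀ ≤ x ∧ x < x₀ + j ∧ o kb x = i) ∨
        (τ.word 18 i = σ.word 18 i ∧
          ¬ (σ.word 18 i = p ∧ ∃ x, x₀ ≤ x ∧ x < x₀ + j ∧ o kb x = i))) ∧
      τ.word 32 0 = Nat.count (fun i => τ.word 18 i = ns) n ∧
      τ.word 32 0 + Nat.count (fun i => τ.word 18 i = p) n =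
        Nat.count (fun i => σ.word 18 i = p) n ∧
      τ.word 32 0 ≤ j ∧ t ≤ 60 * j + 20) := by
  have hM := h.hM
  have he := h.he
  have hp := h.hpn
  have hnd : n ≤ n * d := Nat.le_mul_of_pos_right _ (by omega)
  have hdn : d * n = n * d := mul_comm _ _
  refine WP.seq (Q := fun t τ => t = 3 ∧ τ = σ.setWord 32 0 0)
    (WP.of_pre (by simp; omega)) ?_
  rintro _ _ ⟨rfl, rfl⟩
  have hcn : ∀ (f : ℕ → ℕ) (q : ℕ), Nat.count (fun i => f i = q) n ≤ n := fun f q => Nat.count_le _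
  have H := WP.forLoop (M := M) (q := 33) (a := 31) (P := tagStep) (σ := σ.setWord 32 0 0)
    (fun y τ =>
      (∀ i < n, (τ.word 18 i = ns ∧ σ.word 18 i = p ∧ ∃ x, x₀ ≤ x ∧ x < x₀ + y ∧ o kb x = i) ∨
        (τ.word 18 i = σ.word 18 i ∧
          ¬ (σ.word 18 i = p ∧ ∃ x, x₀ ≤ x ∧ x < x₀ + y ∧ o kb x = i))) ∧
      τ.word 32 0 = Nat.count (fun i => τ.word 18 i = ns) n ∧
      τ.word 32 0 + Nat.count (fun i => τ.word 18 i = p) n =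
        Nat.count (fun i => σ.word 18 i = p) n ∧
      τ.word 32 0 ≤ y) j 46 (by decide) (by decide) (by decide) (by simp [hj]) (by omega)
    (by
      refine ⟨fun i hi => .inr ⟨by simp, ?_⟩, ?_, by simp, by simp⟩
      · rintro ⟨-, x, h1, h2, -⟩; omega
      · simp
        symm
        rw [Nat.count_eq_card_filter_range, Finset.card_eq_zero, Finset.filter_eq_empty_iff]
        intro i hi
        have := hg i (by simpa using hi)
        omega)
    (by
      rintro y τ hy ⟨i1, i2, i3, i4⟩ hf h33
      have f0 : τ.word 0 0 = n := by rw [hf.word _ (by decide)]; simp [h.hn]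
      have f26 : τ.word 26 0 = ns := by rw [hf.word _ (by decide)]; simp [hns]
      have f27 : τ.word 27 0 = p := by rw [hf.word _ (by decide)]; simp [h.hp]
      have f30 : τ.word 30 0 = kb := by rw [hf.word _ (by decide)]; simp [hkb]
      have f35 : τ.word 35 0 = x₀ := by rw [hf.word _ (by decide)]; simp [hx₀]
      have f23 : τ.word 23 = σ.word 23 := by rw [hf.word _ (by decide)]; simp
      obtain ⟨o1, o2⟩ := h.ho kb hkd (x₀ + y) (by omega) (by omega)
      have c1 := idx_lt hkd (show x₀ + y < n by omega)
      have c2 := hcn (τ.word 18) ns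
      have hgz : τ.word 18 (o kb (x₀ + y)) ≤ ns := by
        rcases i1 _ o2 with ⟨a, -⟩ | ⟨a, -⟩
        · omega
        · rw [a]; exact (hg _ o2).le
      refine WP.of_pre ?_
      simp [tagStep, rowB, f0, f26, f27, f30, f35, f23, h33, o1]
      and_intros
      any_goals omega
      · intro hz
        have hz' : σ.word 18 (o kb (x₀ + y)) = p := by
          rcases i1 _ o2 with ⟨a, -⟩ | ⟨a, -⟩
          · omega
          · rw [← a, hz]
        have u1 := count_update (v := ns) o2 hz (by omega)
        -- The same lemma read backwards: resetting the label of this point from `ns` to `p`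
        -- restores the old labelling, which tells how the count of `ns` has grown.
        have u2 := count_update (g := Function.update (τ.word 18) (o kb (x₀ + y)) ns) (p := ns)
          (v := p) o2 (by simp) (by omega)
        simp only [Function.update_idem] at u2
        rw [← hz, Function.update_eq_self] at u2
        and_intros
        any_goals omega
        · intro i hi
          by_cases hio : i = o kb (x₀ + y)
          · subst hio
            exact .inl ⟨by simp, hz', x₀ + y, by omega, by omega, rfl⟩
          · rw [Function.update_of_ne hio]
            rcases i1 i hi with ⟨a, b, x, c⟩ | ⟨a, b⟩
            · exact .inl ⟨a, b, x, by omega, by omega, c.2.2⟩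
            · refine .inr ⟨a, fun hgp x h1 h2 h3 => ?_⟩
              rcases Nat.lt_or_ge x (x₀ + y) with hlt | hge
              · exact b ⟨hgp, x, h1, hlt, h3⟩
              · have : x = x₀ + y := by omega
                exact hio (by rw [← h3, this])
      · intro hz
        and_intros
        any_goals omega
        · intro i hi
          rcases i1 i hi with ⟨a, b, x, c⟩ | ⟨a, b⟩
          · exact .inl ⟨a, b, x, by omega, by omega, c.2.2⟩
          · refine .inr ⟨a, fun hgp x h1 h2 h3 => ?_⟩
            rcases Nat.lt_or_ge x (x₀ + y) with hlt | hge
            · exact b ⟨hgp, x, h1, hlt, h3⟩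
            · have : x = x₀ + y := by omega
              rw [this] at h3
              rw [h3, a] at hz
              exact hz hgp)
  refine H.mono ?_
  rintro t τ ⟨⟨h1, h2, h3, h4⟩, -, ht⟩
  exact ⟨h1, h2, h3, h4, by omega⟩

/-- Record the split of the segment `p`, stored at the node `word 40`. -/
def recordSplit : Prog :=
  .setWord 19 (wv 26) (wv 32) ;;
  .setWord 19 (wv 27) (.minus (.load 19 (wv 27)) (wv 32)) ;;
  .setWord 5 (wv 40) (.minus twoE (.const 1)) ;;
  .setWord 6 (wv 40) twoE ;;
  .setReal 4 (wv 40) (.sqrt (rv 8)) ;;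
  .setReal 5 (wv 40) (rv 9) ;;
  incr 26

/-- Split the segment `p`. -/
def splitStep : Prog :=
  wset 40 (.load 20 (wv 27)) ;; scan ;; cut ;; choosePart ;; tag ;; recordSplit

/-- The result of splitting the segment `p` of a partition into `ns` segments; `xs` and `ys` are
the corners of the bounding box, which is cut perpendicularly to the side `kb`. -/
structure SplitResult (n d p ns u : ℕ) (key : ℕ → ℕ → ℝ) (σ τ : Store) (kb : ℕ)
    (xs ys : ℕ → ℝ) : Prop where
  kb_lt : kb < d
  lo : ∀ k < d, (∃ i < n, σ.word 18 i = p ∧ key k i = xs k) ∧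
    ∀ i < n, σ.word 18 i = p → xs k ≤ key k i
  hi : ∀ k < d, (∃ i < n, σ.word 18 i = p ∧ key k i = ys k) ∧
    ∀ i < n, σ.word 18 i = p → key k i ≤ ys k
  best : ∀ k < d, ys k - xs k ≤ ys kb - xs kb
  ctr : ∀ k < d, τ.real 3 (u * d + k) = (xs k + ys k) / 2
  ctr_other : ∀ y, (∀ k < d, y ≠ u * d + k) → τ.real 3 y = σ.real 3 y
  rad : τ.real 4 = Function.update (σ.real 4) u
    (Real.sqrt (∑ k ∈ Finset.range d, ((ys k - xs k) / 2) ^ 2))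
  len : τ.real 5 = Function.update (σ.real 5) u (ys kb - xs kb)
  child_left : τ.word 5 = Function.update (σ.word 5) u (2 * ns - 1)
  child_right : τ.word 6 = Function.update (σ.word 6) u (2 * ns)
  other : ∀ i < n, σ.word 18 i ≠ p → τ.word 18 i = σ.word 18 i
  part : ∃ q q', (q = p ∧ q' = ns ∨ q = ns ∧ q' = p) ∧ τ.word 20 q = 2 * ns - 1 ∧
    τ.word 20 q' = 2 * ns ∧ ∀ i < n, σ.word 18 i = p →
      (key kb i ≤ (xs kb + ys kb) / 2 ∧ τ.word 18 i = q) ∨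
      ((xs kb + ys kb) / 2 < key kb i ∧ τ.word 18 i = q')
  node_other : ∀ x, x ≠ p → x ≠ ns → τ.word 20 x = σ.word 20 x
  size_new : τ.word 19 ns = Nat.count (fun i => τ.word 18 i = ns) n
  size_old : τ.word 19 p = Nat.count (fun i => τ.word 18 i = p) n
  size_other : ∀ x, x ≠ p → x ≠ ns → τ.word 19 x = σ.word 19 x
  size_add : τ.word 19 p + τ.word 19 ns = σ.word 19 p
  pos_new : 0 < τ.word 19 ns
  pos_old : 0 < τ.word 19 p
  ns_eq : τ.word 26 0 = ns + 1

/-- The new segment has at most `j` points, and `2 * j ≤ R - L ≤ e - s ≤ 2 * h + 1` gives `j ≤ h`: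
what is cut off never needs to be treated again in the same round. The walk and the moves cost
`O(j)`, and `j` positions disappear from the window of the side `kb`, so only `O(d)` is left over.
-/
theorem splitStep_spec {M n d p u s e ns h : ℕ} {o : ℕ → ℕ → ℕ} {σ : Store}
    (hc : SegCtx M n d p u s e o (σ.setWord 40 0 u)) (hd0 : 0 < d)
    (hu : σ.word 20 p = u) (hns : σ.word 26 0 = ns) (hnsn : ns < n)
    (hg : ∀ i < n, σ.word 18 i < ns) (hpns : p < ns)
    (hsz : σ.word 19 p = Nat.count (fun i => σ.word 18 i = p) n) (hsz2 : 2 ≤ σ.word 19 p)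
    (hes : e - s ≤ 2 * h + 1)
    (hdist : ∀ i < n, ∀ j < n, i ≠ j → ∃ k < d, key σ d k i ≠ key σ d k j)
    (hsrt : ∀ k < d, ∀ x y, s ≤ x → x < y → y < e → key σ d k (o k x) ≤ key σ d k (o k y))
    (hW : ∀ k < d, Window n (σ.word 18) p s e (o k) (σ.word 28 k) (σ.word 29 k)) :
    WP M splitStep σ (fun t τ => ∃ kb xs ys, SplitResult n d p ns u (key σ d) σ τ kb xs ys ∧
      (∀ k < d, Window n (τ.word 18) p s e (o k) (τ.word 28 k) (τ.word 29 k)) ∧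
      τ.word 19 ns ≤ h ∧
      t + 130 * windowSum d (τ.word 28) (τ.word 29) ≤
        800 * d + 130 * windowSum d (σ.word 28) (σ.word 29)) := by
  have hM := hc.hM
  have hpn := hc.hpn
  have hun := hc.hun
  have he := hc.he
  have hp : σ.word 27 0 = p := by simpa using hc.hp
  have hnd : n ≤ n * d := Nat.le_mul_of_pos_right _ (by omega)
  have hdn : d * n = n * d := mul_comm _ _
  obtain ⟨i₀, hi₀, hgi₀, -⟩ := exists_count_eq (fun i => σ.word 18 i = p) (n := n) (j := 0) (by omega)
  obtain ⟨i₁, hi₁, hgi₁, hc₁⟩ := exists_count_eq (fun i => σ.word 18 i = p) (n := n) (j := 1) (by omega)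
  obtain ⟨i₂, hi₂, hgi₂, hc₂⟩ := exists_count_eq (fun i => σ.word 18 i = p) (n := n) (j := 0) (by omega)
  have hi12 : i₁ ≠ i₂ := by rintro rfl; omega
  refine WP.seq (Q := fun t τ => t ≤ 5 ∧ τ = σ.setWord 40 0 u)
    (WP.of_pre (by simp [hp, hu]; omega)) ?_
  rintro t0 _ ⟨ht0, rfl⟩
  -- the bounding box
  refine WP.seq (scan_spec hc hd0 hi₀ (by simpa using hgi₀)
    (by simpa [key] using hsrt) (by simpa using hW)).frame ?_
  rintro t1 τ ⟨⟨hS, ht1⟩, hf1⟩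
  have w18 : (σ.setWord 40 0 u).word 18 = σ.word 18 := by simp
  have w28 : (σ.setWord 40 0 u).word 28 = σ.word 28 := by simp
  have w29 : (σ.setWord 40 0 u).word 29 = σ.word 29 := by simp
  rw [w18] at hS
  rw [w28, w29] at ht1
  have hkf : key (σ.setWord 40 0 u) d = key σ d := rfl
  rw [hkf] at hS
  have hc1 : SegCtx M n d p u s e o τ := hc.transfer (hf1.word _ (by decide)) (hf1.word _ (by decide))
    (hf1.word _ (by decide)) (hf1.word _ (by decide)) (hf1.word _ (by decide))
    (hf1.word _ (by decide))
  have key1 : ∀ k, key τ d k = key σ d k := by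
    intro k; funext x; simp only [key]; rw [hf1.real _ (by decide)]; simp
  have a18 : τ.word 18 = σ.word 18 := by rw [hf1.word _ (by decide)]; simp
  have a19 : τ.word 19 = σ.word 19 := by rw [hf1.word _ (by decide)]; simp
  have a20 : τ.word 20 = σ.word 20 := by rw [hf1.word _ (by decide)]; simp
  have a26 : τ.word 26 0 = ns := by rw [hf1.word _ (by decide)]; simp [hns]
  have a5 : τ.word 5 = σ.word 5 := by rw [hf1.word _ (by decide)]; simp
  have a6 : τ.word 6 = σ.word 6 := by rw [hf1.word _ (by decide)]; simp
  have r4 : τ.real 4 = σ.real 4 := by rw [hf1.real _ (by decide)]; simp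
  have r5 : τ.real 5 = σ.real 5 := by rw [hf1.real _ (by decide)]; simp
  obtain ⟨hkb, hbest, hmid⟩ := hS.arg hd0
  generalize hkbe : τ.word 30 0 = kb at hkb hbest hmid
  generalize hLe : τ.word 28 kb = L at hbest hmid
  generalize hRe : τ.word 29 kb = R at hbest hmid
  set xs : ℕ → ℝ := fun k => key σ d k (o k (τ.word 28 k)) with hxs
  set ys : ℕ → ℝ := fun k => key σ d k (o k (τ.word 29 k - 1)) with hys
  have srt' : ∀ k < d, ∀ x y, s ≤ x → x ≤ y → y < e → key σ d k (o k x) ≤ key σ d k (o k y) := by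
    intro k hk x y hx hxy hy
    rcases hxy.eq_or_lt with rfl | hlt
    · exact le_rfl
    · exact hsrt k hk x y hx hlt hy
  have hlo : ∀ k < d, ∀ i < n, σ.word 18 i = p → xs k ≤ key σ d k i := by
    intro k hk i hi hgi
    obtain ⟨x, hx1, hx2, rfl⟩ := (hS.win k hk).mem i hi hgi
    exact srt' k hk _ _ (hS.win k hk).left hx1 (by have := (hS.win k hk).right; omega)
  have hhi : ∀ k < d, ∀ i < n, σ.word 18 i = p → key σ d k i ≤ ys k := by
    intro k hk i hi hgi
    obtain ⟨x, hx1, hx2, rfl⟩ := (hS.win k hk).mem i hi hgi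
    have h1 := (hS.win k hk).left
    have h2 := (hS.win k hk).right
    exact srt' k hk _ _ (by omega) (by omega) (by omega)
  have hbest' : ∀ k < d, ys k - xs k ≤ ys kb - xs kb := by
    intro k hk
    have := hS.best k hk
    rw [hbest] at this
    simp only [hxs, hys, hLe, hRe]
    exact this
  -- Two points of the segment differ in some coordinate, so the longest side has positive length
  -- and the cut separates its ends.
  have hpos : xs kb < ys kb := by
    obtain ⟨k, hk, hne⟩ := hdist i₁ hi₁ i₂ hi₂ hi12
    have b1 := hlo k hk i₁ hi₁ hgi₁
    have b2 := hlo k hk i₂ hi₂ hgi₂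
    have b3 := hhi k hk i₁ hi₁ hgi₁
    have b4 := hhi k hk i₂ hi₂ hgi₂
    have b5 := hbest' k hk
    rcases lt_or_gt_of_ne hne with h | h <;> linarith
  have hmid' : τ.real 10 0 = (xs kb + ys kb) / 2 := by
    rw [hmid]; simp only [hxs, hys, hLe, hRe]
  have hwk := hS.win kb hkb
  rw [hLe, hRe] at hwk
  obtain ⟨e1, e2, e3⟩ := hS.ends kb hkb
  rw [hLe, hRe] at e1
  rw [hLe] at e2
  rw [hRe] at e3
  have hsL := hwk.left
  have hRe' := hwk.right
  set mid := (xs kb + ys kb) / 2 with hmd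
  have xL : key σ d kb (o kb L) = xs kb := by simp only [hxs, hLe]
  have xR : key σ d kb (o kb (R - 1)) = ys kb := by simp only [hys, hRe]
  have xLm : key σ d kb (o kb L) ≤ mid := by rw [xL]; linarith
  have xRm : mid < key σ d kb (o kb (R - 1)) := by rw [xR]; linarith
  -- the cut
  refine WP.seq (cut_spec hc1 hkbe hkb hLe hRe hsL hRe' e1 (X := fun x => key σ d kb (o kb x))
    (fun x => by rw [key1]) hmid' xLm xRm).frame ?_
  rintro t2 υ ⟨⟨j, hj, hj1, hj2, hlt, hl, hr, hor, ht2⟩, hf2⟩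
  have hc2 : SegCtx M n d p u s e o υ := hc1.transfer (hf2.word _ (by decide))
    (hf2.word _ (by decide)) (hf2.word _ (by decide)) (hf2.word _ (by decide))
    (hf2.word _ (by decide)) (hf2.word _ (by decide))
  have key2 : ∀ k, key υ d k = key σ d k := by
    intro k; rw [← key1]; funext x; simp only [key]; rw [hf2.real _ (by decide)]
  have b28 : υ.word 28 = τ.word 28 := hf2.word _ (by decide)
  have b29 : υ.word 29 = τ.word 29 := hf2.word _ (by decide)
  refine WP.seq (choosePart_spec hc2 (by rw [hf2.word _ (by decide)]; exact hkbe) hkb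
    (by rw [b28]; exact hLe) (by rw [b29]; exact hRe) hsL hRe' (mid := mid)
    (X := fun x => key σ d kb (o kb x)) (fun x => by rw [key2])
    (by rw [hf2.real _ (by decide)]; exact hmid') hj hlt
    (by rw [hf2.word _ (by decide)]; exact a26) hnsn).frame ?_
  rintro t3 ρ ⟨⟨ht3, hch⟩, hf3⟩
  have hc3 : SegCtx M n d p u s e o ρ := hc2.transfer (hf3.word _ (by decide))
    (hf3.word _ (by decide)) (hf3.word _ (by decide)) (hf3.word _ (by decide))
    (hf3.word _ (by decide)) (hf3.word _ (by decide))
  have c18 : ρ.word 18 = σ.word 18 := by rw [hf3.word _ (by decide), hf2.word _ (by decide), a18]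
  have c26 : ρ.word 26 0 = ns := by rw [hf3.word _ (by decide), hf2.word _ (by decide), a26]
  have hx₀ : s ≤ ρ.word 35 0 ∧ ρ.word 35 0 + j ≤ e := by
    rcases hch with ⟨-, h1, -⟩ | ⟨-, h1, -⟩ <;> omega
  have c20 : υ.word 20 = σ.word 20 := by rw [hf2.word _ (by decide), a20]
  -- moving the points
  refine WP.seq (tag_spec hc3 (by rw [hf3.word _ (by decide), hf2.word _ (by decide)]; exact hkbe)
    hkb rfl (by rw [hf3.word _ (by decide)]; exact hj) hx₀.1 hx₀.2 c26 hnsn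
    (by rwa [c18]) hpns).frame ?_
  rintro t4 χ ⟨⟨htag, hcnt, hsum, hcj, ht4⟩, hf4⟩
  rw [c18] at htag hsum
  have d26 : χ.word 26 0 = ns := by rw [hf4.word _ (by decide), c26]
  have d27 : χ.word 27 0 = p := by rw [hf4.word _ (by decide)]; exact hc3.hp
  have d40 : χ.word 40 0 = u := by rw [hf4.word _ (by decide)]; exact hc3.hu
  have d19 : χ.word 19 = σ.word 19 := by
    rw [hf4.word _ (by decide), hf3.word _ (by decide), hf2.word _ (by decide), a19]
  have d5 : χ.word 5 = σ.word 5 := by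
    rw [hf4.word _ (by decide), hf3.word _ (by decide), hf2.word _ (by decide), a5]
  have d6 : χ.word 6 = σ.word 6 := by
    rw [hf4.word _ (by decide), hf3.word _ (by decide), hf2.word _ (by decide), a6]
  have d20 : χ.word 20 = ρ.word 20 := hf4.word _ (by decide)
  have d28 : χ.word 28 = ρ.word 28 := hf4.word _ (by decide)
  have d29 : χ.word 29 = ρ.word 29 := hf4.word _ (by decide)
  have dr : ∀ a, χ.real a = τ.real a := by
    intro a
    rw [hf4.real a (by simp [tag, tagStep, forLoop, Prog.realArrays]),
      hf3.real a (by simp [choosePart, Prog.realArrays]),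
      hf2.real a (by simp [cut, Prog.realArrays])]
  -- what was moved
  have hpn' : p ≠ ns := by omega
  -- Every member lies in the window. What was moved lies on its own side by the walk; what was not
  -- moved lies on the other side by the stopping condition and the order of the list.
  have hsplit : ∀ i < n, σ.word 18 i = p →
      (ρ.word 28 = τ.word 28 ∧ ρ.word 29 = Function.update (τ.word 29) kb (R - j) ∧
        ρ.word 20 = Function.update (Function.update (σ.word 20) ns (2 * ns)) p (2 * ns - 1) ∧
        ((key σ d kb i ≤ mid ∧ χ.word 18 i = p ∧ ∃ x, L ≤ x ∧ x < R - j ∧ o kb x = i) ∨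
          (mid < key σ d kb i ∧ χ.word 18 i = ns))) ∨
      (ρ.word 28 = Function.update (τ.word 28) kb (L + j) ∧ ρ.word 29 = τ.word 29 ∧
        ρ.word 20 = Function.update (Function.update (σ.word 20) ns (2 * ns - 1)) p (2 * ns) ∧
        ((key σ d kb i ≤ mid ∧ χ.word 18 i = ns) ∨
          (mid < key σ d kb i ∧ χ.word 18 i = p ∧ ∃ x, L + j ≤ x ∧ x < R ∧ o kb x = i))) := by
    intro i hi hgi
    obtain ⟨x, hx1, hx2, hxi⟩ := hwk.mem i hi hgi
    rcases hch with ⟨g1, g2, g3, g4, g5⟩ | ⟨g1, g2, g3, g4, g5⟩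
    · left
      rw [c20] at g5
      rw [b28] at g3
      rw [b29] at g4
      refine ⟨g3, g4, g5, ?_⟩
      have hRj : key σ d kb (o kb (R - (j + 1))) ≤ mid := by
        rcases hor with h1 | h1
        · exact absurd g1 (not_le.mpr h1)
        · exact h1
      rcases htag i hi with ⟨m1, -, y, my1, my2, my3⟩ | ⟨m1, m2⟩
      · right
        refine ⟨?_, m1⟩
        rw [← my3]; exact hr y (by omega) (by omega)
      · left
        have hxlt : x < R - j := by
          by_contra hge
          exact m2 ⟨hgi, x, by omega, by omega, hxi⟩
        refine ⟨?_, by rw [m1, hgi], x, hx1, hxlt, hxi⟩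
        rw [← hxi]
        exact (srt' kb hkb x (R - (j + 1)) (by omega) (by omega) (by omega)).trans hRj
    · right
      rw [c20] at g5
      rw [b28] at g4
      rw [b29] at g3
      refine ⟨g4, g3, g5, ?_⟩
      rcases htag i hi with ⟨m1, -, y, my1, my2, my3⟩ | ⟨m1, m2⟩
      · left
        refine ⟨?_, m1⟩
        rw [← my3]; exact hl y (by omega) (by omega)
      · right
        have hxlt : L + j ≤ x := by
          by_contra hge
          exact m2 ⟨hgi, x, by omega, by omega, hxi⟩
        refine ⟨?_, by rw [m1, hgi], x, hxlt, hx2, hxi⟩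
        rw [← hxi]
        exact g1.trans_le (srt' kb hkb (L + j) x (by omega) (by omega) (by omega))
  have hother : ∀ i < n, σ.word 18 i ≠ p → χ.word 18 i = σ.word 18 i := by
    intro i hi hne
    rcases htag i hi with ⟨-, m2, -⟩ | ⟨m1, -⟩
    · exact absurd m2 hne
    · exact m1
  have hback : ∀ i < n, χ.word 18 i = p → σ.word 18 i = p := by
    intro i hi hne
    rcases htag i hi with ⟨-, m2, -⟩ | ⟨m1, -⟩
    · exact m2
    · rw [← m1, hne]
  obtain ⟨o1, o2⟩ := hc.ho kb hkb L hsL (by omega)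
  obtain ⟨o3, o4⟩ := hc.ho kb hkb (R - 1) (by omega) (by omega)
  have exI : ∀ q i, i < n → χ.word 18 i = q → 0 < Nat.count (fun i => χ.word 18 i = q) n := by
    intro q i hi hq
    have := Nat.count_strict_mono (p := fun i => χ.word 18 i = q) hq hi
    omega
  -- The members at the two ends of the window lie on different sides of the cut, so neither part is
  -- empty.
  have hposs : 0 < Nat.count (fun i => χ.word 18 i = ns) n ∧
      0 < Nat.count (fun i => χ.word 18 i = p) n := by
    have s1 := hsplit _ o2 e2
    have s2 := hsplit _ o4 e3
    rcases hch with ⟨g1, -, g3, -⟩ | ⟨g1, -, g3, g4, -⟩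
    · have hx : ¬ mid < key σ d kb (o kb (L + j)) := not_lt.mpr g1
      have q1 : χ.word 18 (o kb L) = p := by
        rcases htag _ o2 with ⟨m1, -, y, my1, my2, my3⟩ | ⟨m1, -⟩
        · exfalso
          rcases s1 with ⟨-, -, -, h1 | h1⟩ | ⟨h0, -⟩
          · omega
          · exact absurd xLm (not_le.mpr h1.1)
          · have h0' := congrFun h0 kb
            rw [g3, b28] at h0'
            simp [hLe] at h0'
            omega
        · rw [m1, e2]
      have q2 : χ.word 18 (o kb (R - 1)) = ns := by
        rcases s2 with ⟨-, -, -, h1 | h1⟩ | ⟨h0, -⟩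
        · exact absurd xRm (not_lt.mpr h1.1)
        · exact h1.2
        · have h0' := congrFun h0 kb
          rw [g3, b28] at h0'
          simp [hLe] at h0'
          omega
      exact ⟨exI _ _ o4 q2, exI _ _ o2 q1⟩
    · have q1 : χ.word 18 (o kb L) = ns := by
        rcases s1 with ⟨-, h0, -⟩ | ⟨-, -, -, h1 | h1⟩
        · have h0' := congrFun h0 kb
          rw [g3, b29] at h0'
          simp [hRe] at h0'
          omega
        · exact h1.2
        · exact absurd xLm (not_le.mpr h1.1)
      have q2 : χ.word 18 (o kb (R - 1)) = p := by
        rcases s2 with ⟨-, h0, -⟩ | ⟨-, -, -, h1 | h1⟩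
        · have h0' := congrFun h0 kb
          rw [g3, b29] at h0'
          simp [hRe] at h0'
          omega
        · exact absurd xRm (not_lt.mpr h1.1)
        · exact h1.2.1
      exact ⟨exI _ _ o2 q1, exI _ _ o4 q2⟩
  -- recording the result
  have hsq : 0 ≤ χ.real 8 0 := by
    rw [dr, hS.sum]; exact Finset.sum_nonneg fun k _ => sq_nonneg _
  have hcn : σ.word 19 p ≤ n := by rw [hsz]; exact Nat.count_le _
  have e2n : ns + ns = 2 * ns := by omega
  refine WP.of_pre ?_
  simp only [recordSplit, pre, incr, wset]
  refine ⟨by simp [d26]; omega, by simp; omega, by simp [d27]; omega, ?_, by simp [d40]; omega, ?_,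
    by simp [d40]; omega, ?_, by simp [d40]; omega, ?_, by simp [d40]; omega, ?_, ?_, ?_, ?_⟩
  · simp [d26, d27, hpn', d19]; omega
  · simp [twoE, d26]; omega
  · simp [twoE, d26]; omega
  · simpa using ⟨by omega, hsq⟩
  · simp; omega
  · simp; omega
  · simp [d26]; omega
  · refine ⟨kb, xs, ys, ⟨hkb, ?_, ?_, hbest', ?_, ?_, ?_, ?_, ?_, ?_, ?_, ?_, ?_, ?_, ?_, ?_, ?_, ?_, ?_, ?_⟩,
      ?_, ?_, ?_⟩
    · intro k hk
      obtain ⟨w1, w2, w3⟩ := hS.ends k hk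
      have w4 := (hS.win k hk).left
      have w5 := (hS.win k hk).right
      exact ⟨⟨_, (hc.ho k hk _ w4 (by omega)).2, w2, rfl⟩, hlo k hk⟩
    · intro k hk
      obtain ⟨w1, w2, w3⟩ := hS.ends k hk
      have w4 := (hS.win k hk).left
      have w5 := (hS.win k hk).right
      exact ⟨⟨_, (hc.ho k hk _ (by omega) (by omega)).2, w3, rfl⟩, hhi k hk⟩
    · intro k hk; simp [dr, hS.ctr k hk, hxs, hys]
    · intro y hy; simp [dr, hS.ctr_other y hy]
    · simp [dr, d40, r4, hS.sum, hxs, hys]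
    · simp [dr, d40, r5, hbest, xL, xR]
    · simp [d40, d5, twoE, d26, e2n]
    · simp [d40, d6, twoE, d26, e2n]
    · intro i hi hne; simpa using hother i hi hne
    · rcases hch with ⟨g1, -, g3, g4, g5⟩ | ⟨g1, -, g3, g4, g5⟩
      · refine ⟨p, ns, .inl ⟨rfl, rfl⟩, by simp [d20, g5], ?_, ?_⟩
        · simp [d20, g5, Function.update_of_ne hpn'.symm]
        · intro i hi hgi
          simp
          rcases hsplit i hi hgi with ⟨-, -, -, h1 | h1⟩ | ⟨h0, -⟩
          · exact .inl ⟨h1.1, h1.2.1⟩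
          · exact .inr h1
          · have h0' := congrFun h0 kb
            rw [g3, b28] at h0'
            simp [hLe] at h0'
            omega
      · refine ⟨ns, p, .inr ⟨rfl, rfl⟩, ?_, by simp [d20, g5], ?_⟩
        · simp [d20, g5, Function.update_of_ne hpn'.symm]
        · intro i hi hgi
          simp
          rcases hsplit i hi hgi with ⟨-, h0, -⟩ | ⟨-, -, -, h1 | h1⟩
          · have h0' := congrFun h0 kb
            rw [g3, b29] at h0'
            simp [hRe] at h0'
            omega
          · exact .inl h1
          · exact .inr ⟨h1.1, h1.2.1⟩
    · intro x hx hx'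
      rcases hch with ⟨g1, -, g3, g4, g5⟩ | ⟨g1, -, g3, g4, g5⟩ <;>
        simp [d20, g5, c20, Function.update_of_ne hx, Function.update_of_ne hx']
    · simp [d26, d27, d19, Function.update_of_ne hpn'.symm, Function.update_of_ne hpn', hcnt]
    · simp [d26, d27, d19, Function.update_of_ne hpn']; omega
    · intro x hx hx'
      simp [d26, d27, d19, Function.update_of_ne hx, Function.update_of_ne hx']
    · simp [d26, d27, d19, Function.update_of_ne hpn'.symm, Function.update_of_ne hpn']; omega
    · simp [d26, d27, d19, Function.update_of_ne hpn'.symm, Function.update_of_ne hpn', hcnt]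
      exact hposs.1
    · simp [d26, d27, d19, Function.update_of_ne hpn']; omega
    · simp [d26]
    · intro k hk
      simp [d28, d29]
      have hwin := hS.win k hk
      have hne : ∀ i < n, χ.word 18 i = p → σ.word 18 i = p := hback
      by_cases hkk : k = kb
      · subst hkk
        rcases hch with ⟨g1, -, g3, g4, g5⟩ | ⟨g1, -, g3, g4, g5⟩
        · rw [g3, g4, b28]
          simp [hLe]
          refine ⟨hsL, by omega, fun i hi hgi => ?_⟩
          rcases hsplit i hi (hne i hi hgi) with ⟨-, -, -, h1 | h1⟩ | ⟨h0, -⟩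
          · exact h1.2.2
          · omega
          · have h0' := congrFun h0 k
            rw [g3, b28] at h0'
            simp [hLe] at h0'
            omega
        · rw [g3, g4, b29]
          simp [hRe]
          refine ⟨by omega, by omega, fun i hi hgi => ?_⟩
          rcases hsplit i hi (hne i hi hgi) with ⟨-, h0, -⟩ | ⟨-, -, -, h1 | h1⟩
          · have h0' := congrFun h0 k
            rw [g3, b29] at h0'
            simp [hRe] at h0'
            omega
          · omega
          · exact h1.2.2
      · have hw' : Window n (χ.word 18) p s e (o k) (τ.word 28 k) (τ.word 29 k) :=
          ⟨hwin.left, hwin.right, fun i hi hgi => hwin.mem i hi (hne i hi hgi)⟩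
        rcases hch with ⟨g1, -, g3, g4, g5⟩ | ⟨g1, -, g3, g4, g5⟩
        · rw [g3, g4, b28, b29, Function.update_of_ne hkk]; exact hw'
        · rw [g3, g4, b28, b29, Function.update_of_ne hkk]; exact hw'
    · simp [d26, d27, d19, Function.update_of_ne hpn'.symm, Function.update_of_ne hpn']
      omega
    -- The window of `kb` loses exactly `j` positions, which pays for the walk and for the moves.
    · have hws : windowSum d (ρ.word 28) (ρ.word 29) + j = windowSum d (τ.word 28) (τ.word 29) := by
        rcases hch with ⟨g1, -, g3, g4, g5⟩ | ⟨g1, -, g3, g4, g5⟩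
        · have := windowSum_update hkb (τ.word 28) (τ.word 29) L (R - j)
          rw [← hLe, Function.update_eq_self] at this
          rw [g3, g4, b28, b29]
          omega
        · have := windowSum_update hkb (τ.word 28) (τ.word 29) (L + j) R
          rw [← hRe, Function.update_eq_self] at this
          rw [g3, g4, b28, b29]
          omega
      simp [twoE, d28, d29]
      omega

/-! ## Bounding boxes of sets of points -/

section Box

variable {d n : ℕ} (c : Fin n → Pt d) (S : Finset (Fin n))

/-- The lower end of a side of the bounding box. -/
def boxLo (k : Fin d) : ℝ := sInf ((fun i => c i k) '' (S : Set (Fin n)))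

/-- The upper end of a side of the bounding box. -/
def boxHi (k : Fin d) : ℝ := sSup ((fun i => c i k) '' (S : Set (Fin n)))

/-- The centre of the bounding box. -/
def boxCtr : Pt d := WithLp.toLp 2 fun k => (boxLo c S k + boxHi c S k) / 2

/-- Half of the diagonal of the bounding box. -/
def boxRad : ℝ := Real.sqrt (∑ k, ((boxHi c S k - boxLo c S k) / 2) ^ 2)

/-- The longest side of the bounding box. -/
def boxLen : ℝ := sSup (Set.range fun k => boxHi c S k - boxLo c S k)

variable {c S}

theorem IsSide.lo_eq {k : Fin d} {a b : ℝ} (h : IsSide c S k a b) : boxLo c S k = a := h.1.csInf_eq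

theorem IsSide.hi_eq {k : Fin d} {a b : ℝ} (h : IsSide c S k a b) : boxHi c S k = b := h.2.csSup_eq

theorem isSide_box (h : S.Nonempty) (k : Fin d) : IsSide c S k (boxLo c S k) (boxHi c S k) := by
  have hf : ((fun i => c i k) '' (S : Set (Fin n))).Finite := S.finite_toSet.image _
  have hn : ((fun i => c i k) '' (S : Set (Fin n))).Nonempty := (Finset.coe_nonempty.mpr h).image _
  exact ⟨⟨hn.csInf_mem hf, fun x hx => csInf_le hf.bddBelow hx⟩,
    ⟨hn.csSup_mem hf, fun x hx => le_csSup hf.bddAbove hx⟩⟩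

theorem boxLo_le {i : Fin n} (hi : i ∈ S) (k : Fin d) : boxLo c S k ≤ c i k :=
  (isSide_box ⟨i, hi⟩ k).1.2 ⟨i, hi, rfl⟩

theorem le_boxHi {i : Fin n} (hi : i ∈ S) (k : Fin d) : c i k ≤ boxHi c S k :=
  (isSide_box ⟨i, hi⟩ k).2.2 ⟨i, hi, rfl⟩

theorem boxLen_eq {k : Fin d} (h : ∀ k', boxHi c S k' - boxLo c S k' ≤ boxHi c S k - boxLo c S k) :
    boxLen c S = boxHi c S k - boxLo c S k :=
  IsGreatest.csSup_eq ⟨⟨k, rfl⟩, by rintro _ ⟨k', rfl⟩; exact h k'⟩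

theorem boxLo_singleton (i : Fin n) (k : Fin d) : boxLo c {i} k = c i k := by simp [boxLo]

theorem boxHi_singleton (i : Fin n) (k : Fin d) : boxHi c {i} k = c i k := by simp [boxHi]

end Box

/-! ## The forest of a partially built split tree -/

/-- The memory holds the centre, the half diagonal and the longest side of the bounding box of
`S` at the node `u`. -/
structure DataAt {d n : ℕ} (c : Fin n → Pt d) (σ : Store) (u : ℕ) (S : Finset (Fin n)) : Prop where
  ctr : ∀ k : Fin d, σ.real 3 (u * d + k) = (boxLo c S k + boxHi c S k) / 2
  rad : σ.real 4 u = boxRad c S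
  len : σ.real 5 u = boxLen c S

/-- The node `u` has been split. -/
structure InnerNode {d n : ℕ} (c : Fin n → Pt d) (σ : Store) (N : ℕ) (S : ℕ → Finset (Fin n))
    (u : ℕ) : Prop where
  lt_left : u < σ.word 5 u
  left_lt : σ.word 5 u < N
  lt_right : u < σ.word 6 u
  right_lt : σ.word 6 u < N
  split : ∃ k : Fin d,
    (∀ k', boxHi c (S u) k' - boxLo c (S u) k' ≤ boxHi c (S u) k - boxLo c (S u) k) ∧
    (∀ i ∈ S (σ.word 5 u), c i k ≤ (boxLo c (S u) k + boxHi c (S u) k) / 2) ∧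
    (∀ i ∈ S (σ.word 6 u), (boxLo c (S u) k + boxHi c (S u) k) / 2 < c i k)
  union : S u = S (σ.word 5 u) ∪ S (σ.word 6 u)
  data : DataAt c σ u (S u)

/-- The memory holds a partially built split tree with `ns` leaves, which correspond to the
segments of a partition of the points. The set `S u` is stored at the node `u`. -/
structure Forest {d n : ℕ} (c : Fin n → Pt d) (σ : Store) (ns : ℕ) (S : ℕ → Finset (Fin n)) :
    Prop where
  part : Partitioned n ns (σ.word 18) (σ.word 19)
  root : S 0 = Finset.univ
  node_lt : ∀ p < ns, σ.word 20 p + 1 < 2 * ns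
  mem : ∀ p < ns, ∀ i : Fin n, i ∈ S (σ.word 20 p) ↔ σ.word 18 i = p
  inner : ∀ u, u + 1 < 2 * ns → (∀ p < ns, σ.word 20 p ≠ u) → InnerNode c σ (2 * ns - 1) S u

/-- The memory holds the coordinates of the points. -/
def HoldsPoints {d n : ℕ} (c : Fin n → Pt d) (σ : Store) : Prop :=
  ∀ (i : Fin n) (k : Fin d), σ.real 0 ((i : ℕ) * d + k) = c i k

section

variable {d n : ℕ} {c : Fin n → Pt d} {σ τ : Store} {N ns u p kb : ℕ} {S S' : ℕ → Finset (Fin n)}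
  {xs ys : ℕ → ℝ}

theorem Partitioned.lt_of_two_le {g sz : ℕ → ℕ} (h : Partitioned n ns g sz) (hp : p < ns)
    (h2 : 2 ≤ sz p) : ns < n := by
  conv_rhs => rw [← h.sum]
  calc ns = ∑ p ∈ Finset.range ns, 1 := by simp
    _ < _ := Finset.sum_lt_sum (fun p hp => h.pos p (by simpa using hp))
        ⟨p, by simpa using hp, h2⟩

theorem DataAt.congr {S : Finset (Fin n)} (h : DataAt c σ u S)
    (h3 : ∀ k < d, τ.real 3 (u * d + k) = σ.real 3 (u * d + k)) (h4 : τ.real 4 u = σ.real 4 u)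
    (h5 : τ.real 5 u = σ.real 5 u) : DataAt c τ u S :=
  ⟨fun k => by rw [h3 k k.2, h.ctr], by rw [h4, h.rad], by rw [h5, h.len]⟩

theorem InnerNode.congr {N' : ℕ} (h : InnerNode c σ N S u) (hd : DataAt c τ u (S' u)) (hN : N ≤ N')
    (h5 : τ.word 5 u = σ.word 5 u) (h6 : τ.word 6 u = σ.word 6 u) (hS : ∀ v < N, S' v = S v) :
    InnerNode c τ N' S' u where
  lt_left := h5 ▸ h.lt_left
  left_lt := h5 ▸ h.left_lt.trans_le hN
  lt_right := h6 ▸ h.lt_right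
  right_lt := h6 ▸ h.right_lt.trans_le hN
  split := by
    have := h.split
    rw [h5, h6, hS _ h.left_lt, hS _ h.right_lt, hS u (h.lt_left.trans h.left_lt)]
    exact this
  union := by
    rw [h5, h6, hS _ h.left_lt, hS _ h.right_lt, hS u (h.lt_left.trans h.left_lt)]
    exact h.union
  data := hd

theorem count_congr {f g : ℕ → ℕ} {p q m : ℕ} (h : ∀ i < m, f i = p ↔ g i = q) :
    Nat.count (fun i => f i = p) m = Nat.count (fun i => g i = q) m := by
  rw [Nat.count_eq_card_filter_range, Nat.count_eq_card_filter_range]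
  congr 1
  exact Finset.filter_congr fun i hi => h i (by simpa using hi)

/-- The leaf `u` becomes an inner node with the new children `2 * ns - 1` and `2 * ns`. Older inner
nodes point only to numbers below `2 * ns - 1`, so redefining the stored sets at the new numbers
does not affect them. -/
theorem Forest.split (hF : Forest c σ ns S) (hp : p < ns) (hu : σ.word 20 p = u)
    (hc : HoldsPoints c σ)
    (hR : SplitResult n d p ns u (key σ d) σ τ kb xs ys) : ∃ S', Forest c τ (ns + 1) S' := by
  obtain ⟨q, q', hqq, hq, hq', hpart⟩ := hR.part
  have hkey : ∀ (i : Fin n) (k : Fin d), key σ d k i = c i k := fun i k => hc i k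
  have hul : u + 1 < 2 * ns := hu ▸ hF.node_lt p hp
  -- the segments of the points after the split
  have hcase : ∀ i < n, (σ.word 18 i = p ∧ (τ.word 18 i = q ∨ τ.word 18 i = q')) ∨
      (σ.word 18 i ≠ p ∧ σ.word 18 i < ns ∧ τ.word 18 i = σ.word 18 i) := by
    intro i hi
    by_cases h : σ.word 18 i = p
    · left
      rcases hpart i hi h with h1 | h1
      · exact ⟨h, .inl h1.2⟩
      · exact ⟨h, .inr h1.2⟩
    · exact .inr ⟨h, hF.part.lt i hi, hR.other i hi h⟩
  have hold : ∀ x, x ≠ p → x ≠ ns → ∀ i < n, (τ.word 18 i = x ↔ σ.word 18 i = x) := by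
    intro x h1 h2 i hi
    rcases hcase i hi with h | h <;> omega
  have hneq : q ≠ q' := by omega
  set A : Finset (Fin n) := Finset.univ.filter fun i => τ.word 18 i = q with hA
  set B : Finset (Fin n) := Finset.univ.filter fun i => τ.word 18 i = q' with hB
  set S' := Function.update (Function.update S (2 * ns - 1) A) (2 * ns) B with hS'
  have hSlt : ∀ v, v < 2 * ns - 1 → S' v = S v := by
    intro v hv
    rw [hS', Function.update_of_ne (by omega), Function.update_of_ne (by omega)]
  have hSA : S' (2 * ns - 1) = A := by
    rw [hS', Function.update_of_ne (by omega), Function.update_self]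
  have hSB : S' (2 * ns) = B := by rw [hS', Function.update_self]
  have hSu : ∀ i : Fin n, i ∈ S u ↔ σ.word 18 i = p := by rw [← hu]; exact hF.mem p hp
  have hlo : ∀ k : Fin d, IsSide c (S u) k (xs k) (ys k) := by
    intro k
    obtain ⟨⟨i, hi, h1, h2⟩, h3⟩ := hR.lo k k.2
    obtain ⟨⟨j, hj, h4, h5⟩, h6⟩ := hR.hi k k.2
    refine ⟨⟨⟨⟨i, hi⟩, (hSu _).mpr h1, ?_⟩, ?_⟩, ⟨⟨⟨j, hj⟩, (hSu _).mpr h4, ?_⟩, ?_⟩⟩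
    · rw [← h2]; exact (hkey ⟨i, hi⟩ k).symm
    · rintro _ ⟨i', hi', rfl⟩
      simp only; rw [← hkey]
      exact h3 _ i'.2 ((hSu _).mp hi')
    · rw [← h5]; exact (hkey ⟨j, hj⟩ k).symm
    · rintro _ ⟨i', hi', rfl⟩
      simp only; rw [← hkey]
      exact h6 _ i'.2 ((hSu _).mp hi')
  have e1 : ∀ k : Fin d, boxLo c (S u) k = xs k := fun k => (hlo k).lo_eq
  have e2 : ∀ k : Fin d, boxHi c (S u) k = ys k := fun k => (hlo k).hi_eq
  have hlong : ∀ k' : Fin d, boxHi c (S u) k' - boxLo c (S u) k' ≤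
      boxHi c (S u) ⟨kb, hR.kb_lt⟩ - boxLo c (S u) ⟨kb, hR.kb_lt⟩ := by
    intro k'; rw [e1, e2, e1, e2]; exact hR.best k' k'.2
  refine ⟨S', ⟨⟨?_, ?_, ?_⟩, ?_, ?_, ?_, ?_⟩⟩
  · intro i hi
    rcases hcase i hi with h | h <;> omega
  · intro x hx
    by_cases h1 : x = p
    · rw [h1]; exact hR.size_old
    by_cases h2 : x = ns
    · rw [h2]; exact hR.size_new
    rw [hR.size_other x h1 h2, hF.part.size x (by omega), count_congr (hold x h1 h2)]
  · intro x hx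
    by_cases h1 : x = p
    · rw [h1]; exact hR.pos_old
    by_cases h2 : x = ns
    · rw [h2]; exact hR.pos_new
    rw [hR.size_other x h1 h2]; exact hF.part.pos x (by omega)
  · rw [hSlt 0 (by omega)]; exact hF.root
  · intro x hx
    by_cases h1 : x = q
    · subst h1; omega
    by_cases h2 : x = q'
    · subst h2; omega
    rw [hR.node_other x (by omega) (by omega)]
    have := hF.node_lt x (by omega)
    omega
  · intro x hx i
    by_cases h1 : x = q
    · subst h1; rw [hq, hSA, hA]; simp
    by_cases h2 : x = q'
    · subst h2; rw [hq', hSB, hB]; simp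
    rw [hR.node_other x (by omega) (by omega)]
    have := hF.node_lt x (by omega)
    rw [hSlt _ (by omega), hF.mem x (by omega), hold x (by omega) (by omega) i i.2]
  · intro v hv hnv
    have hvq := hnv q (by omega)
    have hvq' := hnv q' (by omega)
    have hv' : v < 2 * ns - 1 := by omega
    by_cases hvu : v = u
    · subst hvu
      refine ⟨?_, ?_, ?_, ?_, ⟨⟨kb, hR.kb_lt⟩, ?_, ?_, ?_⟩, ?_, ?_, ?_, ?_⟩
      · rw [hR.child_left]; simp; omega
      · rw [hR.child_left]; simp; omega
      · rw [hR.child_right]; simp; omega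
      · rw [hR.child_right]; simp; omega
      · rw [hSlt v hv']; exact hlong
      · rw [hSlt v hv', hR.child_left, Function.update_self, hSA, e1, e2]
        intro i hi
        have hi' : τ.word 18 i = q := by simpa [hA] using hi
        rcases hcase i i.2 with h | h
        · rcases hpart i i.2 h.1 with h3 | h3
          · rw [← hkey]; exact h3.1
          · omega
        · omega
      · rw [hSlt v hv', hR.child_right, Function.update_self, hSB, e1, e2]
        intro i hi
        have hi' : τ.word 18 i = q' := by simpa [hB] using hi
        rcases hcase i i.2 with h | h
        · rcases hpart i i.2 h.1 with h3 | h3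
          · omega
          · rw [← hkey]; exact h3.1
        · omega
      · rw [hSlt v hv', hR.child_left, hR.child_right, Function.update_self, Function.update_self,
          hSA, hSB]
        ext i
        rw [hSu, Finset.mem_union, hA, hB, Finset.mem_filter, Finset.mem_filter]
        simp only [Finset.mem_univ, true_and]
        rcases hcase i i.2 with h | h <;> omega
      · intro k; rw [hSlt v hv', e1, e2]; exact hR.ctr k k.2
      · rw [hSlt v hv', hR.rad, Function.update_self, boxRad, Finset.sum_range]
        simp only [e1, e2]
      · rw [hSlt v hv', boxLen_eq hlong, hR.len, Function.update_self, e1, e2]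
    · have hin := hF.inner v (by omega) (fun x hx => by
        by_cases h1 : x = p
        · rw [h1, hu]; exact fun h => hvu h.symm
        · rw [← hR.node_other x h1 (by omega)]; exact hnv x (by omega))
      refine hin.congr ?_ (by omega) ?_ ?_ hSlt
      · rw [hSlt v hv']
        refine hin.data.congr (fun k hk => hR.ctr_other _ fun k' hk' h => ?_) ?_ ?_
        · exact hvu (idx_inj hk hk' h).1
        · rw [hR.rad, Function.update_of_ne hvu]
        · rw [hR.len, Function.update_of_ne hvu]
      · rw [hR.child_left, Function.update_of_ne hvu]
      · rw [hR.child_right, Function.update_of_ne hvu]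

end

/-! ### Halving all segments in rounds -/

theorem Forest.transfer {d n ns : ℕ} {c : Fin n → Pt d} {σ τ : Store} {S : ℕ → Finset (Fin n)}
    (h : Forest c σ ns S) (h5 : τ.word 5 = σ.word 5) (h6 : τ.word 6 = σ.word 6)
    (h18 : τ.word 18 = σ.word 18) (h19 : τ.word 19 = σ.word 19) (h20 : τ.word 20 = σ.word 20)
    (r3 : τ.real 3 = σ.real 3) (r4 : τ.real 4 = σ.real 4) (r5 : τ.real 5 = σ.real 5) :
    Forest c τ ns S where
  part := by rw [h18, h19]; exact h.part
  root := h.root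
  node_lt := by rw [h20]; exact h.node_lt
  mem := by rw [h18, h20]; exact h.mem
  inner := fun u hu hn => (h.inner u hu (by rw [← h20]; exact hn)).congr
    ((h.inner u hu (by rw [← h20]; exact hn)).data.congr (fun k _ => by rw [r3]) (by rw [r4])
      (by rw [r5])) le_rfl (by rw [h5]) (by rw [h6]) fun _ _ => rfl

/-- Split the segment `word 27` until at most `word 22` of its points are left. -/
def segStep : Prog :=
  forLoop 8 1 (.setWord 28 (wv 8) (.load 25 (wv 27)) ;;
    .setWord 29 (wv 8) (.plus (.load 25 (wv 27)) (.load 19 (wv 27)))) ;;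
  .loop (ltw (wv 22) (.load 19 (wv 27))) splitStep

/-- The fixed data of a round in which segments are split to size `h`: there were `ns₀` segments
with sizes `sz₀`, and `g₀` mapped the points to their segments. -/
structure RoundCtx {d n : ℕ} (M h ns₀ : ℕ) (g₀ sz₀ st : ℕ → ℕ) (o : ℕ → ℕ) (c : Fin n → Pt d)
    (σ : Store) : Prop where
  hM : 2 * (n * d) + 2 * n + 2 * d + 9 ≤ M
  hd0 : 0 < d
  hn : σ.word 0 0 = n
  hd : σ.word 1 0 = d
  hh : σ.word 22 0 = h
  hst : σ.word 25 = st
  ho : σ.word 23 = o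
  pts : HoldsPoints c σ
  inj : Function.Injective c
  bound : ∀ p < ns₀, st p + sz₀ p ≤ n
  small : ∀ p < ns₀, sz₀ p ≤ 2 * h + 1
  pos : 0 < h
  hle : h ≤ n
  dist : ∀ k < d, Distributed n ns₀ g₀ sz₀ st (key σ d k) (fun x => o (k * n + x))

theorem RoundCtx.transfer {d n M h ns₀ : ℕ} {g₀ sz₀ st : ℕ → ℕ} {o : ℕ → ℕ} {c : Fin n → Pt d}
    {σ τ : Store} (H : RoundCtx M h ns₀ g₀ sz₀ st o c σ) (h0 : τ.word 0 = σ.word 0)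
    (h1 : τ.word 1 = σ.word 1) (h22 : τ.word 22 = σ.word 22) (h25 : τ.word 25 = σ.word 25)
    (h23 : τ.word 23 = σ.word 23) (hr : τ.real 0 = σ.real 0) :
    RoundCtx M h ns₀ g₀ sz₀ st o c τ where
  hM := H.hM
  hd0 := H.hd0
  hn := h0 ▸ H.hn
  hd := h1 ▸ H.hd
  hh := h22 ▸ H.hh
  hst := h25 ▸ H.hst
  ho := h23 ▸ H.ho
  pts := fun i k => by rw [hr]; exact H.pts i k
  inj := H.inj
  bound := H.bound
  small := H.small
  pos := H.pos
  hle := H.hle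
  dist := by
    have : ∀ k, key τ d k = key σ d k := fun k => by funext x; simp only [key, hr]
    simpa only [this] using H.dist

/-- A segment that is small already only costs the setting of its windows. Otherwise the windows
start with `d * sz` positions in total, worth 130 each. Every split removes at least one point, so a
potential of `900 * d` per remaining point covers the `O(d)` overhead of each split. Altogether this
is `O(d * sz)`. -/
theorem segStep_spec {d n M h ns₀ p ns : ℕ} {g₀ sz₀ st : ℕ → ℕ} {o : ℕ → ℕ} {c : Fin n → Pt d}
    {σ : Store} {S : ℕ → Finset (Fin n)} (H : RoundCtx M h ns₀ g₀ sz₀ st o c σ)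
    (hF : Forest c σ ns S) (hp : σ.word 27 0 = p) (hns : σ.word 26 0 = ns) (hpn : p < ns)
    (hp0 : p < ns₀) (hsz0 : σ.word 19 p = sz₀ p) (hg0 : ∀ i < n, (σ.word 18 i = p ↔ g₀ i = p)) :
    WP M segStep σ (fun t τ => (∃ ns' S', ns ≤ ns' ∧ τ.word 26 0 = ns' ∧ Forest c τ ns' S' ∧
      (∀ x < ns, x ≠ p → τ.word 19 x = σ.word 19 x ∧
        ∀ i < n, (τ.word 18 i = x ↔ σ.word 18 i = x)) ∧
      (∀ x, ns ≤ x → x < ns' → τ.word 19 x ≤ h) ∧ τ.word 19 p ≤ h) ∧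
      ((σ.word 19 p ≤ h ∧ t ≤ 60 * d) ∨ t ≤ 1100 * (d * σ.word 19 p))) := by
  have hM := H.hM
  have hd0 := H.hd0
  have hnsn := hF.part.le
  have hbd := H.bound p hp0
  have hhn := H.hle
  have hnd : n ≤ n * d := Nat.le_mul_of_pos_right _ (by omega)
  have hdn : d * n = n * d := mul_comm _ _
  have H1 := WP.forLoop (M := M) (q := 8) (a := 1)
    (P := .setWord 28 (wv 8) (.load 25 (wv 27)) ;;
      .setWord 29 (wv 8) (.plus (.load 25 (wv 27)) (.load 19 (wv 27)))) (σ := σ)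
    (fun k τ => ∀ k' < k, τ.word 28 k' = st p ∧ τ.word 29 k' = st p + σ.word 19 p) d 16
    (by decide) (by decide) (by decide) H.hd (by omega) (by intro k hk; omega)
    (by
      intro k τ hk hI hf h8
      have f25 : τ.word 25 = st := by rw [hf.word _ (by decide)]; simp [H.hst]
      have f27 : τ.word 27 0 = p := by rw [hf.word _ (by decide)]; simp [hp]
      have f19 : τ.word 19 = σ.word 19 := by rw [hf.word _ (by decide)]; simp
      refine WP.of_pre ?_
      simp [h8, f25, f27, f19]
      and_intros
      any_goals omega
      intro k' hk'
      rcases hk'.lt_or_eq with hk' | rfl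
      · rw [Function.update_of_ne (by omega), Function.update_of_ne (by omega)]
        exact hI k' hk'
      · simp)
  refine WP.seq H1.frame ?_
  rintro t1 τ₁ ⟨⟨hI, -, ht1⟩, hf1⟩
  have a18 : τ₁.word 18 = σ.word 18 := hf1.word _ (by decide)
  have a19 : τ₁.word 19 = σ.word 19 := hf1.word _ (by decide)
  have a20 : τ₁.word 20 = σ.word 20 := hf1.word _ (by decide)
  have a26 : τ₁.word 26 0 = ns := by rw [hf1.word _ (by decide), hns]
  have a27 : τ₁.word 27 0 = p := by rw [hf1.word _ (by decide), hp]
  have ra : ∀ a, τ₁.real a = σ.real a := fun a =>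
    hf1.real a (by simp [forLoop, Prog.realArrays])
  have H₁ : RoundCtx M h ns₀ g₀ sz₀ st o c τ₁ := H.transfer (hf1.word _ (by decide))
    (hf1.word _ (by decide)) (hf1.word _ (by decide)) (hf1.word _ (by decide))
    (hf1.word _ (by decide)) (ra 0)
  have hF₁ : Forest c τ₁ ns S := hF.transfer (hf1.word _ (by decide)) (hf1.word _ (by decide))
    a18 a19 a20 (ra 3) (ra 4) (ra 5)
  have hszn : σ.word 19 p ≤ n := by rw [hF.part.size p hpn]; exact Nat.count_le _
  by_cases hle : σ.word 19 p ≤ h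
  · have H2 := WP.loop_count (M := M) (b := ltw (wv 22) (.load 19 (wv 27))) (P := splitStep)
      (σ := τ₁) (fun _ τ => τ = τ₁) 0 0 rfl (by intro q τ hq; omega)
      (by
        rintro τ rfl -
        simp [H₁.hh, a27, a19, hle]
        have := hF.part.le
        omega)
    refine H2.mono ?_
    rintro t2 τ ⟨rfl, ht2⟩
    refine ⟨⟨ns, S, le_rfl, a26, hF₁, fun x _ _ => by rw [a18, a19]; simp, fun x _ _ => by omega,
      by rwa [a19]⟩, .inl ⟨hle, ?_⟩⟩
    simp at ht2
    omega
  · have hkeyeq : ∀ (τ : Store), τ.real 0 = σ.real 0 → ∀ k, key τ d k = key σ d k :=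
      fun τ h k => by funext x; simp only [key, h]
    have hW₁ : ∀ k < d, Window n (τ₁.word 18) p (st p) (st p + sz₀ p) (fun x => o (k * n + x))
        (τ₁.word 28 k) (τ₁.word 29 k) := by
      intro k hk
      obtain ⟨b1, b2⟩ := hI k hk
      rw [b1, b2, hsz0, a18]
      refine ⟨le_rfl, le_rfl, fun i hi hgi => ?_⟩
      have := (hg0 i hi).mp hgi
      obtain ⟨x, h1, h2, h3⟩ := (H.dist k hk).sur i hi
      rw [this] at h1 h2
      exact ⟨x, h1, h2, h3⟩
    have H2 := WP.loop_potential (M := M) (b := ltw (wv 22) (.load 19 (wv 27))) (P := splitStep)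
      (σ := τ₁) (γ := ℕ)
      (fun φ τ => (∃ ns' S', ns ≤ ns' ∧ τ.word 26 0 = ns' ∧ Forest c τ ns' S' ∧
        (∀ x < ns, x ≠ p → τ.word 19 x = σ.word 19 x ∧
          ∀ i < n, (τ.word 18 i = x ↔ σ.word 18 i = x)) ∧
        (∀ x, ns ≤ x → x < ns' → τ.word 19 x ≤ h)) ∧
        (∀ k < d, Window n (τ.word 18) p (st p) (st p + sz₀ p) (fun x => o (k * n + x))
          (τ.word 28 k) (τ.word 29 k)) ∧
        φ = 130 * windowSum d (τ.word 28) (τ.word 29) + 900 * (d * τ.word 19 p))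
      (fun φ => φ) (g := 130 * windowSum d (τ₁.word 28) (τ₁.word 29) + 900 * (d * τ₁.word 19 p))
      ⟨⟨ns, S, le_rfl, a26, hF₁, fun x _ _ => by rw [a18, a19]; simp, fun x _ _ => by omega⟩, hW₁,
        rfl⟩
      (by
        rintro φ τ ⟨⟨ns', S', hns', b26, bF, bold, bnew⟩, bW, rfl⟩ hf2
        have b22 : τ.word 22 0 = h := by rw [hf2.word _ (by decide), H₁.hh]
        have b27 : τ.word 27 0 = p := by rw [hf2.word _ (by decide), a27]
        have b0 : τ.word 0 0 = n := by rw [hf2.word _ (by decide), H₁.hn]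
        have b1 : τ.word 1 0 = d := by rw [hf2.word _ (by decide), H₁.hd]
        have b23 : τ.word 23 = o := by rw [hf2.word _ (by decide), H₁.ho]
        have br : τ.real 0 = σ.real 0 := by rw [hf2.real _ (by decide), ra 0]
        have bn := bF.part.le
        have bs : τ.word 19 p ≤ n := by rw [bF.part.size p (by omega)]; exact Nat.count_le _
        refine ⟨by simp [b22, b27]; have := H.pos; have := H.bound; omega, fun hv => ?_⟩
        have hv : h < τ.word 19 p := by simpa [b22, b27] using hv
        have hpos := H.pos
        have hnlt := bF.part.lt_of_two_le (p := p) (by omega) (by omega)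
        have hnode := bF.node_lt p (by omega)
        have bP : HoldsPoints c τ := fun i k => by rw [br]; exact H.pts i k
        have ctx : SegCtx M n d p (τ.word 20 p) (st p) (st p + sz₀ p)
            (fun k x => o (k * n + x)) (τ.setWord 40 0 (τ.word 20 p)) := by
          refine ⟨hM, by simpa using b0, by simpa using b1, by simpa using b27, by simp, ?_,
            by omega, by omega, hbd, ?_⟩
          · intro i hi
            simp
            exact (bF.part.lt i hi).trans hnlt
          · intro k hk x hx hx'
            simp [b23]
            exact ((H.dist k hk).mem p hp0 x hx hx').1
        refine (splitStep_spec (h := h) ctx hd0 rfl b26 hnlt bF.part.lt (by omega)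
          (bF.part.size p (by omega)) (by omega) (by have := H.small p hp0; omega) ?_ ?_ bW).frame.mono ?_
        · intro i hi j hj hij
          have hne : c ⟨i, hi⟩ ≠ c ⟨j, hj⟩ := fun h => hij (by simpa using H.inj h)
          by_contra hcon
          push Not at hcon
          apply hne
          ext k
          have := hcon k k.2
          rw [hkeyeq τ br] at this
          rw [← H.pts, ← H.pts]
          exact this
        · intro k hk x y hx hxy hy
          rw [hkeyeq τ br]
          exact (H.dist k hk).srt p hp0 x y hx hxy hy
        · rintro t υ ⟨⟨kb, xs, ys, hR, hW', hnew, ht⟩, hf3⟩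
          obtain ⟨S'', hF''⟩ := bF.split (by omega) rfl bP hR
          refine ⟨_, ⟨⟨ns' + 1, S'', by omega, hR.ns_eq, hF'', ?_, ?_⟩, hW', rfl⟩, ?_⟩
          · intro x hx hxp
            obtain ⟨e1, e2⟩ := bold x hx hxp
            refine ⟨by rw [hR.size_other x hxp (by omega), e1], fun i hi => ?_⟩
            rw [← e2 i hi]
            by_cases hgi : τ.word 18 i = p
            · obtain ⟨q, q', hqq, -, -, hpart⟩ := hR.part
              rcases hpart i hi hgi with h1 | h1 <;> omega
            · rw [hR.other i hi hgi]
          · intro x hx hx'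
            rcases Nat.lt_succ_iff_lt_or_eq.mp hx' with hx' | rfl
            · rw [hR.size_other x (by omega) (by omega)]; exact bnew x hx hx'
            · exact hnew
          · have h1 := hR.size_add
            have h2 := hR.pos_new
            have h3 : d * υ.word 19 p + d ≤ d * τ.word 19 p := by
              rw [← h1, Nat.mul_add]
              have := Nat.le_mul_of_pos_right d h2
              omega
            simp
            omega)
    refine H2.frame.mono ?_
    rintro t2 τ ⟨⟨φ, ⟨⟨ns', S', hns', b26, bF, bold, bnew⟩, bW, hφ⟩, ht2, hv⟩, hf2⟩
    have b22 : τ.word 22 0 = h := by rw [hf2.word _ (by decide), H₁.hh]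
    have b27 : τ.word 27 0 = p := by rw [hf2.word _ (by decide), a27]
    have hv : ¬ h < τ.word 19 p := by simpa [b22, b27] using hv
    refine ⟨⟨ns', S', hns', b26, bF, bold, bnew, not_lt.mp hv⟩, .inr ?_⟩
    have hws : windowSum d (τ₁.word 28) (τ₁.word 29) = d * σ.word 19 p := by
      unfold windowSum
      rw [Finset.sum_congr rfl (fun k hk => by
        obtain ⟨b1, b2⟩ := hI k (by simpa using hk)
        rw [b1, b2, Nat.add_sub_cancel_left])]
      simp
    rw [hws, a19] at ht2
    simp at ht2
    have hpos := H.pos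
    have h2 : d * 2 ≤ d * σ.word 19 p := Nat.mul_le_mul_left d (by omega)
    omega

/-- The input of the construction of the split tree: the points, and their sorted lists. -/
structure BuildCtx {d n : ℕ} (M : ℕ) (c : Fin n → Pt d) (σ : Store) : Prop where
  hM : 2 * (n * d) + 2 * n + 2 * d + 9 ≤ M
  hd0 : 0 < d
  hn0 : 0 < n
  hn : σ.word 0 0 = n
  hd : σ.word 1 0 = d
  pts : HoldsPoints c σ
  inj : Function.Injective c
  srt : ∀ k < d, SortedPerm n (key σ d k) (fun x => σ.word 17 (k * n + x))

theorem BuildCtx.transfer {d n M : ℕ} {c : Fin n → Pt d} {σ τ : Store} (H : BuildCtx M c σ)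
    (h0 : τ.word 0 = σ.word 0) (h1 : τ.word 1 = σ.word 1) (h17 : τ.word 17 = σ.word 17)
    (hr : τ.real 0 = σ.real 0) : BuildCtx M c τ where
  hM := H.hM
  hd0 := H.hd0
  hn0 := H.hn0
  hn := h0 ▸ H.hn
  hd := h1 ▸ H.hd
  pts := fun i k => by rw [hr]; exact H.pts i k
  inj := H.inj
  srt := by
    have : ∀ k, key τ d k = key σ d k := fun k => by funext x; simp only [key, hr]
    simpa only [this, h17] using H.srt

/-- A round: all segments are split to at most half of the bound `word 36` of their sizes. -/
def round : Prog :=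
  wset 22 (.quot (wv 36) (.const 2)) ;; distribute ;; wset 37 (wv 26) ;; forLoop 27 37 segStep ;;
  wset 36 (wv 22)

/-- With `h = w / 2` one has `w ≤ 2 * h + 1`, so every part cut off has size at most `h`, and only
the segments present at the start need treatment; `word 37` freezes their number. Their sizes add up
to `n`, and the potential in the loop is what the untreated ones are still entitled to. -/
theorem round_spec {d n M w ns : ℕ} {c : Fin n → Pt d} {σ : Store} {S : ℕ → Finset (Fin n)}
    (H : BuildCtx M c σ) (hns : σ.word 26 0 = ns) (hF : Forest c σ ns S) (hw : σ.word 36 0 = w)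
    (hw2 : 2 ≤ w) (hwn : w ≤ n) (hsz : ∀ x < ns, σ.word 19 x ≤ w) :
    WP M round σ (fun t τ => ∃ ns' S', τ.word 26 0 = ns' ∧ Forest c τ ns' S' ∧
      (∀ x < ns', τ.word 19 x ≤ w / 2) ∧ τ.word 36 0 = w / 2 ∧ t ≤ 1500 * (d * n)) := by
  have hM := H.hM
  have hd0 := H.hd0
  have hn0 := H.hn0
  have hnsn := hF.part.le
  have hnd : n ≤ n * d := Nat.le_mul_of_pos_right _ (by omega)
  have hdn : d * n = n * d := mul_comm _ _
  refine WP.seq (Q := fun t τ => t = 6 ∧ τ = σ.setWord 22 0 (w / 2))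
    (WP.of_pre (by simp [hw]; omega)) ?_
  rintro _ _ ⟨rfl, rfl⟩
  refine WP.seq (distribute_spec (key := key σ d) hM (by simpa using H.hn) (by simpa using H.hd)
    hd0 hn0 (by simpa using hns) (by simpa using hF.part) (by simpa using H.srt)).frame ?_
  rintro t1 τ ⟨⟨hb, hdist, ht1⟩, hf1⟩
  refine WP.seq (Q := fun t υ => t ≤ 4 ∧ υ = τ.setWord 37 0 ns)
    (WP.of_pre (by
      have : τ.word 26 0 = ns := by rw [hf1.word _ (by decide)]; simp [hns]
      simp [this]; omega)) ?_
  rintro t1' _ ⟨ht1', rfl⟩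
  have a19 : τ.word 19 = σ.word 19 := by rw [hf1.word _ (by decide)]; simp
  have a18 : τ.word 18 = σ.word 18 := by rw [hf1.word _ (by decide)]; simp
  have ra : ∀ a, τ.real a = σ.real a := fun a => by
    rw [hf1.real a (by simp [distribute, distDim, distStep, forLoop, Prog.realArrays])]; simp
  have hF1 : Forest c τ ns S := hF.transfer (by rw [hf1.word _ (by decide)]; simp)
    (by rw [hf1.word _ (by decide)]; simp) a18 a19 (by rw [hf1.word _ (by decide)]; simp)
    (ra 3) (ra 4) (ra 5)
  have hkey : ∀ (τ : Store), τ.real 0 = σ.real 0 → key τ d = key σ d :=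
    fun τ h => by funext k x; simp only [key, h]
  have ctx : RoundCtx M (w / 2) ns (σ.word 18) (σ.word 19) (τ.word 25) (τ.word 23) c
      (τ.setWord 37 0 ns) := by
    refine ⟨hM, hd0, ?_, ?_, ?_, by simp, by simp, ?_, H.inj, ?_, ?_, by omega, by omega, ?_⟩
    · simp; rw [hf1.word _ (by decide)]; simp [H.hn]
    · simp; rw [hf1.word _ (by decide)]; simp [H.hd]
    · simp; rw [hf1.word _ (by decide)]; simp
    · intro i k; simp [ra]; exact H.pts i k
    · simpa using hb
    · intro p hp; have := hsz p hp; omega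
    · intro k hk
      rw [hkey _ (by simp [ra])]
      simpa using hdist k hk
  have H2 := WP.forLoop_potential (M := M) (q := 27) (a := 37) (P := segStep)
    (σ := τ.setWord 37 0 ns)
    (fun p φ υ => (∃ ns' S', ns ≤ ns' ∧ υ.word 26 0 = ns' ∧ Forest c υ ns' S' ∧
        (∀ x, ns ≤ x → x < ns' → υ.word 19 x ≤ w / 2)) ∧
      (∀ x, p ≤ x → x < ns → υ.word 19 x = σ.word 19 x ∧
        ∀ i < n, (υ.word 18 i = x ↔ σ.word 18 i = x)) ∧
      (∀ x < p, υ.word 19 x ≤ w / 2) ∧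
      φ = 1100 * (d * (n - ∑ x ∈ Finset.range p, σ.word 19 x))) ns (60 * d)
    (1100 * (d * n)) (by decide) (by decide) (by decide) (by simp) (by omega)
    (by
      refine ⟨⟨ns, S, le_rfl, ?_, ?_, fun x _ _ => by omega⟩, ?_, fun x hx => by omega, by simp⟩
      · simp; rw [hf1.word _ (by decide)]; simp [hns]
      · exact hF1.transfer (by simp) (by simp) (by simp) (by simp) (by simp) (by simp) (by simp)
          (by simp)
      · intro x _ _; simp [a18, a19])
    (by
      rintro p φ υ hp ⟨⟨ns', S', hns', b26, bF, bnew⟩, bold, bdone, rfl⟩ hf2 h27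
      have b22 : υ.word 22 = τ.word 22 := by rw [hf2.word _ (by decide)]; simp
      obtain ⟨b1, b2⟩ := bold p le_rfl hp
      have ctx' : RoundCtx M (w / 2) ns (σ.word 18) (σ.word 19) (τ.word 25) (τ.word 23) c υ :=
        ctx.transfer (by rw [hf2.word _ (by decide)]; simp) (by rw [hf2.word _ (by decide)]; simp)
          (by rw [hf2.word _ (by decide)]; simp) (by rw [hf2.word _ (by decide)]; simp)
          (by rw [hf2.word _ (by decide)]; simp) (by rw [hf2.real _ (by decide)]; simp)
      refine (segStep_spec ctx' bF h27 b26 (by omega) hp b1 b2).mono ?_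
      rintro t ρ ⟨⟨ns'', S'', c1, c26, cF, cold, cnew, cp⟩, ht⟩
      refine ⟨_, ⟨⟨ns'', S'', by omega, by simpa using c26, ?_, ?_⟩, ?_, ?_, rfl⟩, ?_⟩
      · exact cF.transfer (by simp) (by simp) (by simp) (by simp) (by simp) (by simp) (by simp)
          (by simp)
      · intro x hx hx'
        simp
        rcases Nat.lt_or_ge x ns' with h | h
        · rw [(cold x h (by omega)).1]; exact bnew x hx h
        · exact cnew x h hx'
      · intro x hx hx'
        simp
        obtain ⟨e1, e2⟩ := cold x (by omega) (by omega)
        obtain ⟨e3, e4⟩ := bold x (by omega) hx'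
        exact ⟨by rw [e1, e3], fun i hi => by rw [e2 i hi, e4 i hi]⟩
      · intro x hx
        simp
        rcases Nat.lt_succ_iff_lt_or_eq.mp hx with hx | rfl
        · rw [(cold x (by omega) (by omega)).1]; exact bdone x hx
        · exact cp
      · have h1 := hF.part.start_add_le hp
        rw [Finset.sum_range_succ]
        have h2 : d * (n - ∑ x ∈ Finset.range p, σ.word 19 x) =
            d * (n - (∑ x ∈ Finset.range p, σ.word 19 x + σ.word 19 p)) + d * σ.word 19 p := by
          rw [← Nat.mul_add]; congr 1; omega
        rw [b1] at ht
        rw [h2]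
        rcases ht with ⟨-, ht⟩ | ht <;> omega)
  refine WP.seq H2.frame ?_
  rintro t2 υ ⟨⟨φ, ⟨⟨ns', S', hns', b26, bF, bnew⟩, -, bdone, -⟩, -, ht2⟩, hf2⟩
  have b22 : υ.word 22 0 = w / 2 := by
    rw [hf2.word _ (by decide)]; simp; rw [hf1.word _ (by decide)]; simp
  have h1 : ns * (60 * d + 13) ≤ n * (73 * d) := Nat.mul_le_mul hnsn (by omega)
  have h2 : n * (73 * d) = 73 * (d * n) := by ring
  have h3 : d ≤ d * n := Nat.le_mul_of_pos_right _ hn0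
  refine WP.of_pre ?_
  simp only [pre, wset]
  refine ⟨by simp; omega, by simp [b22]; omega, ns', S', by simpa using b26, bF.transfer (by simp) (by simp)
    (by simp) (by simp) (by simp) (by simp) (by simp) (by simp), ?_, by simp [b22], ?_⟩
  · intro x hx
    simp
    rcases Nat.lt_or_ge x ns with h | h
    · exact bdone x h
    · exact bnew x h hx
  · simp
    omega

/-- Build the inner nodes of the split tree. -/
def build : Prog :=
  forLoop 9 0 (.setWord 18 (wv 9) (.const 0)) ;;
  .setWord 19 (.const 0) (wv 0) ;; .setWord 20 (.const 0) (.const 0) ;; wset 26 (.const 1) ;;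
  wset 36 (wv 0) ;;
  .loop (.leWord (.const 2) (wv 36)) round

/-- The bound on the sizes is halved in each round, so `Nat.log 2 w` decreases by one and serves as
potential. When the bound is `1`, all segments are singletons, hence there are `n` of them. -/
theorem build_spec {d n M : ℕ} {c : Fin n → Pt d} {σ : Store} (H : BuildCtx M c σ) :
    WP M build σ (fun t τ => ∃ S, Forest c τ n S ∧ (∀ x < n, τ.word 19 x = 1) ∧
      t ≤ 1600 * (d * (n * (Nat.log 2 n + 1)))) := by
  have hM := H.hM
  have hd0 := H.hd0
  have hn0 := H.hn0
  have hnd : n ≤ n * d := Nat.le_mul_of_pos_right _ (by omega)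
  have hdn : d * n = n * d := mul_comm _ _
  have H1 := WP.forLoop (M := M) (q := 9) (a := 0) (P := .setWord 18 (wv 9) (.const 0)) (σ := σ)
    (fun q υ => ∀ x < q, υ.word 18 x = 0) n 5 (by decide) (by decide) (by decide) H.hn
    (by omega) (by intro x hx; omega)
    (by
      intro q υ hq hI hf h9
      refine WP.of_pre ?_
      simp [h9]
      refine ⟨by omega, by omega, fun x hx => ?_⟩
      rcases hx.lt_or_eq with hx | rfl
      · rw [Function.update_of_ne (by omega), hI x hx]
      · simp)
  refine WP.seq H1.frame ?_
  rintro t1 τ ⟨⟨hI, -, ht1⟩, hf1⟩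
  have a0 : τ.word 0 = σ.word 0 := hf1.word _ (by decide)
  set τ' := (((τ.setWord 19 0 n).setWord 20 0 0).setWord 26 0 1).setWord 36 0 n with hτ'
  have hn' : τ.word 0 0 = n := by rw [a0]; exact H.hn
  suffices hs : WP M (.loop (.leWord (.const 2) (wv 36)) round) τ' (fun t υ => ∃ S,
      Forest c υ n S ∧ (∀ x < n, υ.word 19 x = 1) ∧
      t ≤ 1510 * (d * n * Nat.log 2 n) + 10) by
    refine WP.of_pre ?_
    simp [hn']
    refine ⟨by omega, by omega, by omega, by omega, by omega, by omega, ?_⟩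
    refine hs.mono ?_
    rintro t υ ⟨S, h1, h2, h3⟩
    refine ⟨⟨S, h1⟩, h2, ?_⟩
    have e1 : d * (n * (Nat.log 2 n + 1)) = d * n * Nat.log 2 n + d * n := by ring
    rw [e1]
    have : d ≤ d * n := Nat.le_mul_of_pos_right _ hn0
    omega
  have ctx : BuildCtx M c τ' := H.transfer (by simp [hτ', a0])
    (by simp [hτ']; exact hf1.word _ (by decide)) (by simp [hτ']; exact hf1.word _ (by decide))
    (by simp [hτ']; exact hf1.real _ (by decide))
  have hF : Forest c τ' 1 (fun _ => Finset.univ) := by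
    refine ⟨⟨?_, ?_, ?_⟩, rfl, ?_, ?_, ?_⟩
    · intro i hi; simp [hτ', hI i hi]
    · intro p hp
      have : p = 0 := by omega
      subst this
      simp [hτ']
      symm
      rw [Nat.count_iff_forall]
      exact fun i hi => hI i hi
    · intro p hp
      have : p = 0 := by omega
      subst this
      simp [hτ', hn0]
    · intro p hp
      have : p = 0 := by omega
      subst this
      simp [hτ']
    · intro p hp i
      have : p = 0 := by omega
      subst this
      simp [hτ', hI i i.2]
    · intro u hu h
      exact absurd (by simp [hτ']; omega) (h 0 (by omega))
  have H2 := WP.loop_potential (M := M) (b := .leWord (.const 2) (wv 36)) (P := round) (σ := τ')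
    (fun w υ => 0 < w ∧ w ≤ n ∧ υ.word 36 0 = w ∧ ∃ ns S, υ.word 26 0 = ns ∧ Forest c υ ns S ∧
      ∀ x < ns, υ.word 19 x ≤ w) (fun w => 1510 * (d * n * Nat.log 2 w)) (g := n)
    ⟨hn0, le_rfl, by simp [hτ'], 1, _, by simp [hτ'], hF, by
      intro x hx
      have : x = 0 := by omega
      subst this
      simp [hτ']⟩
    (by
      rintro w υ ⟨hw0, hwn, h36, ns, S, h26, hF', hsz⟩ hf2
      refine ⟨by simp [h36]; omega, fun hv => ?_⟩
      have hv : 2 ≤ w := by simpa [h36] using hv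
      have ctx' : BuildCtx M c υ := ctx.transfer (hf2.word _ (by decide)) (hf2.word _ (by decide))
        (hf2.word _ (by decide)) (hf2.real _ (by decide))
      refine (round_spec ctx' h26 hF' h36 hv hwn hsz).mono ?_
      rintro t ρ ⟨ns', S', c26, cF, csz, c36, ht⟩
      refine ⟨w / 2, ⟨by omega, by omega, c36, ns', S', c26, cF, csz⟩, ?_⟩
      have h1 : Nat.log 2 w = Nat.log 2 (w / 2) + 1 := by
        have := Nat.log_pos (b := 2) (by norm_num) hv
        rw [Nat.log_div_base]; omega
      rw [h1, Nat.mul_add]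
      simp
      have : 0 < d * n := Nat.mul_pos hd0 hn0
      omega)
  refine H2.mono ?_
  rintro t υ ⟨w, ⟨hw0, hwn, h36, ns, S, h26, hF', hsz⟩, ht, hv⟩
  have hv : ¬ 2 ≤ w := by simpa [h36] using hv
  have hw1 : w = 1 := by omega
  subst hw1
  have h1 : ∀ x < ns, υ.word 19 x = 1 := fun x hx => by
    have := hsz x hx
    have := hF'.part.pos x hx
    omega
  have h2 : ns = n := by
    have := hF'.part.sum
    rw [Finset.sum_congr rfl (fun x hx => h1 x (by simpa using hx))] at this
    simpa using this
  subst h2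
  refine ⟨S, hF', h1, ?_⟩
  simp at ht
  omega

/-- Write the leaves of the split tree. -/
def leaves : Prog :=
  forLoop 9 0 ((wset 40 (.load 20 (.load 18 (wv 9))) ;;
    .setWord 5 (wv 40) (.const 0) ;; .setWord 7 (wv 40) (wv 9) ;;
    .setReal 4 (wv 40) (.const 0) ;; .setReal 5 (wv 40) (.const 0)) ;;
    forLoop 8 1 (.setReal 3 (.plus (.times (wv 40) (wv 1)) (wv 8)) (keyE (wv 9))))

/-- The memory holds the given tree at node `u`, with the data of the bounding boxes. -/
def Rep {d n : ℕ} (c : Fin n → Pt d) (σ : Store) (N : ℕ) : BTree (Fin n) → ℕ → Prop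
  | .leaf i, u => u < N ∧ σ.word 5 u = 0 ∧ σ.word 7 u = i ∧ DataAt c σ u {i}
  | .node l r, u => u < N ∧ σ.word 5 u ≠ 0 ∧ DataAt c σ u (l.labels ∪ r.labels) ∧
      Rep c σ N l (σ.word 5 u) ∧ Rep c σ N r (σ.word 6 u)

/-! ### The finished tree in memory -/

section

variable {d n N : ℕ} {c : Fin n → Pt d} {σ τ : Store}

theorem Rep.lt {T : BTree (Fin n)} {u : ℕ} (h : Rep c σ N T u) : u < N := by
  cases T <;> exact h.1

theorem Rep.dataAt {T : BTree (Fin n)} {u : ℕ} (h : Rep c σ N T u) : DataAt c σ u T.labels := by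
  cases T
  · exact h.2.2.2
  · exact h.2.2.1

theorem Rep.holdsTree {T : BTree (Fin n)} {u : ℕ} (h : Rep c σ N T u) : HoldsTree σ T u := by
  induction T generalizing u with
  | leaf i => exact ⟨h.2.1, h.2.2.1⟩
  | node l r ihl ihr => exact ⟨h.2.1, ihl h.2.2.2.1, ihr h.2.2.2.2⟩

/-- The left pointer tells leaves from inner nodes, so the contents of the memory at a node
determine the tree. Hence comparing node numbers is enough for the search to recognise a pair of
equal sets. -/
theorem Rep.eq {T U : BTree (Fin n)} {u : ℕ} (h : Rep c σ N T u) (h' : Rep c σ N U u) : T = U := by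
  induction T generalizing u U with
  | leaf i =>
    cases U with
    | leaf j => rw [Fin.ext (h.2.2.1.symm.trans h'.2.2.1)]
    | node l r => exact absurd h.2.1 h'.2.1
  | node l r ihl ihr =>
    cases U with
    | leaf j => exact absurd h'.2.1 h.2.1
    | node l' r' => rw [ihl h.2.2.2.1 h'.2.2.2.1, ihr h.2.2.2.2 h'.2.2.2.2]

theorem Rep.transfer {T : BTree (Fin n)} {u : ℕ} (h : Rep c σ N T u) (h5 : τ.word 5 = σ.word 5)
    (h6 : τ.word 6 = σ.word 6) (h7 : τ.word 7 = σ.word 7) (r3 : τ.real 3 = σ.real 3)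
    (r4 : τ.real 4 = σ.real 4) (r5 : τ.real 5 = σ.real 5) : Rep c τ N T u := by
  have hd : ∀ u S, DataAt c σ u S → DataAt c τ u S := fun u S h =>
    h.congr (fun k _ => by rw [r3]) (by rw [r4]) (by rw [r5])
  induction T generalizing u with
  | leaf i => exact ⟨h.1, by rw [h5]; exact h.2.1, by rw [h7]; exact h.2.2.1, hd _ _ h.2.2.2⟩
  | node l r ihl ihr =>
    refine ⟨h.1, by rw [h5]; exact h.2.1, hd _ _ h.2.2.1, ?_, ?_⟩
    · rw [h5]; exact ihl h.2.2.2.1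
    · rw [h6]; exact ihr h.2.2.2.2

/-- Children have larger numbers than their parent, so the tree is read off by induction on `N - u`.
-/
theorem exists_rep {S : ℕ → Finset (Fin n)}
    (h : ∀ u < N, (∃ i : Fin n, S u = {i} ∧ σ.word 5 u = 0 ∧ σ.word 7 u = i ∧ DataAt c σ u {i}) ∨
      InnerNode c σ N S u) {u : ℕ} (hu : u < N) :
    ∃ T, Rep c σ N T u ∧ T.labels = S u ∧ IsSplitTree c T := by
  obtain ⟨m, hm⟩ : ∃ m, N - u ≤ m := ⟨_, le_rfl⟩
  have hne : ∀ m u, N - u ≤ m → u < N → (S u).Nonempty := by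
    intro m
    induction m with
    | zero => intro u h1 h2; omega
    | succ m ih =>
      intro u h1 h2
      rcases h u h2 with ⟨i, hi, -⟩ | hi
      · rw [hi]; simp
      · rw [hi.union]
        exact (ih _ (by have := hi.lt_left; omega) hi.left_lt).mono Finset.subset_union_left
  induction m generalizing u with
  | zero => omega
  | succ m ih =>
    rcases h u hu with ⟨i, hi, h5, h7, hd⟩ | hi
    · exact ⟨.leaf i, ⟨hu, h5, h7, hd⟩, hi.symm, trivial⟩
    · obtain ⟨l, hl, el, sl⟩ := ih hi.left_lt (by have := hi.lt_left; omega)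
      obtain ⟨r, hr, er, sr⟩ := ih hi.right_lt (by have := hi.lt_right; omega)
      have e : S u = l.labels ∪ r.labels := by rw [hi.union, el, er]
      obtain ⟨k, k1, k2, k3⟩ := hi.split
      have h0 := hi.lt_left
      refine ⟨.node l r, ⟨hu, by omega, e ▸ hi.data, hl, hr⟩, e.symm, sl, sr, k,
        boxLo c (S u) k, boxHi c (S u) k, ?_, ?_, ?_, ?_⟩
      · rw [← e]; exact isSide_box (hne _ u le_rfl hu) k
      · intro k' lo hi' hs
        rw [← e] at hs
        rw [← hs.lo_eq, ← hs.hi_eq]; exact k1 k'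
      · rw [el]; exact k2
      · rw [er]; exact k3

theorem boxRad_singleton (i : Fin n) : boxRad c {i} = 0 := by
  simp [boxRad, boxLo_singleton, boxHi_singleton]

theorem boxLen_singleton (hd : 0 < d) (i : Fin n) : boxLen c {i} = 0 := by
  rw [boxLen_eq (k := ⟨0, hd⟩)] <;> simp [boxLo_singleton, boxHi_singleton]

end

/-- All segments are singletons, so different points sit at different nodes, and these are exactly
the nodes that were never split. Writing the leaves therefore destroys no data of inner nodes, and a
zero left pointer appears exactly at the leaves. -/
theorem leaves_spec {d n M : ℕ} {c : Fin n → Pt d} {σ : Store} {S : ℕ → Finset (Fin n)}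
    (H : BuildCtx M c σ) (hM : 2 * (n * d) + d + 9 ≤ M)
    (hF : Forest c σ n S) (hsz : ∀ x < n, σ.word 19 x = 1) :
    WP M leaves σ (fun t τ => (∃ T, Rep c τ (2 * n - 1) T 0 ∧ IsSplitTreeOf c T) ∧
      t ≤ 100 * (d * n)) := by
  have hM' := H.hM
  have hd0 := H.hd0
  have hn0 := H.hn0
  have hnd : n ≤ n * d := Nat.le_mul_of_pos_right _ (by omega)
  have hdn : d * n = n * d := mul_comm _ _
  have hg : ∀ i < n, σ.word 18 i < n := hF.part.lt
  have hginj : ∀ i < n, ∀ j < n, σ.word 18 i = σ.word 18 j → i = j := by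
    intro i hi j hj hij
    have h1 := hF.part.size _ (hg i hi)
    rw [hsz _ (hg i hi), Nat.count_eq_card_filter_range] at h1
    exact Finset.card_le_one.mp h1.symm.le i (by simp [hi]) j (by simp [hj, hij])
  have hS : ∀ i : Fin n, S (σ.word 20 (σ.word 18 i)) = {i} := by
    intro i
    ext j
    rw [hF.mem _ (hg i i.2), Finset.mem_singleton]
    exact ⟨fun h => Fin.ext (hginj _ j.2 _ i.2 h), fun h => by rw [h]⟩
  have hνinj : ∀ i < n, ∀ j < n, σ.word 20 (σ.word 18 i) = σ.word 20 (σ.word 18 j) → i = j := by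
    intro i hi j hj h
    have h1 := hS ⟨i, hi⟩
    have h2 := hS ⟨j, hj⟩
    simp only at h1 h2
    rw [h, h2, Finset.singleton_inj] at h1
    exact (congrArg Fin.val h1).symm
  have hνlt : ∀ i < n, σ.word 20 (σ.word 18 i) + 1 < 2 * n := fun i hi => hF.node_lt _ (hg i hi)
  have H1 := WP.forLoop (M := M) (q := 9) (a := 0) (σ := σ)
    (P := (wset 40 (.load 20 (.load 18 (wv 9))) ;;
      .setWord 5 (wv 40) (.const 0) ;; .setWord 7 (wv 40) (wv 9) ;;
      .setReal 4 (wv 40) (.const 0) ;; .setReal 5 (wv 40) (.const 0)) ;;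
      forLoop 8 1 (.setReal 3 (.plus (.times (wv 40) (wv 1)) (wv 8)) (keyE (wv 9))))
    (fun q υ => (∀ i < q, υ.word 5 (σ.word 20 (σ.word 18 i)) = 0 ∧
        υ.word 7 (σ.word 20 (σ.word 18 i)) = i ∧ υ.real 4 (σ.word 20 (σ.word 18 i)) = 0 ∧
        υ.real 5 (σ.word 20 (σ.word 18 i)) = 0 ∧ ∀ k < d,
          υ.real 3 (σ.word 20 (σ.word 18 i) * d + k) = σ.real 0 (i * d + k)) ∧
      ∀ u, (∀ i < n, σ.word 20 (σ.word 18 i) ≠ u) → υ.word 5 u = σ.word 5 u ∧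
        υ.real 4 u = σ.real 4 u ∧ υ.real 5 u = σ.real 5 u ∧
        ∀ k < d, υ.real 3 (u * d + k) = σ.real 3 (u * d + k)) n (40 + 31 * d)
    (by decide) (by decide) (by decide) H.hn (by omega)
    ⟨by intro i hi; omega, by simp⟩
    (by
      intro q υ hq ⟨hI, hJ⟩ hf h9
      have f18 : υ.word 18 = σ.word 18 := by rw [hf.word _ (by decide)]; simp
      have f20 : υ.word 20 = σ.word 20 := by rw [hf.word _ (by decide)]; simp
      have f1 : υ.word 1 0 = d := by rw [hf.word _ (by decide)]; simp [H.hd]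
      have f0 : υ.real 0 = σ.real 0 := by rw [hf.real _ (by decide)]; simp
      have hlt := hνlt q hq
      have hgq := hg q hq
      set ν := σ.word 20 (σ.word 18 q) with hν
      set υ' := ((((υ.setWord 40 0 ν).setWord 5 ν 0).setWord 7 ν q).setReal 4 ν 0).setReal 5 ν 0
        with hυ'
      have hνd : ν * d + 2 * d ≤ 2 * (n * d) := by
        calc ν * d + 2 * d = (ν + 2) * d := by ring
          _ ≤ (2 * n) * d := Nat.mul_le_mul_right _ (by omega)
          _ = _ := by ring
      have hqd : q * d + d ≤ n * d := by
        calc q * d + d = (q + 1) * d := by ring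
          _ ≤ _ := Nat.mul_le_mul_right _ hq
      have H2 := WP.forLoop (M := M) (q := 8) (a := 1) (σ := υ')
        (P := .setReal 3 (.plus (.times (wv 40) (wv 1)) (wv 8)) (keyE (wv 9)))
        (fun k ρ => (∀ k' < k, ρ.real 3 (ν * d + k') = σ.real 0 (q * d + k')) ∧
          ∀ x, (∀ k' < d, x ≠ ν * d + k') → ρ.real 3 x = υ.real 3 x) d 18
        (by decide) (by decide) (by decide) (by simp [hυ', f1]) (by omega)
        ⟨by intro i hi; omega, by simp [hυ']⟩
        (by
          intro k ρ hk ⟨hK, hL⟩ hf2 h8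
          have g9 : ρ.word 9 0 = q := by rw [hf2.word _ (by decide)]; simp [hυ', h9]
          have g40 : ρ.word 40 0 = ν := by rw [hf2.word _ (by decide)]; simp [hυ']
          have g1 : ρ.word 1 0 = d := by rw [hf2.word _ (by decide)]; simp [hυ', f1]
          have g0 : ρ.real 0 = σ.real 0 := by rw [hf2.real _ (by decide)]; simp [hυ', f0]
          refine WP.of_pre ?_
          simp [g9, g40, g1, g0, h8, keyE]
          and_intros

          any_goals omega
          · intro k' hk'
            rcases hk'.lt_or_eq with h | rfl
            · rw [Function.update_of_ne (by omega), hK k' h]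
            · simp
          · intro x hx
            rw [Function.update_of_ne (hx k hk), hL x hx])
      have H3 : WP M (forLoop 8 1 (.setReal 3 (.plus (.times (wv 40) (wv 1)) (wv 8)) (keyE (wv 9))))
          υ' (fun t ρ => ((∀ i < q + 1, ρ.word 5 (σ.word 20 (σ.word 18 i)) = 0 ∧
            ρ.word 7 (σ.word 20 (σ.word 18 i)) = i ∧ ρ.real 4 (σ.word 20 (σ.word 18 i)) = 0 ∧
            ρ.real 5 (σ.word 20 (σ.word 18 i)) = 0 ∧ ∀ k < d,
              ρ.real 3 (σ.word 20 (σ.word 18 i) * d + k) = σ.real 0 (i * d + k)) ∧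
          ∀ u, (∀ i < n, σ.word 20 (σ.word 18 i) ≠ u) → ρ.word 5 u = σ.word 5 u ∧
            ρ.real 4 u = σ.real 4 u ∧ ρ.real 5 u = σ.real 5 u ∧
            ∀ k < d, ρ.real 3 (u * d + k) = σ.real 3 (u * d + k)) ∧
            t ≤ 10 + 31 * d) := by
        refine H2.conseq ?_
        rintro t ρ hf2 ⟨⟨hK, hL⟩, -, ht⟩
        have g5 : ρ.word 5 = υ'.word 5 := hf2.word _ (by decide)
        have g7 : ρ.word 7 = υ'.word 7 := hf2.word _ (by decide)
        have g4' : ρ.real 4 = υ'.real 4 := hf2.real _ (by decide)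
        have g5' : ρ.real 5 = υ'.real 5 := hf2.real _ (by decide)
        refine ⟨⟨fun i hi => ?_, fun u hu => ?_⟩, by
          have : d * (18 + 13) = 31 * d := by ring
          omega⟩
        · rw [g5, g7, g4', g5']
          rcases (Nat.lt_succ_iff.mp hi).lt_or_eq with h | rfl
          · have hne : σ.word 20 (σ.word 18 i) ≠ ν := fun e => by
              have := hνinj i (by omega) q hq e
              omega
            obtain ⟨i1, i2, i3, i4, i5⟩ := hI i h
            refine ⟨by simp [hυ', Function.update_of_ne hne, i1],
              by simp [hυ', Function.update_of_ne hne, i2],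
              by simp [hυ', Function.update_of_ne hne, i3],
              by simp [hυ', Function.update_of_ne hne, i4], fun k hk => ?_⟩
            rw [hL _ fun k' hk' e => hne (idx_inj hk hk' e).1]
            exact i5 k hk
          · exact ⟨by simp [hυ', hν], by simp [hυ', hν], by simp [hυ', hν], by simp [hυ', hν], hK⟩
        · have hne : u ≠ ν := fun e => hu q hq e.symm
          obtain ⟨i1, i2, i3, i4⟩ := hJ u hu
          rw [g5, g4', g5']
          refine ⟨by simp [hυ', Function.update_of_ne hne, i1],
            by simp [hυ', Function.update_of_ne hne, i2],
            by simp [hυ', Function.update_of_ne hne, i3], fun k hk => ?_⟩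
          rw [hL _ fun k' hk' e => hne (idx_inj hk hk' e).1]
          exact i4 k hk
      refine WP.seq (Q := fun t ρ => t ≤ 30 ∧ ρ = υ') (WP.of_pre ?_) ?_
      · simp [h9, f18, f20, ← hν]
        and_intros
        any_goals omega
      rintro t _ ⟨ht, rfl⟩
      refine H3.mono ?_
      rintro t' ρ ⟨⟨h1, h2⟩, ht'⟩
      refine ⟨⟨?_, ?_⟩, by omega⟩
      · simpa using h1
      · simpa using h2)
  refine H1.conseq ?_
  rintro t τ hf ⟨⟨hI, hJ⟩, -, ht⟩
  refine ⟨?_, ?_⟩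
  · have hN : ∀ u < 2 * n - 1, (∃ i : Fin n, S u = {i} ∧ τ.word 5 u = 0 ∧ τ.word 7 u = i ∧
        DataAt c τ u {i}) ∨ InnerNode c τ (2 * n - 1) S u := by
      intro u hu
      by_cases h : ∃ i < n, σ.word 20 (σ.word 18 i) = u
      · obtain ⟨i, hi, rfl⟩ := h
        obtain ⟨i1, i2, i3, i4, i5⟩ := hI i hi
        refine .inl ⟨⟨i, hi⟩, hS ⟨i, hi⟩, i1, i2, ⟨fun k => ?_, ?_, ?_⟩⟩
        · rw [i5 k k.2, boxLo_singleton, boxHi_singleton, ← H.pts ⟨i, hi⟩ k]; ring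
        · rw [i3, boxRad_singleton]
        · rw [i4, boxLen_singleton hd0]
      · push Not at h
        obtain ⟨i1, i2, i3, i4⟩ := hJ u h
        have hin := hF.inner u (by omega) (fun p hp e => by
          have h1 := hF.part.pos p hp
          rw [hF.part.size p hp, Nat.count_eq_card_filter_range, Finset.card_pos] at h1
          obtain ⟨i, hi⟩ := h1
          simp at hi
          exact h i hi.1 (by rw [hi.2, e]))
        refine .inr (hin.congr (hin.data.congr i4 i2 i3) le_rfl i1 ?_ fun _ _ => rfl)
        rw [hf.word _ (by decide)]
    obtain ⟨T, h1, h2, h3⟩ := exists_rep hN (u := 0) (by omega)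
    exact ⟨T, h1, by rw [h2, hF.root], h3⟩
  · have : n * (40 + 31 * d + 13) + 10 ≤ 100 * (d * n) := by
      have : n * (40 + 31 * d + 13) = 53 * n + 31 * (d * n) := by ring
      omega
    omega

/-! ## The pairs found by a traversal of the split tree -/

section Run

variable {ι : Type}

/-- The outcome of a search for separated pairs below `(U, V)`: the list of the pairs that satisfy
`ok`, and the list of the pairs that do not and were replaced by two pairs. -/
inductive Run (ok : BTree ι → BTree ι → Prop) (len : BTree ι → ℝ) :
    BTree ι → BTree ι → List (BTree ι × BTree ι) → List (BTree ι × BTree ι) → Prop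
  | done {U V : BTree ι} (h : ok U V) : Run ok len U V [(U, V)] []
  | right {U l r : BTree ι} {o f o' f' : List (BTree ι × BTree ι)} (h : ¬ ok U (.node l r))
      (hl : len U ≤ len (.node l r)) (h1 : Run ok len U l o f) (h2 : Run ok len U r o' f') :
      Run ok len U (.node l r) (o ++ o') ((U, .node l r) :: (f ++ f'))
  | left {V l r : BTree ι} {o f o' f' : List (BTree ι × BTree ι)} (h : ¬ ok (.node l r) V)
      (hl : ¬ len (.node l r) ≤ len V) (h1 : Run ok len l V o f) (h2 : Run ok len r V o' f') :
      Run ok len (.node l r) V (o ++ o') ((.node l r, V) :: (f ++ f'))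

/-- The outcome of the searches at all inner nodes of a tree. -/
inductive AllRun (ok : BTree ι → BTree ι → Prop) (len : BTree ι → ℝ) :
    BTree ι → List (BTree ι × BTree ι) → List (BTree ι × BTree ι) → Prop
  | leaf (i : ι) : AllRun ok len (.leaf i) [] []
  | node {l r : BTree ι} {o f ol fl or fr : List (BTree ι × BTree ι)} (h : Run ok len l r o f)
      (hl : AllRun ok len l ol fl) (hr : AllRun ok len r or fr) :
      AllRun ok len (.node l r) (o ++ (ol ++ or)) (f ++ (fl ++ fr))

/-- The number of nodes of a tree. -/
def BTree.size : BTree ι → ℕ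
  | .leaf _ => 1
  | .node l r => l.size + r.size + 1

variable {ok : BTree ι → BTree ι → Prop} {len : BTree ι → ℝ} {U V T : BTree ι}
  {o f : List (BTree ι × BTree ι)}

theorem Run.length (h : Run ok len U V o f) : o.length = f.length + 1 := by
  induction h with
  | done => simp
  | right _ _ _ _ h1 h2 => simp; omega
  | left _ _ _ _ h1 h2 => simp; omega

variable [DecidableEq ι]

/-- A search outputs one pair more than it splits, and there is one search for each inner node, of
which a binary tree has `(size - 1) / 2`. -/
theorem AllRun.length (h : AllRun ok len T o f) : 2 * o.length + 1 = 2 * f.length + T.size := by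
  induction h with
  | leaf => simp [BTree.size]
  | node h _ _ h1 h2 =>
    have := h.length
    simp [BTree.size]; omega

theorem BTree.labels_nonempty (T : BTree ι) : T.labels.Nonempty := by
  induction T with
  | leaf i => simp [BTree.labels]
  | node l r ihl _ => exact ihl.mono Finset.subset_union_left

theorem BTree.HasSubtree.refl (T : BTree ι) : T.HasSubtree T := by
  cases T
  · rfl
  · exact .inl rfl

theorem BTree.HasSubtree.trans {U V T : BTree ι} (h : U.HasSubtree V) (h' : V.HasSubtree T) :
    U.HasSubtree T := by
  induction T with
  | leaf i => cases h'; exact h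
  | node l r ihl ihr =>
    rcases h' with rfl | h' | h'
    · exact h
    · exact .inr (.inl (ihl h'))
    · exact .inr (.inr (ihr h'))

theorem BTree.HasSubtree.left (l r : BTree ι) : l.HasSubtree (.node l r) := .inr (.inl (.refl l))

theorem BTree.HasSubtree.right (l r : BTree ι) : r.HasSubtree (.node l r) := .inr (.inr (.refl r))

theorem BTree.HasSubtree.labels_subset {U T : BTree ι} (h : U.HasSubtree T) :
    U.labels ⊆ T.labels := by
  induction T with
  | leaf i => cases h; rfl
  | node l r ihl ihr =>
    rcases h with rfl | h | h
    · rfl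
    · exact (ihl h).trans Finset.subset_union_left
    · exact (ihr h).trans Finset.subset_union_right

theorem Run.subtrees (h : Run ok len U V o f) :
    (∀ x ∈ o, ok x.1 x.2 ∧ x.1.HasSubtree U ∧ x.2.HasSubtree V) ∧
      ∀ x ∈ f, ¬ ok x.1 x.2 ∧ x.1.HasSubtree U ∧ x.2.HasSubtree V := by
  induction h with
  | done h => simp [h, BTree.HasSubtree.refl]
  | right h _ _ _ h1 h2 =>
    refine ⟨fun x hx => ?_, fun x hx => ?_⟩
    · rcases List.mem_append.mp hx with hx | hx
      · exact ⟨(h1.1 x hx).1, (h1.1 x hx).2.1, (h1.1 x hx).2.2.trans (.left _ _)⟩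
      · exact ⟨(h2.1 x hx).1, (h2.1 x hx).2.1, (h2.1 x hx).2.2.trans (.right _ _)⟩
    · rcases List.mem_cons.mp hx with rfl | hx
      · exact ⟨h, .refl _, .refl _⟩
      rcases List.mem_append.mp hx with hx | hx
      · exact ⟨(h1.2 x hx).1, (h1.2 x hx).2.1, (h1.2 x hx).2.2.trans (.left _ _)⟩
      · exact ⟨(h2.2 x hx).1, (h2.2 x hx).2.1, (h2.2 x hx).2.2.trans (.right _ _)⟩
  | left h _ _ _ h1 h2 =>
    refine ⟨fun x hx => ?_, fun x hx => ?_⟩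
    · rcases List.mem_append.mp hx with hx | hx
      · exact ⟨(h1.1 x hx).1, (h1.1 x hx).2.1.trans (.left _ _), (h1.1 x hx).2.2⟩
      · exact ⟨(h2.1 x hx).1, (h2.1 x hx).2.1.trans (.right _ _), (h2.1 x hx).2.2⟩
    · rcases List.mem_cons.mp hx with rfl | hx
      · exact ⟨h, .refl _, .refl _⟩
      rcases List.mem_append.mp hx with hx | hx
      · exact ⟨(h1.2 x hx).1, (h1.2 x hx).2.1.trans (.left _ _), (h1.2 x hx).2.2⟩
      · exact ⟨(h2.2 x hx).1, (h2.2 x hx).2.1.trans (.right _ _), (h2.2 x hx).2.2⟩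

theorem AllRun.subtrees (h : AllRun ok len T o f) :
    ∀ x ∈ o, ok x.1 x.2 ∧ x.1.HasSubtree T ∧ x.2.HasSubtree T := by
  induction h with
  | leaf => simp
  | node h _ _ h1 h2 =>
    intro x hx
    rcases List.mem_append.mp hx with hx | hx
    · obtain ⟨a, b, e⟩ := h.subtrees.1 x hx
      exact ⟨a, b.trans (.left _ _), e.trans (.right _ _)⟩
    rcases List.mem_append.mp hx with hx | hx
    · obtain ⟨a, b, e⟩ := h1 x hx
      exact ⟨a, b.trans (.left _ _), e.trans (.left _ _)⟩
    · obtain ⟨a, b, e⟩ := h2 x hx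
      exact ⟨a, b.trans (.right _ _), e.trans (.right _ _)⟩

/-- The pair `x` separates `p` and `q`. -/
def Separates (p q : ι) (x : BTree ι × BTree ι) : Prop :=
  (p ∈ x.1.labels ∧ q ∈ x.2.labels) ∨ (p ∈ x.2.labels ∧ q ∈ x.1.labels)

instance (p q : ι) : DecidablePred (Separates p q) := fun _ => by
  unfold Separates; infer_instance

/-- The children of every inner node have no labels in common. -/
def BTree.Proper : BTree ι → Prop
  | .leaf _ => True
  | .node l r => l.Proper ∧ r.Proper ∧ Disjoint l.labels r.labels

theorem separates_swap {p q : ι} {U V : BTree ι} : Separates p q (U, V) ↔ Separates p q (V, U) :=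
  Or.comm

theorem separates_node {p q : ι} {U l r : BTree ι} (h : Disjoint U.labels (l.labels ∪ r.labels))
    (hlr : Disjoint l.labels r.labels) :
    ((if Separates p q (U, l) then 1 else 0) + if Separates p q (U, r) then 1 else 0) =
      if Separates p q (U, .node l r) then 1 else 0 := by
  have e : Separates p q (U, .node l r) ↔ Separates p q (U, l) ∨ Separates p q (U, r) := by
    simp only [Separates, BTree.labels, Finset.mem_union]; tauto
  have e' : ¬ (Separates p q (U, l) ∧ Separates p q (U, r)) := by
    rw [Finset.disjoint_union_right] at h
    obtain ⟨h1, h2⟩ := h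
    rw [Finset.disjoint_left] at h1 h2 hlr
    rintro ⟨⟨a, b⟩ | ⟨a, b⟩, ⟨a', b'⟩ | ⟨a', b'⟩⟩
    · exact hlr b b'
    · exact h2 a a'
    · exact h1 a' a
    · exact hlr a a'
  by_cases a : Separates p q (U, l)
  · have b : ¬ Separates p q (U, r) := fun b => e' ⟨a, b⟩
    rw [if_pos a, if_neg b, if_pos (e.mpr (.inl a))]
  · by_cases b : Separates p q (U, r)
    · rw [if_neg a, if_pos b, if_pos (e.mpr (.inr b))]
    · rw [if_neg a, if_neg b, if_neg fun h => (e.mp h).elim a b]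

/-- Counting the separating pairs is compatible with concatenation of lists, unlike unique
existence. Splitting a set into disjoint halves distributes the separated couple to exactly one
half. A count of one becomes a unique index only at the end, in `AllRun.coversOnce`. -/
theorem Run.countP (h : Run ok len U V o f) (hU : U.Proper) (hV : V.Proper)
    (hd : Disjoint U.labels V.labels) (p q : ι) :
    o.countP (fun x => Separates p q x) = if Separates p q (U, V) then 1 else 0 := by
  induction h with
  | done h => simp [List.countP_cons]
  | @right U l r _ _ _ _ _ _ _ _ h1 h2 =>
    have hd' := Finset.disjoint_union_right.mp (show Disjoint U.labels (l.labels ∪ r.labels) from hd)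
    rw [List.countP_append, h1 hU hV.1 hd'.1, h2 hU hV.2.1 hd'.2]
    exact separates_node hd hV.2.2
  | @left V l r _ _ _ _ _ _ _ _ h1 h2 =>
    have hd' := Finset.disjoint_union_left.mp (show Disjoint (l.labels ∪ r.labels) V.labels from hd)
    rw [List.countP_append, h1 hU.1 hV hd'.1, h2 hU.2.1 hV hd'.2]
    simp only [separates_swap (V := V)]
    exact separates_node hd.symm hU.2.2

theorem AllRun.countP (h : AllRun ok len T o f) (hT : T.Proper) {p q : ι} (hpq : p ≠ q) :
    o.countP (fun x => Separates p q x) = if p ∈ T.labels ∧ q ∈ T.labels then 1 else 0 := by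
  induction h with
  | leaf i =>
    simp only [List.countP_nil, BTree.labels, Finset.mem_singleton]
    rw [if_neg]
    rintro ⟨rfl, rfl⟩
    exact hpq rfl
  | @node l r _ _ _ _ _ _ h _ _ h1 h2 =>
    rw [List.countP_append, List.countP_append, h1 hT.1, h2 hT.2.1, h.countP hT.1 hT.2.1 hT.2.2]
    have hlr := hT.2.2
    rw [Finset.disjoint_left] at hlr
    have a := @hlr p
    have b := @hlr q
    simp only [Separates, BTree.labels, Finset.mem_union]
    clear h h1 h2 hlr hT hpq
    by_cases a1 : p ∈ l.labels <;> by_cases a2 : p ∈ r.labels <;> by_cases a3 : q ∈ l.labels <;>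
      by_cases a4 : q ∈ r.labels <;> simp_all

theorem List.existsUnique_of_countP {α : Type} {P : α → Prop} [DecidablePred P] {l : List α}
    (h : l.countP (fun x => P x) = 1) : ∃! i : Fin l.length, P l[i] := by
  induction l with
  | nil => simp at h
  | cons a l ih =>
    rw [List.countP_cons] at h
    by_cases ha : P a
    · have h0 : l.countP (fun x => P x) = 0 := by simpa [ha] using h
      rw [List.countP_eq_zero] at h0
      refine ⟨⟨0, by simp⟩, ha, ?_⟩
      rintro ⟨i, hi⟩ hP
      cases i with
      | zero => rfl
      | succ i => exact absurd (by simpa using hP) (by simpa using h0 (l[i]'(by simpa using hi)) (List.getElem_mem _))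
    · obtain ⟨⟨i, hi⟩, hP, hu⟩ := ih (by simpa [ha] using h)
      refine ⟨⟨i + 1, by simpa using hi⟩, by simpa using hP, ?_⟩
      rintro ⟨j, hj⟩ hP'
      cases j with
      | zero => exact absurd hP' ha
      | succ j =>
        have := hu ⟨j, by simpa using hj⟩ (by simpa using hP')
        simpa using this

end Run

theorem AllRun.coversOnce {n : ℕ} {ok : BTree (Fin n) → BTree (Fin n) → Prop}
    {len : BTree (Fin n) → ℝ} {T : BTree (Fin n)} {o f : List (BTree (Fin n) × BTree (Fin n))}
    (h : AllRun ok len T o f) (hT : T.Proper) (hu : T.labels = Finset.univ) :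
    CoversOnce (fun i : Fin o.length => o[i].1.labels) (fun i => o[i].2.labels) := by
  intro p q hpq
  have h1 := h.countP hT hpq
  rw [if_pos (by simp [hu])] at h1
  exact List.existsUnique_of_countP (P := Separates p q) h1

/-- Runs with a weaker criterion refine runs with a criterion that holds more often. -/
theorem Run.refine {ι : Type} {ok ok' : BTree ι → BTree ι → Prop} {len : BTree ι → ℝ}
    {U V : BTree ι} {o f o' f' : List (BTree ι × BTree ι)} (h : Run ok len U V o f)
    (h' : Run ok' len U V o' f') (hok : ∀ U V, ok U V → ok' U V) :
    ∀ x ∈ o, ∃ y ∈ o', ok' y.1 y.2 ∧ (x = y ∨ ∃ o'' f'', ¬ ok y.1 y.2 ∧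
      Run ok len y.1 y.2 o'' f'' ∧ x ∈ o'') := by
  induction h' generalizing o f with
  | @done U V h0 =>
    intro x hx
    refine ⟨_, List.mem_singleton_self _, h0, ?_⟩
    -- The coarser search stops at this pair. The finer one has made the same splits so far, and it
    -- either stops here as well or goes on below this very pair.
    by_cases hk : ok U V
    · cases h with
      | done => exact .inl (by simpa using hx)
      | right h => exact absurd hk h
      | left h => exact absurd hk h
    · exact .inr ⟨_, _, hk, h, hx⟩
  | right h0 hl _ _ ih1 ih2 =>
    cases h with
    | done h => exact absurd (hok _ _ h) h0
    | right h hl' a b =>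
      intro x hx
      rcases List.mem_append.mp hx with hx | hx
      · obtain ⟨y, hy, h⟩ := ih1 a x hx
        exact ⟨y, List.mem_append_left _ hy, h⟩
      · obtain ⟨y, hy, h⟩ := ih2 b x hx
        exact ⟨y, List.mem_append_right _ hy, h⟩
    | left h hl' => exact absurd hl hl'
  | left h0 hl _ _ ih1 ih2 =>
    cases h with
    | done h => exact absurd (hok _ _ h) h0
    | left h hl' a b =>
      intro x hx
      rcases List.mem_append.mp hx with hx | hx
      · obtain ⟨y, hy, h⟩ := ih1 a x hx
        exact ⟨y, List.mem_append_left _ hy, h⟩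
      · obtain ⟨y, hy, h⟩ := ih2 b x hx
        exact ⟨y, List.mem_append_right _ hy, h⟩
    | right h hl' => exact absurd hl' hl

theorem AllRun.refine {ι : Type} {ok ok' : BTree ι → BTree ι → Prop} {len : BTree ι → ℝ}
    {T : BTree ι} {o f o' f' : List (BTree ι × BTree ι)} (h : AllRun ok len T o f)
    (h' : AllRun ok' len T o' f') (hok : ∀ U V, ok U V → ok' U V) :
    ∀ x ∈ o, ∃ y ∈ o', ok' y.1 y.2 ∧ (x = y ∨ ∃ o'' f'', ¬ ok y.1 y.2 ∧
      Run ok len y.1 y.2 o'' f'' ∧ x ∈ o'') := by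
  induction h' generalizing o f with
  | leaf i => cases h; simp
  | node h0 _ _ ih1 ih2 =>
    cases h with
    | node h hl hr =>
      intro x hx
      rcases List.mem_append.mp hx with hx | hx
      · obtain ⟨y, hy, h⟩ := h.refine h0 hok x hx
        exact ⟨y, List.mem_append_left _ hy, h⟩
      rcases List.mem_append.mp hx with hx | hx
      · obtain ⟨y, hy, h⟩ := ih1 hl x hx
        exact ⟨y, List.mem_append_right _ (List.mem_append_left _ hy), h⟩
      · obtain ⟨y, hy, h⟩ := ih2 hr x hx
        exact ⟨y, List.mem_append_right _ (List.mem_append_right _ hy), h⟩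

/-- Runs exist if every pair that does not satisfy `ok` can be split. -/
theorem exists_run {ι : Type} {ok : BTree ι → BTree ι → Prop} {len : BTree ι → ℝ}
    (good : BTree ι → BTree ι → Prop)
    (hl : ∀ l r V, good (.node l r) V → good l V ∧ good r V)
    (hr : ∀ U l r, good U (.node l r) → good U l ∧ good U r)
    (hok : ∀ U V, good U V → ¬ ok U V → (len U ≤ len V → ∃ l r, V = .node l r) ∧
      (¬ len U ≤ len V → ∃ l r, U = .node l r)) {U V : BTree ι} (h : good U V) :
    ∃ o f, Run ok len U V o f := by
  obtain ⟨m, hm⟩ : ∃ m, U.size + V.size ≤ m := ⟨_, le_rfl⟩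
  induction m generalizing U V with
  | zero =>
    have : 0 < U.size := by cases U <;> simp [BTree.size]
    omega
  | succ m ih =>
    by_cases hk : ok U V
    · exact ⟨_, _, .done hk⟩
    obtain ⟨h1, h2⟩ := hok U V h hk
    by_cases hlen : len U ≤ len V
    · obtain ⟨l, r, rfl⟩ := h1 hlen
      obtain ⟨g1, g2⟩ := hr _ _ _ h
      simp only [BTree.size] at hm
      obtain ⟨_, _, a⟩ := ih g1 (by omega)
      obtain ⟨_, _, b⟩ := ih g2 (by omega)
      exact ⟨_, _, .right hk hlen a b⟩
    · obtain ⟨l, r, rfl⟩ := h2 hlen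
      obtain ⟨g1, g2⟩ := hl _ _ _ h
      simp only [BTree.size] at hm
      obtain ⟨_, _, a⟩ := ih g1 (by omega)
      obtain ⟨_, _, b⟩ := ih g2 (by omega)
      exact ⟨_, _, .left hk hlen a b⟩

/-! ### The separation criteria and their test on the machine -/

section Crit

variable {d n : ℕ} (c : Fin n → Pt d) (r : Fin n → ℝ) (s : ℝ) (U V : BTree (Fin n))

/-- The distance of the centres of the bounding boxes. -/
def ctrDist : ℝ := dist (boxCtr c U.labels) (boxCtr c V.labels)

/-- The criterion for the separation of two sets of centres. -/
def CentreCrit : Prop :=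
  (3 * s + 8) * boxRad c U.labels ≤ ctrDist c U V ∧ (3 * s + 8) * boxRad c V.labels ≤ ctrDist c U V

/-- The additional condition for a ball and a set of balls. -/
def LeafCrit : Prop := ∀ i, U = .leaf i → (3 * s + 5) * boxRad c V.labels + r i ≤ ctrDist c U V

/-- The criterion for the separation of two sets of balls. -/
def BallCrit : Prop := CentreCrit c s U V ∧ LeafCrit c r s U V ∧ LeafCrit c r s V U

theorem ctrDist_comm : ctrDist c U V = ctrDist c V U := dist_comm _ _

theorem CentreCrit.symm {c : Fin n → Pt d} {s : ℝ} {U V : BTree (Fin n)} (h : CentreCrit c s U V) :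
    CentreCrit c s V U := by
  unfold CentreCrit at *; rw [ctrDist_comm]; exact h.symm

end Crit

/-- Compute the distance of the centres of the boxes at the nodes `word 44` and `word 45`. -/
def nodeDist : Prog :=
  rset 8 (.const 0) ;;
  forLoop 8 1 (rset 6 (.minus (.load 3 (.plus (.times (wv 44) (wv 1)) (wv 8)))
      (.load 3 (.plus (.times (wv 45) (wv 1)) (wv 8)))) ;;
    rset 8 (.plus (rv 8) (.times (rv 6) (rv 6)))) ;;
  rset 7 (.sqrt (rv 8))

/-- Clear the flag `word 46` if the node `word a` is a leaf whose ball is too close to the box at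
the node `word b`. -/
def leafTest (a b : ℕ) : Prog :=
  .ite (.leWord (.const 1) (.load 5 (wv a))) .skip
    (.ite (.leReal (.plus (.times (.plus (.times (.const 3) (rv 2)) (.const 5)) (.load 4 (wv b)))
        (.load 1 (.load 7 (wv a)))) (rv 7)) .skip (wset 46 (.const 0)))

/-- Test the criterion for the nodes `word 44` and `word 45`. -/
def testPair : Prog :=
  nodeDist ;;
  rset 6 (.plus (.times (.const 3) (rv 2)) (.const 8)) ;;
  .ite (.both (.leReal (.times (rv 6) (.load 4 (wv 44))) (rv 7))
      (.leReal (.times (rv 6) (.load 4 (wv 45))) (rv 7)))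
    (wset 46 (.const 1)) (wset 46 (.const 0)) ;;
  leafTest 44 45 ;; leafTest 45 44

section

variable {d n N M : ℕ} {c : Fin n → Pt d} {r : Fin n → ℝ} {s : ℝ} {σ : Store}
  {U V : BTree (Fin n)} {u v : ℕ}

theorem nodeDist_spec (hd : σ.word 1 0 = d) (hM : N * d + 2 * d + 100 ≤ M) (hNM : N < M)
    (hu : σ.word 44 0 = u) (hv : σ.word 45 0 = v) (hU : Rep c σ N U u) (hV : Rep c σ N V v) :
    WP M nodeDist σ (fun t τ => τ.real 7 0 = ctrDist c U V ∧ t ≤ 60 * d + 30) := by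
  have hlt : ∀ u < N, u * d + d ≤ N * d := fun u hu => by
    calc u * d + d = (u + 1) * d := by ring
      _ ≤ _ := Nat.mul_le_mul_right _ hu
  have hu' := hlt u hU.lt
  have hv' := hlt v hV.lt
  have hun := hU.lt
  have hvn := hV.lt
  have H := WP.forLoop (M := M) (q := 8) (a := 1) (σ := σ.setReal 8 0 0)
    (P := rset 6 (.minus (.load 3 (.plus (.times (wv 44) (wv 1)) (wv 8)))
      (.load 3 (.plus (.times (wv 45) (wv 1)) (wv 8)))) ;;
      rset 8 (.plus (rv 8) (.times (rv 6) (rv 6))))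
    (fun k τ => τ.real 8 0 = ∑ j ∈ Finset.range k, (σ.real 3 (u * d + j) - σ.real 3 (v * d + j)) ^ 2)
    d 35 (by decide) (by decide) (by decide) hd (by omega) (by simp)
    (by
      intro k τ hk hI hf h8
      have f1 : τ.word 1 0 = d := by rw [hf.word _ (by decide)]; simp [hd]
      have f44 : τ.word 44 0 = u := by rw [hf.word _ (by decide)]; simp [hu]
      have f45 : τ.word 45 0 = v := by rw [hf.word _ (by decide)]; simp [hv]
      have f3 : τ.real 3 = σ.real 3 := by rw [hf.real _ (by decide)]; simp
      refine WP.of_pre ?_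
      simp [f1, f44, f45, f3, h8, hI, Finset.sum_range_succ]
      and_intros
      any_goals omega
      ring)
  refine WP.seq (Q := fun t τ => t ≤ 4 ∧ τ = σ.setReal 8 0 0)
    (WP.of_pre (by simp; omega)) ?_
  rintro t _ ⟨ht, rfl⟩
  refine WP.seq H ?_
  rintro t' τ ⟨hI, -, ht'⟩
  refine WP.of_pre ?_
  simp [hI]
  refine ⟨by omega, ⟨by omega, by positivity⟩, ?_, ?_⟩
  · rw [ctrDist, EuclideanSpace.dist_eq, Finset.sum_range]
    congr 1
    refine Finset.sum_congr rfl fun k _ => ?_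
    rw [hU.dataAt.ctr k, hV.dataAt.ctr k, Real.dist_eq, sq_abs]
    rfl
  · have : d * (35 + 13) = 48 * d := by ring
    omega

theorem Rep.left_lt (h : Rep c σ N U u) : σ.word 5 u < N := by
  have := h.lt
  cases U with
  | leaf i => rw [h.2.1]; omega
  | node l r => exact h.2.2.2.1.lt

open Classical in
theorem leafTest_spec {a b f : ℕ} (hab : a ≠ 46 ∧ b ≠ 46) (hs : σ.real 2 0 = s)
    (hr : ∀ i : Fin n, σ.real 1 i = r i) (hM : N < M) (hn : n < M) (h2 : 2 < M)
    (hu : σ.word a 0 = u) (hv : σ.word b 0 = v) (hU : Rep c σ N U u) (hV : Rep c σ N V v)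
    (h7 : σ.real 7 0 = ctrDist c U V) (h46 : σ.word 46 0 = f) :
    WP M (leafTest a b) σ (fun t τ => τ.word 46 0 = (if LeafCrit c r s U V then f else 0) ∧
      (∀ a, a ≠ 46 → τ.word a = σ.word a) ∧ τ.real = σ.real ∧ t ≤ 40) := by
  have hun := hU.lt
  have hvn := hV.lt
  have h5 := hU.left_lt
  refine WP.of_pre ?_
  cases U with
  | leaf i =>
    have e5 := hU.2.1
    have e7 := hU.2.2.1
    have hi := i.2
    have e : LeafCrit c r s (.leaf i) V ↔
        (3 * s + 5) * boxRad c V.labels + r i ≤ ctrDist c (.leaf i) V := by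
      simp [LeafCrit]
    simp only [leafTest, pre, wset, RExpr.Safe, RExpr.val, WExpr.Safe, WExpr.val, Test.Safe,
      Test.val, wv_safe, wv_val, rv_safe, rv_val, hu, hv, e5, e7, hs, h7, hr, hV.dataAt.rad, e]
    refine ⟨by omega, by omega, fun _ => ⟨by simp; omega, fun h => ?_, fun h => ?_⟩⟩
    · push_cast at h
      simp [h, h46]
    · push_cast at h
      simp [h]
      exact ⟨by omega, fun a ha => by simp [ha]⟩
  | node l r' =>
    have e5 : 1 ≤ σ.word 5 u := by have := hU.2.1; omega
    have e : LeafCrit c r s (.node l r') V := by simp [LeafCrit]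
    simp only [leafTest, pre, wset, RExpr.Safe, RExpr.val, WExpr.Safe, WExpr.val, Test.Safe,
      Test.val, wv_safe, wv_val, rv_safe, rv_val, hu, hv]
    refine ⟨by omega, fun _ => ?_, fun h => absurd e5 h⟩
    simp [e, h46]

open Classical in
theorem testPair_spec (hd : σ.word 1 0 = d) (hM : N * d + 2 * d + 100 ≤ M) (hNM : N < M)
    (hn : n < M) (hs : σ.real 2 0 = s) (hr : ∀ i : Fin n, σ.real 1 i = r i)
    (hu : σ.word 44 0 = u) (hv : σ.word 45 0 = v) (hU : Rep c σ N U u) (hV : Rep c σ N V v) :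
    WP M testPair σ (fun t τ => τ.word 46 0 = (if BallCrit c r s U V then 1 else 0) ∧
      t ≤ 60 * d + 160) := by
  have hun := hU.lt
  have hvn := hV.lt
  refine WP.seq (nodeDist_spec hd hM hNM hu hv hU hV).frame ?_
  rintro t1 τ ⟨⟨h7, ht1⟩, hf⟩
  have g2 : τ.real 2 0 = s := by rw [hf.real _ (by decide)]; exact hs
  have g44 : τ.word 44 0 = u := by rw [hf.word _ (by decide)]; exact hu
  have g45 : τ.word 45 0 = v := by rw [hf.word _ (by decide)]; exact hv
  have g4 : τ.real 4 = σ.real 4 := hf.real _ (by decide)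
  have g1 : τ.real 1 = σ.real 1 := hf.real _ (by decide)
  set τ' := τ.setReal 6 0 (3 * s + 8) with hτ'
  refine WP.seq (Q := fun t υ => t = 8 ∧ υ = τ') (WP.of_pre (by simp [g2, hτ']; omega)) ?_
  rintro _ _ ⟨rfl, rfl⟩
  refine WP.seq (Q := fun t υ => t ≤ 25 ∧
    υ = τ'.setWord 46 0 (if CentreCrit c s U V then 1 else 0)) (WP.of_pre ?_) ?_
  · have e : CentreCrit c s U V ↔ (3 * s + 8) * σ.real 4 u ≤ ctrDist c U V ∧
        (3 * s + 8) * σ.real 4 v ≤ ctrDist c U V := by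
      rw [hU.dataAt.rad, hV.dataAt.rad]; rfl
    simp only [pre, rset, wset, RExpr.Safe, RExpr.val, WExpr.Safe, WExpr.val, Test.Safe,
      Test.val, wv_safe, wv_val, rv_safe, rv_val, hτ', Store.setReal_word, Store.setReal_real,
      g44, g45, g2, g4, h7]
    simp only [h7, if_true, Function.update_self, if_neg (show ¬ (4:ℕ) = 6 by decide),
      if_neg (show ¬ (7:ℕ) = 6 by decide), g4, ← e]
    refine ⟨by omega, fun h => ⟨by omega, by omega, by simp, by simp [h]⟩,
      fun h => ⟨by omega, by omega, by simp, by simp [h]⟩⟩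
  rintro t2 _ ⟨ht2, rfl⟩
  set υ := τ'.setWord 46 0 (if CentreCrit c s U V then 1 else 0) with hυ
  have hw : ∀ a ∉ nodeDist.wordArrays, a ≠ 46 → υ.word a = σ.word a := fun a ha ha' => by
    simp [hυ, hτ', ha', hf.word a ha]
  have hr' : ∀ a ∉ nodeDist.realArrays, a ≠ 6 → υ.real a = σ.real a := fun a ha ha' => by
    simp [hυ, hτ', ha', hf.real a ha]
  have tr : ∀ {T u} (ρ : Store), (∀ a, a ≠ 46 → ρ.word a = υ.word a) → ρ.real = υ.real →
      Rep c σ N T u → Rep c ρ N T u := by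
    intro T u ρ h1 h2 hT
    refine hT.transfer ?_ ?_ ?_ ?_ ?_ ?_
    · rw [h1 _ (by decide), hw _ (by decide) (by decide)]
    · rw [h1 _ (by decide), hw _ (by decide) (by decide)]
    · rw [h1 _ (by decide), hw _ (by decide) (by decide)]
    · rw [h2, hr' _ (by decide) (by decide)]
    · rw [h2, hr' _ (by decide) (by decide)]
    · rw [h2, hr' _ (by decide) (by decide)]
  have h7' : υ.real 7 0 = ctrDist c U V := by simp [hυ, hτ', h7]
  refine WP.seq (leafTest_spec (a := 44) (b := 45) (s := s) (r := r) (N := N) (by decide)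
    (by rw [hr' _ (by decide) (by decide), hs])
    (by rw [hr' _ (by decide) (by decide)]; exact hr) hNM hn (by omega)
    (by rw [hw _ (by decide) (by decide), hu]) (by rw [hw _ (by decide) (by decide), hv])
    (tr υ (fun _ _ => rfl) rfl hU) (tr υ (fun _ _ => rfl) rfl hV) h7' rfl) ?_
  rintro t3 ρ ⟨h46, hρ, hρ', ht3⟩
  refine (leafTest_spec (a := 45) (b := 44) (s := s) (r := r) (N := N) (by decide)
    (by rw [hρ', hr' _ (by decide) (by decide), hs])
    (by rw [hρ', hr' _ (by decide) (by decide)]; exact hr) hNM hn (by omega)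
    (by rw [hρ _ (by decide), hw _ (by decide) (by decide), hv])
    (by rw [hρ _ (by decide), hw _ (by decide) (by decide), hu])
    (tr ρ hρ hρ' hV) (tr ρ hρ hρ' hU) (by rw [hρ', h7', ctrDist_comm]) h46).mono ?_
  rintro t4 ω ⟨e46, -, -, ht4⟩
  refine ⟨?_, by omega⟩
  rw [e46, BallCrit, hυ]
  simp
  by_cases a1 : CentreCrit c s U V <;> by_cases a2 : LeafCrit c r s U V <;>
    by_cases a3 : LeafCrit c r s V U <;> simp [a1, a2, a3]

end

/-! ## The computation of the pairs -/

theorem WP.ite {M : ℕ} {b : Test} {P P' : Prog} {σ : Store} {Q : ℕ → Store → Prop}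
    (hs : b.Safe M σ) (h1 : b.val σ → WP M P σ (fun t => Q (b.cost + 1 + t)))
    (h2 : ¬ b.val σ → WP M P' σ (fun t => Q (b.cost + 1 + t))) : WP M (.ite b P P') σ Q := by
  by_cases hb : b.val σ
  · obtain ⟨t, τ, he, hq⟩ := h1 hb
    exact ⟨_, _, .iteTrue _ _ _ _ _ _ (by simp [Test.eval_eq hs, hb]) he, hq⟩
  · obtain ⟨t, τ, he, hq⟩ := h2 hb
    exact ⟨_, _, .iteFalse _ _ _ _ _ _ (by simp [Test.eval_eq hs, hb]) he, hq⟩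

/-- Push a pair of nodes. -/
def push (e f : WExpr) : Prog :=
  .setWord 41 (wv 43) e ;; .setWord 42 (wv 43) f ;; incr 43

/-- The left child of the node `word a`. -/
def lc (a : ℕ) : WExpr := .load 5 (wv a)

/-- The right child of the node `word a`. -/
def rc (a : ℕ) : WExpr := .load 6 (wv a)

/-- Take a pair from the stack. -/
def pop : Prog :=
  wset 43 (.minus (wv 43) (.const 1)) ;; wset 44 (.load 41 (wv 43)) ;; wset 45 (.load 42 (wv 43))

/-- Replace a pair of equal nodes. -/
def expand : Prog :=
  .ite (.leWord (.const 1) (lc 44))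
    (push (rc 44) (rc 44) ;; push (lc 44) (lc 44) ;; push (lc 44) (rc 44)) .skip

/-- Output a pair of nodes, or replace it by two pairs. -/
def resolve : Prog :=
  .ite (.leWord (.const 1) (wv 46))
    (.setWord 3 (wv 2) (wv 44) ;; .setWord 4 (wv 2) (wv 45) ;; incr 2)
    (.ite (.leReal (.load 5 (wv 44)) (.load 5 (wv 45)))
      (push (wv 44) (rc 45) ;; push (wv 44) (lc 45))
      (push (rc 44) (wv 45) ;; push (lc 44) (wv 45)))

/-- Process the topmost pair. -/
def pairStep : Prog := pop ;; .ite (eqw (wv 44) (wv 45)) expand (testPair ;; resolve)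

/-- Compute the pairs. -/
def pairs : Prog :=
  (wset 2 (.const 0) ;; .setWord 41 (.const 0) (.const 0) ;; .setWord 42 (.const 0) (.const 0) ;;
    wset 43 (.const 1)) ;;
  .loop (.leWord (.const 1) (wv 43)) pairStep

/-- A pending pair of nodes, with its contribution to the output and the number of the steps
for it. -/
structure Job (n : ℕ) : Type where
  fst : ℕ
  snd : ℕ
  out : List (BTree (Fin n) × BTree (Fin n))
  calls : ℕ

/-- The longest side of the box at the root of a tree. -/
def treeLen {d n : ℕ} (c : Fin n → Pt d) (T : BTree (Fin n)) : ℝ := boxLen c T.labels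

/-- The ghost data of a pending pair are as they should be. -/
def Job.Ok {d n : ℕ} (c : Fin n → Pt d) (r : Fin n → ℝ) (s : ℝ) (N : ℕ) (σ : Store) (j : Job n) :
    Prop :=
  (j.fst = j.snd ∧ ∃ T f, Rep c σ N T j.fst ∧ T.Proper ∧
    AllRun (BallCrit c r s) (treeLen c) T j.out f ∧
    j.calls = T.size + j.out.length + f.length) ∨
  (∃ U V f, Rep c σ N U j.fst ∧ Rep c σ N V j.snd ∧ Disjoint U.labels V.labels ∧
    Run (BallCrit c r s) (treeLen c) U V j.out f ∧
    j.calls = j.out.length + f.length)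

/-- The memory holds the stack of the pending pairs. -/
def StackAt {n : ℕ} (σ : Store) : List (Job n) → Prop
  | [] => True
  | j :: js => σ.word 41 js.length = j.fst ∧ σ.word 42 js.length = j.snd ∧ StackAt σ js

/-- The invariant of the computation of the pairs: the pairs in `done` have been found, those in
`jobs` are pending. The tree is stored in `σ`. -/
structure PairInv {d n : ℕ} (c : Fin n → Pt d) (r : Fin n → ℝ) (s : ℝ) (N : ℕ) (σ τ : Store)
    (done : List (BTree (Fin n) × BTree (Fin n))) (jobs : List (Job n)) : Prop where
  top : τ.word 43 0 = jobs.length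
  stack : StackAt τ jobs
  cnt : τ.word 2 0 = done.length
  res : ∀ i (h : i < done.length), Rep c σ N done[i].1 (τ.word 3 i) ∧
    Rep c σ N done[i].2 (τ.word 4 i)
  ok : ∀ j ∈ jobs, j.Ok c r s N σ

section

variable {d n N M : ℕ} {c : Fin n → Pt d} {r : Fin n → ℝ} {s : ℝ} {σ τ : Store}
  {total done : List (BTree (Fin n) × BTree (Fin n))} {j : Job n} {js jobs : List (Job n)}

theorem StackAt.congr (h : StackAt σ js) (h1 : ∀ i < js.length, τ.word 41 i = σ.word 41 i)
    (h2 : ∀ i < js.length, τ.word 42 i = σ.word 42 i) : StackAt τ js := by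
  induction js with
  | nil => trivial
  | cons j js ih =>
    simp only [List.length_cons] at h1 h2
    exact ⟨by rw [h1 _ (by omega)]; exact h.1, by rw [h2 _ (by omega)]; exact h.2.1,
      ih h.2.2 (fun i hi => h1 i (by omega)) fun i hi => h2 i (by omega)⟩

theorem BTree.size_pos {ι : Type} (T : BTree ι) : 0 < T.size := by cases T <;> simp [BTree.size]

theorem Job.Ok.calls_pos (h : j.Ok c r s N σ) : 0 < j.calls := by
  rcases h with ⟨-, T, f, -, -, -, h⟩ | ⟨U, V, f, -, -, -, hr, h⟩
  · have := T.size_pos; omega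
  · have := hr.length; omega

/-- Every pending pair needs at least one more step, so the height of the stack is at most the
number of remaining steps. Space is thus bounded by the same count as time. -/
theorem length_le_sum_calls (h : ∀ j ∈ jobs, j.Ok c r s N σ) :
    jobs.length ≤ (jobs.map Job.calls).sum := by
  induction jobs with
  | nil => simp
  | cons j js ih =>
    simp only [List.length_cons, List.map_cons, List.sum_cons]
    have h1 := (h j (by simp)).calls_pos
    have h2 := ih fun j hj => h j (by simp [hj])
    omega

/-- The second expression is evaluated after the first component of the pair has been written; hence
the quantifier over the value `v` in the assumptions about `f`. -/
theorem push_spec {e f : WExpr} (hI : PairInv c r s N σ τ done js) (hM : js.length + 1 < M)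
    (hj : j.Ok c r s N σ) (he : e.Safe M τ) (hf : ∀ v, f.Safe M (τ.setWord 41 js.length v))
    (he' : e.val τ = j.fst) (hf' : ∀ v, f.val (τ.setWord 41 js.length v) = j.snd) :
    WP M (push e f) τ (fun t υ => PairInv c r s N σ υ done (j :: js) ∧
      t ≤ e.cost + f.cost + 12) := by
  have h43 := hI.top
  refine WP.of_pre ?_
  simp only [push, pre, incr, wset, WExpr.Safe, WExpr.val, wv_safe, wv_val, h43, he',
    Store.setWord_word]
  simp [h43, hf, hf']
  refine ⟨by omega, he, by omega, by omega, ⟨by omega, by omega, by omega⟩, ⟨?_, ?_, ?_, ?_, ?_⟩, by omega⟩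
  · simp
  · refine ⟨by simp, by simp, hI.stack.congr (fun i hi => ?_) fun i hi => ?_⟩
    · simp [Function.update_of_ne hi.ne]
    · simp [Function.update_of_ne hi.ne]
  · simpa using hI.cnt
  · simpa using hI.res
  · intro j' hj'
    rcases List.mem_cons.mp hj' with rfl | h
    · exact hj
    · exact hI.ok _ h

/-- On the stack, a node paired with itself stands for all pairs inside its set. The three
successors are pushed in reverse, so that the output has the order prescribed by `AllRun.node`. -/
theorem expand_spec {T : BTree (Fin n)} {o f : List (BTree (Fin n) × BTree (Fin n))} {u : ℕ}
    (hI : PairInv c r s N σ τ done js) (hM : js.length + 3 < M) (hNM : N < M)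
    (h5 : τ.word 5 = σ.word 5) (h6 : τ.word 6 = σ.word 6) (h44 : τ.word 44 0 = u)
    (hT : Rep c σ N T u) (hTp : T.Proper) (hrun : AllRun (BallCrit c r s) (treeLen c) T o f) :
    WP M expand τ (fun t υ => ∃ jobs', PairInv c r s N σ υ done (jobs' ++ js) ∧
      jobs'.flatMap Job.out = o ∧
      (jobs'.map Job.calls).sum + 1 = T.size + o.length + f.length ∧ t ≤ 60) := by
  have hu := hT.lt
  have h5N := hT.left_lt
  cases hrun with
  | leaf i =>
    have e5 := hT.2.1
    refine WP.of_pre ?_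
    simp only [expand, pre, lc, Test.val, Test.Safe, WExpr.Safe, WExpr.val, wv_safe, wv_val, h5,
      h44, e5]
    exact ⟨by omega, fun h => by omega, fun _ => ⟨[], hI, rfl, by simp [BTree.size], by simp⟩⟩
  | @node l r' o f ol fl or fr hlr hl hr =>
    obtain ⟨-, e5, -, hRl, hRr⟩ := hT
    have hll := hRl.lt
    have hrl := hRr.lt
    refine WP.ite (by simp [lc, h5, h44]; omega) (fun _ => ?_)
      (fun h => absurd (by simp [lc, h5, h44]; omega) h)
    refine WP.seq (push_spec (j := ⟨σ.word 6 u, σ.word 6 u, or, r'.size + or.length + fr.length⟩)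
      hI (by omega) (.inl ⟨rfl, r', fr, hRr, hTp.2.1, hr, rfl⟩) (by simp [rc, h6, h44]; omega)
      (by simp [rc, h6, h44]; omega) (by simp [rc, h6, h44]) (by simp [rc, h6, h44])).frame ?_
    rintro t1 τ1 ⟨⟨hI1, ht1⟩, hf1⟩
    have a5 : τ1.word 5 = σ.word 5 := by rw [hf1.word _ (by decide), h5]
    have a6 : τ1.word 6 = σ.word 6 := by rw [hf1.word _ (by decide), h6]
    have a44 : τ1.word 44 0 = u := by rw [hf1.word _ (by decide), h44]
    refine WP.seq (push_spec (j := ⟨σ.word 5 u, σ.word 5 u, ol, l.size + ol.length + fl.length⟩)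
      hI1 (by simp; omega) (.inl ⟨rfl, l, fl, hRl, hTp.1, hl, rfl⟩) (by simp [lc, a5, a44]; omega)
      (by simp [lc, a5, a44]; omega) (by simp [lc, a5, a44]) (by simp [lc, a5, a44])).frame ?_
    rintro t2 τ2 ⟨⟨hI2, ht2⟩, hf2⟩
    have b5 : τ2.word 5 = σ.word 5 := by rw [hf2.word _ (by decide), a5]
    have b6 : τ2.word 6 = σ.word 6 := by rw [hf2.word _ (by decide), a6]
    have b44 : τ2.word 44 0 = u := by rw [hf2.word _ (by decide), a44]
    refine (push_spec (j := ⟨σ.word 5 u, σ.word 6 u, o, o.length + f.length⟩)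
      hI2 (by simp; omega) (.inr ⟨l, r', f, hRl, hRr, hTp.2.2, hlr, rfl⟩)
      (by simp [lc, b5, b44]; omega)
      (by simp [rc, b6, b44]; omega) (by simp [lc, b5, b44]) (by simp [rc, b6, b44])).mono ?_
    rintro t3 τ3 ⟨hI3, ht3⟩
    refine ⟨[_, _, _], hI3, by simp, ?_, ?_⟩
    · simp [BTree.size]; omega
    · simp [lc, rc] at *; omega

open Classical in
theorem resolve_spec {U V : BTree (Fin n)} {o f : List (BTree (Fin n) × BTree (Fin n))} {u v : ℕ}
    (hI : PairInv c r s N σ τ done js) (hM : js.length + 3 < M) (hNM : N < M)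
    (hdM : done.length + 1 < M)
    (h5 : τ.word 5 = σ.word 5) (h6 : τ.word 6 = σ.word 6) (r5 : τ.real 5 = σ.real 5)
    (h44 : τ.word 44 0 = u) (h45 : τ.word 45 0 = v)
    (h46 : τ.word 46 0 = if BallCrit c r s U V then 1 else 0)
    (hU : Rep c σ N U u) (hV : Rep c σ N V v) (hd : Disjoint U.labels V.labels)
    (hrun : Run (BallCrit c r s) (treeLen c) U V o f) :
    WP M resolve τ (fun t υ => ∃ new jobs', PairInv c r s N σ υ (done ++ new) (jobs' ++ js) ∧
      new ++ jobs'.flatMap Job.out = o ∧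
      (jobs'.map Job.calls).sum + 1 = o.length + f.length ∧ t ≤ 60) := by
  have hu := hU.lt
  have hv := hV.lt
  have lU : σ.real 5 u = treeLen c U := hU.dataAt.len
  have lV : σ.real 5 v = treeLen c V := hV.dataAt.len
  have h46M : τ.word 46 0 < M := by rw [h46]; split <;> omega
  cases hrun with
  | done h =>
    rw [if_pos h] at h46
    refine WP.ite (by simp; omega) (fun _ => ?_) (fun h => absurd (by simp [h46]) h)
    have h2 := hI.cnt
    refine WP.of_pre ?_
    simp only [pre, incr, wset, WExpr.Safe, WExpr.val, wv_safe, wv_val, h2, h44, h45,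
      Store.setWord_word]
    simp [h2, h44, h45]
    refine ⟨by omega, by omega, by omega, by omega, by omega, by omega, [(U, V)], [], ⟨?_, ?_, ?_, ?_, ?_⟩, by simp,
      by simp⟩
    · simpa using hI.top
    · exact hI.stack.congr (by simp) (by simp)
    · simp
    · intro i hi
      rcases (Nat.lt_succ_iff.mp (by simpa using hi)).lt_or_eq with h | rfl
      · simp only [List.getElem_append_left h]
        simp [Function.update_of_ne h.ne]
        exact hI.res i h
      · simp [hU, hV]
    · simpa using hI.ok
  | @right U l r' o f o' f' h hl h1 h2 =>
    rw [if_neg h] at h46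
    refine WP.ite (by simp; omega) (fun h => absurd h (by simp [h46])) (fun _ => ?_)
    refine WP.ite (by simp [h44, h45]; omega) (fun _ => ?_)
      (fun h => absurd (by simp [h44, h45, r5, lU, lV, hl]) h)
    obtain ⟨-, e5, -, hRl, hRr⟩ := hV
    have hll := hRl.lt
    have hrl := hRr.lt
    simp only [BTree.labels, Finset.disjoint_union_right] at hd
    refine WP.seq (push_spec (j := ⟨u, σ.word 6 v, o', o'.length + f'.length⟩)
      hI (by omega) (.inr ⟨_, _, _, hU, hRr, hd.2, h2, rfl⟩) (by simp [h44]; omega)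
      (by simp [rc, h6, h45]; omega) (by simp [h44]) (by simp [rc, h6, h45])).frame ?_
    rintro t1 τ1 ⟨⟨hI1, ht1⟩, hf1⟩
    have a5 : τ1.word 5 = σ.word 5 := by rw [hf1.word _ (by decide), h5]
    have a44 : τ1.word 44 0 = u := by rw [hf1.word _ (by decide), h44]
    have a45 : τ1.word 45 0 = v := by rw [hf1.word _ (by decide), h45]
    refine (push_spec (j := ⟨u, σ.word 5 v, o, o.length + f.length⟩)
      hI1 (by simp; omega) (.inr ⟨_, _, _, hU, hRl, hd.1, h1, rfl⟩) (by simp [a44]; omega)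
      (by simp [lc, a5, a45]; omega) (by simp [a44]) (by simp [lc, a5, a45])).mono ?_
    rintro t2 τ2 ⟨hI2, ht2⟩
    refine ⟨[], [_, _], by simpa using hI2, by simp, ?_, ?_⟩
    · simp; omega
    · simp [lc, rc] at *; omega
  | @left V l r' o f o' f' h hl h1 h2 =>
    rw [if_neg h] at h46
    refine WP.ite (by simp; omega) (fun h => absurd h (by simp [h46])) (fun _ => ?_)
    refine WP.ite (by simp [h44, h45]; omega)
      (fun h => absurd (by simpa [h44, h45, r5, lU, lV] using h) hl) (fun _ => ?_)
    obtain ⟨-, e5, -, hRl, hRr⟩ := hU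
    have hll := hRl.lt
    have hrl := hRr.lt
    simp only [BTree.labels, Finset.disjoint_union_left] at hd
    refine WP.seq (push_spec (j := ⟨σ.word 6 u, v, o', o'.length + f'.length⟩)
      hI (by omega) (.inr ⟨_, _, _, hRr, hV, hd.2, h2, rfl⟩) (by simp [rc, h6, h44]; omega)
      (by simp [h45]; omega) (by simp [rc, h6, h44]) (by simp [h45])).frame ?_
    rintro t1 τ1 ⟨⟨hI1, ht1⟩, hf1⟩
    have a5 : τ1.word 5 = σ.word 5 := by rw [hf1.word _ (by decide), h5]
    have a44 : τ1.word 44 0 = u := by rw [hf1.word _ (by decide), h44]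
    have a45 : τ1.word 45 0 = v := by rw [hf1.word _ (by decide), h45]
    refine (push_spec (j := ⟨σ.word 5 u, v, o, o.length + f.length⟩)
      hI1 (by simp; omega) (.inr ⟨_, _, _, hRl, hV, hd.1, h1, rfl⟩)
      (by simp [lc, a5, a44]; omega) (by simp [a45]; omega) (by simp [lc, a5, a44])
      (by simp [a45])).mono ?_
    rintro t2 τ2 ⟨hI2, ht2⟩
    refine ⟨[], [_, _], by simpa using hI2, by simp, ?_, ?_⟩
    · simp; omega
    · simp [lc, rc] at *; omega

theorem pairStep_spec (hI : PairInv c r s N σ τ done (j :: js)) (hM : js.length + 3 < M)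
    (hM' : N * d + 2 * d + 100 ≤ M) (hNM : N < M) (hdM : done.length + 1 < M) (hn : n < M)
    (hd : σ.word 1 0 = d) (hs : σ.real 2 0 = s) (hr : ∀ i : Fin n, σ.real 1 i = r i)
    (hf : Frame pairs σ τ) :
    WP M pairStep τ (fun t υ => ∃ new jobs', PairInv c r s N σ υ (done ++ new) (jobs' ++ js) ∧
      new ++ jobs'.flatMap Job.out = j.out ∧
      (jobs'.map Job.calls).sum + 1 = j.calls ∧ t ≤ 60 * d + 300) := by
  have h43 := hI.top
  obtain ⟨s1, s2, s3⟩ := hI.stack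
  have hj := hI.ok j (by simp)
  obtain ⟨hu, hv⟩ : j.fst < N ∧ j.snd < N := by
    rcases hj with ⟨e, T, f, h, -⟩ | ⟨U, V, f, h, h', -⟩
    · exact ⟨h.lt, e ▸ h.lt⟩
    · exact ⟨h.lt, h'.lt⟩
  simp only [List.length_cons] at h43
  refine WP.seq (WP.frame (Q := fun t υ => t ≤ 20 ∧ PairInv c r s N σ υ done js ∧
    υ.word 44 0 = j.fst ∧ υ.word 45 0 = j.snd) (WP.of_pre ?_)) ?_
  · simp [pop, h43, s1, s2]
    refine ⟨by omega, by omega, by omega, by omega, by omega, by omega, ?_, ?_, ?_, ?_, ?_⟩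
    · simp
    · exact s3.congr (by simp) (by simp)
    · simpa using hI.cnt
    · simpa using hI.res
    · exact fun j' hj' => hI.ok j' (List.mem_cons_of_mem _ hj')
  rintro t1 υ ⟨⟨ht1, hI1, h44, h45⟩, hf1⟩
  have w : ∀ a, a ∉ pairs.wordArrays → a ∉ pop.wordArrays → υ.word a = σ.word a := fun a h h' => by
    rw [hf1.word a h', hf.word a h]
  have rr : ∀ a, a ∉ pairs.realArrays → υ.real a = σ.real a := fun a h => by
    rw [hf1.real a (by simp [pop, Prog.realArrays]), hf.real a h]
  rcases hj with ⟨e, T, f, hT, hTp, hrun, hcalls⟩ | ⟨U, V, f, hU, hV, hdis, hrun, hcalls⟩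
  · refine WP.ite (by simp [h44, h45]; omega) (fun _ => ?_) (fun h => absurd (by simp [h44, h45, e]) h)
    refine (expand_spec hI1 hM hNM (w _ (by decide) (by decide)) (w _ (by decide) (by decide)) h44
      hT hTp hrun).mono ?_
    rintro t2 ω ⟨jobs', h1, h2, h3, h4⟩
    exact ⟨[], jobs', by simpa using h1, by simpa using h2, by omega, by simp; omega⟩
  -- Equal node numbers would mean equal trees, but a nonempty set is not disjoint from itself. So
  -- the test of the numbers tells the two kinds of jobs apart.
  · have hne : j.fst ≠ j.snd := by
      intro h
      rw [← h] at hV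
      rw [hU.eq hV] at hdis
      have := V.labels_nonempty
      simp at hdis
      simp [hdis] at this
    refine WP.ite (by simp [h44, h45]; omega)
      (fun h => absurd (by simpa [h44, h45] using h) hne) (fun _ => ?_)
    have tr : ∀ {T u}, Rep c σ N T u → Rep c υ N T u := fun hT =>
      hT.transfer (w _ (by decide) (by decide)) (w _ (by decide) (by decide))
        (w _ (by decide) (by decide)) (rr _ (by decide)) (rr _ (by decide)) (rr _ (by decide))
    refine WP.seq (testPair_spec (r := r) (s := s) (c := c) (N := N) (n := n)
      (by rw [w _ (by decide) (by decide), hd]) hM' hNM hn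
      (by rw [rr _ (by decide), hs]) (by rw [rr _ (by decide)]; exact hr) h44 h45 (tr hU)
      (tr hV)).frame ?_
    rintro t2 ω ⟨⟨h46, ht2⟩, hf2⟩
    have hI2 : PairInv c r s N σ ω done js := by
      refine ⟨?_, hI1.stack.congr ?_ ?_, ?_, ?_, hI1.ok⟩
      · rw [hf2.word _ (by decide), hI1.top]
      · intro i _; rw [hf2.word _ (by decide)]
      · intro i _; rw [hf2.word _ (by decide)]
      · rw [hf2.word _ (by decide), hI1.cnt]
      · rw [hf2.word _ (by decide), hf2.word _ (by decide)]; exact hI1.res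
    refine (resolve_spec hI2 hM hNM hdM
      (by rw [hf2.word _ (by decide), w _ (by decide) (by decide)])
      (by rw [hf2.word _ (by decide), w _ (by decide) (by decide)])
      (by rw [hf2.real _ (by decide), rr _ (by decide)])
      (by rw [hf2.word _ (by decide), h44]) (by rw [hf2.word _ (by decide), h45]) h46 hU hV hdis
      hrun).mono ?_
    rintro t3 ω' ⟨new, jobs', h1, h2, h3, h4⟩
    exact ⟨new, jobs', h1, h2, by omega, by simp; omega⟩

theorem pairs_spec {T : BTree (Fin n)} {o f : List (BTree (Fin n) × BTree (Fin n))} {E : ℕ}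
    (hT : Rep c σ N T 0) (hTp : T.Proper) (hrun : AllRun (BallCrit c r s) (treeLen c) T o f)
    (hE : T.size + o.length + f.length ≤ E) (hEM : E + 4 < M)
    (hM' : N * d + 2 * d + 100 ≤ M) (hNM : N < M) (hn : n < M)
    (hd : σ.word 1 0 = d) (hs : σ.real 2 0 = s) (hr : ∀ i : Fin n, σ.real 1 i = r i) :
    WP M pairs σ (fun t τ => Rep c τ N T 0 ∧ τ.word 2 0 = o.length ∧
      (∀ i (h : i < o.length), Rep c τ N o[i].1 (τ.word 3 i) ∧ Rep c τ N o[i].2 (τ.word 4 i)) ∧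
      t ≤ (60 * d + 310) * E + 50) := by
  refine WP.conseq (Q := fun t τ => τ.word 2 0 = o.length ∧
      (∀ i (h : i < o.length), Rep c σ N o[i].1 (τ.word 3 i) ∧ Rep c σ N o[i].2 (τ.word 4 i)) ∧
      t ≤ (60 * d + 310) * E + 50) ?_ ?_
  swap
  · rintro t τ hf ⟨h1, h2, h3⟩
    have tr : ∀ {T u}, Rep c σ N T u → Rep c τ N T u := fun hT =>
      hT.transfer (hf.word _ (by decide)) (hf.word _ (by decide)) (hf.word _ (by decide))
        (hf.real _ (by decide)) (hf.real _ (by decide)) (hf.real _ (by decide))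
    exact ⟨tr hT, h1, fun i h => ⟨tr (h2 i h).1, tr (h2 i h).2⟩, h3⟩
  set j0 : Job n := ⟨0, 0, o, T.size + o.length + f.length⟩ with hj0
  refine WP.seq (WP.frame (Q := fun t τ => PairInv c r s N σ τ [] [j0] ∧ t ≤ 20)
    (WP.of_pre ?_)) ?_
  · simp
    refine ⟨by omega, by omega, ⟨?_, ?_, ?_, ?_, ?_⟩⟩
    · simp
    · exact ⟨by simp [hj0], by simp [hj0], trivial⟩
    · simp
    · intro i hi; simp at hi
    · intro j hj
      obtain rfl : j = j0 := by simpa using hj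
      exact .inl ⟨rfl, T, f, hT, hTp, hrun, rfl⟩
  rintro t0 τ0 ⟨⟨hI0, ht0⟩, hf0⟩
  have H := WP.loop_potential (M := M) (b := .leWord (.const 1) (wv 43)) (P := pairStep) (σ := τ0)
    (fun (g : List (BTree (Fin n) × BTree (Fin n)) × List (Job n)) τ =>
      PairInv c r s N σ τ g.1 g.2 ∧ g.1 ++ g.2.flatMap Job.out = o ∧
        (g.2.map Job.calls).sum ≤ E)
    (fun g => (60 * d + 310) * (g.2.map Job.calls).sum) (g := ([], [j0]))
    ⟨hI0, by simp [hj0], by simpa [hj0] using hE⟩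
    (by
      rintro ⟨done, jobs⟩ τ ⟨hI, hout, hcalls⟩ hf
      have hlen := length_le_sum_calls hI.ok
      have h43 := hI.top
      simp only at hlen hcalls hout h43
      refine ⟨by simp [h43]; omega, fun hv => ?_⟩
      have hv' : 1 ≤ jobs.length := by simpa [h43] using hv
      cases jobs with
      | nil => simp at hv'
      | cons j js =>
        have hjs : ∀ j ∈ js, j.Ok c r s N σ := fun j hj => hI.ok j (by simp [hj])
        have hol : done.length ≤ o.length := by
          rw [← hout]; simp
        have hj1 := (hI.ok j (by simp)).calls_pos
        simp only [List.map_cons, List.sum_cons, List.length_cons] at hcalls hlen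
        have hfp : Frame pairs σ τ := by
          refine ⟨fun a ha => ?_, fun a ha => ?_⟩
          · simp only [pairs, Prog.wordArrays, List.mem_append, not_or] at ha
            rw [hf.word a (by simpa [Prog.wordArrays] using ha.2),
              hf0.word a (by simpa [Prog.wordArrays] using ha.1)]
          · simp only [pairs, Prog.realArrays, List.mem_append, not_or] at ha
            rw [hf.real a (by simpa [Prog.realArrays] using ha.2),
              hf0.real a (by simpa [Prog.realArrays] using ha.1)]
        refine (pairStep_spec (done := done) (js := js) hI (by omega) hM' hNM (by omega) hn hd hs hr hfp).mono ?_
        rintro t υ ⟨new, jobs', h1, h2, h3, h4⟩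
        refine ⟨(done ++ new, jobs' ++ js), ⟨h1, ?_, ?_⟩, ?_⟩
        · rw [← hout]
          simp only [List.flatMap_append, List.flatMap_cons, ← h2, List.append_assoc]
        · simp only [List.map_append, List.sum_append]
          omega
        · simp only [List.map_append, List.sum_append, List.map_cons, List.sum_cons]
          rw [← h3]
          have : (60 * d + 310) * ((jobs'.map Job.calls).sum + 1 + (js.map Job.calls).sum) =
            (60 * d + 310) * ((jobs'.map Job.calls).sum + (js.map Job.calls).sum) +
              (60 * d + 310) := by ring
          rw [this]
          simp
          omega)
  refine H.mono ?_
  rintro t τ ⟨⟨done, jobs⟩, ⟨hI, hout, hcalls⟩, ht, hv⟩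
  have h43 := hI.top
  simp only at hcalls hout h43 hI
  have : jobs = [] := by
    have : ¬ 1 ≤ jobs.length := by simpa [h43] using hv
    exact List.length_eq_zero_iff.mp (by omega)
  subst this
  obtain rfl : done = o := by simpa using hout
  refine ⟨hI.cnt, hI.res, ?_⟩
  have h1 : (60 * d + 310) * (T.size + done.length + f.length) ≤ (60 * d + 310) * E :=
    Nat.mul_le_mul_left _ hE
  simp [hj0] at ht
  omega

end

/-! ## Correctness of the decomposition -/

section

variable {d n : ℕ} {c : Fin n → Pt d} {r : Fin n → ℝ} {s : ℝ} {S : Finset (Fin n)}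
  {T U V : BTree (Fin n)}

theorem IsSplitTree.proper (h : IsSplitTree c T) : T.Proper := by
  induction T with
  | leaf i => trivial
  | node l r ihl ihr =>
    obtain ⟨hl, hr, k, lo, hi, -, -, h1, h2⟩ := h
    refine ⟨ihl hl, ihr hr, Finset.disjoint_left.mpr fun i hi hi' => ?_⟩
    exact absurd (h1 i hi) (not_le.mpr (h2 i hi'))

theorem IsSplitTree.subtree (h : IsSplitTree c T) (hU : U.HasSubtree T) : IsSplitTree c U := by
  induction T with
  | leaf i => cases hU; trivial
  | node l r ihl ihr =>
    rcases hU with rfl | hU | hU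
    · exact h
    · exact ihl h.1 hU
    · exact ihr h.2.1 hU

theorem boxLo_le_boxHi (h : S.Nonempty) (k : Fin d) : boxLo c S k ≤ boxHi c S k := by
  obtain ⟨i, hi⟩ := h
  exact (boxLo_le hi k).trans (le_boxHi hi k)

theorem boxHi_sub_boxLo_le (k : Fin d) : boxHi c S k - boxLo c S k ≤ boxLen c S :=
  le_csSup (Set.finite_range _).bddAbove ⟨k, rfl⟩

theorem boxLen_nonneg (hd : 0 < d) (h : S.Nonempty) : 0 ≤ boxLen c S :=
  (sub_nonneg.mpr (boxLo_le_boxHi h ⟨0, hd⟩)).trans (boxHi_sub_boxLo_le _)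

theorem boxRad_nonneg : 0 ≤ boxRad c S := Real.sqrt_nonneg _

theorem IsSplitTree.treeLen_pos {l r : BTree (Fin n)} (h : IsSplitTree c (.node l r)) :
    0 < treeLen c (.node l r) := by
  obtain ⟨-, -, k, lo, hi, hs, -, h1, h2⟩ := h
  obtain ⟨i, hi'⟩ := l.labels_nonempty
  obtain ⟨j, hj⟩ := r.labels_nonempty
  have e1 := h1 i hi'
  have e2 := h2 j hj
  have e3 := hs.1.2 ⟨i, by simp [hi'], rfl⟩
  have e4 := hs.2.2 ⟨j, by simp [hj], rfl⟩
  simp only at e3 e4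
  refine lt_of_lt_of_le ?_ (boxHi_sub_boxLo_le k)
  simp only [BTree.labels]
  rw [hs.lo_eq, hs.hi_eq]
  linarith

theorem half_boxLen_le_boxRad (hd : 0 < d) : boxLen c S / 2 ≤ boxRad c S := by
  have : Nonempty (Fin d) := ⟨⟨0, hd⟩⟩
  have h : boxLen c S ∈ Set.range fun k => boxHi c S k - boxLo c S k :=
    (Set.range_nonempty _).csSup_mem (Set.finite_range _)
  obtain ⟨k, hk⟩ := h
  rw [← hk, boxRad]
  refine Real.le_sqrt_of_sq_le ?_
  exact Finset.single_le_sum (f := fun k => ((boxHi c S k - boxLo c S k) / 2) ^ 2)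
    (fun k _ => by positivity) (Finset.mem_univ k)

theorem boxRad_le (hd : 0 < d) (h : S.Nonempty) : boxRad c S ≤ √d * (boxLen c S / 2) := by
  have h0 := boxLen_nonneg (c := c) hd h
  rw [boxRad]
  refine Real.sqrt_le_left (by positivity) |>.mpr ?_
  rw [mul_pow, Real.sq_sqrt (by positivity)]
  calc ∑ k, ((boxHi c S k - boxLo c S k) / 2) ^ 2 ≤ ∑ _k : Fin d, (boxLen c S / 2) ^ 2 := by
        refine Finset.sum_le_sum fun k _ => ?_
        have h1 := boxHi_sub_boxLo_le (c := c) (S := S) k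
        have h2 := sub_nonneg.mpr (boxLo_le_boxHi (c := c) h k)
        gcongr
    _ = _ := by simp

theorem boxCtr_singleton (i : Fin n) : boxCtr c {i} = c i := by
  ext k
  simp [boxCtr, boxLo_singleton, boxHi_singleton]

theorem dist_boxCtr_le {x : Pt d} (hx : ∀ k, boxLo c S k ≤ x k ∧ x k ≤ boxHi c S k) :
    dist x (boxCtr c S) ≤ boxRad c S := by
  rw [EuclideanSpace.dist_eq, boxRad]
  refine Real.sqrt_le_sqrt (Finset.sum_le_sum fun k _ => ?_)
  obtain ⟨h1, h2⟩ := hx k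
  have e : boxCtr c S k = (boxLo c S k + boxHi c S k) / 2 := rfl
  rw [Real.dist_eq, sq_abs, e]
  exact sq_le_sq' (by linarith) (by linarith)

theorem boundingBox_subset (S : Finset (Fin n)) {ρ : ℝ} (hρ : boxRad c S ≤ ρ) :
    boundingBox (c '' (S : Set (Fin n))) ⊆ Metric.closedBall (boxCtr c S) ρ := by
  intro x hx
  refine Metric.mem_closedBall.mpr ((dist_boxCtr_le fun k => ?_).trans hρ)
  obtain ⟨_, ⟨i, hi, rfl⟩, _, ⟨j, hj, rfl⟩, h1, h2⟩ := hx k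
  exact ⟨(boxLo_le hi k).trans h1, h2.trans (le_boxHi hj k)⟩

theorem enclosingBalls {A B : Finset (Fin n)} {ρ : ℝ} (hA : boxRad c A ≤ ρ) (hB : boxRad c B ≤ ρ)
    (h : 2 * ρ < dist (boxCtr c A) (boxCtr c B)) :
    EnclosingBalls (c '' (A : Set (Fin n))) (c '' (B : Set (Fin n))) (boxCtr c A) (boxCtr c B) ρ :=
  ⟨boxRad_nonneg.trans hA, Metric.closedBall_disjoint_closedBall (by linarith),
    boundingBox_subset A hA, boundingBox_subset B hB⟩

/-- The given balls are pairwise disjoint. -/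
def DisjointBalls (c : Fin n → Pt d) (r : Fin n → ℝ) : Prop :=
  (∀ i, 0 ≤ r i) ∧ ∀ i j, i ≠ j →
    Disjoint (Metric.closedBall (c i) (r i)) (Metric.closedBall (c j) (r j))

theorem DisjointBalls.lt_dist (h : DisjointBalls c r) {i j : Fin n} (hij : i ≠ j) :
    r i < dist (c i) (c j) := by
  by_contra! h'
  refine Set.disjoint_left.mp (h.2 i j hij) (?_ : c j ∈ _) (Metric.mem_closedBall_self (h.1 j))
  rwa [Metric.mem_closedBall, dist_comm]

theorem DisjointBalls.injective (h : DisjointBalls c r) : Function.Injective c := by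
  intro i j hij
  by_contra hne
  have h1 := h.lt_dist hne
  rw [hij, dist_self] at h1
  exact absurd (h.1 i) (not_le.mpr h1)

/-- Both half diagonals vanish, and what remains is that the radius of each ball is at most the
distance of the centres, which holds as the balls are disjoint. This is the base case that makes the
search end. -/
theorem ballCrit_leaf (h : DisjointBalls c r) {i j : Fin n} (hij : i ≠ j) :
    BallCrit c r s (.leaf i) (.leaf j) := by
  have h1 := h.lt_dist hij
  have h2 := h.lt_dist hij.symm
  rw [dist_comm] at h2
  refine ⟨⟨?_, ?_⟩, ?_, ?_⟩
  · simp only [BTree.labels, boxRad_singleton, mul_zero, ctrDist]; positivity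
  · simp only [BTree.labels, boxRad_singleton, mul_zero, ctrDist]; positivity
  · rintro _ ⟨⟩
    simp only [BTree.labels, boxRad_singleton, mul_zero, ctrDist, boxCtr_singleton]
    linarith
  · rintro _ ⟨⟩
    rw [ctrDist_comm]
    simp only [BTree.labels, boxRad_singleton, mul_zero, ctrDist, boxCtr_singleton]
    linarith

/-- The arguments of the search for separated pairs. -/
structure GoodPair (c : Fin n → Pt d) (U V : BTree (Fin n)) : Prop where
  left : IsSplitTree c U
  right : IsSplitTree c V
  disj : Disjoint U.labels V.labels

theorem GoodPair.of_node {l r : BTree (Fin n)} (h : IsSplitTree c (.node l r)) : GoodPair c l r :=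
  ⟨h.1, h.2.1, h.proper.2.2⟩

theorem GoodPair.symm (h : GoodPair c U V) : GoodPair c V U := ⟨h.right, h.left, h.disj.symm⟩

theorem GoodPair.mono {U' V' : BTree (Fin n)} (h : GoodPair c U V) (hU : U'.HasSubtree U)
    (hV : V'.HasSubtree V) : GoodPair c U' V' :=
  ⟨h.left.subtree hU, h.right.subtree hV, h.disj.mono hU.labels_subset hV.labels_subset⟩

/-- The set to be split is the longer one, and a leaf has length `0` while inner nodes have positive
length. So the only pairs that could not be split consist of two leaves, and these satisfy `ok`. -/
theorem GoodPair.exists_run {ok : BTree (Fin n) → BTree (Fin n) → Prop} (hd : 0 < d)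
    (hok : ∀ i j, i ≠ j → ok (.leaf i) (.leaf j)) (h : GoodPair c U V) :
    ∃ o f, Run ok (treeLen c) U V o f := by
  refine BallWSPD.exists_run (GoodPair c) (fun l r V h => ⟨h.mono (.left l r) (.refl V),
    h.mono (.right l r) (.refl V)⟩) (fun U l r h => ⟨h.mono (.refl U) (.left l r),
    h.mono (.refl U) (.right l r)⟩) (fun U V h hn => ⟨fun hl => ?_, fun hl => ?_⟩) h
  · cases V with
    | node l r => exact ⟨l, r, rfl⟩
    | leaf j =>
      have e : treeLen c (.leaf j) = 0 := boxLen_singleton hd j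
      cases U with
      | node l r =>
        have := h.left.treeLen_pos
        linarith
      | leaf i =>
        refine absurd (hok i j ?_) hn
        rintro rfl
        simpa [BTree.labels] using h.disj
  · cases U with
    | node l r => exact ⟨l, r, rfl⟩
    | leaf i =>
      have e : treeLen c (.leaf i) = 0 := boxLen_singleton hd i
      have := boxLen_nonneg (c := c) hd V.labels_nonempty
      exact absurd (e.trans_le this) hl

theorem exists_allRun {ok : BTree (Fin n) → BTree (Fin n) → Prop} (hd : 0 < d)
    (hok : ∀ i j, i ≠ j → ok (.leaf i) (.leaf j)) (h : IsSplitTree c T) :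
    ∃ o f, AllRun ok (treeLen c) T o f := by
  induction T with
  | leaf i => exact ⟨_, _, .leaf i⟩
  | node l r ihl ihr =>
    obtain ⟨_, _, a⟩ := (GoodPair.of_node h).exists_run hd hok
    obtain ⟨_, _, b⟩ := ihl h.1
    obtain ⟨_, _, e⟩ := ihr h.2.1
    exact ⟨_, _, .node a b e⟩

/-- The strict inequality makes the enclosing balls disjoint. It is clear if the larger half
diagonal is positive; if both vanish, the sets are leaves with different centres. -/
theorem GoodPair.two_mul_lt (hd : 0 < d) (hs : 0 < s) (hc : Function.Injective c)
    (h : GoodPair c U V) (hk : CentreCrit c s U V) :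
    2 * max (boxRad c U.labels) (boxRad c V.labels) < ctrDist c U V := by
  have hm : (3 * s + 8) * max (boxRad c U.labels) (boxRad c V.labels) ≤ ctrDist c U V := by
    rcases max_choice (boxRad c U.labels) (boxRad c V.labels) with e | e <;> rw [e]
    exacts [hk.1, hk.2]
  have h0 : 0 ≤ max (boxRad c U.labels) (boxRad c V.labels) := le_max_of_le_left boxRad_nonneg
  rcases h0.lt_or_eq with h0 | h0
  · nlinarith
  rw [← h0, mul_zero]
  have hU : boxRad c U.labels ≤ 0 := by rw [h0]; exact le_max_left _ _
  have hV : boxRad c V.labels ≤ 0 := by rw [h0]; exact le_max_right _ _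
  have hnode : ∀ {l r}, IsSplitTree c (.node l r) → 0 < boxRad c (BTree.node l r).labels :=
    fun {l r} h => by
      have h1 := h.treeLen_pos
      have h2 := half_boxLen_le_boxRad (c := c) (S := (BTree.node l r).labels) hd
      unfold treeLen at h1
      exact lt_of_lt_of_le (by linarith) h2
  cases U with
  | node l r => exact absurd (hnode h.left) (not_lt.mpr hU)
  | leaf i =>
    cases V with
    | node l r => exact absurd (hnode h.right) (not_lt.mpr hV)
    | leaf j =>
      simp only [ctrDist, BTree.labels, boxCtr_singleton]
      refine dist_pos.mpr fun e => ?_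
      have := hc e
      subst this
      simpa [BTree.labels] using h.disj

/-- The common radius is the larger half diagonal `ρ`; the two radii take `2ρ` from the distance
`(3s+8)ρ` of the centres. -/
theorem GoodPair.pointsWellSeparated (hd : 0 < d) (hs : 0 < s) (hc : Function.Injective c)
    (h : GoodPair c U V) (hk : CentreCrit c s U V) :
    PointsWellSeparated (3 * s + 6) (c '' (U.labels : Set (Fin n)))
      (c '' (V.labels : Set (Fin n))) := by
  refine ⟨_, _, _, enclosingBalls (le_max_left _ _) (le_max_right _ _)
    (h.two_mul_lt hd hs hc hk), ?_⟩
  have hm : (3 * s + 8) * max (boxRad c U.labels) (boxRad c V.labels) ≤ ctrDist c U V := by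
    rcases max_choice (boxRad c U.labels) (boxRad c V.labels) with e | e <;> rw [e]
    exacts [hk.1, hk.2]
  rw [ctrDist] at hm
  rw [ballDist]
  linarith

theorem BTree.Proper.one_lt_card {l r : BTree (Fin n)} (h : (BTree.node l r).Proper) :
    1 < (BTree.node l r).labels.card := by
  rw [BTree.labels, Finset.card_union_of_disjoint h.2.2]
  have h1 := l.labels_nonempty.card_pos
  have h2 := r.labels_nonempty.card_pos
  omega

/-- A single ball contributes half diagonal `0`, so `ρ` is the half diagonal of the other set, and
`LeafCrit` leaves `(3s+4)ρ` after `r` and one radius are subtracted. For two larger sets the centre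
criterion alone gives `(3s+6)ρ`, more than needed. -/
theorem GoodPair.ballsWellSeparated (hd : 0 < d) (hs : 0 < s) (hc : Function.Injective c)
    (h : GoodPair c U V) (hk : BallCrit c r s U V) :
    BallsWellSeparated c r s U.labels V.labels := by
  refine ⟨U.labels_nonempty, V.labels_nonempty, _, _, _, enclosingBalls (le_max_left _ _)
    (le_max_right _ _) (h.two_mul_lt hd hs hc hk.1), ?_⟩
  have hUp := h.left.proper
  have hVp := h.right.proper
  cases U with
  | leaf i =>
    cases V with
    | leaf j => exact .inl ⟨by simp [BTree.labels], by simp [BTree.labels]⟩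
    | node l r' =>
      refine .inr (.inl ⟨i, rfl, hVp.one_lt_card, ?_⟩)
      have h1 := hk.2.1 i rfl
      have e : max (boxRad c (BTree.leaf i).labels) (boxRad c (BTree.node l r').labels) =
          boxRad c (BTree.node l r').labels := by
        refine max_eq_right ?_
        rw [BTree.labels, boxRad_singleton]; exact boxRad_nonneg
      rw [e, ballDist]
      rw [ctrDist, BTree.labels, boxCtr_singleton] at h1
      linarith
  | node l r' =>
    cases V with
    | leaf j =>
      refine .inr (.inr (.inl ⟨j, hUp.one_lt_card, rfl, ?_⟩))
      have h1 := hk.2.2 j rfl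
      have e : max (boxRad c (BTree.node l r').labels) (boxRad c (BTree.leaf j).labels) =
          boxRad c (BTree.node l r').labels := by
        refine max_eq_left ?_
        rw [BTree.labels, boxRad_singleton]; exact boxRad_nonneg
      rw [e, ballDist]
      rw [ctrDist, BTree.labels, boxCtr_singleton] at h1
      linarith
    | node l2 r2 =>
      refine .inr (.inr (.inr ⟨hUp.one_lt_card, hVp.one_lt_card, ?_⟩))
      have hm : (3 * s + 8) * max (boxRad c (BTree.node l r').labels)
          (boxRad c (BTree.node l2 r2).labels) ≤
          dist (boxCtr c (BTree.node l r').labels) (boxCtr c (BTree.node l2 r2).labels) := by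
        rcases max_choice (boxRad c (BTree.node l r').labels)
          (boxRad c (BTree.node l2 r2).labels) with e | e <;> rw [e]
        exacts [hk.1.1, hk.1.2]
      have h0 : 0 ≤ max (boxRad c (BTree.node l r').labels) (boxRad c (BTree.node l2 r2).labels) :=
        le_max_of_le_left boxRad_nonneg
      rw [ballDist]
      nlinarith

/-- The pairs in a run belong to good pairs. -/
theorem AllRun.goodPair {ok : BTree (Fin n) → BTree (Fin n) → Prop} {len : BTree (Fin n) → ℝ}
    {o f : List (BTree (Fin n) × BTree (Fin n))} (h : AllRun ok len T o f) (hT : IsSplitTree c T) :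
    ∀ x ∈ o, ok x.1 x.2 ∧ GoodPair c x.1 x.2 := by
  induction h with
  | leaf => simp
  | node h _ _ h1 h2 =>
    intro x hx
    rcases List.mem_append.mp hx with hx | hx
    · obtain ⟨a, b, e⟩ := h.subtrees.1 x hx
      exact ⟨a, (GoodPair.of_node hT).mono b e⟩
    rcases List.mem_append.mp hx with hx | hx
    · exact h1 hT.1 x hx
    · exact h2 hT.2.1 x hx

theorem Run.of_leaf_left {ok : BTree (Fin n) → BTree (Fin n) → Prop} {len : BTree (Fin n) → ℝ}
    {o f : List (BTree (Fin n) × BTree (Fin n))} {i : Fin n} (h : Run ok len (.leaf i) V o f)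
    {x : BTree (Fin n) × BTree (Fin n)} (hx : x ∈ o) :
    x.1 = .leaf i ∧ x.2.labels ⊆ V.labels := by
  obtain ⟨-, a, b⟩ := h.subtrees.1 x hx
  exact ⟨a, b.labels_subset⟩

theorem Run.of_leaf_right {ok : BTree (Fin n) → BTree (Fin n) → Prop} {len : BTree (Fin n) → ℝ}
    {o f : List (BTree (Fin n) × BTree (Fin n))} {i : Fin n} (h : Run ok len U (.leaf i) o f)
    {x : BTree (Fin n) × BTree (Fin n)} (hx : x ∈ o) :
    x.2 = .leaf i ∧ x.1.labels ⊆ U.labels := by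
  obtain ⟨-, a, b⟩ := h.subtrees.1 x hx
  exact ⟨b, a.labels_subset⟩

/-- The decomposition of the balls refines that of the centres. -/
theorem AllRun.refinesSingletonPairs (hb : DisjointBalls c r)
    (hT : IsSplitTree c T) {o f o' f' : List (BTree (Fin n) × BTree (Fin n))}
    (h : AllRun (BallCrit c r s) (treeLen c) T o f)
    (h' : AllRun (CentreCrit c s) (treeLen c) T o' f') :
    RefinesSingletonPairs (fun i : Fin o.length => o[i].1.labels) (fun i => o[i].2.labels)
      (fun i : Fin o'.length => o'[i].1.labels) (fun i => o'[i].2.labels) := by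
  intro i
  obtain ⟨y, hy, hok, hx⟩ := h.refine h' (fun U V h => h.1) o[i] (List.getElem_mem _)
  obtain ⟨j, hj, rfl⟩ := List.getElem_of_mem hy
  have hg := (h'.goodPair hT _ hy).2
  refine ⟨⟨j, hj⟩, ?_⟩
  simp only [Fin.getElem_fin] at hx ⊢
  rcases hx with hx | ⟨o'', f'', hn, hr, hx⟩
  · exact .inl ⟨by rw [hx], by rw [hx]⟩
  generalize o'[j] = y at *
  obtain ⟨U, V⟩ := y
  simp only at hr hn hok hg ⊢
  have hUp := hg.left.proper
  have hVp := hg.right.proper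
  -- The centre criterion holds and the full one fails. The two differ only in the condition for
  -- leaves, which is vacuous for two inner nodes and automatic for two leaves; so exactly one of
  -- the sets is a singleton.
  cases U with
  | leaf a =>
    cases V with
    | leaf b =>
      refine absurd (ballCrit_leaf hb ?_) hn
      rintro rfl
      simpa [BTree.labels] using hg.disj
    | node l r' =>
      obtain ⟨e1, e2⟩ := hr.of_leaf_left hx
      exact .inr (.inl ⟨by simp [BTree.labels], hVp.one_lt_card, by rw [e1], e2⟩)
  | node l r' =>
    cases V with
    | leaf b =>
      obtain ⟨e1, e2⟩ := hr.of_leaf_right hx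
      exact .inr (.inr ⟨by simp [BTree.labels], hUp.one_lt_card, by rw [e1], e2⟩)
    | node l2 r2 =>
      exact absurd ⟨hok, by rintro _ ⟨⟩, by rintro _ ⟨⟩⟩ hn

end

/-! ## Cells of the split tree -/

section

variable {d n : ℕ} {c : Fin n → Pt d} {r : Fin n → ℝ} {s : ℝ} {S : Finset (Fin n)}
  {T U V : BTree (Fin n)}

/-- A half-open box, given by its lower and upper ends. -/
def halfOpenBox (p : (Fin d → ℝ) × (Fin d → ℝ)) : Set (Pt d) := {x | ∀ k, p.1 k < x k ∧ x k ≤ p.2 k}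

/-- All sides of the box are at least `t`. -/
def Wide (p : (Fin d → ℝ) × (Fin d → ℝ)) (t : ℝ) : Prop := ∀ k, t ≤ p.2 k - p.1 k

theorem Wide.mono {p : (Fin d → ℝ) × (Fin d → ℝ)} {t t' : ℝ} (h : Wide p t) (ht : t' ≤ t) :
    Wide p t' := fun k => ht.trans (h k)

theorem boxLen_mono {S' : Finset (Fin n)} (hd : 0 < d) (h : S.Nonempty) (hS : S ⊆ S') :
    boxLen c S ≤ boxLen c S' := by
  have : Nonempty (Fin d) := ⟨⟨0, hd⟩⟩
  refine csSup_le (Set.range_nonempty _) ?_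
  rintro _ ⟨k, rfl⟩
  refine le_trans ?_ (boxHi_sub_boxLo_le k)
  obtain ⟨⟨i, hi, h1⟩, -⟩ := (isSide_box (c := c) h k).1
  obtain ⟨⟨j, hj, h2⟩, -⟩ := (isSide_box (c := c) h k).2
  have h3 := boxLo_le (c := c) (hS hi) k
  have h4 := le_boxHi (c := c) (hS hj) k
  simp only at h1 h2
  linarith

theorem treeLen_mono (hd : 0 < d) (h : U.HasSubtree V) : treeLen c U ≤ treeLen c V :=
  boxLen_mono hd U.labels_nonempty h.labels_subset

theorem BTree.HasSubtree.size_le {ι : Type} {U T : BTree ι} (h : U.HasSubtree T) :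
    U.size ≤ T.size := by
  induction T with
  | leaf i => cases h; rfl
  | node l r ihl ihr =>
    rcases h with rfl | h | h
    · rfl
    · have := ihl h; simp only [BTree.size]; omega
    · have := ihr h; simp only [BTree.size]; omega

/-- Cells for the nodes of a split tree. -/
structure Cells (c : Fin n → Pt d) (T : BTree (Fin n))
    (C : BTree (Fin n) → (Fin d → ℝ) × (Fin d → ℝ)) : Prop where
  sub : ∀ W : BTree (Fin n), W.HasSubtree T → halfOpenBox (C W) ⊆ halfOpenBox (C T)
  mem : ∀ W : BTree (Fin n), W.HasSubtree T → ∀ i ∈ W.labels, c i ∈ halfOpenBox (C W)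
  disj : ∀ W W' : BTree (Fin n), W.HasSubtree T → W'.HasSubtree T → Disjoint W.labels W'.labels →
    Disjoint (halfOpenBox (C W)) (halfOpenBox (C W'))
  wide : ∀ l r : BTree (Fin n), (BTree.node l r).HasSubtree T →
    Wide (C l) (treeLen c (.node l r) / 2) ∧ Wide (C r) (treeLen c (.node l r) / 2)

theorem not_hasSubtree_of_disjoint {W l r : BTree (Fin n)} (h : Disjoint l.labels r.labels)
    (hW : W.HasSubtree l) : ¬ W.HasSubtree r := fun hW' => by
  obtain ⟨i, hi⟩ := W.labels_nonempty
  exact Finset.disjoint_left.mp h (hW.labels_subset hi) (hW'.labels_subset hi)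

/-- The cell of a node is cut by the plane through the middle of the bounding box of its points,
which lies inside the cell. In the direction of the cut each half keeps at least half of the longest
side of the box, and the other directions are unchanged; so both children have cells with all sides
at least half the length of their parent. Cells are open below and closed above, as points on the
cut go to the left. -/
theorem exists_cells (hd : 0 < d) (hT : IsSplitTree c T) {p : (Fin d → ℝ) × (Fin d → ℝ)}
    (hp : ∀ i ∈ T.labels, c i ∈ halfOpenBox p) (hw : Wide p (treeLen c T / 2)) :
    ∃ C, C T = p ∧ Cells c T C := by
  induction T generalizing p with
  | leaf i =>
    refine ⟨fun _ => p, rfl, ⟨fun W _ => subset_rfl, fun W hW => ?_, fun W W' hW hW' h => ?_,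
      fun l r h => ?_⟩⟩
    · cases hW; exact hp
    · cases hW; cases hW'; simp [BTree.labels] at h
    · cases h
  | node l r ihl ihr =>
    have hprop := hT.proper
    have hlen := hT.treeLen_pos
    obtain ⟨hl, hr, k, lo, hi, hs, hbest, h1, h2⟩ := hT
    have hlo := hs.lo_eq
    have hhi := hs.hi_eq
    have hk : treeLen c (.node l r) = hi - lo := by
      rw [treeLen, BTree.labels, boxLen_eq (k := k), hlo, hhi]
      intro k'
      rw [hlo, hhi]
      exact hbest k' _ _ (isSide_box (l.labels_nonempty.mono Finset.subset_union_left) k')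
    obtain ⟨⟨i0, hi0, e0⟩, -⟩ := hs.1
    obtain ⟨⟨i1, hi1, e1⟩, -⟩ := hs.2
    have p0 := (hp i0 hi0 k).1
    have p1 := (hp i1 hi1 k).2
    simp only at e0 e1
    rw [e0] at p0
    rw [e1] at p1
    set m := (lo + hi) / 2 with hm
    set pl : (Fin d → ℝ) × (Fin d → ℝ) := (p.1, Function.update p.2 k m) with hpl
    set pr : (Fin d → ℝ) × (Fin d → ℝ) := (Function.update p.1 k m, p.2) with hpr
    have wl : Wide pl (treeLen c (.node l r) / 2) := by
      intro k'
      by_cases h : k' = k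
      · subst h; simp [hpl]; linarith
      · simp [hpl, Function.update_of_ne h]; exact hw k'
    have wr : Wide pr (treeLen c (.node l r) / 2) := by
      intro k'
      by_cases h : k' = k
      · subst h; simp [hpr]; linarith
      · simp [hpr, Function.update_of_ne h]; exact hw k'
    have sl : halfOpenBox pl ⊆ halfOpenBox p := by
      intro x hx k'
      refine ⟨(hx k').1, ?_⟩
      have h' := (hx k').2
      by_cases h : k' = k
      · subst h; simp [hpl] at h'; linarith
      · simpa [hpl, Function.update_of_ne h] using h'
    have sr : halfOpenBox pr ⊆ halfOpenBox p := by
      intro x hx k'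
      refine ⟨?_, (hx k').2⟩
      have h' := (hx k').1
      by_cases h : k' = k
      · subst h; simp [hpr] at h'; linarith
      · simpa [hpr, Function.update_of_ne h] using h'
    have slr : Disjoint (halfOpenBox pl) (halfOpenBox pr) := by
      rw [Set.disjoint_left]
      intro x hx hx'
      have a := (hx k).2
      have b := (hx' k).1
      simp [hpl] at a
      simp [hpr] at b
      linarith
    have ml := treeLen_mono (c := c) hd (BTree.HasSubtree.left l r)
    have mr := treeLen_mono (c := c) hd (BTree.HasSubtree.right l r)
    obtain ⟨Cl, el, Hl⟩ := ihl hl (p := pl) (by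
      intro i hi' k'
      have a := hp i (by simp [BTree.labels, hi']) k'
      refine ⟨a.1, ?_⟩
      by_cases h : k' = k
      · subst h; simpa [hpl] using h1 i hi'
      · simpa [hpl, Function.update_of_ne h] using a.2) (wl.mono (by linarith))
    obtain ⟨Cr, er, Hr⟩ := ihr hr (p := pr) (by
      intro i hi' k'
      have a := hp i (by simp [BTree.labels, hi']) k'
      refine ⟨?_, a.2⟩
      by_cases h : k' = k
      · subst h; simpa [hpr] using h2 i hi'
      · simpa [hpr, Function.update_of_ne h] using a.1) (wr.mono (by linarith))
    classical
    -- Cells are attached to subtrees as values. This is consistent because label sets on the two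
    -- sides are disjoint and nonempty, so no subtree occurs on both sides.
    set C : BTree (Fin n) → (Fin d → ℝ) × (Fin d → ℝ) := fun W =>
      if W = .node l r then p else if W.HasSubtree l then Cl W else Cr W with hC
    have C0 : C (.node l r) = p := by simp [hC]
    have CL : ∀ W : BTree (Fin n), W.HasSubtree l → C W = Cl W := by
      intro W hW
      have : W ≠ .node l r := by
        rintro rfl
        have := hW.size_le
        simp only [BTree.size] at this; omega
      simp [hC, this, hW]
    have CR : ∀ W : BTree (Fin n), W.HasSubtree r → C W = Cr W := by
      intro W hW
      have : W ≠ .node l r := by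
        rintro rfl
        have := hW.size_le
        simp only [BTree.size] at this; omega
      have h' : ¬ W.HasSubtree l := fun h => not_hasSubtree_of_disjoint hprop.2.2 h hW
      simp [hC, this, h']
    have Sl : ∀ W : BTree (Fin n), W.HasSubtree l → halfOpenBox (C W) ⊆ halfOpenBox pl :=
      fun W hW => by rw [CL W hW, ← el]; exact Hl.sub W hW
    have Sr : ∀ W : BTree (Fin n), W.HasSubtree r → halfOpenBox (C W) ⊆ halfOpenBox pr :=
      fun W hW => by rw [CR W hW, ← er]; exact Hr.sub W hW
    have hne : ∀ W : BTree (Fin n), W.HasSubtree (.node l r) →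
        ¬ Disjoint (BTree.node l r).labels W.labels := by
      intro W hW h
      obtain ⟨i, hi⟩ := W.labels_nonempty
      exact Finset.disjoint_left.mp h (hW.labels_subset hi) hi
    refine ⟨C, C0, ⟨?_, ?_, ?_, ?_⟩⟩
    · rintro W (rfl | hW | hW)
      · rfl
      · rw [C0]; exact (Sl W hW).trans sl
      · rw [C0]; exact (Sr W hW).trans sr
    · rintro W (rfl | hW | hW)
      · rw [C0]; exact hp
      · rw [CL W hW]; exact Hl.mem W hW
      · rw [CR W hW]; exact Hr.mem W hW
    · rintro W W' hW hW' h
      rcases hW with rfl | hW | hW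
      · exact absurd h (hne _ hW')
      · rcases hW' with rfl | hW' | hW'
        · exact absurd h.symm (hne _ (.inr (.inl hW)))
        · rw [CL W hW, CL W' hW']; exact Hl.disj W W' hW hW' h
        · exact slr.mono (Sl W hW) (Sr W' hW')
      · rcases hW' with rfl | hW' | hW'
        · exact absurd h.symm (hne _ (.inr (.inr hW)))
        · exact slr.symm.mono (Sr W hW) (Sl W' hW')
        · rw [CR W hW, CR W' hW']; exact Hr.disj W W' hW hW' h
    · rintro l' r' (h | h | h)
      · cases h
        rw [CL l (.refl l), CR r (.refl r), el, er]
        exact ⟨wl, wr⟩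
      · rw [CL l' ((BTree.HasSubtree.left l' r').trans h),
          CL r' ((BTree.HasSubtree.right l' r').trans h)]
        exact Hl.wide l' r' h
      · rw [CR l' ((BTree.HasSubtree.left l' r').trans h),
          CR r' ((BTree.HasSubtree.right l' r').trans h)]
        exact Hr.wide l' r' h

theorem IsSplitTree.exists_cells (hd : 0 < d) (hT : IsSplitTree c T) : ∃ C, Cells c T C := by
  have h0 := boxLen_nonneg (c := c) hd T.labels_nonempty
  obtain ⟨C, -, h⟩ := BallWSPD.exists_cells hd hT
    -- The root cell extends below the bounding box, since a cell excludes its lower faces; the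
    -- further extension makes every side long enough even if the box is flat.
    (p := (fun k => boxLo c T.labels k - treeLen c T - 1, fun k => boxHi c T.labels k))
    (fun i hi k => ⟨by
      have := boxLo_le (c := c) hi k
      simp only [treeLen]; linarith, le_boxHi hi k⟩)
    (fun k => by
      have := boxLo_le_boxHi (c := c) T.labels_nonempty k
      simp only [treeLen]; linarith)
  exact ⟨C, h⟩

/-! ## The pairs that are split -/

/-- A pair that was split at its second set. -/
structure SplitPair (c : Fin n → Pt d) (ok : BTree (Fin n) → BTree (Fin n) → Prop)
    (T : BTree (Fin n)) (C : BTree (Fin n) → (Fin d → ℝ) × (Fin d → ℝ)) (U V : BTree (Fin n)) :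
    Prop where
  good : GoodPair c U V
  left : U.HasSubtree T
  right : V.HasSubtree T
  len : treeLen c U ≤ treeLen c V
  node : ∃ l r, V = .node l r
  not_ok : ¬ ok U V
  wide : Wide (C U) (treeLen c V / 2)

variable {ok : BTree (Fin n) → BTree (Fin n) → Prop}
  {C : BTree (Fin n) → (Fin d → ℝ) × (Fin d → ℝ)} {o f : List (BTree (Fin n) × BTree (Fin n))}

/-- The invariant: both cells have sides at least half the length of the longer set. Splitting the
longer set preserves it, because the children's cells have sides at least half the length of the
split set, the other cell was that wide already, and neither length can exceed that of the split set
afterwards. Symmetry of `ok` allows the split set to be written second. -/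
theorem Run.splitPair (hd : 0 < d) (hsymm : ∀ U V, ok U V → ok V U) (hC : Cells c T C)
    (h : Run ok (treeLen c) U V o f) (hg : GoodPair c U V)
    (hU : U.HasSubtree T) (hV : V.HasSubtree T)
    (w1 : Wide (C U) (max (treeLen c U) (treeLen c V) / 2))
    (w2 : Wide (C V) (max (treeLen c U) (treeLen c V) / 2)) :
    ∀ x ∈ f, (treeLen c x.1 ≤ treeLen c x.2 → SplitPair c ok T C x.1 x.2) ∧
      (¬ treeLen c x.1 ≤ treeLen c x.2 → SplitPair c ok T C x.2 x.1) := by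
  induction h with
  | done h => simp
  | @right U l r _ _ _ _ hn hl _ _ ih1 ih2 =>
    have ml := treeLen_mono (c := c) hd (BTree.HasSubtree.left l r)
    have mr := treeLen_mono (c := c) hd (BTree.HasSubtree.right l r)
    obtain ⟨v1, v2⟩ := hC.wide l r hV
    rw [max_eq_right hl] at w1
    intro x hx
    rcases List.mem_cons.mp hx with rfl | hx
    · exact ⟨fun _ => ⟨hg, hU, hV, hl, ⟨l, r, rfl⟩, hn, w1⟩, fun h => absurd hl h⟩
    have a1 : max (treeLen c U) (treeLen c l) / 2 ≤ treeLen c (.node l r) / 2 := by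
      have := max_le hl ml; linarith
    have a2 : max (treeLen c U) (treeLen c r) / 2 ≤ treeLen c (.node l r) / 2 := by
      have := max_le hl mr; linarith
    rcases List.mem_append.mp hx with hx | hx
    · exact ih1 (hg.mono (.refl U) (.left l r)) hU ((BTree.HasSubtree.left l r).trans hV)
        (w1.mono a1) (v1.mono a1) x hx
    · exact ih2 (hg.mono (.refl U) (.right l r)) hU ((BTree.HasSubtree.right l r).trans hV)
        (w1.mono a2) (v2.mono a2) x hx
  | @left V l r _ _ _ _ hn hl _ _ ih1 ih2 =>
    have ml := treeLen_mono (c := c) hd (BTree.HasSubtree.left l r)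
    have mr := treeLen_mono (c := c) hd (BTree.HasSubtree.right l r)
    obtain ⟨v1, v2⟩ := hC.wide l r hU
    have hl' := (not_le.mp hl).le
    rw [max_eq_left hl'] at w2
    intro x hx
    rcases List.mem_cons.mp hx with rfl | hx
    · exact ⟨fun h => absurd h hl, fun _ => ⟨hg.symm, hV, hU, hl', ⟨l, r, rfl⟩,
        fun h => hn (hsymm _ _ h), w2⟩⟩
    have a1 : max (treeLen c l) (treeLen c V) / 2 ≤ treeLen c (.node l r) / 2 := by
      have := max_le ml hl'; linarith
    have a2 : max (treeLen c r) (treeLen c V) / 2 ≤ treeLen c (.node l r) / 2 := by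
      have := max_le mr hl'; linarith
    rcases List.mem_append.mp hx with hx | hx
    · exact ih1 (hg.mono (.left l r) (.refl V)) ((BTree.HasSubtree.left l r).trans hU) hV
        (v1.mono a1) (w2.mono a1) x hx
    · exact ih2 (hg.mono (.right l r) (.refl V)) ((BTree.HasSubtree.right l r).trans hU) hV
        (v2.mono a2) (w2.mono a2) x hx

theorem AllRun.splitPair (hd : 0 < d) (hsymm : ∀ U V, ok U V → ok V U) (hC : Cells c T C)
    (hU : U.HasSubtree T) (hT : IsSplitTree c U) (h : AllRun ok (treeLen c) U o f) :
    ∀ x ∈ f, (treeLen c x.1 ≤ treeLen c x.2 → SplitPair c ok T C x.1 x.2) ∧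
      (¬ treeLen c x.1 ≤ treeLen c x.2 → SplitPair c ok T C x.2 x.1) := by
  induction h with
  | leaf => simp
  | @node l r _ _ _ _ _ _ h _ _ ihl ihr =>
    have ml := treeLen_mono (c := c) hd (BTree.HasSubtree.left l r)
    have mr := treeLen_mono (c := c) hd (BTree.HasSubtree.right l r)
    obtain ⟨v1, v2⟩ := hC.wide l r hU
    have a : max (treeLen c l) (treeLen c r) / 2 ≤ treeLen c (.node l r) / 2 := by
      have := max_le ml mr; linarith
    have hl := (BTree.HasSubtree.left l r).trans hU
    have hr := (BTree.HasSubtree.right l r).trans hU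
    intro x hx
    rcases List.mem_append.mp hx with hx | hx
    · exact h.splitPair hd hsymm hC (.of_node hT) hl hr (v1.mono a) (v2.mono a) x hx
    rcases List.mem_append.mp hx with hx | hx
    · exact ihl hl hT.1 x hx
    · exact ihr hr hT.2.1 x hx

/-- Pairs with a common second set that was split have disjoint first sets, and vice versa. -/
def Unnested (len : BTree (Fin n) → ℝ) (x y : BTree (Fin n) × BTree (Fin n)) : Prop :=
  (len x.1 ≤ len x.2 → len y.1 ≤ len y.2 → x.2 = y.2 → Disjoint x.1.labels y.1.labels) ∧
    (¬ len x.1 ≤ len x.2 → ¬ len y.1 ≤ len y.2 → x.1 = y.1 → Disjoint x.2.labels y.2.labels)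

theorem ne_of_disjoint_labels {l r U V : BTree (Fin n)} (h : Disjoint l.labels r.labels)
    (hU : U.HasSubtree l) (hV : V.HasSubtree r) : U ≠ V := by
  rintro rfl
  exact not_hasSubtree_of_disjoint h hU hV

theorem disjoint_labels {l r U V : BTree (Fin n)} (h : Disjoint l.labels r.labels)
    (hU : U.HasSubtree l) (hV : V.HasSubtree r) : Disjoint U.labels V.labels :=
  h.mono hU.labels_subset hV.labels_subset

theorem not_hasSubtree_child {l r : BTree (Fin n)} :
    ¬ (BTree.node l r).HasSubtree l ∧ ¬ (BTree.node l r).HasSubtree r :=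
  ⟨fun h => by have := h.size_le; simp only [BTree.size] at this; omega,
    fun h => by have := h.size_le; simp only [BTree.size] at this; omega⟩

/-- Below a split of `V` the two branches have disjoint second sets. So no second set occurs in
both, while a common first set has disjoint partners there. The split pair itself cannot recur with
the same `V`, since afterwards only proper subtrees of `V` occur. -/
theorem Run.pairwise {len : BTree (Fin n) → ℝ} (h : Run ok len U V o f) (hU : U.Proper)
    (hV : V.Proper) (hd : Disjoint U.labels V.labels) : f.Pairwise (Unnested len) := by
  induction h with
  | done => exact .nil
  | @right U l r _ _ _ _ _ hl h1 h2 ih1 ih2 =>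
    have hd' := Finset.disjoint_union_right.mp (show Disjoint U.labels (l.labels ∪ r.labels) from hd)
    refine List.pairwise_cons.mpr ⟨fun y hy => ⟨fun _ _ e => ?_, fun h => absurd hl h⟩,
      List.pairwise_append.mpr ⟨ih1 hU hV.1 hd'.1, ih2 hU hV.2.1 hd'.2, fun x hx y hy => ?_⟩⟩
    · simp only at e
      rcases List.mem_append.mp hy with hy | hy
      · exact absurd (e ▸ (h1.subtrees.2 y hy).2.2) not_hasSubtree_child.1
      · exact absurd (e ▸ (h2.subtrees.2 y hy).2.2) not_hasSubtree_child.2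
    · have a := (h1.subtrees.2 x hx).2.2
      have b := (h2.subtrees.2 y hy).2.2
      exact ⟨fun _ _ e => absurd e (ne_of_disjoint_labels hV.2.2 a b),
        fun _ _ _ => disjoint_labels hV.2.2 a b⟩
  | @left V l r _ _ _ _ _ hl h1 h2 ih1 ih2 =>
    have hd' := Finset.disjoint_union_left.mp (show Disjoint (l.labels ∪ r.labels) V.labels from hd)
    refine List.pairwise_cons.mpr ⟨fun y hy => ⟨fun h => absurd h hl, fun _ _ e => ?_⟩,
      List.pairwise_append.mpr ⟨ih1 hU.1 hV hd'.1, ih2 hU.2.1 hV hd'.2, fun x hx y hy => ?_⟩⟩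
    · simp only at e
      rcases List.mem_append.mp hy with hy | hy
      · exact absurd (e ▸ (h1.subtrees.2 y hy).2.1) not_hasSubtree_child.1
      · exact absurd (e ▸ (h2.subtrees.2 y hy).2.1) not_hasSubtree_child.2
    · have a := (h1.subtrees.2 x hx).2.1
      have b := (h2.subtrees.2 y hy).2.1
      exact ⟨fun _ _ _ => disjoint_labels hU.2.2 a b,
        fun _ _ e => absurd e (ne_of_disjoint_labels hU.2.2 a b)⟩

theorem AllRun.subtrees_fails {len : BTree (Fin n) → ℝ} (h : AllRun ok len T o f) :
    ∀ x ∈ f, x.1.HasSubtree T ∧ x.2.HasSubtree T := by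
  induction h with
  | leaf => simp
  | node h _ _ h1 h2 =>
    intro x hx
    rcases List.mem_append.mp hx with hx | hx
    · obtain ⟨-, b, e⟩ := h.subtrees.2 x hx
      exact ⟨b.trans (.left _ _), e.trans (.right _ _)⟩
    rcases List.mem_append.mp hx with hx | hx
    · exact ⟨(h1 x hx).1.trans (.left _ _), (h1 x hx).2.trans (.left _ _)⟩
    · exact ⟨(h2 x hx).1.trans (.right _ _), (h2 x hx).2.trans (.right _ _)⟩

theorem AllRun.pairwise {len : BTree (Fin n) → ℝ} (h : AllRun ok len T o f) (hT : T.Proper) :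
    f.Pairwise (Unnested len) := by
  induction h with
  | leaf => exact .nil
  | @node l r _ _ _ _ _ _ h hl hr ihl ihr =>
    have hd := hT.2.2
    refine List.pairwise_append.mpr ⟨h.pairwise hT.1 hT.2.1 hd, List.pairwise_append.mpr
      ⟨ihl hT.1, ihr hT.2.1, fun x hx y hy => ?_⟩, fun x hx y hy => ?_⟩
    · have a := hl.subtrees_fails x hx
      have b := hr.subtrees_fails y hy
      exact ⟨fun _ _ _ => disjoint_labels hd a.1 b.1, fun _ _ _ => disjoint_labels hd a.2 b.2⟩
    · have a := (h.subtrees.2 x hx).2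
      rcases List.mem_append.mp hy with hy | hy
      · have b := hl.subtrees_fails y hy
        exact ⟨fun _ _ e => absurd e.symm (ne_of_disjoint_labels hd b.2 a.2),
          fun _ _ _ => (disjoint_labels hd b.2 a.2).symm⟩
      · have b := hr.subtrees_fails y hy
        exact ⟨fun _ _ _ => disjoint_labels hd a.1 b.1,
          fun _ _ e => absurd e (ne_of_disjoint_labels hd a.1 b.1)⟩

end

open MeasureTheory

/-! ## Packing -/

/-- The volume of the unit ball. -/
def unitVol (d : ℕ) : ℝ := √Real.pi ^ d / Real.Gamma (d / 2 + 1)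

theorem unitVol_pos (d : ℕ) : 0 < unitVol d :=
  div_pos (pow_pos (Real.sqrt_pos.mpr Real.pi_pos) _) (Real.Gamma_pos_of_pos (by positivity))

theorem volume_closedBall {d : ℕ} (hd : 0 < d) (x : Pt d) {R : ℝ} (hR : 0 ≤ R) :
    volume (Metric.closedBall x R) = ENNReal.ofReal (R ^ d * unitVol d) := by
  have : Nonempty (Fin d) := ⟨⟨0, hd⟩⟩
  rw [EuclideanSpace.volume_closedBall, Fintype.card_fin, ENNReal.ofReal_mul (by positivity),
    ENNReal.ofReal_pow hR, unitVol]

theorem halfOpenBox_eq {d : ℕ} (p : (Fin d → ℝ) × (Fin d → ℝ)) :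
    halfOpenBox p = (WithLp.ofLp : Pt d → Fin d → ℝ) ⁻¹'
      (Set.pi Set.univ fun k => Set.Ioc (p.1 k) (p.2 k)) := by
  ext x; simp [halfOpenBox, Set.mem_pi]

theorem measurableSet_halfOpenBox {d : ℕ} (p : (Fin d → ℝ) × (Fin d → ℝ)) :
    MeasurableSet (halfOpenBox p) := by
  rw [halfOpenBox_eq]
  exact (PiLp.volume_preserving_ofLp (Fin d)).measurable
    (MeasurableSet.univ_pi fun k => measurableSet_Ioc)

theorem volume_halfOpenBox {d : ℕ} (p : (Fin d → ℝ) × (Fin d → ℝ)) :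
    volume (halfOpenBox p) = ∏ k, ENNReal.ofReal (p.2 k - p.1 k) := by
  rw [halfOpenBox_eq, (PiLp.volume_preserving_ofLp (Fin d)).measure_preimage
    (MeasurableSet.univ_pi fun k => measurableSet_Ioc).nullMeasurableSet, Real.volume_pi_Ioc]

/-- Comparison of the total volume of the disjoint sets with the volume of the ball that contains
them. -/
theorem packing {d : ℕ} (hd : 0 < d) {ι : Type*} (F : Finset ι) (A : ι → Set (Pt d)) {v R : ℝ}
    {b : Pt d} (hR : 0 ≤ R) (hv : 0 ≤ v) (hm : ∀ i ∈ F, MeasurableSet (A i))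
    (hA : ∀ i ∈ F, volume (A i) = ENNReal.ofReal v)
    (hdis : ∀ i ∈ F, ∀ j ∈ F, i ≠ j → Disjoint (A i) (A j))
    (hsub : ∀ i ∈ F, A i ⊆ Metric.closedBall b R) : F.card * v ≤ R ^ d * unitVol d := by
  have h1 : volume (⋃ i ∈ F, A i) = ENNReal.ofReal (F.card * v) := by
    rw [measure_biUnion_finset (fun i hi j hj hij => hdis i hi j hj hij) hm,
      Finset.sum_congr rfl hA, Finset.sum_const, nsmul_eq_mul, ENNReal.ofReal_mul (by positivity),
      ENNReal.ofReal_natCast]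
  have h2 : volume (⋃ i ∈ F, A i) ≤ volume (Metric.closedBall b R) :=
    measure_mono (Set.iUnion₂_subset hsub)
  rw [h1, volume_closedBall hd b hR] at h2
  exact (ENNReal.ofReal_le_ofReal_iff (mul_nonneg (by positivity) (unitVol_pos d).le)).mp h2

/-- In each coordinate the interval of length `t` ends at `x k`, unless it would then leave the box
from below, in which case it starts at the lower end of the box. Either way its points are within
`t` of `x k`. -/
theorem exists_cube {d : ℕ} {p : (Fin d → ℝ) × (Fin d → ℝ)} {t : ℝ} {x : Pt d} (ht : 0 ≤ t)
    (hp : Wide p t) (hx : x ∈ halfOpenBox p) :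
    ∃ a : Fin d → ℝ, halfOpenBox (a, fun k => a k + t) ⊆ halfOpenBox p ∧
      ∀ y ∈ halfOpenBox (a, fun k => a k + t), dist y x ≤ √d * t := by
  refine ⟨fun k => max (p.1 k) (x k - t), fun y hy k => ?_, fun y hy => ?_⟩
  · obtain ⟨h1, h2⟩ := hy k
    simp only at h1 h2
    refine ⟨(le_max_left _ _).trans_lt h1, h2.trans ?_⟩
    have := hp k
    have := (hx k).2
    rcases max_choice (p.1 k) (x k - t) with e | e <;> rw [e] <;> linarith
  · rw [EuclideanSpace.dist_eq]
    refine Real.sqrt_le_left (by positivity) |>.mpr ?_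
    rw [mul_pow, Real.sq_sqrt (by positivity)]
    calc ∑ k, dist (y k) (x k) ^ 2 ≤ ∑ _k : Fin d, t ^ 2 := by
          refine Finset.sum_le_sum fun k _ => ?_
          rw [Real.dist_eq, sq_abs]
          obtain ⟨h1, h2⟩ := hy k
          simp only at h1 h2
          have := (hx k).1
          have := le_max_left (p.1 k) (x k - t)
          have := le_max_right (p.1 k) (x k - t)
          refine sq_le_sq' (by linarith) ?_
          rcases max_choice (p.1 k) (x k - t) with e | e <;> rw [e] at h2 <;> linarith
      _ = _ := by simp

section

variable {d n : ℕ} {c : Fin n → Pt d} {r : Fin n → ℝ} {s : ℝ} {T V : BTree (Fin n)}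
  {C : BTree (Fin n) → (Fin d → ℝ) × (Fin d → ℝ)} {F : Finset (BTree (Fin n))}

/-- Let `t` be half the length of `V`. Both half diagonals are at most `√d * t`, so failure of the
criterion puts the box centres at distance less than `(3s+8) * √d * t`. The cell of `U` has all
sides at least `t` and contains a cube of side `t` within `√d * t` of a point of `U`. These cubes
are disjoint and lie within `(3s+10) * √d * t` of the box centre of `V`; `3s+11` leaves some room.
-/
theorem card_not_centreCrit (hd : 0 < d) (hs : 0 < s) (hC : Cells c T C)
    (hF : ∀ U ∈ F, SplitPair c (BallCrit c r s) T C U V ∧ ¬ CentreCrit c s U V)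
    (hdis : ∀ U ∈ F, ∀ U' ∈ F, U ≠ U' → Disjoint U.labels U'.labels) :
    (F.card : ℝ) ≤ ((3 * s + 11) * √d) ^ d * unitVol d := by
  rcases F.eq_empty_or_nonempty with rfl | ⟨U0, hU0⟩
  · simp only [Finset.card_empty, Nat.cast_zero]
    have := unitVol_pos d
    positivity
  have hlen : 0 < treeLen c V := by
    obtain ⟨l, r', rfl⟩ := (hF U0 hU0).1.node
    exact (hF U0 hU0).1.good.right.treeLen_pos
  set t := treeLen c V / 2 with ht
  have ht0 : 0 < t := by positivity
  have hex : ∀ U : BTree (Fin n), ∃ a : Fin d → ℝ, U ∈ F →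
      halfOpenBox (a, fun k => a k + t) ⊆ halfOpenBox (C U) ∧
      ∃ i ∈ U.labels, ∀ y ∈ halfOpenBox (a, fun k => a k + t), dist y (c i) ≤ √d * t := by
    intro U
    by_cases hU : U ∈ F
    · obtain ⟨i, hi⟩ := U.labels_nonempty
      obtain ⟨a, h1, h2⟩ := exists_cube ht0.le (hF U hU).1.wide
        (hC.mem U (hF U hU).1.left i hi)
      exact ⟨a, fun _ => ⟨h1, i, hi, h2⟩⟩
    · exact ⟨0, fun h => absurd h hU⟩
  choose a ha using hex
  have h := packing hd F (fun U => halfOpenBox (a U, fun k => a U k + t)) (v := t ^ d)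
    (R := (3 * s + 11) * √d * t) (b := boxCtr c V.labels) (by positivity) (by positivity)
    (fun U _ => measurableSet_halfOpenBox _)
    (fun U _ => by rw [volume_halfOpenBox]; simp [ENNReal.ofReal_pow ht0.le])
    (fun U hU U' hU' hne => (hC.disj U U' (hF U hU).1.left (hF U' hU').1.left
      (hdis U hU U' hU' hne)).mono (ha U hU).1 (ha U' hU').1)
    (by
      intro U hU y hy
      obtain ⟨-, i, hi, h2⟩ := ha U hU
      obtain ⟨hsp, hn⟩ := hF U hU
      have e1 := h2 y hy
      have e2 : dist (c i) (boxCtr c U.labels) ≤ boxRad c U.labels :=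
        dist_boxCtr_le fun k => ⟨boxLo_le hi k, le_boxHi hi k⟩
      have hlenU : treeLen c U / 2 ≤ t := by have := hsp.len; linarith
      have e3 : boxRad c U.labels ≤ √d * t :=
        (boxRad_le hd U.labels_nonempty).trans (mul_le_mul_of_nonneg_left hlenU (by positivity))
      have e4 : boxRad c V.labels ≤ √d * t := boxRad_le hd V.labels_nonempty
      have e5 : ctrDist c U V < (3 * s + 8) * (√d * t) := by
        by_contra! h
        exact hn ⟨(mul_le_mul_of_nonneg_left e3 (by positivity)).trans h,
          (mul_le_mul_of_nonneg_left e4 (by positivity)).trans h⟩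
      rw [ctrDist] at e5
      rw [Metric.mem_closedBall]
      have e6 := dist_triangle4 y (c i) (boxCtr c U.labels) (boxCtr c V.labels)
      have : 0 ≤ √d * t := by positivity
      nlinarith)
  rw [mul_pow ((3 * s + 11) * √d) t d] at h
  have h0 : 0 < t ^ d := by positivity
  refine le_of_mul_le_mul_right (h.trans_eq ?_) h0
  ring

/-- Only the condition for the leaf `U = {i}` fails, so the distance `D` from `c i` to the box
centre `b` satisfies `(3s+8)ρ ≤ D < (3s+5)ρ + r i`. The point of the segment from `b` to `c i` at
distance `(3s+8)ρ` from `b` is therefore more than `3ρ` deep inside the ball of `i`. The balls of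
radius `3ρ` around these points are disjoint, as they lie in different input balls, and they are
contained in the ball of radius `(3s+12)ρ` around `b`. The ratio of the radii is `s + 4`. -/
theorem card_not_leafCrit (hd : 0 < d) (hs : 0 < s) (hb : DisjointBalls c r)
    (hF : ∀ U ∈ F, SplitPair c (BallCrit c r s) T C U V ∧ CentreCrit c s U V) :
    (F.card : ℝ) ≤ (s + 4) ^ d := by
  rcases F.eq_empty_or_nonempty with rfl | ⟨U0, hU0⟩
  · simp only [Finset.card_empty, Nat.cast_zero]
    positivity
  obtain ⟨l, r', hV⟩ := (hF U0 hU0).1.node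
  set ρ := boxRad c V.labels with hρ
  set b := boxCtr c V.labels with hbdef
  have hρ0 : 0 < ρ := by
    have h1 := (hV ▸ (hF U0 hU0).1.good.right).treeLen_pos
    rw [← hV] at h1
    have h2 := half_boxLen_le_boxRad (c := c) (S := V.labels) hd
    unfold treeLen at h1
    exact lt_of_lt_of_le (by linarith) h2
  have hex : ∀ U : BTree (Fin n), ∃ (i : Fin n) (z : Pt d), U ∈ F → U = .leaf i ∧
      dist z b ≤ (3 * s + 8) * ρ ∧ dist z (c i) ≤ r i - 3 * ρ := by
    intro U
    by_cases hU : U ∈ F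
    · obtain ⟨hsp, hk⟩ := hF U hU
      have hn := hsp.not_ok
      have hVU : LeafCrit c r s V U := by rw [hV]; rintro _ ⟨⟩
      have hUV : ¬ LeafCrit c r s U V := fun h => hn ⟨hk, h, hVU⟩
      unfold LeafCrit at hUV
      push Not at hUV
      obtain ⟨i, rfl, hi⟩ := hUV
      have h2 := hk.2
      rw [ctrDist, BTree.labels, boxCtr_singleton] at hi h2
      set D := dist (c i) b with hD
      have hD0 : 0 < D := lt_of_lt_of_le (by positivity) h2
      have hDn : ‖c i - b‖ = D := (dist_eq_norm _ _).symm
      -- The fraction of the way from the box centre to `c i` at which the point is chosen; it is at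
      -- most `1` by the centre criterion.
      set q := (3 * s + 8) * ρ / D with hq
      have hqD : q * D = (3 * s + 8) * ρ := by rw [hq]; field_simp
      have hq0 : 0 ≤ q := by positivity
      have hq1 : q ≤ 1 := (div_le_one hD0).mpr h2
      refine ⟨i, b + q • (c i - b), fun _ => ⟨rfl, ?_, ?_⟩⟩
      · rw [dist_eq_norm, add_sub_cancel_left, norm_smul, hDn, Real.norm_of_nonneg hq0, hqD]
      · have e : b + q • (c i - b) - c i = (1 - q) • (b - c i) := by module
        rw [dist_eq_norm, e, norm_smul, norm_sub_rev b, hDn, Real.norm_of_nonneg (by linarith)]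
        linarith
    -- Outside `F` the choice is arbitrary; some index exists because `V` has a label.
    · have : n ≠ 0 := by
        obtain ⟨i, -⟩ := V.labels_nonempty
        have := i.2; omega
      exact ⟨⟨0, by omega⟩, 0, fun h => absurd h hU⟩
  choose i z hz using hex
  have hsub : ∀ U ∈ F, Metric.closedBall (z U) (3 * ρ) ⊆ Metric.closedBall (c (i U)) (r (i U)) :=
    fun U hU => Metric.closedBall_subset_closedBall' (by have := (hz U hU).2.2; linarith)
  have h := packing hd F (fun U => Metric.closedBall (z U) (3 * ρ)) (v := (3 * ρ) ^ d * unitVol d)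
    (R := (3 * s + 12) * ρ) (b := b) (by positivity)
    (mul_nonneg (by positivity) (unitVol_pos d).le)
    (fun U _ => Metric.isClosed_closedBall.measurableSet)
    (fun U _ => volume_closedBall hd _ (by positivity))
    (fun U hU U' hU' hne => by
      refine (hb.2 (i U) (i U') fun e => hne ?_).mono (hsub U hU) (hsub U' hU')
      rw [(hz U hU).1, (hz U' hU').1, e])
    (fun U hU => Metric.closedBall_subset_closedBall' (by have := (hz U hU).2.1; linarith))
  have h0 : 0 < (3 * ρ) ^ d * unitVol d := mul_pos (by positivity) (unitVol_pos d)
  refine le_of_mul_le_mul_right (h.trans_eq ?_) h0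
  rw [← mul_assoc, ← mul_pow]
  congr 2
  ring

/-- A bound for the number of the pairs that are split at a given set. -/
def splitBound (d : ℕ) (s : ℝ) : ℝ := ((3 * s + 11) * √d) ^ d * unitVol d + (s + 4) ^ d

theorem card_splitPair (hd : 0 < d) (hs : 0 < s) (hb : DisjointBalls c r) (hC : Cells c T C)
    (hF : ∀ U ∈ F, SplitPair c (BallCrit c r s) T C U V)
    (hdis : ∀ U ∈ F, ∀ U' ∈ F, U ≠ U' → Disjoint U.labels U'.labels) :
    (F.card : ℝ) ≤ splitBound d s := by
  classical
  rw [← Finset.card_filter_add_card_filter_not (s := F) (fun U => ¬ CentreCrit c s U V),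
    Nat.cast_add, splitBound]
  refine add_le_add (card_not_centreCrit (r := r) (V := V) hd hs hC ?_ ?_)
    (card_not_leafCrit (T := T) (C := C) (V := V) hd hs hb ?_)
  · intro U hU
    rw [Finset.mem_filter] at hU
    exact ⟨hF U hU.1, hU.2⟩
  · intro U hU U' hU'
    exact hdis U (Finset.mem_of_mem_filter U hU) U' (Finset.mem_of_mem_filter U' hU')
  · intro U hU
    rw [Finset.mem_filter] at hU
    exact ⟨hF U hU.1, not_not.mp hU.2⟩

/-- The list of the subtrees of a tree. -/
def BTree.subtrees {ι : Type} : BTree ι → List (BTree ι)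
  | .leaf i => [.leaf i]
  | .node l r => .node l r :: (l.subtrees ++ r.subtrees)

theorem BTree.HasSubtree.mem_subtrees {ι : Type} {U T : BTree ι} (h : U.HasSubtree T) :
    U ∈ T.subtrees := by
  induction T with
  | leaf i => cases h; simp [BTree.subtrees]
  | node l r ihl ihr =>
    rcases h with rfl | h | h
    · simp [BTree.subtrees]
    · simp [BTree.subtrees, ihl h]
    · simp [BTree.subtrees, ihr h]

theorem BTree.length_subtrees {ι : Type} (T : BTree ι) : T.subtrees.length = T.size := by
  induction T with
  | leaf i => rfl
  | node l r ihl ihr => simp [BTree.subtrees, BTree.size, ihl, ihr]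

theorem BTree.Proper.size_eq (h : T.Proper) : T.size + 1 = 2 * T.labels.card := by
  induction T with
  | leaf i => simp [BTree.size, BTree.labels]
  | node l r ihl ihr =>
    rw [BTree.labels, Finset.card_union_of_disjoint h.2.2, BTree.size]
    have := ihl h.1
    have := ihr h.2.1
    omega

theorem length_le_of_fibers {α β : Type} (g : α → β) (l : List α) (S : List β) {N : ℝ}
    (hN : 0 ≤ N) (hl : l.Nodup) (hS : ∀ x ∈ l, g x ∈ S)
    (h : ∀ y, ∀ G : Finset α, (∀ x ∈ G, x ∈ l ∧ g x = y) → (G.card : ℝ) ≤ N) :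
    (l.length : ℝ) ≤ N * S.length := by
  classical
  have h1 := Finset.card_le_mul_card_image_of_maps_to (s := l.toFinset) (t := S.toFinset) (f := g)
    (fun x hx => by simpa using hS x (by simpa using hx)) ⌊N⌋₊
    (fun y _ => Nat.le_floor (h y _ fun x hx => by simpa using hx))
  rw [List.toFinset_card_of_nodup hl] at h1
  have h2 : (l.length : ℝ) ≤ (⌊N⌋₊ : ℝ) * (S.toFinset.card : ℝ) := by exact_mod_cast h1
  refine h2.trans (mul_le_mul (Nat.floor_le hN) ?_ (by positivity) hN)
  exact_mod_cast S.toFinset_card_le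

theorem BallCrit.symm {U V : BTree (Fin n)} (h : BallCrit c r s U V) : BallCrit c r s V U :=
  ⟨h.1.symm, h.2.2, h.2.1⟩

/-- The number of the pairs that are split. -/
theorem AllRun.length_fails_le (hd : 0 < d) (hs : 0 < s) (hb : DisjointBalls c r)
    (hT : IsSplitTree c T) {o f : List (BTree (Fin n) × BTree (Fin n))}
    (h : AllRun (BallCrit c r s) (treeLen c) T o f) :
    (f.length : ℝ) ≤ 2 * (splitBound d s * T.size) := by
  classical
  obtain ⟨C, hC⟩ := hT.exists_cells hd
  have hsp := h.splitPair hd (fun _ _ => BallCrit.symm) hC (.refl T) hT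
  have hpw := h.pairwise hT.proper
  have hN : 0 ≤ splitBound d s :=
    add_nonneg (mul_nonneg (by positivity) (unitVol_pos d).le) (by positivity)
  have hne : ∀ U : BTree (Fin n), ¬ Disjoint U.labels U.labels := fun U h => by
    obtain ⟨i, hi⟩ := U.labels_nonempty
    exact Finset.disjoint_left.mp h hi hi
  have hnd : f.Nodup := by
    refine hpw.imp fun {x y} hxy e => ?_
    subst e
    by_cases hl : treeLen c x.1 ≤ treeLen c x.2
    · exact hne _ (hxy.1 hl hl rfl)
    · exact hne _ (hxy.2 hl hl rfl)
  have hpw' : ∀ x ∈ f, ∀ y ∈ f, x ≠ y → Unnested (treeLen c) x y := by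
    have : Std.Symm (Unnested (n := n) (treeLen c)) := ⟨fun x y ⟨h1, h2⟩ =>
      ⟨fun a b e => (h1 b a e.symm).symm, fun a b e => (h2 b a e.symm).symm⟩⟩
    exact fun x hx y hy => List.Pairwise.forall hpw hx hy
  -- Pairs split at their second set are charged to it, and in `key2` the others to their first set.
  -- A node can be charged in both ways, whence the factor 2.
  have key1 : ((f.filter fun x => decide (treeLen c x.1 ≤ treeLen c x.2)).length : ℝ) ≤
      splitBound d s * T.subtrees.length := by
    refine length_le_of_fibers Prod.snd _ _ hN (hnd.filter _) ?_ ?_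
    · intro x hx
      simp only [List.mem_filter, decide_eq_true_eq] at hx
      exact ((hsp x hx.1).1 hx.2).right.mem_subtrees
    · intro V G hG
      simp only [List.mem_filter, decide_eq_true_eq] at hG
      have hinj : Set.InjOn Prod.fst (G : Set (BTree (Fin n) × BTree (Fin n))) := by
        rintro x hx y hy e
        exact Prod.ext e ((hG x hx).2.trans (hG y hy).2.symm)
      rw [← Finset.card_image_of_injOn hinj]
      refine card_splitPair (r := r) (V := V) (T := T) (C := C) hd hs hb hC ?_ ?_
      · intro U hU
        obtain ⟨x, hx, rfl⟩ := Finset.mem_image.mp hU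
        obtain ⟨⟨h1, h2⟩, h3⟩ := hG x hx
        rw [← h3]
        exact (hsp x h1).1 h2
      · intro U hU U' hU' hne'
        obtain ⟨x, hx, rfl⟩ := Finset.mem_image.mp hU
        obtain ⟨y, hy, rfl⟩ := Finset.mem_image.mp hU'
        obtain ⟨⟨h1, h2⟩, h3⟩ := hG x hx
        obtain ⟨⟨h1', h2'⟩, h3'⟩ := hG y hy
        exact (hpw' x h1 y h1' fun e => hne' (by rw [e])).1 h2 h2' (h3.trans h3'.symm)
  have key2 : ((f.filter fun x => !decide (treeLen c x.1 ≤ treeLen c x.2)).length : ℝ) ≤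
      splitBound d s * T.subtrees.length := by
    refine length_le_of_fibers Prod.fst _ _ hN (hnd.filter _) ?_ ?_
    · intro x hx
      simp only [List.mem_filter, Bool.not_eq_true', decide_eq_false_iff_not] at hx
      exact ((hsp x hx.1).2 hx.2).right.mem_subtrees
    · intro V G hG
      simp only [List.mem_filter, Bool.not_eq_true', decide_eq_false_iff_not] at hG
      have hinj : Set.InjOn Prod.snd (G : Set (BTree (Fin n) × BTree (Fin n))) := by
        rintro x hx y hy e
        exact Prod.ext ((hG x hx).2.trans (hG y hy).2.symm) e
      rw [← Finset.card_image_of_injOn hinj]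
      refine card_splitPair (r := r) (V := V) (T := T) (C := C) hd hs hb hC ?_ ?_
      · intro U hU
        obtain ⟨x, hx, rfl⟩ := Finset.mem_image.mp hU
        obtain ⟨⟨h1, h2⟩, h3⟩ := hG x hx
        rw [← h3]
        exact (hsp x h1).2 h2
      · intro U hU U' hU' hne'
        obtain ⟨x, hx, rfl⟩ := Finset.mem_image.mp hU
        obtain ⟨y, hy, rfl⟩ := Finset.mem_image.mp hU'
        obtain ⟨⟨h1, h2⟩, h3⟩ := hG x hx
        obtain ⟨⟨h1', h2'⟩, h3'⟩ := hG y hy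
        exact (hpw' x h1 y h1' fun e => hne' (by rw [e])).2 h2 h2' (h3.trans h3'.symm)
  have hsum : f.length = (f.filter fun x => decide (treeLen c x.1 ≤ treeLen c x.2)).length +
      (f.filter fun x => !decide (treeLen c x.1 ≤ treeLen c x.2)).length := by
    rw [← List.countP_eq_length_filter, ← List.countP_eq_length_filter]
    exact (List.length_eq_countP_add_countP
      (fun x : BTree (Fin n) × BTree (Fin n) => decide (treeLen c x.1 ≤ treeLen c x.2))).trans
      (by congr 1; exact List.countP_congr fun x _ => by simp)
  rw [T.length_subtrees] at key1 key2
  rw [hsum]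
  push_cast
  linarith

end

/-! ## Estimates -/

/-- With `G = Γ(d/2+1)` and `H = Γ((d+1)/2)`, the duplication formula gives `H * G = √π * d! / 2^d`.
Log-convexity at the midpoint of `d/2` and `d/2+1` gives `H² ≤ Γ(d/2) * G ≤ 2 * G²`. Together `π *
(d!/2^d)² ≤ 2 * G⁴`, and `π ≥ 2`. -/
theorem factorial_le_gamma_sq {d : ℕ} (hd : 1 ≤ d) :
    (d.factorial : ℝ) / 2 ^ d ≤ Real.Gamma (d / 2 + 1) ^ 2 := by
  set G := Real.Gamma ((d : ℝ) / 2 + 1) with hG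
  set H := Real.Gamma (((d : ℝ) + 1) / 2) with hH
  have hd' : (1 : ℝ) ≤ d := by exact_mod_cast hd
  have hG0 : 0 < G := Real.Gamma_pos_of_pos (by positivity)
  have hH0 : 0 < H := Real.Gamma_pos_of_pos (by positivity)
  have h1 : H * G = d.factorial / 2 ^ d * √Real.pi := by
    have h := Real.Gamma_mul_Gamma_add_half (((d : ℝ) + 1) / 2)
    have e1 : ((d : ℝ) + 1) / 2 + 1 / 2 = d / 2 + 1 := by ring
    have e2 : 2 * (((d : ℝ) + 1) / 2) = d + 1 := by ring
    have e3 : (1 : ℝ) - (d + 1) = -d := by ring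
    rw [e1, e2, e3, Real.Gamma_nat_eq_factorial, Real.rpow_neg (by norm_num),
      Real.rpow_natCast] at h
    rw [hH, hG, h]; ring
  have h2 : H ^ 2 ≤ 2 * G ^ 2 := by
    have h := Real.Gamma_mul_add_mul_le_rpow_Gamma_mul_rpow_Gamma (s := (d : ℝ) / 2)
      (t := (d : ℝ) / 2 + 1) (a := 1 / 2) (b := 1 / 2) (by positivity) (by positivity)
      (by norm_num) (by norm_num) (by norm_num)
    have e1 : 1 / 2 * ((d : ℝ) / 2) + 1 / 2 * (d / 2 + 1) = (d + 1) / 2 := by ring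
    have hg0 : 0 ≤ Real.Gamma ((d : ℝ) / 2) := (Real.Gamma_pos_of_pos (by positivity)).le
    rw [e1, ← Real.mul_rpow hg0 hG0.le, ← Real.sqrt_eq_rpow] at h
    have h3 := Real.Gamma_add_one (s := (d : ℝ) / 2) (by positivity)
    have h4 : H ^ 2 ≤ Real.Gamma ((d : ℝ) / 2) * G := by
      have := pow_le_pow_left₀ hH0.le h 2
      rwa [Real.sq_sqrt (by positivity)] at this
    rw [← hG] at h3
    have h5 : Real.Gamma ((d : ℝ) / 2) ≤ 2 * G := by rw [h3]; nlinarith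
    nlinarith
  have h3 : (d.factorial / 2 ^ d : ℝ) ^ 2 * Real.pi ≤ 2 * (G ^ 2) ^ 2 := by
    calc (d.factorial / 2 ^ d : ℝ) ^ 2 * Real.pi = (H * G) ^ 2 := by
          rw [h1, mul_pow, Real.sq_sqrt Real.pi_pos.le]
      _ = H ^ 2 * G ^ 2 := by ring
      _ ≤ (2 * G ^ 2) * G ^ 2 := by gcongr
      _ = _ := by ring
  have h4 := Real.two_le_pi
  refine le_of_sq_le_sq ?_ (by positivity)
  nlinarith [sq_nonneg (d.factorial / 2 ^ d : ℝ)]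

theorem unitVol_sq_le {d : ℕ} (hd : 1 ≤ d) : unitVol d ^ 2 ≤ 8 ^ d / d.factorial := by
  have h := factorial_le_gamma_sq hd
  have h0 : (0 : ℝ) < d.factorial / 2 ^ d := by positivity
  rw [unitVol, div_pow, ← pow_mul, mul_comm d 2, pow_mul, Real.sq_sqrt Real.pi_pos.le]
  calc Real.pi ^ d / Real.Gamma (d / 2 + 1) ^ 2 ≤ 4 ^ d / (d.factorial / 2 ^ d) := by
        gcongr
        exact Real.pi_le_four
    _ = _ := by
        rw [div_div_eq_mul_div, ← mul_pow]; norm_num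

theorem natCast_sq_le_four_pow (d : ℕ) : (d : ℝ) ^ 2 ≤ 4 ^ d := by
  have h : (d : ℝ) ≤ 2 ^ d := by exact_mod_cast Nat.lt_two_pow_self.le
  calc (d : ℝ) ^ 2 ≤ (2 ^ d) ^ 2 := by gcongr
    _ = 4 ^ d := by rw [← pow_mul, mul_comm, pow_mul]; norm_num

/-- A bound on the square by a number that is at least `1` bounds the number itself. This allows
half-integral powers of `d` to be handled after squaring, without taking roots again. -/
theorem le_of_sq_le_exp {a x : ℝ} (hx : 0 ≤ x) (h : a ^ 2 ≤ Real.exp x) : a ≤ Real.exp x := by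
  have := Real.one_le_exp hx
  nlinarith

/-- Both summands are squared. For the first one, `v² ≤ 8^d/d!`, `d² ≤ 4^d` and `d^d ≤ 3^d * d!`
leave `(8*8*4*196*3)^d / d!`: of the factorial squared in the denominator one factor survives the
power of `√d`. The second one leaves `(8*4*25)^d / d!`. Each is a term of an exponential series,
hence bounded independently of `d`. -/
theorem exists_splitBound_le : ∃ K : ℝ, 0 < K ∧ ∀ d : ℕ, 1 ≤ d →
    d * (((14 * √d) ^ d * unitVol d + 5 ^ d) * unitVol d) ≤ K := by
  refine ⟨Real.exp (8 * 8 * 4 * 196 * 3) + Real.exp (8 * 4 * 25), by positivity, fun d hd => ?_⟩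
  have hV := unitVol_sq_le hd
  have hV0 := unitVol_pos d
  have h2 := natCast_sq_le_four_pow d
  have hf : (0 : ℝ) < d.factorial := by positivity
  have hA : d * (14 * √d) ^ d * unitVol d ^ 2 ≤ Real.exp (8 * 8 * 4 * 196 * 3) := by
    refine le_of_sq_le_exp (by norm_num) ?_
    have hdd : (d : ℝ) ^ d ≤ 3 ^ d * d.factorial := by
      have h := Real.pow_div_factorial_le_exp (d : ℝ) (by positivity) d
      rw [div_le_iff₀ hf] at h
      refine h.trans ?_
      gcongr
      rw [← mul_one (d : ℝ), Real.exp_nat_mul]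
      gcongr
      exact Real.exp_one_lt_three.le
    calc (d * (14 * √d) ^ d * unitVol d ^ 2) ^ 2
        = (unitVol d ^ 2) ^ 2 * (d : ℝ) ^ 2 * ((14 * √d) ^ 2) ^ d := by
          rw [← pow_mul (14 * √d), mul_comm 2 d, pow_mul]; ring
      _ = (unitVol d ^ 2) ^ 2 * (d : ℝ) ^ 2 * (196 ^ d * (d : ℝ) ^ d) := by
          have e : (14 * √(d : ℝ)) ^ 2 = 196 * d := by
            rw [mul_pow, Real.sq_sqrt (by positivity)]; norm_num
          rw [e, mul_pow]
      _ ≤ (8 ^ d / d.factorial) ^ 2 * 4 ^ d * (196 ^ d * (3 ^ d * d.factorial)) := by gcongr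
      _ = (8 * 8 * 4 * 196 * 3) ^ d / d.factorial := by
          simp only [mul_pow]; field_simp
      _ ≤ _ := Real.pow_div_factorial_le_exp _ (by norm_num) d
  have hB : d * 5 ^ d * unitVol d ≤ Real.exp (8 * 4 * 25) := by
    refine le_of_sq_le_exp (by norm_num) ?_
    calc ((d : ℝ) * 5 ^ d * unitVol d) ^ 2 = unitVol d ^ 2 * (d : ℝ) ^ 2 * (5 ^ 2) ^ d := by
          rw [← pow_mul, mul_comm 2 d, pow_mul]; ring
      _ ≤ (8 ^ d / (d.factorial : ℝ)) * 4 ^ d * (5 ^ 2) ^ d := by gcongr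
      _ = (8 * 4 * 25 : ℝ) ^ d / (d.factorial : ℝ) := by
          rw [mul_pow, mul_pow, show (5 : ℝ) ^ 2 = 25 by norm_num]; ring
      _ ≤ _ := Real.pow_div_factorial_le_exp _ (by norm_num) d
  calc d * (((14 * √d) ^ d * unitVol d + 5 ^ d) * unitVol d)
      = d * (14 * √d) ^ d * unitVol d ^ 2 + d * 5 ^ d * unitVol d := by ring
    _ ≤ _ := add_le_add hA hB

theorem sepFactor_eq (d : ℕ) (s : ℝ) : sepFactor d s = max s 1 ^ d / unitVol d := by
  have h : √Real.pi ^ d = Real.pi ^ ((d : ℝ) / 2) := by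
    rw [Real.sqrt_eq_rpow, ← Real.rpow_natCast, ← Real.rpow_mul Real.pi_pos.le]
    congr 1; ring
  rw [sepFactor, unitVol, h, div_div_eq_mul_div]

/-- With `w = max(s,1)` one has `3s+11 ≤ 14w` and `s+4 ≤ 5w`, so the power `w^d` splits off and
matches that in `sepFactor`; multiplying by the volume of the unit ball reduces the claim to
`exists_splitBound_le`. The bound on `d` alone lets `sepFactor` absorb the size `d * n` of the
input. -/
theorem exists_sepFactor_bounds : ∃ K : ℝ, 0 < K ∧ ∀ (d : ℕ) (s : ℝ), 1 ≤ d → 0 < s →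
    d ≤ K * sepFactor d s ∧ d * splitBound d s ≤ K * sepFactor d s := by
  obtain ⟨K, hK, h⟩ := exists_splitBound_le
  refine ⟨K, hK, fun d s hd hs => ?_⟩
  have h1 := h d hd
  have hV := unitVol_pos d
  set w := max s 1 with hw
  have hw1 : 1 ≤ w := le_max_right _ _
  have hws : s ≤ w := le_max_left _ _
  have hwd : 1 ≤ w ^ d := one_le_pow₀ hw1
  have hb : splitBound d s ≤ w ^ d * ((14 * √d) ^ d * unitVol d + 5 ^ d) := by
    calc splitBound d s ≤ ((14 * w) * √d) ^ d * unitVol d + (5 * w) ^ d := by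
          rw [splitBound]
          gcongr <;> linarith
      _ = _ := by simp only [mul_pow]; ring
  have hb1 : 1 ≤ (14 * √d) ^ d * unitVol d + 5 ^ d := by
    have h5 : (1 : ℝ) ≤ 5 ^ d := one_le_pow₀ (by norm_num)
    have : 0 ≤ (14 * √d) ^ d * unitVol d := by positivity
    linarith
  have key : d * (w ^ d * ((14 * √d) ^ d * unitVol d + 5 ^ d)) ≤ K * sepFactor d s := by
    rw [sepFactor_eq, ← hw, ← mul_div_assoc, le_div_iff₀ hV]
    calc d * (w ^ d * ((14 * √d) ^ d * unitVol d + 5 ^ d)) * unitVol d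
        = w ^ d * (d * (((14 * √d) ^ d * unitVol d + 5 ^ d) * unitVol d)) := by ring
      _ ≤ w ^ d * K := by gcongr
      _ = _ := mul_comm _ _
  refine ⟨le_trans ?_ key, le_trans ?_ key⟩
  · exact le_mul_of_one_le_right (by positivity) (one_le_mul_of_one_le_of_one_le hwd hb1)
  · gcongr

/-! ### Adding up time and space -/

theorem log_two_add_one_le {n : ℕ} (hn : 1 ≤ n) :
    ((Nat.log 2 n + 1 : ℕ) : ℝ) ≤ 4 * Real.log (n + 1) ∧ 1 ≤ 2 * Real.log (n + 1) := by
  have hn' : (1 : ℝ) ≤ n := by exact_mod_cast hn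
  have h2 : (1 / 2 : ℝ) ≤ Real.log 2 := by have := Real.log_two_gt_d9; linarith
  have h3 : Real.log 2 ≤ Real.log (n + 1) := Real.log_le_log (by norm_num) (by linarith)
  have h4 : (Nat.log 2 n : ℝ) * Real.log 2 ≤ Real.log (n + 1) := by
    rw [← Real.log_pow]
    refine Real.log_le_log (by positivity) ?_
    have : (2 ^ Nat.log 2 n : ℕ) ≤ n := Nat.pow_log_le_self 2 (by omega)
    have h5 : ((2 ^ Nat.log 2 n : ℕ) : ℝ) ≤ n := by exact_mod_cast this
    push_cast at h5
    linarith
  refine ⟨?_, by linarith⟩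
  push_cast
  nlinarith [(Nat.cast_nonneg (Nat.log 2 n) : (0 : ℝ) ≤ _)]

/-- The whole algorithm. -/
def ballWSPD : Prog := sortAll ;; build ;; leaves ;; pairs

/-- The resources needed by the algorithm. -/
theorem exists_resource_bounds : ∃ K : ℝ, 0 < K ∧ ∀ (d n F O : ℕ) (s : ℝ), 1 ≤ d → 1 ≤ n → 0 < s →
    (F : ℝ) ≤ 2 * (splitBound d s * (2 * n - 1 : ℕ)) → O = F + n - 1 →
    (O : ℝ) ≤ K * sepFactor d s * n ∧
    ((2023 * (d * (n * (Nat.log 2 n + 1))) + 100 * (d * n) +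
      ((60 * d + 310) * (2 * n - 1 + O + F) + 50) : ℕ) : ℝ) ≤
        K * sepFactor d s * n * Real.log (n + 1) ∧
    ((2 * (n * d) + 2 * n + 2 * d + 110 + (2 * n - 1 + O + F) : ℕ) : ℝ) ≤
      K * sepFactor d s * n := by
  obtain ⟨K, hK, h⟩ := exists_sepFactor_bounds
  -- The largest demand is the time. Sorting and building need `4 * 2023 = 8092`; the other stages
  -- need `100 + 370 * 11 + 50`, doubled because a logarithm is supplied by `1 ≤ 2 * log (n + 1)`.
  -- The constant leaves ample room.
  refine ⟨30000 * K, by positivity, fun d n F O s hd hn hs hF hO => ?_⟩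
  obtain ⟨h1, h2⟩ := h d s hd hs
  obtain ⟨h3, h4⟩ := log_two_add_one_le hn
  set L := Nat.log 2 n + 1 with hL
  set κ := sepFactor d s with hκ
  have hd' : (1 : ℝ) ≤ d := by exact_mod_cast hd
  have hn' : (1 : ℝ) ≤ n := by exact_mod_cast hn
  have hKκ : 1 ≤ K * κ := hd'.trans h1
  have hsub : ((2 * n - 1 : ℕ) : ℝ) ≤ 2 * n := by
    have : 2 * n - 1 ≤ 2 * n := Nat.sub_le _ _
    exact_mod_cast this
  have hsb0 : 0 ≤ splitBound d s :=
    add_nonneg (mul_nonneg (by positivity) (unitVol_pos d).le) (by positivity)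
  -- the number of the pairs that are split, times the dimension
  have hdF : d * (F : ℝ) ≤ 4 * (K * κ * n) := by
    calc d * (F : ℝ) ≤ d * (2 * (splitBound d s * (2 * n))) := by gcongr; exact hF.trans (by gcongr)
      _ = 4 * (d * splitBound d s * n) := by ring
      _ ≤ 4 * (K * κ * n) := by gcongr
  have hdn : (d : ℝ) * n ≤ K * κ * n := by gcongr
  have hF0 : (0 : ℝ) ≤ F := by positivity
  have hF1 : (F : ℝ) ≤ d * F := le_mul_of_one_le_left hF0 hd'
  have hn1 : (n : ℝ) ≤ d * n := le_mul_of_one_le_left (by positivity) hd'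
  have hd1 : (d : ℝ) ≤ d * n := le_mul_of_one_le_right (by positivity) hn'
  have hO' : (O : ℝ) ≤ F + n := by
    have : O ≤ F + n := by omega
    exact_mod_cast this
  have hX : 0 ≤ K * κ * n := by positivity
  refine ⟨by nlinarith, ?_, ?_⟩
  · push_cast
    have hE : ((2 * n - 1 : ℕ) : ℝ) + O + F ≤ 3 * n + 2 * F := by linarith
    have e1 : (60 * (d : ℝ) + 310) * (((2 * n - 1 : ℕ) : ℝ) + O + F) ≤
        370 * (3 * (K * κ * n) + 8 * (K * κ * n)) := by
      calc (60 * (d : ℝ) + 310) * (((2 * n - 1 : ℕ) : ℝ) + O + F)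
          ≤ (370 * d) * (3 * n + 2 * F) := by gcongr; linarith
        _ = 370 * (3 * (d * n) + 2 * (d * F)) := by ring
        _ ≤ 370 * (3 * (K * κ * n) + 8 * (K * κ * n)) := by linarith
    have e2 : 2023 * ((d : ℝ) * (n * L)) ≤ 8092 * (K * κ * n * Real.log (n + 1)) := by
      calc 2023 * ((d : ℝ) * (n * L)) = 2023 * ((d * n) * L) := by ring
        _ ≤ 2023 * ((K * κ * n) * (4 * Real.log (n + 1))) := by gcongr
        _ = _ := by ring
    have e3 : K * κ * n ≤ 2 * (K * κ * n * Real.log (n + 1)) := by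
      calc K * κ * n = K * κ * n * 1 := by ring
        _ ≤ K * κ * n * (2 * Real.log (n + 1)) := by gcongr
        _ = _ := by ring
    have e4 : 1 ≤ K * κ * n := one_le_mul_of_one_le_of_one_le hKκ hn'
    have e5 : 30000 * K * κ * n * Real.log (n + 1) =
      30000 * (K * κ * n * Real.log (n + 1)) := by ring
    rw [e5]
    linarith
  · push_cast
    have e4 : 1 ≤ K * κ * n := one_le_mul_of_one_le_of_one_le hKκ hn'
    have e5 : 30000 * K * κ * n = 30000 * (K * κ * n) := by ring
    rw [e5]
    linarith

/-- The bound `E` is assumed for every split tree and every search in it, since the size of the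
machine has to be fixed before the run determines the tree. The coefficient 2023 is 423 for sorting
plus 1600 for building. -/
theorem ballWSPD_spec {d n M E : ℕ} {c : Fin n → Pt d} {r : Fin n → ℝ} {s : ℝ} {σ : Store}
    (hd : 1 ≤ d) (hn : 1 ≤ n) (hb : DisjointBalls c r) (hin : HoldsInput c r s σ)
    (hE : ∀ (T : BTree (Fin n)) (o f : List (BTree (Fin n) × BTree (Fin n))),
      IsSplitTreeOf c T → AllRun (BallCrit c r s) (treeLen c) T o f →
      T.size + o.length + f.length ≤ E)
    (hM : 2 * (n * d) + 2 * n + 2 * d + 110 + E ≤ M) :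
    WP M ballWSPD σ (fun t τ => ∃ T o f, IsSplitTreeOf c T ∧
      AllRun (BallCrit c r s) (treeLen c) T o f ∧ Rep c τ (2 * n - 1) T 0 ∧
      τ.word 2 0 = o.length ∧
      (∀ i (h : i < o.length), Rep c τ (2 * n - 1) o[i].1 (τ.word 3 i) ∧
        Rep c τ (2 * n - 1) o[i].2 (τ.word 4 i)) ∧
      t ≤ 2023 * (d * (n * (Nat.log 2 n + 1))) + 100 * (d * n) + ((60 * d + 310) * E + 50)) := by
  obtain ⟨hn0, hd0, hp, hr, hs⟩ := hin
  refine WP.seq (sortAll_spec (M := M) (by omega) hn0 hn hd0 hd).frame ?_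
  rintro t1 τ1 ⟨⟨hsort, ht1⟩, hf1⟩
  have r1 : ∀ a, τ1.real a = σ.real a := fun a => hf1.real a (by
    have : sortAll.realArrays = [] := by decide
    simp [this])
  have hkey : key τ1 d = key σ d := by funext k x; simp only [key, r1]
  have H1 : BuildCtx M c τ1 := by
    refine ⟨by omega, hd, hn, ?_, ?_, ?_, hb.injective, ?_⟩
    · rw [hf1.word _ (by decide), hn0]
    · rw [hf1.word _ (by decide), hd0]
    · intro i k; rw [r1]; exact hp i k
    · intro k hk; rw [hkey]; exact hsort k hk
  refine WP.seq (build_spec H1).frame ?_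
  rintro t2 τ2 ⟨⟨S, hF, hsz, ht2⟩, hf2⟩
  have H2 : BuildCtx M c τ2 := H1.transfer (hf2.word _ (by decide)) (hf2.word _ (by decide))
    (hf2.word _ (by decide)) (hf2.real _ (by decide))
  refine WP.seq (leaves_spec H2 (by omega) hF hsz).frame ?_
  rintro t3 τ3 ⟨⟨⟨T, hT, hTs⟩, ht3⟩, hf3⟩
  obtain ⟨o, f, hrun⟩ := exists_allRun (ok := BallCrit c r s) hd
    (fun i j hij => ballCrit_leaf hb hij) hTs.2
  have hN : (2 * n - 1) * d ≤ 2 * (n * d) := by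
    calc (2 * n - 1) * d ≤ (2 * n) * d := Nat.mul_le_mul_right _ (Nat.sub_le _ _)
      _ = _ := by ring
  have hEE := hE T o f hTs hrun
  have w3 : ∀ a, a ∉ sortAll.wordArrays → a ∉ build.wordArrays → a ∉ leaves.wordArrays →
      τ3.word a = σ.word a := fun a h h' h'' => by
    rw [hf3.word a h'', hf2.word a h', hf1.word a h]
  have r3 : ∀ a, a ∉ build.realArrays → a ∉ leaves.realArrays →
      τ3.real a = σ.real a := fun a h' h'' => by
    rw [hf3.real a h'', hf2.real a h', r1]
  refine (pairs_spec hT hTs.2.proper hrun hEE (by omega) (by omega) (by omega) (by omega)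
    (by rw [w3 _ (by decide) (by decide) (by decide), hd0])
    (by rw [r3 _ (by decide) (by decide), hs])
    (by rw [r3 _ (by decide) (by decide)]; exact hr)).mono ?_
  rintro t4 τ ⟨h1, h2, h3, h4⟩
  exact ⟨T, o, f, hTs, hrun, h1, h2, h3, by omega⟩

end BallWSPD

end

theorem mainTheorem1 :
    ∃ (P : BallWSPD.Prog) (K : ℝ), 0 < K ∧
      ∀ (d n : ℕ) (c : Fin n → BallWSPD.Pt d) (r : Fin n → ℝ) (s : ℝ),
        1 ≤ d → 1 ≤ n → 0 < s → (∀ i, 0 ≤ r i) →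
        (∀ i j, i ≠ j →
          Disjoint (Metric.closedBall (c i) (r i)) (Metric.closedBall (c j) (r j))) →
        ∀ σ : BallWSPD.Store, BallWSPD.HoldsInput c r s σ →
          ∃ (M t : ℕ) (τ : BallWSPD.Store) (m : ℕ) (A B : Fin m → Finset (Fin n))
            (T : BallWSPD.BTree (Fin n)) (m' : ℕ) (A' B' : Fin m' → Finset (Fin n)),
            -- the decomposition and its size
            BallWSPD.IsBallWSPD c r s A B ∧
            (m : ℝ) ≤ K * BallWSPD.sepFactor d s * n ∧
            -- its origin
            BallWSPD.IsSplitTreeOf c T ∧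
            BallWSPD.PairsFromTree T A' B' ∧
            BallWSPD.IsPointWSPD c (3 * s + 6) A' B' ∧
            BallWSPD.RefinesSingletonPairs A B A' B' ∧
            -- its computation, in time `t` and space `O(M)`
            BallWSPD.Exec M P σ t τ ∧
            BallWSPD.HoldsOutput τ T A B ∧
            (t : ℝ) ≤ K * BallWSPD.sepFactor d s * n * Real.log (n + 1) ∧
            (M : ℝ) ≤ K * BallWSPD.sepFactor d s * n := by
  obtain ⟨K, hK, hres⟩ := BallWSPD.exists_resource_bounds
  refine ⟨BallWSPD.ballWSPD, K, hK, fun d n c r s hd hn hs hr hdis σ hin => ?_⟩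
  have hb : BallWSPD.DisjointBalls c r := ⟨hr, hdis⟩
  have hsize : ∀ T : BallWSPD.BTree (Fin n), BallWSPD.IsSplitTreeOf c T → T.size = 2 * n - 1 := by
    intro T hT
    have h := hT.2.proper.size_eq
    rw [hT.1, Finset.card_univ, Fintype.card_fin] at h
    omega
  have hlen : ∀ (T : BallWSPD.BTree (Fin n)) (o f : List (_ × _)), BallWSPD.IsSplitTreeOf c T →
      BallWSPD.AllRun (BallWSPD.BallCrit c r s) (BallWSPD.treeLen c) T o f →
      (f.length : ℝ) ≤ 2 * (BallWSPD.splitBound d s * (2 * n - 1 : ℕ)) ∧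
        o.length = f.length + n - 1 := by
    intro T o f hT h
    have h1 := h.length
    rw [hsize T hT] at h1
    exact ⟨by rw [← hsize T hT]; exact h.length_fails_le hd hs hb hT.2, by omega⟩
  -- the number of the pairs that are split is bounded before the tree is known
  set F := ⌊2 * (BallWSPD.splitBound d s * (2 * n - 1 : ℕ))⌋₊ with hF
  have hF0 : 0 ≤ 2 * (BallWSPD.splitBound d s * (2 * n - 1 : ℕ)) := by
    have : 0 ≤ BallWSPD.splitBound d s :=
      add_nonneg (mul_nonneg (by positivity) (BallWSPD.unitVol_pos d).le) (by positivity)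
    positivity
  obtain ⟨hO, ht, hM⟩ := hres d n F (F + n - 1) s hd hn hs (Nat.floor_le hF0) rfl
  have hfF : ∀ (T : BallWSPD.BTree (Fin n)) (o f : List (_ × _)), BallWSPD.IsSplitTreeOf c T →
      BallWSPD.AllRun (BallWSPD.BallCrit c r s) (BallWSPD.treeLen c) T o f → f.length ≤ F :=
    fun T o f hT h => Nat.le_floor (hlen T o f hT h).1
  obtain ⟨t, τ, hex, T, o, f, hT, hrun, hRep, hm, hout, htime⟩ :=
    BallWSPD.ballWSPD_spec (r := r) (s := s) (E := 2 * n - 1 + (F + n - 1) + F) hd hn hb hin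
      (fun T o f hT h => by
        have h1 := hfF T o f hT h
        have h2 := (hlen T o f hT h).2
        rw [hsize T hT]
        omega) le_rfl
  -- The decomposition of the centres is not computed; it exists as the outcome of the same search,
  -- on the same tree, with the centre criterion alone.
  obtain ⟨o', f', hrun'⟩ := BallWSPD.exists_allRun (ok := BallWSPD.CentreCrit c s) hd
    (fun i j hij => (BallWSPD.ballCrit_leaf (s := s) hb hij).1) hT.2
  have hc := hb.injective
  refine ⟨_, t, τ, o.length, fun i => o[i].1.labels, fun i => o[i].2.labels, T, o'.length,
    fun i => o'[i].1.labels, fun i => o'[i].2.labels, ⟨fun i => ?_, ?_⟩, ?_, hT, fun i => ?_,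
    ⟨fun i => ?_, ?_⟩, ?_, hex, ⟨hRep.holdsTree, hm, fun i => ?_⟩, ?_, hM⟩
  · obtain ⟨h1, h2⟩ := hrun.goodPair hT.2 o[i] (List.getElem_mem _)
    exact h2.ballsWellSeparated hd hs hc h1
  · exact hrun.coversOnce hT.2.proper hT.1
  · refine le_trans ?_ hO
    have h1 := hfF T o f hT hrun
    have h2 := (hlen T o f hT hrun).2
    have h3 : o.length ≤ F + n - 1 := by omega
    exact_mod_cast h3
  · obtain ⟨-, h1, h2⟩ := hrun'.subtrees o'[i] (List.getElem_mem _)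
    exact ⟨⟨_, h1, rfl⟩, ⟨_, h2, rfl⟩⟩
  · obtain ⟨h1, h2⟩ := hrun'.goodPair hT.2 o'[i] (List.getElem_mem _)
    exact ⟨BallWSPD.BTree.labels_nonempty _, BallWSPD.BTree.labels_nonempty _,
      h2.pointsWellSeparated hd hs hc h1⟩
  · exact hrun'.coversOnce hT.2.proper hT.1
  · exact hrun.refinesSingletonPairs hb hT.2 hrun'
  · obtain ⟨-, h1, h2⟩ := hrun.subtrees o[i] (List.getElem_mem _)
    obtain ⟨h3, h4⟩ := hout i i.2
    exact ⟨_, _, h1, h2, h3.holdsTree, h4.holdsTree, rfl, rfl⟩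
  · refine le_trans ?_ ht
    exact_mod_cast htime
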